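/- Let $V=\mathbb C^N$ and write $X_m$ for an operator $X\in\mathrm{End}(V^{\otimes2})$ acting in the factors $m,m+1$ of $V^{\otimes n}$. An R-matrix is an invertible $R\in\mathrm{End}(V^{\otimes 2})$ with $R_1R_2R_1=R_2R_1R_2$. $X$ is skew invertible if there is $\Psi_X$ with $\mathrm{Tr}_{(2)}X_{12}(\Psi_X)_{23}=\mathrm{Tr}_{(2)}(\Psi_X)_{12}X_{23}=P_{13}$ ($P$ the flip); it is strict skew invertible if moreover one of $C_X=\mathrm{Tr}_{(1)}(\Psi_X)_{12}$, $D_X=\mathrm{Tr}_{(2)}(\Psi_X)_{12}$ is invertible. A pair of R-matrices $\{R,F\}$ is compatible if $R_1F_2F_1=F_2F_1R_2$ and $R_2F_1F_2=F_1F_2R_1$. Put $\mathrm{Tr}_R(Y)=\mathrm{Tr}(D_RY)$. Let $q\in\mathbb C\setminus\{0,\pm1\}$, $\mu\in\mathbb C\setminus\{0,q,-q^{-1}\}$, $i_q=(q^i-q^{-i})/(q-q^{-1})$. $R$ is of BMW type if its minimal polynomial is $(x-q)(x+q^{-1})(x-\mu)$ and $K=\mu^{-1}(q-q^{-1})^{-1}(qI-R)(q^{-1}I+R)$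 satisfies $K_2K_1=R_1^{\pm1}R_2^{\pm1}K_1$ and $K_1K_2K_1=K_1$. Put $\rho_R(\sigma_i)=R_i$, $\rho_R(\kappa_i)=K_i$, $\sigma_i^-(x)=1+\frac{x-1}{q-q^{-1}}\sigma_i+\frac{x-1}{q\mu^{-1}x+1}\kappa_i$, $a^{(1)}=1$ and $a^{(i+1)}=\frac{q^i}{(i+1)_q}a^{(i)}\sigma_i^-(q^{-2i})a^{(i)}$; $\uparrow n$ denotes the shift $\sigma_i\mapsto\sigma_{i+n}$. For $k\ge2$, a skew invertible BMW-type $R$ is of type $Sp(2k)$ if $\mu=-q^{-1-2k}$, $i_q\ne0$ and $\rho_R(a^{(i)})\neq0$ for $2\le i\le k$, and $\rho_R(a^{(k)\uparrow1}\sigma_1^-(q^{-2k})a^{(k)\uparrow1})=0$. Let $\{R,F\}$ be a compatible pair of R-matrices, $R$ of type $Sp(2k)$ and $F$ strict skew invertible. For an $N\times N$ matrix $M$ put $M_{\overline1}=M_1$, $M_{\overline{i+1}}=F_iM_{\overline i}F_i^{-1}$. The quantum matrix algebra $\mathcal M(R,F)$ is the unital $\mathbb C$-algebra generated by the entries of $M$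 subject to $R_1M_{\overline1}M_{\overline2}=M_{\overline1}M_{\overline2}R_1$. For $\alpha\in\mathbb C\mathcal B_n$ (group algebra of the braid group) put $$ch(\alpha)=\mathrm{Tr}_{R(1,\dots,n)}\bigl(M_{\overline1}\cdots M_{\overline n}\,\rho_R(\alpha)\bigr),\qquad (M^\alpha)_1=\mathrm{Tr}_{R(2,\dots,n)}\bigl(M_{\overline1}\cdots M_{\overline n}\,\rho_R(\alpha)\bigr).$$ Let $\mathcal C(R,F)$ be the span of $1$ and all $ch(\alpha)$, and $\mathcal P(R,F)$ the span of all $I\,c$, $c\in\mathcal C(R,F)$, and all $M^\alpha$. Put $g=\eta^{-1}ch(\kappa_1)$ with $\eta=\frac{(q-\mu)(q^{-1}+\mu)}{\mu(q-q^{-1})}$, $a_0=1$, $a_i=ch(a^{(i)})$, and $\epsilon_i=\sum_{j=0}^{[i/2]}a_{i-2j}g^j$ for $0\le i\le k$, $\epsilon_{k+i}=\epsilon_{k-i}g^i$ for $1\le i\le k$. Let $\mathcal E_{2k}$ be the commutative $\mathbb C$-algebra generated by $\nu_0,\dots,\nu_{2k}$ with relations $\nu_{k+j}\nu_{k+1-j}=\nu_0^2$,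 $j=1,\dots,k$; $e_i$ denotes the elementary symmetric functions. **Corollary.** $\mathcal C(R,F)$ is a commutative subalgebra of $\mathcal M(R,F)$, and there is an associative bilinear product $\star$ on $\mathcal P(R,F)$ with $M^{\alpha}\star M^{\beta}=M^{\alpha\star\beta}$, where $\alpha\star\beta=\alpha\,\beta^{\uparrow n}\sigma_n\cdots\sigma_2\sigma_1\sigma_2^{-1}\cdots\sigma_n^{-1}$ for $\alpha\in\mathbb C\mathcal B_n$, $(I c)\star M^\alpha=M^\alpha\star(I c)=M^\alpha c$ and $(I c)\star(I c')=I\,cc'$. (1) If $g,a_1,\dots,a_k$ are algebraically independent over $\mathbb C$, then there is a unique algebra homomorphism $\pi:\mathcal C(R,F)\to\mathcal E_{2k}$ with $$g\mapsto\nu_0^2,\qquad a_i\mapsto e_i(\nu_0,-\nu_0,\nu_1,\dots,\nu_{2k}),\quad i=1,\dots,k.$$ (2) Let $\pi:\mathcal C(R,F)\to\mathcal E_{2k}$ be an algebra homomorphism with these values. Then the formula $(N\otimes\nu)\star(N'\otimes\nu')=(N\star N')\otimes\nu\nu'$ defines an associative bilinear product on $\mathcal P(R,F)\otimes_{\mathcal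 C(R,F)}\mathcal E_{2k}$, where $\mathcal C(R,F)$ acts on $\mathcal P(R,F)$ by right multiplication of the matrix entries and on $\mathcal E_{2k}$ through $\pi$. In this completed algebra the left-hand side of the Cayley–Hamilton identity $\sum_{i=0}^{2k}(-q)^iM^{\overline{2k-i}}\epsilon_i=0$ (with $M^{\overline n}$ the $n$-th $\star$-power, $M^{\overline 0}=I$) factorizes, and $$\sum_{i=0}^{2k}(-q)^i\,M^{\overline{2k-i}}\otimes\pi(\epsilon_i)\;=\;\prod_{i=1}^{2k}{}^{\!\star}\,\bigl(M-q\nu_iI\bigr)\;=\;0,$$ where $M$ and $\nu_iI$ stand for $M\otimes1$ and $I\otimes\nu_i$. -/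

import Mathlib

open scoped TensorProduct

/-! Tensor powers of `V = ℂ^N` are indexed by words: an operator on `V^{⊗n}` is a matrix whose rows
and columns are indexed by `Fin n → Fin N`, and an operator on `V ⊗ V` is a matrix indexed by
`Fin N × Fin N`. Tensor legs and braid generators are numbered from `0` in the code. -/

namespace OSpQM

noncomputable section

/-- Operators on `V ⊗ V`. -/
abbrev Op2 (N : ℕ) : Type := Matrix (Fin N × Fin N) (Fin N × Fin N) ℂ

/-- Operators on `V^{⊗n}`. -/
abbrev OpN (N n : ℕ) : Type := Matrix (Fin n → Fin N) (Fin n → Fin N) ℂ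

/-! ### R-matrices -/

/-- The operator `X` acting in the neighbouring legs `m`, `m + 1` of `V^{⊗n}` and as the identity in
all other legs (only used for `m + 1 < n`). -/
def opAt {N : ℕ} (n : ℕ) (X : Op2 N) (m : ℕ) : OpN N n :=
  Matrix.of fun x y =>
    if h : m + 1 < n then
      if ∀ l : Fin n, (l : ℕ) ≠ m → (l : ℕ) ≠ m + 1 → x l = y l then
        X (x ⟨m, by omega⟩, x ⟨m + 1, h⟩) (y ⟨m, by omega⟩, y ⟨m + 1, h⟩)
      else 0
    else if x = y then 1 else 0

/-- An R-matrix: an invertible solution of the Yang-Baxter equation `R₁ R₂ R₁ = R₂ R₁ R₂`. -/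
structure IsRMatrix {N : ℕ} (R : Op2 N) : Prop where
  isUnit : IsUnit R
  yangBaxter : opAt 3 R 0 * opAt 3 R 1 * opAt 3 R 0 = opAt 3 R 1 * opAt 3 R 0 * opAt 3 R 1

/-- `Ψ` is a skew inverse of `X`: `Tr₍₂₎ X₁₂ Ψ₂₃ = Tr₍₂₎ Ψ₁₂ X₂₃ = P₁₃`, written in matrix entries;
`P` is the flip. -/
def IsSkewInverse {N : ℕ} (X Ψ : Op2 N) : Prop :=
  (∀ i j i' j' : Fin N, ∑ a, ∑ m, X (i, a) (j, m) * Ψ (m, i') (a, j')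
      = if i = j' ∧ i' = j then 1 else 0) ∧
  (∀ i j i' j' : Fin N, ∑ a, ∑ m, Ψ (i, a) (j, m) * X (m, i') (a, j')
      = if i = j' ∧ i' = j then 1 else 0)

/-- Skew invertibility. -/
def SkewInvertible {N : ℕ} (X : Op2 N) : Prop := ∃ Ψ : Op2 N, IsSkewInverse X Ψ

open Classical in
/-- The (unique) skew inverse `Ψ_X` of a skew invertible operator. -/
def skewInv {N : ℕ} (X : Op2 N) : Op2 N :=
  if h : SkewInvertible X then h.choose else 0

/-- `C_X = Tr₍₁₎ (Ψ_X)₁₂`. -/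
def matC {N : ℕ} (X : Op2 N) : Matrix (Fin N) (Fin N) ℂ :=
  Matrix.of fun i j => ∑ a, skewInv X (a, i) (a, j)

/-- `D_X = Tr₍₂₎ (Ψ_X)₁₂`. -/
def matD {N : ℕ} (X : Op2 N) : Matrix (Fin N) (Fin N) ℂ :=
  Matrix.of fun i j => ∑ a, skewInv X (i, a) (j, a)

/-- Strict skew invertibility. -/
def StrictSkewInvertible {N : ℕ} (X : Op2 N) : Prop :=
  SkewInvertible X ∧ (IsUnit (matC X) ∨ IsUnit (matD X))

/-- `{R, F}` is a compatible pair of R-matrices. -/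
structure IsCompatiblePair {N : ℕ} (R F : Op2 N) : Prop where
  left : IsRMatrix R
  right : IsRMatrix F
  twist₁ : opAt 3 R 0 * opAt 3 F 1 * opAt 3 F 0 = opAt 3 F 1 * opAt 3 F 0 * opAt 3 R 1
  twist₂ : opAt 3 R 1 * opAt 3 F 0 * opAt 3 F 1 = opAt 3 F 0 * opAt 3 F 1 * opAt 3 R 0

/-- The operator `K_m = ρ_R(κ) = μ⁻¹ (q - q⁻¹)⁻¹ (q I - R_m) (q⁻¹ I + R_m)` on `V^{⊗n}`. -/
def opK {N : ℕ} (R : Op2 N) (q μ : ℂ) (n m : ℕ) : OpN N n :=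
  (μ * (q - q⁻¹))⁻¹ • ((q • (1 : OpN N n) - opAt n R m) * (q⁻¹ • (1 : OpN N n) + opAt n R m))

/-- An R-matrix of BMW type with parameters `q`, `μ`; the cubic characteristic polynomial is required
to be the minimal one. -/
structure IsBMWType {N : ℕ} (R : Op2 N) (q μ : ℂ) : Prop where
  q_ne : q ≠ 0 ∧ q ≠ 1 ∧ q ≠ -1
  mu_ne : μ ≠ 0 ∧ μ ≠ q ∧ μ ≠ -q⁻¹
  isRMatrix : IsRMatrix R
  minimal : minpoly ℂ R = (Polynomial.X - Polynomial.C q) * (Polynomial.X + Polynomial.C q⁻¹)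
    * (Polynomial.X - Polynomial.C μ)
  rel_pos : opK R q μ 3 1 * opK R q μ 3 0 = opAt 3 R 0 * opAt 3 R 1 * opK R q μ 3 0
  rel_neg : opK R q μ 3 1 * opK R q μ 3 0 = (opAt 3 R 0)⁻¹ * (opAt 3 R 1)⁻¹ * opK R q μ 3 0
  rel_K : opK R q μ 3 0 * opK R q μ 3 1 * opK R q μ 3 0 = opK R q μ 3 0

/-- The `q`-number `i_q = (q^i - q^{-i}) / (q - q⁻¹)`. -/
def qNum (q : ℂ) (i : ℕ) : ℂ := (q ^ i - q⁻¹ ^ i) / (q - q⁻¹)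

/-- The baxterized operator `ρ_R(σ⁻(x)) = 1 + (x-1)/(q-q⁻¹) R_m + (x-1)/(q μ⁻¹ x + 1) K_m`. -/
def baxt {N : ℕ} (R : Op2 N) (q μ : ℂ) (n m : ℕ) (x : ℂ) : OpN N n :=
  1 + ((x - 1) / (q - q⁻¹)) • opAt n R m + ((x - 1) / (q * μ⁻¹ * x + 1)) • opK R q μ n m

/-- `ρ_R(a^{(i)↑s})`: the `i`-th antisymmetrizer in the legs `s, …, s + i - 1` of `V^{⊗n}`, where
`a^{(1)} = 1` and `a^{(i+1)} = q^i / (i+1)_q · a^{(i)} σ_i⁻(q^{-2i}) a^{(i)}`. -/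
def antisym {N : ℕ} (R : Op2 N) (q μ : ℂ) (n s : ℕ) : ℕ → OpN N n
  | 0 => 1
  | 1 => 1
  | i + 2 => (q ^ (i + 1) / qNum q (i + 2)) •
      (antisym R q μ n s (i + 1) * baxt R q μ n (s + i) (q⁻¹ ^ (2 * (i + 1)))
        * antisym R q μ n s (i + 1))

/-- An `Sp(2k)`-type R-matrix with parameter `q` (and `μ = -q^{-1-2k}`): a skew invertible R-matrix of
BMW type such that the antisymmetrizers `ρ_R(a^{(i)})` are nonzero for `2 ≤ i ≤ k` and the
unnormalized antisymmetrizer of order `k + 1` vanishes. -/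
structure IsSpType {N : ℕ} (R : Op2 N) (q : ℂ) (k : ℕ) : Prop where
  two_le : 2 ≤ k
  skew : SkewInvertible R
  bmw : IsBMWType R q (-q⁻¹ ^ (2 * k + 1))
  qNum_ne : ∀ i, 2 ≤ i → i ≤ k → qNum q i ≠ 0
  rank_ne : ∀ i, 2 ≤ i → i ≤ k → (antisym R q (-q⁻¹ ^ (2 * k + 1)) i 0 i).rank ≠ 0
  vanish : antisym R q (-q⁻¹ ^ (2 * k + 1)) (k + 1) 1 k
      * baxt R q (-q⁻¹ ^ (2 * k + 1)) (k + 1) 0 (q⁻¹ ^ (2 * k))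
      * antisym R q (-q⁻¹ ^ (2 * k + 1)) (k + 1) 1 k = 0

/-! ### The quantum matrix algebra -/

section Copies

variable {N : ℕ} {A : Type} [Ring A] [Algebra ℂ A]

/-- A numerical operator regarded as an operator with entries in `A`. -/
def scal (A : Type) [Ring A] [Algebra ℂ A] {n : ℕ} (X : OpN N n) :
    Matrix (Fin n → Fin N) (Fin n → Fin N) A :=
  X.map (algebraMap ℂ A)

/-- The matrix copies on `V^{⊗(n+1)}`: the first one is `M` acting in the first leg, and each next
copy is obtained by conjugation, `F_i M_i̅ F_i⁻¹`. -/
def copy (F : Op2 N) (M : Matrix (Fin N) (Fin N) A) (n : ℕ) :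
    ℕ → Matrix (Fin (n + 1) → Fin N) (Fin (n + 1) → Fin N) A
  | 0 => Matrix.of fun x y => if ∀ l, l ≠ 0 → x l = y l then M (x 0) (y 0) else 0
  | i + 1 => scal A (opAt (n + 1) F i) * copy F M n i * scal A (opAt (n + 1) F i)⁻¹

/-- The product of the first `n + 1` copies of `M`, acting on `V^{⊗(n+1)}`. -/
def copyProd (F : Op2 N) (M : Matrix (Fin N) (Fin N) A) (n : ℕ) :
    Matrix (Fin (n + 1) → Fin N) (Fin (n + 1) → Fin N) A :=
  (List.ofFn fun i : Fin (n + 1) => copy F M n i).prod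

/-- The R-trace (with matrix `D`) over all `n + 1` legs. -/
def traceAll (D : Matrix (Fin N) (Fin N) ℂ) {n : ℕ}
    (Y : Matrix (Fin (n + 1) → Fin N) (Fin (n + 1) → Fin N) A) : A :=
  ∑ s : Fin (n + 1) → Fin N, ∑ t : Fin (n + 1) → Fin N, (∏ l, D (s l) (t l)) • Y t s

/-- The R-trace (with matrix `D`) over all legs but the first. -/
def traceTail (D : Matrix (Fin N) (Fin N) ℂ) {n : ℕ}
    (Y : Matrix (Fin (n + 1) → Fin N) (Fin (n + 1) → Fin N) A) : Matrix (Fin N) (Fin N) A :=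
  Matrix.of fun a b =>
    ∑ s : Fin n → Fin N, ∑ t : Fin n → Fin N, (∏ l, D (s l) (t l)) •
      Y (Fin.cons a t) (Fin.cons b s)

end Copies

/-- The matrix of free generators `M_a^b`. -/
def freeMat (N : ℕ) : Matrix (Fin N) (Fin N) (FreeAlgebra ℂ (Fin N × Fin N)) :=
  Matrix.of fun a b => FreeAlgebra.ι ℂ (a, b)

/-- The defining relations: the entries of `R₁ M₁̅ M₂̅ = M₁̅ M₂̅ R₁`. -/
inductive QMRel {N : ℕ} (R F : Op2 N) :
    FreeAlgebra ℂ (Fin N × Fin N) → FreeAlgebra ℂ (Fin N × Fin N) → Prop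
  | entry (x y : Fin 2 → Fin N) :
      QMRel R F
        ((scal (FreeAlgebra ℂ (Fin N × Fin N)) (opAt 2 R 0) * (copy F (freeMat N) 1 0 * copy F (freeMat N) 1 1)) x y)
        ((copy F (freeMat N) 1 0 * copy F (freeMat N) 1 1 *
          scal (FreeAlgebra ℂ (Fin N × Fin N)) (opAt 2 R 0)) x y)

/-- The quantum matrix algebra `M(R, F)`. -/
def QMA {N : ℕ} (R F : Op2 N) : Type := RingQuot (QMRel R F)

instance {N : ℕ} (R F : Op2 N) : Ring (QMA R F) := inferInstanceAs (Ring (RingQuot (QMRel R F)))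

instance {N : ℕ} (R F : Op2 N) : Algebra ℂ (QMA R F) :=
  inferInstanceAs (Algebra ℂ (RingQuot (QMRel R F)))

/-- The quotient map from the free algebra onto `M(R, F)`. -/
def QMA.mk {N : ℕ} (R F : Op2 N) : FreeAlgebra ℂ (Fin N × Fin N) →ₐ[ℂ] QMA R F :=
  RingQuot.mkAlgHom ℂ (QMRel R F)

/-- The matrix `M` of generators of `M(R, F)`. -/
def genMat {N : ℕ} (R F : Op2 N) : Matrix (Fin N) (Fin N) (QMA R F) :=
  (freeMat N).map (QMA.mk R F)

/-! ### The characteristic subalgebra -/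

/-- The image under `ρ_R` of the group algebra of the braid group on `n + 1` strands: the unital
subalgebra of `End V^{⊗(n+1)}` generated by the `R_i` and their inverses. -/
def braidImage {N : ℕ} (R : Op2 N) (n : ℕ) : Subalgebra ℂ (OpN N (n + 1)) :=
  Algebra.adjoin ℂ {X | ∃ i, i < n ∧ (X = opAt (n + 1) R i ∨ X = (opAt (n + 1) R i)⁻¹)}

/-- `ch(α) = Tr_R₍₁…ₙ₊₁₎ (M₁̅ ⋯ M̅ₙ₊₁ ρ_R(α))`, where the argument is `ρ_R(α)`. -/
def ch {N : ℕ} (R F : Op2 N) (n : ℕ) (α : OpN N (n + 1)) : QMA R F :=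
  traceAll (matD R) (copyProd F (genMat R F) n * scal _ α)

/-- The linear span of the unity and of all `ch(α)`. -/
def charSpace {N : ℕ} (R F : Op2 N) : Submodule ℂ (QMA R F) :=
  Submodule.span ℂ ({1} ∪ {x | ∃ n, ∃ α ∈ braidImage R n, x = ch R F n α})

/-- The characteristic subalgebra `C(R, F)`. -/
def charAlg {N : ℕ} (R F : Op2 N) : Subalgebra ℂ (QMA R F) :=
  Algebra.adjoin ℂ (charSpace R F : Set (QMA R F))

section Membership

variable {N : ℕ} (R F : Op2 N) (q μ : ℂ)

lemma ch_mem {n : ℕ} {α : OpN N (n + 1)} (h : α ∈ braidImage R n) : ch R F n α ∈ charAlg R F :=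
  Algebra.subset_adjoin (Submodule.subset_span (Or.inr ⟨n, α, h, rfl⟩))

lemma opAt_mem {n m : ℕ} (h : m < n) : opAt (n + 1) R m ∈ braidImage R n :=
  Algebra.subset_adjoin ⟨m, h, Or.inl rfl⟩

lemma opK_mem {n m : ℕ} (h : m < n) : opK R q μ (n + 1) m ∈ braidImage R n := by
  unfold opK
  exact Subalgebra.smul_mem _ (mul_mem
    (sub_mem (Subalgebra.smul_mem _ (one_mem _) _) (opAt_mem R h))
    (add_mem (Subalgebra.smul_mem _ (one_mem _) _) (opAt_mem R h))) _

lemma antisym_mem (n i : ℕ) (h : i ≤ n + 1) : antisym R q μ (n + 1) 0 i ∈ braidImage R n := by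
  induction i with
  | zero => simp [antisym]
  | succ i ih =>
    cases i with
    | zero => simp [antisym]
    | succ i =>
      have h1 := ih (by omega)
      have hi : 0 + i < n := by omega
      simp only [antisym]
      refine Subalgebra.smul_mem _ (mul_mem (mul_mem h1 ?_) h1) _
      exact add_mem (add_mem (one_mem _) (Subalgebra.smul_mem _ (opAt_mem R hi) _))
        (Subalgebra.smul_mem _ (opK_mem R q μ hi) _)

/-- `η = (q - μ)(q⁻¹ + μ) / (μ (q - q⁻¹))`. -/
def eta : ℂ := (q - μ) * (q⁻¹ + μ) / (μ * (q - q⁻¹))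

/-- The 2-contraction `g = η⁻¹ ch(κ₁)`. -/
def contr : charAlg R F :=
  (eta q μ)⁻¹ • ⟨ch R F 1 (opK R q μ 2 0), ch_mem R F (opK_mem R q μ (by omega))⟩

/-- The elements `a₀ = 1`, `a_i = ch(a^{(i)})`. -/
def elemA : ℕ → charAlg R F
  | 0 => 1
  | i + 1 => ⟨ch R F i (antisym R q μ (i + 1) 0 (i + 1)),
      ch_mem R F (antisym_mem R q μ i (i + 1) le_rfl)⟩

/-- The coefficients `ε_i = ∑_{0 ≤ j ≤ i/2} a_{i-2j} g^j` for `i ≤ k` and `ε_{k+i} = ε_{k-i} g^i` for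
`1 ≤ i ≤ k` of the Cayley-Hamilton identity. -/
def eps (k i : ℕ) : charAlg R F :=
  if i ≤ k then ∑ j ∈ Finset.range (i / 2 + 1), elemA R F q μ (i - 2 * j) * contr R F q μ ^ j
  else (∑ j ∈ Finset.range ((2 * k - i) / 2 + 1),
    elemA R F q μ (2 * k - i - 2 * j) * contr R F q μ ^ j) * contr R F q μ ^ (i - k)

end Membership

/-- Algebraic independence over `ℂ` of finitely many (pairwise commuting) elements of an algebra that
is not assumed to be commutative as a whole: the monomials in these elements are linearly independent.
For elements of a commutative algebra this is `AlgebraicIndependent ℂ x`. -/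
def MonomialsIndependent {A : Type} [Ring A] [Algebra ℂ A] {m : ℕ} (x : Fin m → A) : Prop :=
  LinearIndependent ℂ fun d : Fin m → ℕ => (List.ofFn fun i => x i ^ d i).prod

/-! ### The space `P(R, F)` and the `⋆`-product -/

/-- `M^α = Tr_R₍₂…ₙ₊₁₎ (M₁̅ ⋯ M̅ₙ₊₁ ρ_R(α))`, where the argument is `ρ_R(α)`. -/
def matPow {N : ℕ} (R F : Op2 N) (n : ℕ) (α : OpN N (n + 1)) :
    Matrix (Fin N) (Fin N) (QMA R F) :=
  traceTail (matD R) (copyProd F (genMat R F) n * scal _ α)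

/-- The multiple `I c` of the identity matrix. -/
def idMul {N : ℕ} {A : Type} [Ring A] (c : A) : Matrix (Fin N) (Fin N) A :=
  Matrix.diagonal fun _ => c

/-- Component-wise right multiplication of a matrix by `c`. -/
def rightMul {N : ℕ} {A : Type} [Ring A] (X : Matrix (Fin N) (Fin N) A) (c : A) :
    Matrix (Fin N) (Fin N) A :=
  X.map fun x => x * c

/-- `P(R, F)`: the span of all `I c` with `c ∈ C(R, F)` and all `M^α`. -/
def PSpace {N : ℕ} (R F : Op2 N) : Submodule ℂ (Matrix (Fin N) (Fin N) (QMA R F)) :=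
  Submodule.span ℂ ({X | ∃ c ∈ charAlg R F, X = idMul c} ∪
    {X | ∃ n, ∃ α ∈ braidImage R n, X = matPow R F n α})

lemma matPow_one {N : ℕ} (R F : Op2 N) : matPow R F 0 1 = genMat R F := by
  ext a b
  have h : scal (QMA R F) (1 : OpN N 1) = 1 := by
    simp [scal, Matrix.map_one]
  simp [matPow, traceTail, copyProd, copy, h, Subsingleton.elim _ (0 : Fin 1)]

/-- `P(R, F)` as a vector space in its own right. -/
def PAlg {N : ℕ} (R F : Op2 N) : Type := PSpace R F

instance {N : ℕ} (R F : Op2 N) : AddCommGroup (PAlg R F) :=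
  inferInstanceAs (AddCommGroup (PSpace R F))

instance {N : ℕ} (R F : Op2 N) : Module ℂ (PAlg R F) := inferInstanceAs (Module ℂ (PSpace R F))

/-- The inclusion of `P(R, F)` into the matrices over `M(R, F)`. -/
def PAlg.toMat {N : ℕ} {R F : Op2 N} : PAlg R F →ₗ[ℂ] Matrix (Fin N) (Fin N) (QMA R F) :=
  (PSpace R F).subtype

/-- The identity matrix as an element of `P(R, F)`. -/
def idP {N : ℕ} (R F : Op2 N) : PAlg R F :=
  ⟨1, Submodule.subset_span (Or.inl ⟨1, one_mem _, by simp [idMul]⟩)⟩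

/-- The matrix `M` of generators as an element of `P(R, F)`. -/
def genP {N : ℕ} (R F : Op2 N) : PAlg R F :=
  ⟨genMat R F, Submodule.subset_span (Or.inr ⟨0, 1, one_mem _, (matPow_one R F).symm⟩)⟩

/-- `ρ_R(α β^{↑})`: the operator `α` in the first `n + 1` legs and `β` in the last `m + 1` legs. -/
def juxt {N n m : ℕ} (α : OpN N (n + 1)) (β : OpN N (m + 1)) : OpN N (n + 1 + m + 1) :=
  Matrix.of fun x y =>
    α (fun i => x ⟨i, by omega⟩) (fun i => y ⟨i, by omega⟩)
      * β (fun j => x ⟨n + 1 + j, by omega⟩) (fun j => y ⟨n + 1 + j, by omega⟩)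

/-- `ρ_R(α ⋆ β)`, where `α ⋆ β = α β^{↑n} (σ_n ⋯ σ_2 σ_1 σ_2⁻¹ ⋯ σ_n⁻¹)` for `α` on `n` strands; in the
code `α` has `n + 1` strands and `σ_{j+1}` is represented by `opAt _ R j`. -/
def starExp {N n m : ℕ} (R : Op2 N) (α : OpN N (n + 1)) (β : OpN N (m + 1)) :
    OpN N (n + 1 + m + 1) :=
  juxt α β * ((List.range (n + 1)).reverse.map fun j => opAt (n + 1 + m + 1) R j).prod
    * ((List.range n).map fun j => (opAt (n + 1 + m + 1) R (j + 1))⁻¹).prod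

/-- The defining formulas of the `⋆`-product on `P(R, F)`. -/
structure IsStarProduct {N : ℕ} (R F : Op2 N)
    (star : PAlg R F →ₗ[ℂ] PAlg R F →ₗ[ℂ] PAlg R F) : Prop where
  pow_pow : ∀ (n m : ℕ), ∀ α ∈ braidImage R n, ∀ β ∈ braidImage R m, ∀ X Y : PAlg R F,
    X.toMat = matPow R F n α →
    Y.toMat = matPow R F m β →
    (star X Y).toMat = matPow R F (n + 1 + m) (starExp R α β)
  id_pow : ∀ (n : ℕ), ∀ α ∈ braidImage R n, ∀ c ∈ charAlg R F, ∀ X Y : PAlg R F,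
    X.toMat = idMul c →
    Y.toMat = matPow R F n α →
    (star X Y).toMat = rightMul (matPow R F n α) c ∧
    (star Y X).toMat = rightMul (matPow R F n α) c
  id_id : ∀ c ∈ charAlg R F, ∀ d ∈ charAlg R F, ∀ X Y : PAlg R F,
    X.toMat = idMul c →
    Y.toMat = idMul d →
    (star X Y).toMat = idMul (c * d)

/-- The product `x₀ (x₁ (⋯ (x_{r-1} 1)))` with respect to a bilinear operation `mul`. -/
def prodWith {A : Type} [AddCommGroup A] [Module ℂ A] (mul : A →ₗ[ℂ] A →ₗ[ℂ] A) (one : A) {r : ℕ}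
    (x : Fin r → A) : A :=
  (List.ofFn x).foldr (fun a b => mul a b) one

/-! ### Spectral variables and the completed algebra -/

/-- The ideal of the relations `ν_{k+j} ν_{k+1-j} = ν_0²`, `j = 1, …, k`. -/
def specIdeal (k : ℕ) : Ideal (MvPolynomial (Fin (2 * k + 1)) ℂ) :=
  Ideal.span (Set.range fun j : Fin k =>
    (MvPolynomial.X ⟨k + (j + 1), by omega⟩ * MvPolynomial.X ⟨k + 1 - (j + 1), by omega⟩
      - MvPolynomial.X 0 ^ 2 : MvPolynomial (Fin (2 * k + 1)) ℂ))

/-- The algebra `E_{2k}` of spectral variables. -/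
abbrev SpecAlg (k : ℕ) : Type := MvPolynomial (Fin (2 * k + 1)) ℂ ⧸ specIdeal k

/-- The spectral variable `ν_i`, `0 ≤ i ≤ 2k`. -/
def nu (k : ℕ) (i : Fin (2 * k + 1)) : SpecAlg k :=
  Ideal.Quotient.mk (specIdeal k) (MvPolynomial.X i)

/-- The multiset `ν_0, -ν_0, ν_1, …, ν_{2k}`. -/
def spectrumSp (k : ℕ) : Multiset (SpecAlg k) :=
  nu k 0 ::ₘ (-nu k 0) ::ₘ (Finset.univ.val.map fun i : Fin (2 * k) => nu k i.succ)

/-- `π` takes the prescribed values on the generators: `g ↦ ν_0²` and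
`a_i ↦ e_i(ν_0, -ν_0, ν_1, …, ν_{2k})` for `1 ≤ i ≤ k`. -/
structure IsSpectralHom {N : ℕ} (R F : Op2 N) (q μ : ℂ) (k : ℕ)
    (π : charAlg R F →ₐ[ℂ] SpecAlg k) : Prop where
  map_contr : π (contr R F q μ) = nu k 0 ^ 2
  map_elemA : ∀ i, 1 ≤ i → i ≤ k → π (elemA R F q μ i) = (spectrumSp k).esymm i

/-- The relations `(N c) ⊗ ν = N ⊗ (π(c) ν)` of the tensor product over `C(R, F)`. -/
def balanced {N : ℕ} (R F : Op2 N) {k : ℕ} (π : charAlg R F →ₐ[ℂ] SpecAlg k) :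
    Submodule ℂ (PAlg R F ⊗[ℂ] SpecAlg k) :=
  Submodule.span ℂ {z | ∃ (X Y : PAlg R F) (c : charAlg R F) (ν : SpecAlg k),
    Y.toMat = rightMul X.toMat (c : QMA R F) ∧ z = Y ⊗ₜ[ℂ] ν - X ⊗ₜ[ℂ] (π c * ν)}

/-- The completed space `P(R, F) ⊗_{C(R, F)} E_{2k}`; `E_{2k}` is a `C(R, F)`-module through `π`. -/
abbrev Completion {N : ℕ} (R F : Op2 N) {k : ℕ} (π : charAlg R F →ₐ[ℂ] SpecAlg k) : Type :=
  (PAlg R F ⊗[ℂ] SpecAlg k) ⧸ balanced R F π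

/-- The element `X ⊗ ν` of the completed space. -/
def tens {N : ℕ} (R F : Op2 N) {k : ℕ} (π : charAlg R F →ₐ[ℂ] SpecAlg k) (X : PAlg R F)
    (ν : SpecAlg k) : Completion R F π :=
  Submodule.Quotient.mk (X ⊗ₜ[ℂ] ν)

end

end OSpQM

/-!
# The spectral factorization of the Cayley-Hamilton identity for `Sp(2k)`-type quantum matrices

All operators on tensor powers `V^{⊗n}`, with entries in an algebra `A`, act on the functions on words
of infinite length (`Chain N A`); an operator on finitely many legs acts there as the identity in all
other legs. A braid on `n` strands is represented by the family of its shifts along the chain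
(`Fam N A`, with the generators `gen A R i`), so that the shift `↑` is an endomorphism `shf` and the
relations of the Birman-Murakami-Wenzl algebra hold without reference to `n`. The matrix `M^α` becomes
an operator `mp n α` in the leg `0`, and `ch(α)` a scalar operator `chf n α`.

*R-traces.* The slices of a skew invertible `R` span all matrices, hence an identity for `Tr_R R = 1`
with an auxiliary leg determines partial R-traces of arbitrary operators (`matD_smul_of_slices`). This
gives the invariance of R-traces under conjugation by `F` (`E_conj`), the commutation of `D ⊗ D` with
`R` (`Setup.weight_comm`), which makes R-traces cyclic, and, together with the contraction `κ`, the
invertibility of `D_R` (`Setup.matC_mul_matD_eq`). The operator `κ` then has rank one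
(`Setup.exists_kap_eq`), so that `M_1 M_2 κ` is `κ` times a scalar, which is `g` up to a factor.

*The `⋆`-product.* `M^{α ⋆ β}` depends on `β` only through `M^β` (`Setup.mp_right`). A conjugation by the
braid that exchanges the two blocks of strands, and does not touch the first strand, turns the exponent
into its mirror image (`Setup.mp_star`), so that it also depends on `α` only through `M^α`. Hence the
product is well defined (`Setup.exists_star`). The same braid shows that the elements `ch(α)` commute
(`Setup.chf_comm`), and associativity is a relation between two pure braids
(`BraidSeq.pureR_mul_pureR`).

*The Cayley-Hamilton identity.* The antisymmetrizers absorb the generators (`asym_absorb`), are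
invariant under the reversal of the strands and satisfy a recursion that adds a strand on the left
(`asym_succ_left`). It yields a coupled system of recursions for `M^{a^{(i)}}` and `M^{a^{(i)↑1} κ₁}` with
respect to `M ⋆ -` (`Setup.vecA_succ`, `Setup.mulPowL_vecB_succ`). The system is solved explicitly
(`telescope`), and the vanishing of the antisymmetrizer of order `k + 1` becomes the identity
`Setup.cayley_hamilton`. The same recursions show that the power sums, and by the reduction of words
in the braid generators (`reduction`) all `ch(α)`, are polynomials in `g, a_1, …, a_k`
(`Setup.charAlg_eq_genAlg`); therefore `π` exists and is unique if these elements are independent.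

*Factorization.* The generating polynomial of `e_i(ν_0, -ν_0, ν_1, …, ν_{2k})` is the one of
`e_i(ν_1, …, ν_{2k})` times `X² - ν_0²`, and the latter polynomial is palindromic with respect to `ν_0²`.
Hence `π(ε_i) = e_i(ν_1, …, ν_{2k})` for all `i ≤ 2k` (`IsSpectralHom.map_eps`). In the completed algebra
the product of the factors `M - q ν_i I` is the value of `∏ (X - q ν_i)` at the `⋆`-powers of `M`
(`prodWith_eq_polyVal`), which is the Cayley-Hamilton expression by Vieta's formulas.
-/

namespace OSpQM

noncomputable section

/-! ### Operators on an infinite chain -/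

section Chain

variable {N : ℕ} {A : Type} [Ring A] [Algebra ℂ A]

/-- Linear operators on the functions of an infinite word `x : ℕ → Fin N`, with values in `A`. All
tensor powers of `V`, with coefficients in `A`, act here at once, so that operators on different
numbers of legs can be multiplied without casts. -/
abbrev Chain (N : ℕ) (A : Type) [Ring A] [Algebra ℂ A] : Type := Module.End ℂ ((ℕ → Fin N) → A)

/-- The matrix unit `e_{ab}` acting in the leg `m`. -/
def eU (A : Type) [Ring A] [Algebra ℂ A] (m : ℕ) (a b : Fin N) : Chain N A where
  toFun f x := if x m = a then f (Function.update x m b) else 0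
  map_add' f g := by ext x; by_cases h : x m = a <;> simp [h]
  map_smul' c f := by ext x; by_cases h : x m = a <;> simp [h]

/-- An element of `A` acting by left multiplication of the values. -/
def cst (N : ℕ) (A : Type) [Ring A] [Algebra ℂ A] : A →ₐ[ℂ] Chain N A where
  toFun c := { toFun := fun f x => c * f x
               map_add' := fun f g => by ext x; simp [mul_add]
               map_smul' := fun r f => by ext x; simp }
  map_one' := by ext; simp
  map_mul' c d := by ext; simp [mul_assoc]
  map_zero' := by ext; simp
  map_add' c d := by ext; simp [add_mul]
  commutes' r := by ext; simp [Algebra.smul_def]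

@[simp] lemma eU_apply (m : ℕ) (a b : Fin N) (f : (ℕ → Fin N) → A) (x : ℕ → Fin N) :
    eU A m a b f x = if x m = a then f (Function.update x m b) else 0 := rfl

@[simp] lemma cst_apply (c : A) (f : (ℕ → Fin N) → A) (x : ℕ → Fin N) :
    cst N A c f x = c * f x := rfl

lemma eU_mul (m : ℕ) (a b c d : Fin N) :
    eU A m a b * eU A m c d = if b = c then eU A m a d else 0 := by
  ext f x
  by_cases h : b = c <;> by_cases h' : x m = a <;> simp [h, h']

lemma eU_comm {m l : ℕ} (h : m ≠ l) (a b c d : Fin N) :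
    Commute (eU A m a b) (eU A l c d) := by
  ext f x
  simp only [Module.End.mul_apply, eU_apply, Function.update_of_ne h, Function.update_of_ne h.symm]
  rw [Function.update_comm h]
  split_ifs <;> rfl

lemma sum_eU (m : ℕ) : ∑ a : Fin N, eU A m a a = 1 := by
  ext f x
  simp [LinearMap.sum_apply, Finset.sum_apply]

lemma cst_comm (c : A) (m : ℕ) (a b : Fin N) : Commute (cst N A c) (eU A m a b) := by
  ext f x
  simp

lemma cst_injective [NeZero N] : Function.Injective (cst N A) := by
  intro c d h
  have := congrFun (congrArg (fun T : Chain N A => T fun _ => 1) h) fun _ => 0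
  simpa using this

/-- `Y` commutes with all operators in the leg `m`, that is, it acts as the identity there. -/
def Off (m : ℕ) (Y : Chain N A) : Prop := ∀ a b, Commute Y (eU A m a b)

namespace Off

variable {m l : ℕ} {X Y : Chain N A}

lemma one : Off m (1 : Chain N A) := fun _ _ => Commute.one_left _
lemma zero : Off m (0 : Chain N A) := fun _ _ => Commute.zero_left _
lemma mul (hX : Off m X) (hY : Off m Y) : Off m (X * Y) := fun a b => (hX a b).mul_left (hY a b)
lemma smul (c : ℂ) (hX : Off m X) : Off m (c • X) := fun a b => (hX a b).smul_left c
lemma sum {ι : Type*} {s : Finset ι} {X : ι → Chain N A} (h : ∀ i ∈ s, Off m (X i)) :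
    Off m (∑ i ∈ s, X i) := fun a b => Commute.sum_left _ _ _ fun i hi => h i hi a b
lemma of_eU (h : l ≠ m) (a b : Fin N) : Off m (eU A l a b) := fun _ _ => eU_comm h _ _ _ _
lemma of_cst (c : A) : Off m (cst N A c) := fun _ _ => cst_comm _ _ _ _

end Off

/-- The sum of the slices of `Y` along the leg `m` : `Y = ∑ Y_{ab} e_{ab}`. -/
lemma sum_slices (m : ℕ) (Y : Chain N A) :
    ∑ a, ∑ b, (∑ c, eU A m c a * Y * eU A m b c) * eU A m a b = Y := by
  have h1 : ∀ a b : Fin N, (∑ c, eU A m c a * Y * eU A m b c) * eU A m a b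
      = eU A m a a * Y * eU A m b b := by
    intro a b
    rw [Finset.sum_mul, Finset.sum_eq_single a]
    · rw [mul_assoc, eU_mul, if_pos rfl]
    · intro c _ hc
      rw [mul_assoc, eU_mul, if_neg hc, mul_zero]
    · simp
  simp_rw [h1]
  simp_rw [← Finset.mul_sum, sum_eU, mul_one, ← Finset.sum_mul, sum_eU, one_mul]

lemma Off.slice (m : ℕ) (Y : Chain N A) (a b : Fin N) :
    Off m (∑ c, eU A m c a * Y * eU A m b c) := by
  intro i j
  rw [commute_iff_eq, Finset.sum_mul, Finset.mul_sum, Finset.sum_eq_single i,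
    Finset.sum_eq_single j]
  · rw [mul_assoc, eU_mul, if_pos rfl, ← mul_assoc, ← mul_assoc, eU_mul, if_pos rfl]
  · intro c _ hc
    rw [← mul_assoc, ← mul_assoc, eU_mul, if_neg (Ne.symm hc), zero_mul, zero_mul]
  · simp
  · intro c _ hc
    rw [mul_assoc, eU_mul, if_neg hc, mul_zero]
  · simp

/-- The coefficients of an expansion in the matrix units of one leg are unique. -/
lemma slices_unique {m : ℕ} {c d : Fin N → Fin N → Chain N A} (hc : ∀ a b, Off m (c a b))
    (hd : ∀ a b, Off m (d a b))
    (h : ∑ a, ∑ b, c a b * eU A m a b = ∑ a, ∑ b, d a b * eU A m a b) (a b : Fin N) :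
    c a b = d a b := by
  have key : ∀ c : Fin N → Fin N → Chain N A, (∀ a b, Off m (c a b)) →
      ∑ i, eU A m i a * (∑ a, ∑ b, c a b * eU A m a b) * eU A m b i = c a b := by
    intro c hc
    have : ∀ i, eU A m i a * (∑ a, ∑ b, c a b * eU A m a b) * eU A m b i
        = c a b * eU A m i i := by
      intro i
      rw [Finset.mul_sum, Finset.sum_mul, Finset.sum_eq_single a]
      · rw [Finset.mul_sum, Finset.sum_mul, Finset.sum_eq_single b]
        · rw [← mul_assoc, ← (hc a b i a).eq, mul_assoc, mul_assoc, eU_mul, if_pos rfl, eU_mul,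
            if_pos rfl]
        · intro b' _ hb
          rw [mul_assoc, mul_assoc, eU_mul, if_neg hb, mul_zero, mul_zero]
        · simp
      · intro a' _ ha
        rw [Finset.mul_sum, Finset.sum_mul]
        refine Finset.sum_eq_zero fun b' _ => ?_
        rw [← mul_assoc, ← (hc a' b' i a).eq, mul_assoc (c a' b'), eU_mul, if_neg (Ne.symm ha),
          mul_zero, zero_mul]
      · simp
    simp_rw [this]
    rw [← Finset.mul_sum, sum_eU, mul_one]
  rw [← key c hc, h, key d hd]

/-! ### Partial traces -/

/-- The (unweighted) partial trace over the leg `m`, followed by the identity operator there. -/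
def ptr (m : ℕ) : Chain N A →ₗ[ℂ] Chain N A :=
  ∑ a, ∑ t, LinearMap.mulLeft ℂ (eU A m a t) ∘ₗ LinearMap.mulRight ℂ (eU A m t a)

lemma ptr_apply (m : ℕ) (Y : Chain N A) :
    ptr m Y = ∑ a, ∑ t, eU A m a t * Y * eU A m t a := by
  simp [ptr, LinearMap.sum_apply, mul_assoc]

/-- The numerical matrix `D` acting in the leg `m`. -/
def legOp (A : Type) [Ring A] [Algebra ℂ A] (D : Matrix (Fin N) (Fin N) ℂ) (m : ℕ) : Chain N A :=
  ∑ s, ∑ t, D s t • eU A m s t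

/-- The partial trace over the leg `m` with the weight `D`, followed by the identity operator
there. -/
def E (D : Matrix (Fin N) (Fin N) ℂ) (m : ℕ) : Chain N A →ₗ[ℂ] Chain N A :=
  ptr m ∘ₗ LinearMap.mulRight ℂ (legOp A D m)

variable (D : Matrix (Fin N) (Fin N) ℂ)

lemma E_apply (m : ℕ) (Y : Chain N A) : E D m Y = ptr m (Y * legOp A D m) := rfl

lemma legOp_off {m l : ℕ} (h : l ≠ m) : Off m (legOp A D l) :=
  Off.sum fun _ _ => Off.sum fun _ _ => (Off.of_eU h _ _).smul _

lemma off_legOp_comm {m : ℕ} {X : Chain N A} (h : Off m X) : Commute X (legOp A D m) :=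
  Commute.sum_right _ _ _ fun s _ => Commute.sum_right _ _ _ fun t _ => (h s t).smul_right _

lemma ptr_mul_left {m : ℕ} {X : Chain N A} (h : Off m X) (Y : Chain N A) :
    ptr m (X * Y) = X * ptr m Y := by
  simp only [ptr_apply, Finset.mul_sum]
  refine Finset.sum_congr rfl fun a _ => Finset.sum_congr rfl fun t _ => ?_
  rw [← mul_assoc, ← (h a t).eq]; simp only [mul_assoc]

lemma ptr_mul_right {m : ℕ} {X : Chain N A} (h : Off m X) (Y : Chain N A) :
    ptr m (Y * X) = ptr m Y * X := by
  simp only [ptr_apply, Finset.sum_mul]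
  refine Finset.sum_congr rfl fun a _ => Finset.sum_congr rfl fun t _ => ?_
  rw [mul_assoc, mul_assoc, (h t a).eq]; simp only [mul_assoc]

lemma E_mul_left {m : ℕ} {X : Chain N A} (h : Off m X) (Y : Chain N A) :
    E D m (X * Y) = X * E D m Y := by
  rw [E_apply, mul_assoc, ptr_mul_left h, E_apply]

lemma E_mul_right {m : ℕ} {X : Chain N A} (h : Off m X) (Y : Chain N A) :
    E D m (Y * X) = E D m Y * X := by
  rw [E_apply, mul_assoc, (off_legOp_comm D h).eq, ← mul_assoc, ptr_mul_right h, E_apply]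

lemma ptr_off (m : ℕ) (Y : Chain N A) : Off m (ptr m Y) := by
  rw [ptr_apply, Finset.sum_comm]
  exact Off.sum fun t _ => Off.slice m Y t t

lemma E_off (m : ℕ) (Y : Chain N A) : Off m (E D m Y) := ptr_off _ _

lemma ptr_off_of {m l : ℕ} {Y : Chain N A} (h : Off l Y) : Off l (ptr m Y) := by
  by_cases e : m = l
  · subst e; exact ptr_off _ _
  · rw [ptr_apply]
    exact Off.sum fun a _ => Off.sum fun t _ => ((Off.of_eU e _ _).mul h).mul (Off.of_eU e _ _)

lemma E_off_of {m l : ℕ} {Y : Chain N A} (h : Off l Y) : Off l (E D m Y) := by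
  by_cases e : m = l
  · subst e; exact E_off _ _ _
  · exact ptr_off_of (h.mul (legOp_off D e))

lemma ptr_eU_comm (m : ℕ) (b c : Fin N) (Y : Chain N A) :
    ptr m (eU A m b c * Y) = ptr m (Y * eU A m b c) := by
  have h1 : ∀ a t, eU A m a t * (eU A m b c * Y) * eU A m t a
      = if t = b then eU A m a c * Y * eU A m t a else 0 := by
    intro a t
    rw [← mul_assoc, eU_mul]; split_ifs <;> simp
  have h2 : ∀ a t, eU A m a t * (Y * eU A m b c) * eU A m t a
      = if c = t then eU A m a t * Y * eU A m b a else 0 := by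
    intro a t
    rw [mul_assoc, mul_assoc Y, eU_mul]; split_ifs <;> simp [mul_assoc]
  simp [ptr_apply, h1, h2]

lemma E_eU (m : ℕ) (a b : Fin N) : E D m (eU A m a b) = D b a • 1 := by
  have : eU A m a b * legOp A D m = ∑ t, D b t • eU A m a t := by
    simp only [legOp, Finset.mul_sum, mul_smul_comm, eU_mul]
    rw [Finset.sum_comm]; simp
  rw [E_apply, this, map_sum, ← sum_eU (A := A) (N := N) m, Finset.smul_sum]
  simp only [map_smul, ptr_apply]
  rw [Finset.sum_eq_single a]
  · rw [Finset.smul_sum]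
    refine Finset.sum_congr rfl fun i _ => ?_
    congr 1
    rw [Finset.sum_eq_single a]
    · rw [eU_mul, if_pos rfl, eU_mul, if_pos rfl]
    · intro t _ ht; rw [eU_mul, if_neg ht, zero_mul]
    · simp
  · intro t _ ht
    rw [Finset.sum_eq_zero, smul_zero]
    intro i _
    refine Finset.sum_eq_zero fun s _ => ?_
    rw [eU_mul]
    split_ifs
    · rw [eU_mul, if_neg]
      rintro rfl; simp_all
    · simp
  · simp

lemma E_one (m : ℕ) : E D m (1 : Chain N A) = D.trace • 1 := by
  rw [← sum_eU (A := A) (N := N) m, map_sum]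
  simp only [E_eU, Matrix.trace, Matrix.diag, Finset.sum_smul, sum_eU]

/-- The partial trace of an operator in terms of its slices. -/
lemma E_eq_sum_slices (m : ℕ) (Y : Chain N A) :
    E D m Y = ∑ a, ∑ b, D b a • ∑ c, eU A m c a * Y * eU A m b c := by
  conv_lhs => rw [← sum_slices m Y]
  simp only [map_sum]
  refine Finset.sum_congr rfl fun a _ => Finset.sum_congr rfl fun b _ => ?_
  rw [E_mul_left D (Off.slice m Y a b), E_eU, mul_smul_comm, mul_one]

/-! ### Numerical operators in two legs -/

/-- The matrix units of `End (V ⊗ V)` in the legs `l`, `m`. -/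
def eU2 (A : Type) [Ring A] [Algebra ℂ A] (l m : ℕ) (p r : Fin N × Fin N) : Chain N A :=
  eU A l p.1 r.1 * eU A m p.2 r.2

/-- The operator `X` on `V ⊗ V` acting in the legs `l`, `m`. -/
def opR (A : Type) [Ring A] [Algebra ℂ A] (X : Op2 N) (l m : ℕ) : Chain N A :=
  ∑ p, ∑ r, X p r • eU2 A l m p r

lemma eU2_mul {l m : ℕ} (h : l ≠ m) (p r p' r' : Fin N × Fin N) :
    eU2 A l m p r * eU2 A l m p' r' = if r = p' then eU2 A l m p r' else 0 := by
  have : eU2 A l m p r * eU2 A l m p' r'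
      = (eU A l p.1 r.1 * eU A l p'.1 r'.1) * (eU A m p.2 r.2 * eU A m p'.2 r'.2) := by
    simp only [eU2]
    rw [mul_assoc, ← mul_assoc (eU A m _ _), (eU_comm h.symm _ _ _ _).eq]
    simp only [mul_assoc]
  rw [this, eU_mul, eU_mul]
  by_cases h1 : r.1 = p'.1 <;> by_cases h2 : r.2 = p'.2 <;> simp [h1, h2, eU2, Prod.ext_iff]

lemma opR_mul {l m : ℕ} (h : l ≠ m) (X Y : Op2 N) : opR A X l m * opR A Y l m = opR A (X * Y) l m := by
  have : ∀ p r, X p r • eU2 A l m p r * opR A Y l m = ∑ r', (X p r * Y r r') • eU2 A l m p r' := by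
    intro p r
    rw [opR, Finset.mul_sum, Finset.sum_eq_single r]
    · rw [Finset.mul_sum]
      refine Finset.sum_congr rfl fun r' _ => ?_
      rw [smul_mul_smul_comm, eU2_mul h, if_pos rfl]
    · intro p' _ hp
      rw [Finset.mul_sum]
      refine Finset.sum_eq_zero fun r' _ => ?_
      rw [smul_mul_smul_comm, eU2_mul h, if_neg (Ne.symm hp), smul_zero]
    · simp
  conv_lhs => rw [opR]
  simp only [Finset.sum_mul, this]
  rw [opR]
  refine Finset.sum_congr rfl fun p _ => ?_
  rw [Finset.sum_comm]
  refine Finset.sum_congr rfl fun r' _ => ?_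
  rw [← Finset.sum_smul, Matrix.mul_apply]

lemma opR_one (l m : ℕ) : opR A (1 : Op2 N) l m = 1 := by
  have : ∀ p : Fin N × Fin N, ∑ r, (1 : Op2 N) p r • eU2 A l m p r = eU A l p.1 p.1 * eU A m p.2 p.2 := by
    intro p
    rw [Finset.sum_eq_single p] <;> simp +contextual [eU2, eq_comm]
  rw [opR]
  simp only [this, Fintype.sum_prod_type, ← Finset.mul_sum, sum_eU, mul_one]

lemma opR_add (X Y : Op2 N) (l m : ℕ) : opR A (X + Y) l m = opR A X l m + opR A Y l m := by
  simp [opR, add_smul, Finset.sum_add_distrib]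

lemma opR_smul (c : ℂ) (X : Op2 N) (l m : ℕ) : opR A (c • X) l m = c • opR A X l m := by
  simp [opR, mul_smul, Finset.smul_sum]

/-- The representation of `End (V ⊗ V)` in two different legs. -/
def opRHom (A : Type) [Ring A] [Algebra ℂ A] {l m : ℕ} (h : l ≠ m) : Op2 N →ₐ[ℂ] Chain N A :=
  AlgHom.ofLinearMap
    { toFun := fun X => opR A X l m
      map_add' := fun X Y => opR_add X Y l m
      map_smul' := fun c X => opR_smul c X l m }
    (opR_one l m) (fun X Y => (opR_mul h X Y).symm)

lemma opR_off {l m j : ℕ} (hl : l ≠ j) (hm : m ≠ j) (X : Op2 N) : Off j (opR A X l m) :=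
  Off.sum fun _ _ => Off.sum fun _ _ => ((Off.of_eU hl _ _).mul (Off.of_eU hm _ _)).smul _

/-- An operator that acts trivially in the two legs commutes with `opR`. -/
lemma off_opR_comm {l m : ℕ} {Y : Chain N A} (hl : Off l Y) (hm : Off m Y) (X : Op2 N) :
    Commute Y (opR A X l m) :=
  Commute.sum_right _ _ _ fun _ _ => Commute.sum_right _ _ _ fun _ _ =>
    ((hl _ _).mul_right (hm _ _)).smul_right _

lemma opR_eq_slices (X : Op2 N) {l m : ℕ} (h : l ≠ m) :
    opR A X l m = ∑ i, ∑ k, (∑ j, ∑ n, X (i, j) (k, n) • eU A m j n) * eU A l i k := by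
  simp only [opR, Fintype.sum_prod_type, eU2, Finset.sum_mul, smul_mul_assoc]
  refine Finset.sum_congr rfl fun i _ => ?_
  rw [Finset.sum_comm]
  refine Finset.sum_congr rfl fun k _ => Finset.sum_congr rfl fun j _ =>
    Finset.sum_congr rfl fun n _ => ?_
  rw [(eU_comm h _ _ _ _).eq]

lemma opR_apply (X : Op2 N) {l m : ℕ} (h : l ≠ m) (f : (ℕ → Fin N) → A) (x : ℕ → Fin N) :
    opR A X l m f x =
      ∑ r, X (x l, x m) r • f (Function.update (Function.update x l r.1) m r.2) := by
  simp only [opR, eU2, LinearMap.sum_apply, Finset.sum_apply, LinearMap.smul_apply, Pi.smul_apply,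
    Module.End.mul_apply, eU_apply, Function.update_of_ne h.symm]
  rw [Finset.sum_eq_single (x l, x m)]
  · simp
  · intro p _ hp
    refine Finset.sum_eq_zero fun r _ => ?_
    split_ifs with h1 h2
    · exact absurd (Prod.ext h1.symm h2.symm) hp
    all_goals simp
  · simp

/-! ### Finitely many legs -/

/-- The representation of the `A`-valued matrices on `n` legs, placed along `φ`. -/
def emb {n : ℕ} (φ : Fin n → ℕ) :
    Matrix (Fin n → Fin N) (Fin n → Fin N) A →ₗ[ℂ] Chain N A where
  toFun X :=
    { toFun := fun f x => ∑ y, X (x ∘ φ) y * f (Function.extend φ y x)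
      map_add' := fun f g => by ext x; simp [mul_add, Finset.sum_add_distrib]
      map_smul' := fun r f => by ext x; simp [Finset.smul_sum] }
  map_add' X Y := by ext f x; simp [add_mul, Finset.sum_add_distrib]
  map_smul' r X := by ext f x; simp [Finset.smul_sum]

lemma emb_apply {n : ℕ} (φ : Fin n → ℕ) (X : Matrix (Fin n → Fin N) (Fin n → Fin N) A)
    (f : (ℕ → Fin N) → A) (x : ℕ → Fin N) :
    emb φ X f x = ∑ y, X (x ∘ φ) y * f (Function.extend φ y x) := rfl

section Emb

variable {n : ℕ} {φ : Fin n → ℕ} (hφ : Function.Injective φ)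
include hφ

lemma extend_comp_self (x : ℕ → Fin N) : Function.extend φ (x ∘ φ) x = x := by
  funext l
  by_cases h : ∃ i, φ i = l
  · obtain ⟨i, rfl⟩ := h
    rw [hφ.extend_apply]; rfl
  · rw [Function.extend_apply' _ _ _ h]

lemma extend_comp_leg (y : Fin n → Fin N) (x : ℕ → Fin N) : Function.extend φ y x ∘ φ = y :=
  funext fun i => hφ.extend_apply y x i

lemma extend_extend (y z : Fin n → Fin N) (x : ℕ → Fin N) :
    Function.extend φ y (Function.extend φ z x) = Function.extend φ y x := by
  funext l
  by_cases h : ∃ i, φ i = l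
  · obtain ⟨i, rfl⟩ := h
    rw [hφ.extend_apply, hφ.extend_apply]
  · simp only [Function.extend_apply' _ _ _ h]

lemma extend_eq_iff (y : Fin n → Fin N) (x z : ℕ → Fin N) :
    Function.extend φ y x = z ↔ z ∘ φ = y ∧ ∀ l, (¬ ∃ i, φ i = l) → x l = z l := by
  constructor
  · rintro rfl
    refine ⟨extend_comp_leg hφ y x, fun l hl => (Function.extend_apply' _ _ _ hl).symm⟩
  · rintro ⟨rfl, h⟩
    funext l
    by_cases hl : ∃ i, φ i = l
    · obtain ⟨i, rfl⟩ := hl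
      rw [hφ.extend_apply]; rfl
    · rw [Function.extend_apply' _ _ _ hl, h l hl]

lemma emb_one : emb φ (1 : Matrix (Fin n → Fin N) (Fin n → Fin N) A) = 1 := by
  ext f x
  simp [emb_apply, Matrix.one_apply, extend_comp_self hφ]

lemma emb_mul (X Y : Matrix (Fin n → Fin N) (Fin n → Fin N) A) :
    emb φ (X * Y) = emb φ X * emb φ Y := by
  ext f x
  simp only [emb_apply, Module.End.mul_apply, extend_comp_leg hφ, extend_extend hφ, Matrix.mul_apply,
    Finset.sum_mul, Finset.mul_sum, mul_assoc]
  rw [Finset.sum_comm]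

lemma emb_injective [NeZero N] :
    Function.Injective (emb φ : Matrix (Fin n → Fin N) (Fin n → Fin N) A →ₗ[ℂ] Chain N A) := by
  classical
  intro X Y h
  ext a b
  have := congrFun (congrArg (fun T : Chain N A => T fun w => if w ∘ φ = b then 1 else 0) h)
    (Function.extend φ a fun _ => 0)
  simpa [emb_apply, extend_comp_leg hφ] using this

lemma emb_scal_opAt (X : Op2 N) {m : ℕ} (h : m + 1 < n) :
    emb φ (scal A (opAt n X m)) = opR A X (φ ⟨m, by omega⟩) (φ ⟨m + 1, h⟩) := by
  have hne : φ ⟨m, by omega⟩ ≠ φ ⟨m + 1, h⟩ := fun e => by simpa using hφ e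
  ext f x
  rw [opR_apply X hne, emb_apply]
  simp only [scal, opAt, Matrix.map_apply, Matrix.of_apply, dif_pos h, ← Algebra.smul_def,
    Function.comp_apply, ite_smul, zero_smul]
  rw [← Finset.sum_filter]
  refine Finset.sum_bij' (fun y _ => (y ⟨m, by omega⟩, y ⟨m + 1, h⟩))
    (fun r _ => Function.update (Function.update (x ∘ φ) ⟨m, by omega⟩ r.1) ⟨m + 1, h⟩ r.2)
    ?_ ?_ ?_ ?_ ?_
  · simp
  · intro r _
    simp only [Finset.mem_filter, Finset.mem_univ, true_and]
    intro l h1 h2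
    rw [Function.update_of_ne (fun e => h2 (congrArg Fin.val e)),
      Function.update_of_ne (fun e => h1 (congrArg Fin.val e))]
    rfl
  · intro y hy
    simp only [Finset.mem_filter, Finset.mem_univ, true_and] at hy
    funext l
    by_cases h2 : l = ⟨m + 1, h⟩
    · subst h2; simp
    · rw [Function.update_of_ne h2]
      by_cases h1 : l = ⟨m, by omega⟩
      · subst h1; simp
      · rw [Function.update_of_ne h1]
        exact hy l (fun e => h1 (Fin.ext e)) (fun e => h2 (Fin.ext e))
  · intro r _
    simp
  · intro y hy
    simp only [Finset.mem_filter, Finset.mem_univ, true_and] at hy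
    congr 2
    rw [extend_eq_iff hφ]
    constructor
    · funext l
      by_cases h2 : l = ⟨m + 1, h⟩
      · subst h2; simp
      · by_cases h1 : l = ⟨m, by omega⟩
        · subst h1; simp [hne]
        · have e1 : φ l ≠ φ ⟨m, by omega⟩ := fun e => h1 (hφ e)
          have e2 : φ l ≠ φ ⟨m + 1, h⟩ := fun e => h2 (hφ e)
          simp only [Function.comp_apply, Function.update_of_ne e1, Function.update_of_ne e2]
          exact hy l (fun e => h1 (Fin.ext e)) (fun e => h2 (Fin.ext e))
    · intro l hl
      rw [Function.update_of_ne (fun e => hl ⟨_, e.symm⟩),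
        Function.update_of_ne (fun e => hl ⟨_, e.symm⟩)]

/-- The representation `emb φ` of the numerical operators on `n` legs. -/
def num (A : Type) [Ring A] [Algebra ℂ A] : OpN N n →ₐ[ℂ] Chain N A :=
  AlgHom.ofLinearMap (emb φ ∘ₗ
    { toFun := fun X => scal A X
      map_add' := fun X Y => by ext; simp [scal]
      map_smul' := fun r X => by ext; simp [scal, Algebra.algebraMap_eq_smul_one (A := A), mul_smul] })
    (by simp [scal, Matrix.map_one, emb_one hφ])
    (fun X Y => by simp [scal, Matrix.map_mul, emb_mul hφ])

lemma num_apply (X : OpN N n) : num hφ A X = emb φ (scal A X) := rfl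

end Emb

/-- The legs `s, …, s + n - 1`. -/
def ofs (s n : ℕ) : Fin n → ℕ := fun i => s + i

lemma ofs_injective (s n : ℕ) : Function.Injective (ofs s n) := by
  intro i j h
  ext
  simpa [ofs] using h

/-- The matrix `X` acting in the leg `0`. -/
def leg (X : Matrix (Fin N) (Fin N) A) : Chain N A := ∑ a, ∑ b, cst N A (X a b) * eU A 0 a b

lemma leg_injective [NeZero N] : Function.Injective (leg : Matrix (Fin N) (Fin N) A → Chain N A) := by
  intro X Y h
  ext a b
  exact cst_injective (slices_unique (fun a b => Off.of_cst (X a b)) (fun a b => Off.of_cst (Y a b)) h a b)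

lemma leg_apply (X : Matrix (Fin N) (Fin N) A) (f : (ℕ → Fin N) → A) (x : ℕ → Fin N) :
    leg X f x = ∑ b, X (x 0) b * f (Function.update x 0 b) := by
  simp only [leg, LinearMap.sum_apply, Finset.sum_apply, Module.End.mul_apply, cst_apply, eU_apply]
  rw [Finset.sum_comm]
  simp

/-- The word `y b`. -/
abbrev snocW {n : ℕ} (y : Fin n → Fin N) (b : Fin N) : Fin (n + 1) → Fin N :=
  Fin.snoc (α := fun _ => Fin N) y b

/-- The trace with weight `D` over the last leg. -/
def ptrLast (D : Matrix (Fin N) (Fin N) ℂ) {n : ℕ}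
    (Y : Matrix (Fin (n + 1) → Fin N) (Fin (n + 1) → Fin N) A) :
    Matrix (Fin n → Fin N) (Fin n → Fin N) A :=
  Matrix.of fun x y => ∑ s, ∑ t, D s t • Y (snocW x t) (snocW y s)

lemma E_apply_apply (m : ℕ) (Y : Chain N A) (f : (ℕ → Fin N) → A) (x : ℕ → Fin N) :
    E D m Y f x = ∑ s, ∑ t, D s t • Y (eU A m s (x m) f) (Function.update x m t) := by
  have h : ∀ a t, eU A m a t * (Y * legOp A D m) * eU A m t a
      = ∑ s, D s t • (eU A m a t * Y * eU A m s a) := by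
    intro a t
    simp only [legOp, Finset.mul_sum, Finset.sum_mul, mul_smul_comm, smul_mul_assoc, mul_assoc,
      eU_mul]
    refine Finset.sum_congr rfl fun s _ => ?_
    rw [Finset.sum_eq_single t] <;> simp +contextual
  rw [E_apply, ptr_apply]
  simp only [h, LinearMap.sum_apply, Finset.sum_apply, LinearMap.smul_apply, Pi.smul_apply,
    Module.End.mul_apply]
  simp only [eU_apply m _ _ (Y _) x]
  rw [Finset.sum_eq_single (x m)]
  · rw [Finset.sum_comm]; simp
  · intro a _ ha
    simp [Ne.symm ha]
  · simp

lemma sum_snocW {M : Type*} [AddCommMonoid M] {n : ℕ} (g : (Fin (n + 1) → Fin N) → M) :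
    ∑ y, g y = ∑ b, ∑ y, g (snocW y b) := by
  rw [← (Fin.snocEquiv fun _ => Fin N).sum_comp, Fintype.sum_prod_type]
  rfl

lemma E_emb (s n : ℕ) (Y : Matrix (Fin (n + 1) → Fin N) (Fin (n + 1) → Fin N) A) :
    E D (s + n) (emb (ofs s (n + 1)) Y) = emb (ofs s n) (ptrLast D Y) := by
  ext f x
  simp only [E_apply_apply, emb_apply, ptrLast, Matrix.of_apply, eU_apply, Finset.sum_mul,
    smul_mul_assoc]
  conv_rhs => rw [Finset.sum_comm]
  refine Finset.sum_congr rfl fun a _ => ?_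
  conv_rhs => rw [Finset.sum_comm]
  refine Finset.sum_congr rfl fun t _ => ?_
  rw [← Finset.smul_sum]
  congr 1
  rw [sum_snocW, Finset.sum_eq_single a]
  · refine Finset.sum_congr rfl fun y _ => ?_
    have e1 : Function.update x (s + n) t ∘ ofs s (n + 1)
        = snocW (x ∘ ofs s n) t := by
      funext i
      refine Fin.lastCases ?_ (fun i => ?_) i
      · simp [ofs]
      · have : s + (i : ℕ) ≠ s + n := by omega
        simp [ofs, Function.update_of_ne this]
    have e2 : ∀ b, Function.extend (ofs s (n + 1)) (snocW y b)
        (Function.update x (s + n) t) (s + n) = b := by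
      intro b
      have := (ofs_injective s (n + 1)).extend_apply (snocW y b)
        (Function.update x (s + n) t) (Fin.last n)
      simpa [ofs] using this
    have e3 : Function.update (Function.extend (ofs s (n + 1)) (snocW y a)
        (Function.update x (s + n) t)) (s + n) (x (s + n)) = Function.extend (ofs s n) y x := by
      symm
      rw [extend_eq_iff (ofs_injective s n)]
      constructor
      · funext i
        have h1 : s + (i : ℕ) ≠ s + n := by omega
        have := (ofs_injective s (n + 1)).extend_apply (snocW y a)
          (Function.update x (s + n) t) i.castSucc
        simp only [ofs, Fin.val_castSucc, Fin.snoc_castSucc] at this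
        simp [ofs, Function.update_of_ne h1, this]
      · intro l hl
        by_cases h1 : l = s + n
        · subst h1; simp
        · rw [Function.update_of_ne h1, Function.extend_apply', Function.update_of_ne h1]
          rintro ⟨i, rfl⟩
          refine Fin.lastCases (fun h1 _ => h1 (by simp [ofs])) (fun i _ hl => ?_) i h1 hl
          exact hl ⟨i, by simp [ofs]⟩
    simp only [e1, e2, if_true, e3]
  · intro b _ hb
    refine Finset.sum_eq_zero fun y _ => ?_
    have e2 : Function.extend (ofs s (n + 1)) (snocW y b)
        (Function.update x (s + n) t) (s + n) = b := by
      have := (ofs_injective s (n + 1)).extend_apply (snocW y b)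
        (Function.update x (s + n) t) (Fin.last n)
      simpa [ofs] using this
    simp only [e2, if_neg hb, mul_zero]
  · simp

end Chain

/-! ### Iterated R-traces and conjugation -/

section Sums

variable {M : Type*} [AddCommMonoid M] {ι κ l m : Type*} [Fintype ι] [Fintype κ] [Fintype l]
  [Fintype m]

lemma sum_comm_one_two (f : ι → κ → l → M) : ∑ i, ∑ k, ∑ j, f i k j = ∑ k, ∑ j, ∑ i, f i k j := by
  rw [Finset.sum_comm]
  exact Finset.sum_congr rfl fun k _ => Finset.sum_comm

lemma sum_comm_two_two (f : ι → κ → l → m → M) :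
    ∑ i, ∑ k, ∑ j, ∑ n, f i k j n = ∑ j, ∑ n, ∑ i, ∑ k, f i k j n := by
  simp_rw [sum_comm_one_two (f _)]
  rw [sum_comm_one_two]

end Sums

section Traces

variable {N : ℕ} {A : Type} [Ring A] [Algebra ℂ A] (D : Matrix (Fin N) (Fin N) ℂ)

/-- The partial trace over the legs `s + 1, …, s + m`. -/
def trs (s : ℕ) : ℕ → Chain N A →ₗ[ℂ] Chain N A
  | 0 => LinearMap.id
  | m + 1 => trs s m ∘ₗ E D (s + m + 1)

@[simp] lemma trs_zero (s : ℕ) (Y : Chain N A) : trs D s 0 Y = Y := rfl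

lemma trs_succ (s m : ℕ) (Y : Chain N A) : trs D s (m + 1) Y = trs D s m (E D (s + m + 1) Y) := rfl

/-- The word `a y`. -/
abbrev consW {n : ℕ} (a : Fin N) (y : Fin n → Fin N) : Fin (n + 1) → Fin N :=
  Fin.cons (α := fun _ => Fin N) a y

lemma sum_consW {M : Type*} [AddCommMonoid M] {n : ℕ} (g : (Fin (n + 1) → Fin N) → M) :
    ∑ y, g y = ∑ b, ∑ y, g (consW b y) := by
  rw [← (Fin.consEquiv fun _ => Fin N).sum_comp, Fintype.sum_prod_type]
  rfl

lemma traceTail_succ {n : ℕ} (Y : Matrix (Fin (n + 2) → Fin N) (Fin (n + 2) → Fin N) A) :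
    traceTail D Y = traceTail D (ptrLast D Y) := by
  ext a b
  simp only [traceTail, ptrLast, Matrix.of_apply]
  rw [sum_snocW, Finset.sum_comm]
  refine Finset.sum_congr rfl fun s _ => ?_
  simp_rw [sum_snocW (n := n), Finset.smul_sum]
  rw [← sum_comm_one_two]
  refine Finset.sum_congr rfl fun t _ => Finset.sum_congr rfl fun b' _ =>
    Finset.sum_congr rfl fun a' _ => ?_
  rw [smul_smul, Fin.prod_univ_castSucc]
  simp only [snocW, Fin.snoc_castSucc, Fin.snoc_last, Fin.cons_snoc_eq_snoc_cons]

lemma leg_traceTail (n : ℕ) (Y : Matrix (Fin (n + 1) → Fin N) (Fin (n + 1) → Fin N) A) :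
    leg (traceTail D Y) = trs D 0 n (emb (ofs 0 (n + 1)) Y) := by
  induction n with
  | zero =>
    ext f x
    rw [leg_apply, trs_zero, emb_apply, sum_consW]
    refine Finset.sum_congr rfl fun b _ => ?_
    simp only [traceTail, Matrix.of_apply, Finset.univ_unique, Finset.sum_singleton,
      Finset.univ_eq_empty, Finset.prod_empty, one_smul]
    have e : ∀ (c : Fin N) y, consW c y = fun _ : Fin 1 => c := fun c y => by
      funext i; rw [show i = 0 by omega]; rfl
    congr 2
    · exact (e _ _).trans (by funext i; rw [show i = 0 by omega]; rfl)
    · symm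
      rw [extend_eq_iff (ofs_injective _ _)]
      refine ⟨by funext i; rw [show i = 0 by omega]; simp [ofs], fun l hl => ?_⟩
      rw [Function.update_of_ne]
      exact fun h => hl ⟨0, by simp [ofs, h]⟩
  | succ n ih =>
    rw [traceTail_succ, ih, trs_succ, ← E_emb]
    simp only [zero_add]

lemma E_leg (X : Matrix (Fin N) (Fin N) A) :
    E D 0 (leg X) = cst N A (∑ a, ∑ b, D b a • X a b) := by
  simp only [leg, map_sum, map_smul]
  refine Finset.sum_congr rfl fun a _ => Finset.sum_congr rfl fun b _ => ?_
  rw [E_mul_left D (Off.of_cst _), E_eU, mul_smul_comm, mul_one]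

lemma traceAll_eq {n : ℕ} (Y : Matrix (Fin (n + 1) → Fin N) (Fin (n + 1) → Fin N) A) :
    traceAll D Y = ∑ a, ∑ b, D b a • traceTail D Y a b := by
  simp only [traceAll, traceTail, Matrix.of_apply]
  rw [sum_consW]
  simp_rw [sum_consW (n := n), Finset.smul_sum]
  conv_rhs => rw [Finset.sum_comm]
  refine Finset.sum_congr rfl fun b _ => ?_
  rw [Finset.sum_comm]
  refine Finset.sum_congr rfl fun a _ => Finset.sum_congr rfl fun s _ =>
    Finset.sum_congr rfl fun t _ => ?_
  rw [smul_smul, Fin.prod_univ_succ]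
  simp only [consW, Fin.cons_zero, Fin.cons_succ]

lemma cst_traceAll (n : ℕ) (Y : Matrix (Fin (n + 1) → Fin N) (Fin (n + 1) → Fin N) A) :
    cst N A (traceAll D Y) = E D 0 (trs D 0 n (emb (ofs 0 (n + 1)) Y)) := by
  rw [← leg_traceTail, E_leg, traceAll_eq]

lemma emb_copy_zero (F : Op2 N) (M : Matrix (Fin N) (Fin N) A) (n : ℕ) :
    emb (ofs 0 (n + 1)) (copy F M n 0) = leg M := by
  ext f x
  rw [leg_apply, emb_apply]
  simp only [copy, Matrix.of_apply, ite_mul, zero_mul]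
  rw [← Finset.sum_filter]
  refine Finset.sum_bij' (fun y _ => y 0) (fun b _ => Function.update (x ∘ ofs 0 (n + 1)) 0 b)
    (by simp) ?_ ?_ (by simp) ?_
  · intro b _
    simp +contextual
  · intro y hy
    simp only [Finset.mem_filter, Finset.mem_univ, true_and] at hy
    funext l
    by_cases h : l = 0
    · subst h; simp
    · rw [Function.update_of_ne h]; exact hy l h
  · intro y hy
    simp only [Finset.mem_filter, Finset.mem_univ, true_and] at hy
    congr 2
    rw [extend_eq_iff (ofs_injective _ _)]
    constructor
    · funext l
      by_cases h : l = 0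
      · subst h; simp [ofs]
      · have : ofs 0 (n + 1) l ≠ 0 := by simpa [ofs] using h
        rw [Function.comp_apply, Function.update_of_ne this]; exact hy l h
    · intro l hl
      rw [Function.update_of_ne]
      exact fun h => hl ⟨0, by simp [ofs, h]⟩

end Traces

section Numerical

variable {N : ℕ} {R : Op2 N}

lemma skewInv_spec (h : SkewInvertible R) : IsSkewInverse R (skewInv R) := by
  rw [skewInv, dif_pos h]; exact h.choose_spec

/-- The slices of a skew invertible operator span all matrices: a linear map on matrices is determined
by its values on the slices of `R`, and the map with value `z` on the slices that sum up to the
identity is a multiple of the trace with weight `D_R`. -/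
lemma matD_smul_of_slices (h : SkewInvertible R) {M : Type*} [AddCommGroup M] [Module ℂ M]
    {φ : Fin N → Fin N → M} {z : M}
    (hφ : ∀ i k, ∑ j, ∑ l, R (i, j) (k, l) • φ j l = if i = k then z else 0) (i j : Fin N) :
    φ j i = matD R i j • z := by
  have h1 : φ j i = ∑ i', ∑ j', (if i = j' ∧ i' = j then (1 : ℂ) else 0) • φ i' j' := by
    rw [Finset.sum_eq_single j, Finset.sum_eq_single i] <;> simp +contextual [eq_comm]
  simp_rw [h1, ← (skewInv_spec h).2 i j, Finset.sum_smul, mul_smul]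
  calc _ = ∑ a, ∑ m, skewInv R (i, a) (j, m) • ∑ i', ∑ j', R (m, i') (a, j') • φ i' j' := by
        simp_rw [Finset.smul_sum]
        exact sum_comm_two_two _
    _ = _ := by simp [hφ, matD, Finset.sum_smul]

/-- `Tr₍₂₎ (D_R)₂ R = I`. -/
lemma sum_mul_matD (h : SkewInvertible R) (i k : Fin N) :
    ∑ j, ∑ l, R (i, j) (k, l) * matD R l j = if i = k then 1 else 0 := by
  have := fun c => (skewInv_spec h).1 i k c c
  have h2 : ∑ c, ∑ a, ∑ m, R (i, a) (k, m) * skewInv R (m, c) (a, c) = if i = k then 1 else 0 := by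
    simp_rw [this]
    by_cases e : i = k
    · subst e; rw [Finset.sum_eq_single i] <;> simp +contextual [eq_comm]
    · rw [if_neg e]; refine Finset.sum_eq_zero fun c _ => if_neg fun hc => e (hc.1.trans hc.2)
  rw [← h2, sum_comm_one_two]
  simp [matD, Finset.mul_sum]

end Numerical

section Conj

variable {N : ℕ} {A : Type} [Ring A] [Algebra ℂ A]

lemma E_opR (D : Matrix (Fin N) (Fin N) ℂ) (X : Op2 N) {l m : ℕ} (h : l ≠ m) :
    E D m (opR A X l m) = ∑ i, ∑ k, (∑ j, ∑ n, X (i, j) (k, n) * D n j) • eU A l i k := by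
  rw [opR_eq_slices X h]
  simp only [map_sum]
  refine Finset.sum_congr rfl fun i _ => Finset.sum_congr rfl fun k _ => ?_
  rw [E_mul_right D (Off.of_eU h _ _)]
  simp only [map_sum, map_smul, E_eU, smul_smul, ← Finset.sum_smul, smul_one_mul]

lemma E_opR_self {R : Op2 N} (hR : SkewInvertible R) {l m : ℕ} (h : l ≠ m) :
    E (matD R) m (opR A R l m) = 1 := by
  rw [E_opR _ _ h]
  simp only [sum_mul_matD hR, ite_smul, one_smul, zero_smul, Finset.sum_ite_eq, Finset.mem_univ,
    if_true, sum_eU]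

/-- Comparison of coefficients in the leg `l`: here `φ` is a map applied to the second factor of `X`, and
all operators `φ j n` act trivially in the leg `l`. -/
lemma slices_eq_of_sum {φ : Fin N → Fin N → Chain N A} {z : Chain N A} {X : Op2 N} {l : ℕ}
    (hφ : ∀ j n, Off l (φ j n)) (hz : Off l z)
    (h : ∑ i, ∑ k, (∑ j, ∑ n, X (i, j) (k, n) • φ j n) * eU A l i k = z) (i k : Fin N) :
    ∑ j, ∑ n, X (i, j) (k, n) • φ j n = if i = k then z else 0 := by
  refine slices_unique (m := l) (c := fun i k => ∑ j, ∑ n, X (i, j) (k, n) • φ j n)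
    (d := fun i k => if i = k then z else 0)
    (fun a b => Off.sum fun j _ => Off.sum fun n _ => (hφ j n).smul _)
    (fun a b => by split_ifs; exacts [hz, Off.zero]) ?_ i k
  rw [h]
  simp [← Finset.mul_sum, sum_eU]

/-- The weighted trace over the second leg of a conjugate `G Y G⁻¹` of an operator in the first leg is
the weighted trace of `Y`, provided that conjugation by `G` can be traded against a conjugation of
`R` in the neighbouring legs. -/
lemma E_conj_of {R : Op2 N} (hR : SkewInvertible R) {l m m' : ℕ} (hlm : l ≠ m) (hlm' : l ≠ m')
    (hmm' : m ≠ m') {G G' : Op2 N} {U U' : Chain N A} (hU : Off m' U) (hU' : Off m' U')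
    (hUU : U * U' = 1)
    (h : opR A G m m' * opR A R l m * opR A G' m m' = U * opR A R m m' * U')
    {Y : Chain N A} (hY : Off m' Y) :
    E (matD R) m' (opR A G m m' * Y * opR A G' m m') = E (matD R) m Y := by
  have h1 : E (matD R) m' (opR A G m m' * opR A R l m * opR A G' m m') = 1 := by
    rw [h, E_mul_right _ hU', E_mul_left _ hU, E_opR_self hR hmm', mul_one, hUU]
  have hl : ∀ i k : Fin N, Off m' (eU A l i k) := fun i k => Off.of_eU hlm' i k
  have hG : ∀ (G : Op2 N) (i k : Fin N), Commute (eU A l i k) (opR A G m m') := fun G i k =>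
    off_opR_comm (Off.of_eU hlm i k) (Off.of_eU hlm' i k) G
  have h2 := slices_eq_of_sum (X := R) (l := l) (z := (1 : Chain N A))
    (φ := fun j n => E (matD R) m' (opR A G m m' * eU A m j n * opR A G' m m'))
    (fun j n => E_off_of _ (((opR_off (Ne.symm hlm) (Ne.symm hlm') G).mul
      (Off.of_eU (Ne.symm hlm) _ _)).mul (opR_off (Ne.symm hlm) (Ne.symm hlm') G'))) Off.one (by
      rw [← h1, opR_eq_slices R hlm]
      simp only [Finset.mul_sum, Finset.sum_mul, map_sum, mul_smul_comm, smul_mul_assoc, map_smul]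
      refine Finset.sum_congr rfl fun i _ => Finset.sum_congr rfl fun k _ =>
        Finset.sum_congr rfl fun j _ => Finset.sum_congr rfl fun n _ => ?_
      rw [← E_mul_right _ (hl i k)]
      simp only [mul_assoc]
      rw [(hG G' i k).eq])
  -- The traces of the conjugated matrix units satisfy the equations of `sum_mul_matD` and are
  -- therefore equal to the entries of `D`; the rest is the expansion of `Y` in matrix units.
  have h3 := matD_smul_of_slices hR h2
  obtain ⟨Z, hZ⟩ : ∃ Z : Fin N → Fin N → Chain N A,
      Z = fun a b => ∑ c, eU A m c a * Y * eU A m b c := ⟨_, rfl⟩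
  have hY2 : ∑ a, ∑ b, Z a b * eU A m a b = Y := by rw [hZ]; exact sum_slices m Y
  have z1 : ∀ a b, Off m (Z a b) := fun a b => by rw [hZ]; exact Off.slice m Y a b
  have z2 : ∀ a b, Off m' (Z a b) := fun a b => by
    rw [hZ]; exact Off.sum fun c _ => ((Off.of_eU hmm' _ _).mul hY).mul (Off.of_eU hmm' _ _)
  rw [← hY2]
  simp only [Finset.mul_sum, Finset.sum_mul, map_sum]
  refine Finset.sum_congr rfl fun a _ => Finset.sum_congr rfl fun b _ => ?_
  rw [← mul_assoc, ← (off_opR_comm (z1 a b) (z2 a b) G).eq, mul_assoc, mul_assoc,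
    E_mul_left _ (z2 a b), ← mul_assoc, h3, E_mul_left _ (z1 a b), E_eU]

end Conj

/-! ### The relations of the Birman-Murakami-Wenzl algebra -/

section BMW

variable {B : Type*} [Ring B] [Algebra ℂ B]

/-- The polynomial `κ = μ⁻¹ (q - q⁻¹)⁻¹ (q - s)(q⁻¹ + s)` in a generator `s`. -/
def kap (q μ : ℂ) (s : B) : B := (μ * (q - q⁻¹))⁻¹ • ((q • (1 : B) - s) * (q⁻¹ • (1 : B) + s))

/-- The inverse of a generator `s` satisfying the cubic relation. -/
def inv' (q μ : ℂ) (s : B) : B := s - (q - q⁻¹) • (1 : B) + (q - q⁻¹) • kap q μ s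

/-- The cubic characteristic equation of a generator. -/
def Cubic (q μ : ℂ) (s : B) : Prop :=
  (s - q • (1 : B)) * (s + q⁻¹ • (1 : B)) * (s - μ • (1 : B)) = 0

/-- The parameters are generic enough for `κ` to be defined. -/
structure Params (q μ : ℂ) : Prop where
  q_ne : q ≠ 0
  lam_ne : q - q⁻¹ ≠ 0
  mu_ne : μ ≠ 0
  mu_q : μ ≠ q
  mu_q' : μ ≠ -q⁻¹

variable {q μ : ℂ} {s t : B}

lemma map_kap {B' : Type*} [Ring B'] [Algebra ℂ B'] (f : B →ₐ[ℂ] B') (s : B) :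
    f (kap q μ s) = kap q μ (f s) := by
  simp [kap]

lemma map_inv' {B' : Type*} [Ring B'] [Algebra ℂ B'] (f : B →ₐ[ℂ] B') (s : B) :
    f (inv' q μ s) = inv' q μ (f s) := by
  simp [inv', map_kap]

lemma kap_comm (hst : Commute s t) : Commute (kap q μ s) t := by
  unfold kap
  exact ((((Commute.one_left t).smul_left q).sub_left hst).mul_left
    (((Commute.one_left t).smul_left _).add_left hst)).smul_left _

/-- Everything intertwining two generators intertwines the corresponding elements `κ`. -/
lemma kap_intertwine {w : B} (h : w * s = t * w) : w * kap q μ s = kap q μ t * w := by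
  simp only [kap, mul_smul_comm, smul_mul_assoc]
  congr 1
  have h1 : w * (q • 1 - s) = (q • 1 - t) * w := by
    rw [mul_sub, sub_mul, h]; simp
  have h2 : w * (q⁻¹ • 1 + s) = (q⁻¹ • 1 + t) * w := by
    rw [mul_add, add_mul, h]; simp
  rw [← mul_assoc, h1, mul_assoc, h2, mul_assoc]

section Single

variable (hP : Params q μ)
include hP

lemma mul_self_eq (s : B) :
    s * s = 1 + (q - q⁻¹) • s - ((q - q⁻¹) * μ) • kap q μ s := by
  have h1 := hP.q_ne
  have h2 := hP.lam_ne
  have h3 := hP.mu_ne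
  have : ((q - q⁻¹) * μ) • kap q μ s = (q • (1 : B) - s) * (q⁻¹ • (1 : B) + s) := by
    rw [kap, smul_smul, mul_comm (q - q⁻¹) μ, mul_inv_cancel₀ (mul_ne_zero h3 h2), one_smul]
  rw [this, sub_mul, mul_add, mul_add]
  simp only [smul_mul_assoc, one_mul, mul_smul_comm, mul_one, smul_smul]
  match_scalars <;> field_simp <;> ring

omit hP in
lemma mul_kap (hs : Cubic q μ s) : s * kap q μ s = μ • kap q μ s := by
  have : (s - μ • (1 : B)) * kap q μ s = 0 := by
    have h : (s - μ • (1 : B)) * ((q • (1 : B) - s) * (q⁻¹ • (1 : B) + s)) =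
        - ((s - q • (1 : B)) * (s + q⁻¹ • (1 : B)) * (s - μ • (1 : B))) := by
      have c : Commute (s - μ • (1 : B)) ((q • (1 : B) - s) * (q⁻¹ • (1 : B) + s)) := by
        have cs : Commute (s - μ • (1 : B)) s :=
          (Commute.refl s).sub_left ((Commute.one_left s).smul_left μ)
        have c1 : ∀ c : ℂ, Commute (s - μ • (1 : B)) (c • (1 : B)) :=
          fun c => (Commute.one_right _).smul_right c
        exact ((c1 q).sub_right cs).mul_right ((c1 _).add_right cs)
      rw [c.eq, ← neg_mul, ← neg_mul]
      congr 2
      · abel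
      · abel
    rw [kap, mul_smul_comm, h, hs, neg_zero, smul_zero]
  rwa [sub_mul, smul_mul_assoc, one_mul, sub_eq_zero] at this

omit hP in
lemma kap_mul (hs : Cubic q μ s) : kap q μ s * s = μ • kap q μ s := by
  rw [(kap_comm (Commute.refl s)).eq, mul_kap hs]

lemma kap_mul_kap (hs : Cubic q μ s) : kap q μ s * kap q μ s = eta q μ • kap q μ s := by
  have e : kap q μ s * kap q μ s
      = (μ * (q - q⁻¹))⁻¹ • ((q • (1 : B) - s) * (q⁻¹ • (1 : B) + s)) * kap q μ s := rfl
  rw [e, smul_mul_assoc, mul_assoc, add_mul, mul_kap hs]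
  have : q⁻¹ • (1 : B) * kap q μ s + μ • kap q μ s = (q⁻¹ + μ) • kap q μ s := by
    rw [smul_mul_assoc, one_mul, add_smul]
  rw [this, mul_smul_comm, sub_mul, mul_kap hs, smul_mul_assoc, one_mul, ← sub_smul, smul_smul,
    smul_smul, eta]
  congr 1
  have h2 := hP.lam_ne
  have h3 := hP.mu_ne
  field_simp

lemma eta_ne : eta q μ ≠ 0 := by
  unfold eta
  refine div_ne_zero (mul_ne_zero (sub_ne_zero.2 hP.mu_q.symm) ?_)
    (mul_ne_zero hP.mu_ne hP.lam_ne)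
  intro h
  exact hP.mu_q' (eq_neg_of_add_eq_zero_right h)

lemma mul_inv' (hs : Cubic q μ s) : s * inv' q μ s = 1 := by
  rw [inv', mul_add, mul_sub, mul_self_eq hP s, mul_smul_comm, mul_smul_comm, mul_one, mul_kap hs]
  module

lemma inv'_mul (hs : Cubic q μ s) : inv' q μ s * s = 1 := by
  rw [inv', add_mul, sub_mul, mul_self_eq hP s, smul_mul_assoc, smul_mul_assoc, one_mul, kap_mul hs]
  module

lemma kap_mul_inv' (hs : Cubic q μ s) : kap q μ s * inv' q μ s = μ⁻¹ • kap q μ s := by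
  have h := congrArg (· * inv' q μ s) (kap_mul hs)
  simp only [mul_assoc, mul_inv' hP hs, mul_one, smul_mul_assoc] at h
  conv_rhs => rw [h]
  rw [smul_smul, inv_mul_cancel₀ hP.mu_ne, one_smul]

end Single

/-- The relations between two neighbouring generators of the Birman-Murakami-Wenzl algebra. -/
structure BMWPair (q μ : ℂ) (s t : B) : Prop where
  cubic_left : Cubic q μ s
  cubic_right : Cubic q μ t
  braid : s * t * s = t * s * t
  kk₁ : kap q μ t * kap q μ s = s * t * kap q μ s
  kk₂ : kap q μ t * kap q μ s = kap q μ t * s * t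
  kk₃ : kap q μ s * kap q μ t = t * s * kap q μ t
  kk₄ : kap q μ s * kap q μ t = kap q μ s * t * s
  kkk₁ : kap q μ s * kap q μ t * kap q μ s = kap q μ s
  kkk₂ : kap q μ t * kap q μ s * kap q μ t = kap q μ t

/-- The relations `κ_t κ_s = s t κ_s`, `κ_s κ_t κ_s = κ_s` imply their mirror images, since
conjugation by `s t s` swaps `s` and `t`. -/
lemma BMWPair.of_rel (hP : Params q μ) (hs : Cubic q μ s) (ht : Cubic q μ t)
    (hb : s * t * s = t * s * t) (h1 : kap q μ t * kap q μ s = s * t * kap q μ s)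
    (h2 : kap q μ s * kap q μ t * kap q μ s = kap q μ s) : BMWPair q μ s t := by
  have w : (s * t) * kap q μ s = kap q μ t * (s * t) :=
    kap_intertwine (by rw [hb]; simp only [mul_assoc])
  have ds : (s * t * s) * s = t * (s * t * s) := by
    conv_lhs => rw [hb]
    simp only [mul_assoc]
  have dt : (s * t * s) * t = s * (s * t * s) := by
    rw [mul_assoc s t s, mul_assoc, ← hb, mul_assoc s t s]
  have kds := kap_intertwine (q := q) (μ := μ) ds
  have kdt := kap_intertwine (q := q) (μ := μ) dt
  have dinv : (s * t * s) * (inv' q μ s * inv' q μ t * inv' q μ s) = 1 := by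
    simp only [mul_assoc]
    rw [← mul_assoc s (inv' q μ s), mul_inv' hP hs, one_mul, ← mul_assoc t, mul_inv' hP ht, one_mul,
      mul_inv' hP hs]
  -- `s t s` is invertible, so the mirrored relations may be checked after multiplication by it.
  have cancel : ∀ {x y : B}, x * (s * t * s) = y * (s * t * s) → x = y := by
    intro x y h
    have := congrArg (· * (inv' q μ s * inv' q μ t * inv' q μ s)) h
    simpa only [mul_assoc _ (s * t * s), dinv, mul_one] using this
  have h3 : kap q μ s * kap q μ t = t * s * kap q μ t := by
    apply cancel
    calc kap q μ s * kap q μ t * (s * t * s)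
        = (s * t * s) * (kap q μ t * kap q μ s) := by
          rw [mul_assoc, ← kds, ← mul_assoc, ← kdt, mul_assoc]
      _ = ((s * t * s) * s) * t * kap q μ s := by rw [h1]; simp only [mul_assoc]
      _ = t * ((s * t * s) * t) * kap q μ s := by rw [ds]; simp only [mul_assoc]
      _ = t * s * ((s * t * s) * kap q μ s) := by rw [dt]; simp only [mul_assoc]
      _ = t * s * kap q μ t * (s * t * s) := by rw [kds]; simp only [mul_assoc]
  refine ⟨hs, ht, hb, h1, ?_, h3, ?_, h2, ?_⟩
  · rw [h1, w, mul_assoc]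
  · have w' : (t * s) * kap q μ t = kap q μ s * (t * s) :=
      kap_intertwine (by rw [← hb]; simp only [mul_assoc])
    rw [h3, w', mul_assoc]
  · apply cancel
    calc kap q μ t * kap q μ s * kap q μ t * (s * t * s)
        = kap q μ t * (kap q μ s * (s * t * s)) * kap q μ s := by
          rw [mul_assoc _ (kap q μ t), ← kds]; simp only [mul_assoc]
      _ = (kap q μ t * (s * t * s)) * kap q μ t * kap q μ s := by
          rw [← kdt]; simp only [mul_assoc]
      _ = (s * t * s) * (kap q μ s * kap q μ t * kap q μ s) := by
          rw [← kds]; simp only [mul_assoc]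
      _ = kap q μ t * (s * t * s) := by rw [h2, kds]

namespace BMWPair

variable (hP : Params q μ) (h : BMWPair q μ s t)

include h

lemma symm : BMWPair q μ t s :=
  ⟨h.cubic_right, h.cubic_left, h.braid.symm, h.kk₃, h.kk₄, h.kk₁, h.kk₂, h.kkk₂, h.kkk₁⟩

include hP

/-- `κ_s t κ_s = μ⁻¹ κ_s` -/
lemma kap_mul_mul_kap : kap q μ s * t * kap q μ s = μ⁻¹ • kap q μ s := by
  have e : kap q μ s = μ • (kap q μ s * t * kap q μ s) := by
    calc kap q μ s = kap q μ s * (kap q μ t * kap q μ s) := by rw [← mul_assoc, h.kkk₁]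
      _ = (kap q μ s * s) * t * kap q μ s := by rw [h.kk₁]; simp only [mul_assoc]
      _ = _ := by rw [kap_mul h.cubic_left]; simp only [smul_mul_assoc]
  conv_rhs => rw [e]
  rw [smul_smul, inv_mul_cancel₀ hP.mu_ne, one_smul]

/-- `t κ_s = s⁻¹ κ_t κ_s` -/
lemma mul_kap_eq : t * kap q μ s = inv' q μ s * (kap q μ t * kap q μ s) := by
  rw [h.kk₁, ← mul_assoc, ← mul_assoc, inv'_mul hP h.cubic_left, one_mul]

/-- `κ_s t = κ_s κ_t s⁻¹` -/
lemma kap_mul_eq : kap q μ s * t = kap q μ s * kap q μ t * inv' q μ s := by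
  rw [h.kk₄, mul_assoc, mul_inv' hP h.cubic_left, mul_one]

/-- `s κ_t κ_s = t⁻¹ κ_s` -/
lemma mul_kap_kap : s * (kap q μ t * kap q μ s) = inv' q μ t * kap q μ s := by
  have h1 := h.kap_mul_mul_kap hP
  rw [h.kk₁, inv', ← mul_assoc, ← mul_assoc, mul_self_eq hP]
  simp only [add_mul, sub_mul, smul_mul_assoc, one_mul, h1, h.kk₁]
  match_scalars <;> field_simp [hP.mu_ne]

/-- `κ_t κ_s t = κ_t s⁻¹` -/
lemma kap_kap_mul : kap q μ t * kap q μ s * t = kap q μ t * inv' q μ s := by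
  have h1 := h.symm.kap_mul_mul_kap hP
  rw [h.kk₂, inv', mul_assoc, mul_self_eq hP]
  simp only [mul_add, mul_sub, mul_smul_comm, mul_one]
  rw [h1, ← h.kk₂]
  match_scalars <;> field_simp [hP.mu_ne]

end BMWPair

/-- The first `n` terms of the sequence `r` satisfy the relations of the generators of the
Birman-Murakami-Wenzl algebra. -/
structure BMWSeq (q μ : ℂ) (r : ℕ → B) (n : ℕ) : Prop where
  cubic : ∀ i, i < n → Cubic q μ (r i)
  pair : ∀ i, i + 1 < n → BMWPair q μ (r i) (r (i + 1))
  comm : ∀ i j, i + 2 ≤ j → j < n → Commute (r i) (r j)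

lemma BMWSeq.rev {r : ℕ → B} {n : ℕ} (h : BMWSeq q μ r n) :
    BMWSeq q μ (fun j => r (n - 1 - j)) n := by
  refine ⟨fun i hi => h.cubic _ (by omega), fun i hi => ?_, fun i j hij hj =>
    (h.comm _ _ (by omega) (by omega)).symm⟩
  have := (h.pair (n - 1 - (i + 1)) (by omega)).symm
  rwa [show n - 1 - (i + 1) + 1 = n - 1 - i by omega] at this

lemma BMWSeq.shift {r : ℕ → B} {n : ℕ} (h : BMWSeq q μ r (n + 1)) :
    BMWSeq q μ (fun j => r (j + 1)) n :=
  ⟨fun i hi => h.cubic _ (by omega), fun i hi => h.pair _ (by omega),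
    fun i j hij hj => h.comm _ _ (by omega) (by omega)⟩

open MulOpposite in
lemma kap_op (s : B) : kap q μ (op s) = op (kap q μ s) := by
  have c : Commute (q • (1 : B) - s) (q⁻¹ • (1 : B) + s) := by
    have cs : Commute s (q⁻¹ • (1 : B) + s) :=
      ((Commute.one_right s).smul_right _).add_right (Commute.refl s)
    exact ((Commute.one_left _).smul_left q).sub_left cs
  have : op (kap q μ s) = op ((μ * (q - q⁻¹))⁻¹ • ((q⁻¹ • (1 : B) + s) * (q • (1 : B) - s))) := by
    rw [kap, c.eq]
  rw [this, kap]
  simp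

open MulOpposite in
lemma BMWSeq.op {r : ℕ → B} {n : ℕ} (h : BMWSeq q μ r n) :
    BMWSeq q μ (fun j => op (r j)) n := by
  have hc : ∀ {s : B}, Cubic q μ s → Cubic q μ (MulOpposite.op s) := by
    intro s hs
    have c1 : ∀ c d : ℂ, Commute (s - c • (1 : B)) (s - d • (1 : B)) := fun c d =>
      (((Commute.refl s).sub_left ((Commute.one_left _).smul_left _))).sub_right
        ((Commute.one_right _).smul_right _)
    have c2 : ∀ c d : ℂ, Commute (s - c • (1 : B)) (s + d • (1 : B)) := fun c d =>
      (((Commute.refl s).sub_left ((Commute.one_left _).smul_left _))).add_right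
        ((Commute.one_right _).smul_right _)
    have : (s - μ • (1 : B)) * ((s + q⁻¹ • (1 : B)) * (s - q • (1 : B))) = 0 := by
      rw [← (c2 q q⁻¹).eq, ((c1 μ q).mul_right (c2 μ q⁻¹)).eq]
      exact hs
    have := congrArg MulOpposite.op this
    simpa [Cubic] using this
  refine ⟨fun i hi => hc (h.cubic i hi), fun i hi => ?_, fun i j hij hj => ?_⟩
  · have p := h.pair i hi
    refine ⟨hc p.cubic_left, hc p.cubic_right, ?_, ?_, ?_, ?_, ?_, ?_, ?_⟩ <;>
      simp only [kap_op, ← op_mul, op_inj, ← mul_assoc]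
    exacts [p.braid, p.kk₄, p.kk₃, p.kk₂, p.kk₁, p.kkk₁, p.kkk₂]
  · exact (h.comm i j hij hj).op

end BMW

/-! ### Antisymmetrizers -/

section Antisym

variable {B : Type*} [Ring B] [Algebra ℂ B]

/-- The baxterized generator `1 + (x-1)/(q-q⁻¹) s + (x-1)/(q μ⁻¹ x + 1) κ`. -/
def bax (q μ : ℂ) (s : B) (x : ℂ) : B :=
  1 + ((x - 1) / (q - q⁻¹)) • s + ((x - 1) / (q * μ⁻¹ * x + 1)) • kap q μ s

/-- The antisymmetrizer on `i` strands built from the generators `r 0, …, r (i - 2)`. -/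
def asym (q μ : ℂ) (r : ℕ → B) : ℕ → B
  | 0 => 1
  | 1 => 1
  | i + 2 => (q ^ (i + 1) / qNum q (i + 2)) •
      (asym q μ r (i + 1) * bax q μ (r i) (q⁻¹ ^ (2 * (i + 1))) * asym q μ r (i + 1))

variable {q μ : ℂ}

lemma map_bax {B' : Type*} [Ring B'] [Algebra ℂ B'] (f : B →ₐ[ℂ] B') (s : B) (x : ℂ) :
    f (bax q μ s x) = bax q μ (f s) x := by
  simp [bax, map_kap]

lemma map_asym {B' : Type*} [Ring B'] [Algebra ℂ B'] (f : B →ₐ[ℂ] B') (r : ℕ → B) (i : ℕ) :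
    f (asym q μ r i) = asym q μ (fun j => f (r j)) i := by
  induction i using asym.induct with
  | case1 => simp [asym]
  | case2 => simp [asym]
  | case3 i ih => simp [asym, ih, map_bax]

lemma asym_congr {r r' : ℕ → B} {i : ℕ} (h : ∀ j, j + 1 < i → r j = r' j) :
    asym q μ r i = asym q μ r' i := by
  induction i using asym.induct with
  | case1 => simp [asym]
  | case2 => simp [asym]
  | case3 i ih => rw [asym, asym, ih fun j hj => h j (by omega), h i (by omega)]

lemma bax_comm {s t : B} (h : Commute s t) (x : ℂ) : Commute (bax q μ s x) t :=
  ((Commute.one_left t).add_left (h.smul_left _)).add_left ((kap_comm h).smul_left _)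

lemma asym_comm {r : ℕ → B} {t : B} {i : ℕ} (h : ∀ j, j + 1 < i → Commute (r j) t) :
    Commute (asym q μ r i) t := by
  induction i using asym.induct with
  | case1 => exact Commute.one_left _
  | case2 => exact Commute.one_left _
  | case3 i ih =>
    have := ih fun j hj => h j (by omega)
    exact ((this.mul_left (bax_comm (h i (by omega)) _)).mul_left this).smul_left _

open MulOpposite in
lemma asym_op (r : ℕ → B) (i : ℕ) : asym q μ (fun j => op (r j)) i = op (asym q μ r i) := by
  induction i using asym.induct with
  | case1 => simp [asym]
  | case2 => simp [asym]
  | case3 i ih => simp [asym, ih, bax, kap_op, mul_assoc]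

/-- The conditions on the parameters under which the antisymmetrizers on at most `k` strands, and the
baxterized generator that would define the next one, exist. -/
structure ParamsUpTo (q μ : ℂ) (k : ℕ) : Prop extends Params q μ where
  qNum_ne : ∀ i, 1 ≤ i → i ≤ k → qNum q i ≠ 0
  den_ne : ∀ i, 1 ≤ i → i ≤ k → q * μ⁻¹ * q⁻¹ ^ (2 * i) + 1 ≠ 0

section

lemma mul_kap_eq_zero {z s : B} (h : z * s = -q⁻¹ • z) : z * kap q μ s = 0 := by
  rw [kap, mul_smul_comm]
  have : z * ((q • (1 : B) - s) * (q⁻¹ • (1 : B) + s)) = 0 := by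
    rw [← mul_assoc, mul_sub, h, mul_smul_comm, mul_one, ← sub_smul, smul_mul_assoc, mul_add, h,
      mul_smul_comm, mul_one, ← add_smul]
    simp
  rw [this, smul_zero]

variable (hP : Params q μ)
include hP

/-- The value of `σ⁻(q^{-2i})` under `σ ↦ -q⁻¹`, `κ ↦ 0` cancels the normalization of the
antisymmetrizer. -/
lemma norm_mul_eq (i : ℕ) (hi : qNum q (i + 1) ≠ 0) :
    q ^ i / qNum q (i + 1) * (1 + (q⁻¹ ^ (2 * i) - 1) / (q - q⁻¹) * (-q⁻¹)) = 1 := by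
  have h1 := hP.q_ne
  have h2 := hP.lam_ne
  have h3 : 1 + (q⁻¹ ^ (2 * i) - 1) / (q - q⁻¹) * (-q⁻¹) = qNum q (i + 1) / q ^ i := by
    rw [qNum, eq_div_iff (pow_ne_zero _ h1), eq_div_iff h2]
    have e : (1 + (q⁻¹ ^ (2 * i) - 1) / (q - q⁻¹) * -q⁻¹) * q ^ i * (q - q⁻¹)
        = ((q - q⁻¹) + (q⁻¹ ^ (2 * i) - 1) * -q⁻¹) * q ^ i := by
      rw [mul_right_comm, add_mul, div_mul_eq_mul_div, div_mul_cancel₀ _ h2, one_mul]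
    rw [e]
    have e2 : q⁻¹ ^ (2 * i) * q ^ i = q⁻¹ ^ i := by
      rw [two_mul, pow_add, mul_assoc, ← mul_pow, inv_mul_cancel₀ h1, one_pow, mul_one]
    linear_combination -q⁻¹ * e2
  rw [h3]
  field_simp

omit hP in
lemma mul_bax {z s : B} (h : z * s = -q⁻¹ • z) (x : ℂ) :
    z * bax q μ s x = (1 + (x - 1) / (q - q⁻¹) * (-q⁻¹)) • z := by
  rw [bax, mul_add, mul_add, mul_smul_comm, mul_smul_comm, mul_kap_eq_zero h, h, mul_one]
  module

/-- An element on which the generators act from the right by `-q⁻¹` absorbs the antisymmetrizer. -/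
lemma mul_asym {z : B} {r : ℕ → B} {i : ℕ} (hq : ∀ j, 1 ≤ j → j ≤ i → qNum q j ≠ 0)
    (h : ∀ j, j + 1 < i → z * r j = -q⁻¹ • z) : z * asym q μ r i = z := by
  induction i using asym.induct with
  | case1 => simp [asym]
  | case2 => simp [asym]
  | case3 i ih =>
    have ih := ih (fun j h1 h2 => hq j h1 (by omega)) fun j hj => h j (by omega)
    rw [asym, mul_smul_comm, ← mul_assoc, ← mul_assoc, ih, mul_bax (h i (by omega)),
      smul_mul_assoc, ih, smul_smul, norm_mul_eq hP _ (hq _ (by omega) le_rfl), one_smul]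

/-- The inductive step of the fusion procedure. If the first generator acts on `a` by `-q⁻¹`, then the
product of two baxterized generators maps `a` to an element on which the second generator acts by
`-q⁻¹`. -/
lemma mul_bax_bax {a s t : B} (h : BMWPair q μ s t) (ha : a * s = -q⁻¹ • a) {y : ℂ}
    (hy : q * μ⁻¹ * y + 1 ≠ 0) (hx : q * μ⁻¹ * (q⁻¹ ^ 2 * y) + 1 ≠ 0) :
    a * bax q μ t (q⁻¹ ^ 2 * y) * bax q μ s y * (t + q⁻¹ • (1 : B)) = 0 := by
  have h1 := hP.q_ne
  have h2 := hP.lam_ne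
  have h3 := hP.mu_ne
  have hk : a * kap q μ s = 0 := mul_kap_eq_zero ha
  have hi : a * inv' q μ s = -q • a := by
    rw [inv', mul_add, mul_sub, mul_smul_comm, mul_smul_comm, hk, ha, mul_one]
    module
  -- All products are reduced to a combination of `a`, `a t`, `a κ_t`, `a t s`, `a κ_t s`, `a κ_t κ_s`.
  have r1 : a * t * s * t = -q⁻¹ • (a * t * s) := by
    calc a * t * s * t = a * (t * s * t) := by simp only [mul_assoc]
      _ = a * s * t * s := by rw [← h.braid]; simp only [mul_assoc]
      _ = _ := by rw [ha]; simp only [smul_mul_assoc]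
  have r2 : a * t * kap q μ s = -q • (a * kap q μ t * kap q μ s) := by
    calc a * t * kap q μ s = a * inv' q μ s * (kap q μ t * kap q μ s) := by
          rw [mul_assoc, h.mul_kap_eq hP, mul_assoc]
      _ = _ := by rw [hi]; simp only [smul_mul_assoc, mul_assoc]
  have r3 : a * kap q μ t * kap q μ s * t = a * kap q μ t * s - (q - q⁻¹) • (a * kap q μ t)
      + (q - q⁻¹) • (a * kap q μ t * kap q μ s) := by
    calc a * kap q μ t * kap q μ s * t = a * (kap q μ t * kap q μ s * t) := by
          simp only [mul_assoc]
      _ = _ := by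
          rw [h.kap_kap_mul hP, inv']
          simp only [mul_add, mul_sub, mul_smul_comm, mul_one, mul_assoc]
  have r4 : a * t * t = a + (q - q⁻¹) • (a * t) - ((q - q⁻¹) * μ) • (a * kap q μ t) := by
    rw [mul_assoc, mul_self_eq hP]
    simp only [mul_add, mul_sub, mul_smul_comm, mul_one]
  have r5 : a * kap q μ t * t = μ • (a * kap q μ t) := by
    rw [mul_assoc, kap_mul h.cubic_right, mul_smul_comm]
  have r6 : a * kap q μ t * s * t = a * kap q μ t * kap q μ s := by
    simp only [mul_assoc]
    rw [← mul_assoc (kap q μ t) s t, ← h.kk₂]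
  simp only [bax, mul_add, add_mul, mul_smul_comm, smul_mul_assoc, mul_one, ha, hk, r1, r2, r3, r4,
    r5, r6, smul_add, smul_sub, smul_zero, zero_mul]
  have hx' : q * y * q⁻¹ ^ 2 + μ ≠ 0 := by
    intro h0; apply hx; field_simp at h0 ⊢; linear_combination h0
  have hx'' : q * (y * q⁻¹ ^ 2) + μ ≠ 0 := by rwa [← mul_assoc]
  have hx3 : y + q * μ ≠ 0 := by
    intro h0; apply hx'; field_simp; linear_combination h0
  have hy3 : q * y + μ ≠ 0 := by
    intro h0; apply hy; field_simp; linear_combination h0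
  have hy4 : y * q + μ ≠ 0 := by rwa [mul_comm y q]
  have hl : q ^ 2 - 1 ≠ 0 := by
    intro h0; apply h2; field_simp; linear_combination h0
  -- The coefficients are now compared as rational functions of `q`, `μ` and `y`.
  have e1 : q * μ⁻¹ * (q⁻¹ ^ 2 * y) + 1 = (y + q * μ) / (q * μ) := by field_simp
  have e2 : q * μ⁻¹ * y + 1 = (q * y + μ) / μ := by field_simp
  have e3 : q - q⁻¹ = (q ^ 2 - 1) / q := by field_simp
  rw [e1, e2, e3]
  match_scalars
  all_goals
    field_simp
    ring

lemma bax_mul {s : B} (hs : Cubic q μ s) (hd : q * μ⁻¹ * q⁻¹ ^ 2 + 1 ≠ 0) :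
    bax q μ s (q⁻¹ ^ 2) * (s + q⁻¹ • (1 : B)) = 0 := by
  have h1 := hP.q_ne
  have h2 := hP.lam_ne
  have h3 := hP.mu_ne
  have hl : q ^ 2 - 1 ≠ 0 := by
    intro h0; apply h2; field_simp; linear_combination h0
  have hd' : q * μ + 1 ≠ 0 := by
    intro h0; apply hd; field_simp; linear_combination h0
  have e1 : q * μ⁻¹ * q⁻¹ ^ 2 + 1 = (q * μ + 1) / (q * μ) := by
    field_simp; ring
  have e3 : q - q⁻¹ = (q ^ 2 - 1) / q := by field_simp
  rw [bax, e1]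
  simp only [mul_add, add_mul, smul_mul_assoc, mul_smul_comm, mul_one, one_mul,
    mul_self_eq hP, kap_mul hs]
  rw [e3]
  match_scalars <;> field_simp <;> ring

/-- The antisymmetrizer is a projector that absorbs the generators from the right. -/
lemma asym_absorb {k n : ℕ} (hk : ParamsUpTo q μ k) {r : ℕ → B} (hr : BMWSeq q μ r n) {i : ℕ}
    (hi : i ≤ k) (hn : i ≤ n + 1) :
    asym q μ r i * asym q μ r i = asym q μ r i ∧
      ∀ j, j + 1 < i → asym q μ r i * r j = -q⁻¹ • asym q μ r i := by
  induction i using asym.induct with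
  | case1 => simp [asym]
  | case2 => simp [asym]
  | case3 i ih =>
    obtain ⟨ih1, ih2⟩ := ih (by omega) (by omega)
    set a := asym q μ r (i + 1) with ha
    set b := asym q μ r (i + 2) with hb
    have hbdef : b = (q ^ (i + 1) / qNum q (i + 2)) •
        (a * bax q μ (r i) (q⁻¹ ^ (2 * (i + 1))) * a) := by rw [hb, asym]
    have hba : b * a = b := by rw [hbdef, smul_mul_assoc, mul_assoc, ih1]
    have habs : ∀ j, j + 1 < i + 2 → b * r j = -q⁻¹ • b := by
      intro j hj
      by_cases hji : j < i
      · rw [hbdef, smul_mul_assoc, mul_assoc, ih2 j (by omega), mul_smul_comm, smul_comm]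
      obtain rfl : j = i := by omega
      have hcub := hr.cubic j (by omega)
      suffices h : a * bax q μ (r j) (q⁻¹ ^ (2 * (j + 1))) * a * (r j + q⁻¹ • (1 : B)) = 0 by
        rw [mul_add, mul_smul_comm, mul_one] at h
        rw [hbdef, smul_mul_assoc, eq_neg_of_add_eq_zero_left h, neg_smul, smul_neg, smul_comm]
      cases j with
      | zero =>
        have e : a = 1 := by rw [ha, asym]
        rw [e, one_mul, mul_one]
        exact bax_mul hP hcub (hk.den_ne 1 le_rfl (by omega))
      | succ j =>
        have hpair := hr.pair j (by omega)
        set a' := asym q μ r (j + 1) with ha'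
        set c := q ^ (j + 1) / qNum q (j + 2) with hc
        have hadef : a = c • (a' * bax q μ (r j) (q⁻¹ ^ (2 * (j + 1))) * a') := by rw [ha, asym]
        have hcomm : Commute a' (r (j + 1)) :=
          asym_comm fun l hl => hr.comm l (j + 1) (by omega) (by omega)
        have haa' : a * a' = a :=
          mul_asym hP (fun l h1 h2 => hk.qNum_ne l h1 (by omega)) fun l hl => ih2 l (by omega)
        -- With `a = c a' σ⁻ a'` for the shorter antisymmetrizer `a'`, which commutes with the last
        -- generator, the two baxterized generators become neighbours.
        have key := mul_bax_bax hP hpair (ih2 j (by omega)) (y := q⁻¹ ^ (2 * (j + 1)))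
          (hk.den_ne _ (by omega) (by omega)) (by
            rw [← pow_add, show 2 + 2 * (j + 1) = 2 * (j + 2) by ring]
            exact hk.den_ne _ (by omega) (by omega))
        rw [← pow_add, show 2 + 2 * (j + 1) = 2 * (j + 1 + 1) by ring] at key
        have hc2 : Commute a' (r (j + 1) + q⁻¹ • (1 : B)) :=
          hcomm.add_right ((Commute.one_right _).smul_right _)
        have hc1 : Commute a' (bax q μ (r (j + 1)) (q⁻¹ ^ (2 * (j + 1 + 1)))) :=
          (bax_comm hcomm.symm _).symm
        conv_lhs => rw [mul_assoc a, mul_assoc a]; arg 2; arg 1; arg 2; rw [hadef]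
        rw [mul_smul_comm, smul_mul_assoc, mul_smul_comm]
        have : a * (bax q μ (r (j + 1)) (q⁻¹ ^ (2 * (j + 1 + 1))) *
            (a' * bax q μ (r j) (q⁻¹ ^ (2 * (j + 1))) * a') * (r (j + 1) + q⁻¹ • (1 : B))) =
            (a * a') * bax q μ (r (j + 1)) (q⁻¹ ^ (2 * (j + 1 + 1))) *
              bax q μ (r j) (q⁻¹ ^ (2 * (j + 1))) * (r (j + 1) + q⁻¹ • (1 : B)) * a' := by
          simp only [mul_assoc]
          rw [hc2.eq, ← mul_assoc a' (bax _ _ (r (j + 1)) _), hc1.eq]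
          simp only [mul_assoc]
        rw [this, haa', key, zero_mul, smul_zero]
    refine ⟨?_, habs⟩
    conv_lhs => arg 2; rw [hbdef]
    rw [mul_smul_comm, ← mul_assoc, ← mul_assoc, hba, mul_bax (habs i (by omega)), smul_mul_assoc,
      hba, smul_smul, norm_mul_eq hP _ (hk.qNum_ne _ (by omega) (by omega)), one_smul]

/-- The antisymmetrizer absorbs the generators from the left. -/
lemma asym_absorb_left {k n : ℕ} (hk : ParamsUpTo q μ k) {r : ℕ → B} (hr : BMWSeq q μ r n) {i : ℕ}
    (hi : i ≤ k) (hn : i ≤ n + 1) (j : ℕ) (hj : j + 1 < i) :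
    r j * asym q μ r i = -q⁻¹ • asym q μ r i := by
  -- The recursion is symmetric, so the passage to the opposite algebra preserves `asym`.
  have := (asym_absorb hP hk hr.op hi hn).2 j hj
  rw [asym_op, ← MulOpposite.op_mul, ← MulOpposite.op_smul, MulOpposite.op_inj] at this
  exact this

lemma asym_mul {z : B} {r : ℕ → B} {i : ℕ} (hq : ∀ j, 1 ≤ j → j ≤ i → qNum q j ≠ 0)
    (h : ∀ j, j + 1 < i → r j * z = -q⁻¹ • z) : asym q μ r i * z = z := by
  have := mul_asym hP (z := MulOpposite.op z) (r := fun j => MulOpposite.op (r j)) hq fun j hj => by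
    rw [← MulOpposite.op_mul, h j hj, MulOpposite.op_smul]
  rwa [asym_op, ← MulOpposite.op_mul, MulOpposite.op_inj] at this

/-- The antisymmetrizer is determined by its absorption properties; hence it does not change when the
order of the generators is reversed. -/
lemma asym_rev {k n : ℕ} (hk : ParamsUpTo q μ k) {r : ℕ → B} (hr : BMWSeq q μ r n)
    (hn : n + 1 ≤ k) : asym q μ (fun j => r (n - 1 - j)) (n + 1) = asym q μ r (n + 1) := by
  have hq : ∀ j, 1 ≤ j → j ≤ n + 1 → qNum q j ≠ 0 := fun j h1 h2 => hk.qNum_ne j h1 (by omega)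
  have h1 : asym q μ (fun j => r (n - 1 - j)) (n + 1) * asym q μ r (n + 1) = asym q μ r (n + 1) :=
    asym_mul hP hq fun j hj => asym_absorb_left hP hk hr hn le_rfl _ (by omega)
  have h2 : asym q μ (fun j => r (n - 1 - j)) (n + 1) * asym q μ r (n + 1)
      = asym q μ (fun j => r (n - 1 - j)) (n + 1) := by
    refine mul_asym hP hq fun j hj => ?_
    have := (asym_absorb hP hk hr.rev hn le_rfl).2 (n - 1 - j) (by omega)
    rwa [show n - 1 - (n - 1 - j) = j by omega] at this
  rw [← h2, h1]

/-- The recursion for the antisymmetrizers that adds a strand on the left. -/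
lemma asym_succ_left {k n : ℕ} (hk : ParamsUpTo q μ k) {r : ℕ → B} (hr : BMWSeq q μ r (n + 1))
    (hn : n + 2 ≤ k) :
    asym q μ r (n + 2) = (q ^ (n + 1) / qNum q (n + 2)) •
      (asym q μ (fun j => r (j + 1)) (n + 1) * bax q μ (r 0) (q⁻¹ ^ (2 * (n + 1))) *
        asym q μ (fun j => r (j + 1)) (n + 1)) := by
  -- The defining recursion is applied to the reversed sequence of generators.
  rw [← asym_rev hP hk hr hn, asym, ← asym_rev hP hk hr.shift (by omega)]
  have : asym q μ (fun j => r (n + 1 - 1 - j)) (n + 1)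
      = asym q μ (fun j => r (n - 1 - j + 1)) (n + 1) :=
    asym_congr fun j hj => by congr 1; omega
  rw [this]
  simp

end

end Antisym

/-! ### Reduction of words in the generators -/

section Strands

variable {B : Type*} [Ring B] [Algebra ℂ B]

/-- The subalgebra of operators on `n` strands: it is generated by the first `n - 1` generators. -/
def strands (r : ℕ → B) (n : ℕ) : Subalgebra ℂ B := Algebra.adjoin ℂ {x | ∃ i, i + 1 < n ∧ x = r i}

variable {q μ : ℂ} {r : ℕ → B}

lemma gen_mem {n i : ℕ} (h : i + 1 < n) : r i ∈ strands r n := Algebra.subset_adjoin ⟨i, h, rfl⟩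

lemma strands_mono {n m : ℕ} (h : n ≤ m) : strands r n ≤ strands r m :=
  Algebra.adjoin_mono fun _ ⟨i, hi, e⟩ => ⟨i, by omega, e⟩

/-- There are no generators on a single strand. -/
lemma strands_eq_bot {n : ℕ} (hn : n ≤ 1) : strands r n = ⊥ := by
  rw [eq_bot_iff, strands]
  refine Algebra.adjoin_le ?_
  rintro x ⟨i, hi, -⟩
  omega

lemma kap_mem_of {S : Subalgebra ℂ B} {s : B} (h : s ∈ S) : kap q μ s ∈ S :=
  S.smul_mem (mul_mem (sub_mem (S.smul_mem (one_mem _) _) h)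
    (add_mem (S.smul_mem (one_mem _) _) h)) _

lemma inv'_mem_of {S : Subalgebra ℂ B} {s : B} (h : s ∈ S) : inv' q μ s ∈ S :=
  add_mem (sub_mem h (S.smul_mem (one_mem _) _)) (S.smul_mem (kap_mem_of h) _)

lemma bax_mem_of {S : Subalgebra ℂ B} {s : B} (h : s ∈ S) (x : ℂ) : bax q μ s x ∈ S :=
  add_mem (add_mem (one_mem _) (S.smul_mem h _)) (S.smul_mem (kap_mem_of h) _)

lemma asym_mem_of {S : Subalgebra ℂ B} {r : ℕ → B} {i : ℕ} (h : ∀ j, j + 1 < i → r j ∈ S) :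
    asym q μ r i ∈ S := by
  induction i using asym.induct with
  | case1 => exact one_mem _
  | case2 => exact one_mem _
  | case3 i ih =>
    have := ih fun j hj => h j (by omega)
    exact S.smul_mem (mul_mem (mul_mem this (bax_mem_of (h i (by omega)) _)) this) _

lemma strands_comm (hc : ∀ i j, i + 2 ≤ j → Commute (r i) (r j)) {n j : ℕ} (hj : n ≤ j) {x : B}
    (hx : x ∈ strands r n) : Commute x (r j) := by
  induction hx using Algebra.adjoin_induction with
  | mem x hx => obtain ⟨i, hi, rfl⟩ := hx; exact hc i j (by omega)
  | algebraMap c => exact Algebra.commutes c _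
  | add x y _ _ hx hy => exact hx.add_left hy
  | mul x y _ _ hx hy => exact hx.mul_left hy

variable (r) in
/-- The span of the elements `x z y`, where `x`, `y` are operators on `n + 1` strands and `z` is
`1`, `r_n` or `κ_n`. -/
def dspan (q μ : ℂ) (n : ℕ) : Submodule ℂ B :=
  Submodule.span ℂ {w | ∃ x ∈ strands r (n + 1), ∃ y ∈ strands r (n + 1), ∃ z,
    (z = 1 ∨ z = r n ∨ z = kap q μ (r n)) ∧ w = x * z * y}

section

variable {n : ℕ}

lemma mem_dspan {x y z : B} (hx : x ∈ strands r (n + 1)) (hy : y ∈ strands r (n + 1))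
    (hz : z = 1 ∨ z = r n ∨ z = kap q μ (r n)) : x * z * y ∈ dspan r q μ n :=
  Submodule.subset_span ⟨x, hx, y, hy, z, hz, rfl⟩

lemma dspan_mul_left {x w : B} (hx : x ∈ strands r (n + 1)) (hw : w ∈ dspan r q μ n) :
    x * w ∈ dspan r q μ n := by
  induction hw using Submodule.span_induction with
  | mem w hw =>
    obtain ⟨a, ha, b, hb, z, hz, rfl⟩ := hw
    rw [← mul_assoc, ← mul_assoc]
    exact mem_dspan (mul_mem hx ha) hb hz
  | zero => simp
  | add u v _ _ hu hv => rw [mul_add]; exact add_mem hu hv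
  | smul c u _ hu => rw [mul_smul_comm]; exact Submodule.smul_mem _ _ hu

lemma dspan_mul_right {x w : B} (hx : x ∈ strands r (n + 1)) (hw : w ∈ dspan r q μ n) :
    w * x ∈ dspan r q μ n := by
  induction hw using Submodule.span_induction with
  | mem w hw =>
    obtain ⟨a, ha, b, hb, z, hz, rfl⟩ := hw
    rw [mul_assoc]
    exact mem_dspan ha (mul_mem hb hx) hz
  | zero => simp
  | add u v _ _ hu hv => rw [add_mul]; exact add_mem hu hv
  | smul c u _ hu => rw [smul_mul_assoc]; exact Submodule.smul_mem _ _ hu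

lemma strands_le_dspan {x : B} (hx : x ∈ strands r (n + 1)) : x ∈ dspan r q μ n := by
  simpa using mem_dspan (q := q) (μ := μ) hx (one_mem _) (Or.inl rfl)

lemma gen_mem_dspan : r n ∈ dspan r q μ n := by
  simpa using mem_dspan (q := q) (μ := μ) (one_mem (strands r (n + 1)))
    (one_mem (strands r (n + 1))) (Or.inr (Or.inl rfl))

lemma kap_mem_dspan : kap q μ (r n) ∈ dspan r q μ n := by
  simpa using mem_dspan (q := q) (μ := μ) (one_mem (strands r (n + 1)))
    (one_mem (strands r (n + 1))) (Or.inr (Or.inr rfl))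

end

variable (hP : Params q μ) (hr : ∀ n, BMWSeq q μ r n)
include hP hr

/-- A product of two of the elements `r_n`, `κ_n` with nothing in between. -/
lemma prod_mem_dspan (n : ℕ) {z z' : B} (hz : z = r n ∨ z = kap q μ (r n))
    (hz' : z' = r n ∨ z' = kap q μ (r n)) : z * z' ∈ dspan r q μ n := by
  have hc := (hr (n + 1)).cubic n (by omega)
  have hk : ∀ (c : ℂ) {x : B}, x ∈ dspan r q μ n → c • x ∈ dspan r q μ n :=
    fun c _ h => Submodule.smul_mem _ c h
  rcases hz with rfl | rfl <;> rcases hz' with rfl | rfl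
  · rw [mul_self_eq hP]
    exact sub_mem (add_mem (strands_le_dspan (one_mem _)) (hk _ gen_mem_dspan)) (hk _ kap_mem_dspan)
  · rw [mul_kap hc]; exact hk _ kap_mem_dspan
  · rw [kap_mul hc]; exact hk _ kap_mem_dspan
  · rw [kap_mul_kap hP hc]; exact hk _ kap_mem_dspan

/-- The reduction of words with two letters from the last generator. -/
lemma prod_mem_dspan' (n : ℕ) {z z' v : B} (hz : z = r (n + 1) ∨ z = kap q μ (r (n + 1)))
    (hz' : z' = r (n + 1) ∨ z' = kap q μ (r (n + 1)))
    (hv : v = 1 ∨ v = r n ∨ v = kap q μ (r n)) : z * v * z' ∈ dspan r q μ (n + 1) := by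
  have hp := (hr (n + 2)).pair n (by omega)
  have hs : r n ∈ strands r (n + 2) := gen_mem (by omega)
  have hsk : kap q μ (r n) ∈ strands r (n + 2) := kap_mem_of hs
  have hsi : inv' q μ (r n) ∈ strands r (n + 2) := inv'_mem_of hs
  have hk : ∀ (c : ℂ) {x : B}, x ∈ dspan r q μ (n + 1) → c • x ∈ dspan r q μ (n + 1) :=
    fun c _ h => Submodule.smul_mem _ c h
  have t : r (n + 1) ∈ dspan r q μ (n + 1) := gen_mem_dspan
  have k : kap q μ (r (n + 1)) ∈ dspan r q μ (n + 1) := kap_mem_dspan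
  rcases hv with rfl | rfl | rfl
  · rw [mul_one]; exact prod_mem_dspan hP hr _ hz hz'
  · rcases hz with rfl | rfl <;> rcases hz' with rfl | rfl
    · rw [← hp.braid]; exact dspan_mul_right hs (dspan_mul_left hs t)
    · rw [← hp.kk₃]; exact dspan_mul_left hsk k
    · rw [← hp.kk₂]; exact dspan_mul_right hsk k
    · rw [hp.symm.kap_mul_mul_kap hP]; exact hk _ k
  · rcases hz with rfl | rfl <;> rcases hz' with rfl | rfl
    · rw [hp.mul_kap_eq hP, mul_assoc, hp.kap_kap_mul hP]
      exact dspan_mul_left hsi (dspan_mul_right hsi k)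
    · rw [mul_assoc, hp.symm.mul_kap_kap hP]; exact dspan_mul_left hsi k
    · rw [hp.kap_kap_mul hP]; exact dspan_mul_right hsi k
    · rw [hp.kkk₂]; exact k

/-- The reduction of a word with two letters from the last generator and an operator `w` on fewer strands
in between; `w` is itself reduced by the hypothesis `ih`. -/
lemma mid_mem_dspan (n : ℕ)
    (ih : ∀ m, n = m + 1 → ∀ x ∈ strands r (m + 2), x ∈ dspan r q μ m) {z z' w : B}
    (hz : z = r n ∨ z = kap q μ (r n)) (hz' : z' = r n ∨ z' = kap q μ (r n))
    (hw : w ∈ strands r (n + 1)) : z * w * z' ∈ dspan r q μ n := by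
  have hc : ∀ i j, i + 2 ≤ j → Commute (r i) (r j) := fun i j hij =>
    (hr (j + 1)).comm i j hij (by omega)
  cases n with
  | zero =>
    rw [strands_eq_bot (by omega)] at hw
    obtain ⟨c, rfl⟩ := Algebra.mem_bot.1 hw
    rw [← Algebra.commutes, mul_assoc, ← Algebra.smul_def]
    exact Submodule.smul_mem _ _ (prod_mem_dspan hP hr _ hz hz')
  | succ n =>
    replace hw := ih n rfl w hw
    have hcz : ∀ x ∈ strands r (n + 1), ∀ z, (z = r (n + 1) ∨ z = kap q μ (r (n + 1))) →
        Commute x z := by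
      rintro x hx z (rfl | rfl)
      · exact strands_comm hc le_rfl hx
      · exact (kap_comm (strands_comm hc le_rfl hx).symm).symm
    induction hw using Submodule.span_induction with
    | mem w hw =>
      obtain ⟨x, hx, y, hy, v, hv, rfl⟩ := hw
      have e : z * (x * v * y) * z' = x * (z * v * z') * y := by
        rw [← mul_assoc, ← mul_assoc, ← (hcz x hx z hz).eq, mul_assoc _ y, (hcz y hy z' hz').eq]
        simp only [mul_assoc]
      rw [e]
      exact dspan_mul_right (strands_mono (by omega) hy)
        (dspan_mul_left (strands_mono (by omega) hx) (prod_mem_dspan' hP hr n hz hz' hv))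
    | zero => simp
    | add u v _ _ hu hv => rw [mul_add, add_mul]; exact add_mem hu hv
    | smul c u _ hu => rw [mul_smul_comm, smul_mul_assoc]; exact Submodule.smul_mem _ _ hu

/-- Every operator on `n + 2` strands is a sum of products in which the last generator enters at
most once. -/
lemma mem_dspan_of_mem (n : ℕ) : ∀ x ∈ strands r (n + 2), x ∈ dspan r q μ n := by
  have main : ∀ n, (∀ m, n = m + 1 → ∀ x ∈ strands r (m + 2), x ∈ dspan r q μ m) →
      ∀ x ∈ strands r (n + 2), x ∈ dspan r q μ n := by
    intro n ih x hx
    induction hx using Algebra.adjoin_induction with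
    | mem x hx =>
      obtain ⟨i, hi, rfl⟩ := hx
      rcases Nat.lt_or_ge i n with h | h
      · exact strands_le_dspan (gen_mem (by omega))
      · obtain rfl : i = n := by omega
        exact gen_mem_dspan
    | algebraMap c => exact strands_le_dspan (Subalgebra.algebraMap_mem _ c)
    | add x y _ _ hx hy => exact add_mem hx hy
    | mul x y hx' hy' hx hy =>
      clear hx' hy'
      induction hx using Submodule.span_induction with
      | zero => simp
      | add u v _ _ hu hv => rw [add_mul]; exact add_mem hu hv
      | smul c u _ hu => rw [smul_mul_assoc]; exact Submodule.smul_mem _ _ hu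
      | mem u hu =>
        obtain ⟨a, ha, b, hb, z, hz, rfl⟩ := hu
        induction hy using Submodule.span_induction with
        | zero => simp
        | add u v _ _ hu hv => rw [mul_add]; exact add_mem hu hv
        | smul c u _ hu => rw [mul_smul_comm]; exact Submodule.smul_mem _ _ hu
        | mem u hu =>
          obtain ⟨a', ha', b', hb', z', hz', rfl⟩ := hu
          rcases hz with rfl | hz
          · rw [mul_one, mul_assoc a', ← mul_assoc _ a']
            have := mem_dspan (q := q) (μ := μ) (mul_mem (mul_mem ha hb) ha') hb' hz'
            rwa [mul_assoc] at this
          rcases hz' with rfl | hz'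
          · rw [mul_one, mul_assoc _ b]
            exact mem_dspan ha (mul_mem hb (mul_mem ha' hb')) (Or.inr hz)
          have e : a * z * b * (a' * z' * b') = a * (z * (b * a') * z') * b' := by
            simp only [mul_assoc]
          rw [e]
          exact dspan_mul_right hb' (dspan_mul_left ha
            (mid_mem_dspan hP hr n ih hz hz' (mul_mem hb ha')))
  induction n with
  | zero => exact main 0 fun m hm => by omega
  | succ n ih => exact main (n + 1) fun m hm => by obtain rfl : n = m := by omega
                                                   exact ih

/-- The sandwich `κ_n w κ_n` of an operator on `n + 1` strands. -/
lemma kap_mul_mul_kap_mem (n : ℕ) {w : B} (hw : w ∈ strands r (n + 1)) :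
    ∃ w' ∈ strands r n, kap q μ (r n) * w * kap q μ (r n) = w' * kap q μ (r n) := by
  have hc : ∀ i j, i + 2 ≤ j → Commute (r i) (r j) := fun i j hij =>
    (hr (j + 1)).comm i j hij (by omega)
  have hcub := (hr (n + 1)).cubic n (by omega)
  cases n with
  | zero =>
    rw [strands_eq_bot (by omega)] at hw
    obtain ⟨c, rfl⟩ := Algebra.mem_bot.1 hw
    refine ⟨algebraMap ℂ B (c * eta q μ), Subalgebra.algebraMap_mem _ _, ?_⟩
    rw [← Algebra.commutes, mul_assoc, kap_mul_kap hP hcub, map_mul, mul_assoc, ← Algebra.smul_def (eta q μ)]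
  | succ n =>
    have hp := (hr (n + 2)).pair n (by omega)
    replace hw := mem_dspan_of_mem hP hr n w hw
    have hcz : ∀ x ∈ strands r (n + 1), Commute x (kap q μ (r (n + 1))) := fun x hx =>
      (kap_comm (strands_comm hc le_rfl hx).symm).symm
    induction hw using Submodule.span_induction with
    | mem w hw =>
      obtain ⟨x, hx, y, hy, v, hv, rfl⟩ := hw
      have e : kap q μ (r (n + 1)) * (x * v * y) * kap q μ (r (n + 1))
          = x * (kap q μ (r (n + 1)) * v * kap q μ (r (n + 1))) * y := by
        rw [← mul_assoc, ← mul_assoc, ← (hcz x hx).eq, mul_assoc _ y, (hcz y hy).eq]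
        simp only [mul_assoc]
      obtain ⟨c, hcv⟩ : ∃ c : ℂ, kap q μ (r (n + 1)) * v * kap q μ (r (n + 1))
          = c • kap q μ (r (n + 1)) := by
        rcases hv with rfl | rfl | rfl
        · exact ⟨_, by rw [mul_one, kap_mul_kap hP hcub]⟩
        · exact ⟨_, hp.symm.kap_mul_mul_kap hP⟩
        · exact ⟨1, by rw [hp.kkk₂, one_smul]⟩
      refine ⟨c • (x * y), Subalgebra.smul_mem _ (mul_mem hx hy) _, ?_⟩
      rw [e, hcv, mul_smul_comm, smul_mul_assoc, mul_assoc, ← (hcz y hy).eq, smul_mul_assoc,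
        mul_assoc]
    | zero => exact ⟨0, zero_mem _, by simp⟩
    | add u v _ _ hu hv =>
      obtain ⟨a, ha, ha'⟩ := hu
      obtain ⟨b, hb, hb'⟩ := hv
      exact ⟨a + b, add_mem ha hb, by rw [mul_add, add_mul, ha', hb', add_mul]⟩
    | smul c u _ hu =>
      obtain ⟨a, ha, ha'⟩ := hu
      exact ⟨c • a, Subalgebra.smul_mem _ ha _, by rw [mul_smul_comm, smul_mul_assoc, ha', smul_mul_assoc]⟩

omit hP hr in
/-- The word `r_j r_{j+1} ⋯ r_{j+l-1}`. -/
def word (r : ℕ → B) (j : ℕ) : ℕ → B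
  | 0 => 1
  | l + 1 => r j * word r (j + 1) l

omit hP hr in
lemma word_comm (hc : ∀ i j, i + 2 ≤ j → Commute (r i) (r j)) {n j : ℕ} (hj : n ≤ j) {x : B}
    (hx : x ∈ strands r n) (l : ℕ) : Commute x (word r j l) := by
  induction l generalizing j with
  | zero => exact Commute.one_right _
  | succ l ih => exact (strands_comm hc hj hx).mul_right (ih (by omega))

omit hP hr [Algebra ℂ B] in
lemma word_succ (j l : ℕ) : word r j (l + 1) = word r j l * r (j + l) := by
  induction l generalizing j with
  | zero => simp [word]
  | succ l ih =>
    have := ih (j + 1)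
    rw [word, this, show j + 1 + l = j + (l + 1) by omega, ← mul_assoc]
    rfl

omit hP hr in
lemma word_mem {n j l : ℕ} (h : j + l < n) : word r j l ∈ strands r n := by
  induction l generalizing j with
  | zero => exact one_mem _
  | succ l ih => exact mul_mem (gen_mem (by omega)) (ih (by omega))

/-- In `κ_j r_{j+1} ⋯ r_{j+l}` the contraction can be moved to the last strands. -/
lemma kap_mul_word (j l : ℕ) : ∃ u ∈ strands r (j + l + 1), ∃ v ∈ strands r (j + l + 1),
    kap q μ (r j) * word r (j + 1) l = u * kap q μ (r (j + l)) * v := by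
  induction l generalizing j with
  | zero => exact ⟨1, one_mem _, 1, one_mem _, by simp [word]⟩
  | succ l ih =>
    have hc : ∀ i j, i + 2 ≤ j → Commute (r i) (r j) := fun i j hij =>
      (hr (j + 1)).comm i j hij (by omega)
    obtain ⟨u, hu, v, hv, e⟩ := ih (j + 1)
    have hp := (hr (j + 2)).pair j (by omega)
    have hj : r j ∈ strands r (j + 2) := gen_mem (by omega)
    have hi : inv' q μ (r j) ∈ strands r (j + 2) := inv'_mem_of hj
    have hle : strands r (j + 2) ≤ strands r (j + (l + 1) + 1) := strands_mono (by omega)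
    rw [show j + 1 + l = j + (l + 1) by omega] at hu hv e
    refine ⟨kap q μ (r j) * u, mul_mem (hle (kap_mem_of hj)) hu, v * inv' q μ (r j),
      mul_mem hv (hle hi), ?_⟩
    -- `κ_j r_{j+1} = κ_j κ_{j+1} r_j⁻¹`, and `r_j⁻¹` passes through the rest of the word.
    rw [word, ← mul_assoc, hp.kap_mul_eq hP, mul_assoc _ (inv' q μ (r j)),
      (word_comm hc le_rfl hi l).eq, mul_assoc (kap q μ (r j)), ← mul_assoc (kap q μ (r (j + 1))), e]
    simp only [mul_assoc]

/-- A trace-like functional on `n + 2` strands is determined, modulo the contributions of products of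
operators on fewer strands and of operators containing `κ_n`, by its value on the Coxeter word. -/
lemma reduction {V : Type*} [AddCommGroup V] [Module ℂ V] (f : B →ₗ[ℂ] V) (S : Submodule ℂ V)
    (n : ℕ) (hf : ∀ x ∈ strands r (n + 2), ∀ y ∈ strands r (n + 2), f (x * y) = f (y * x))
    (hk : ∀ x ∈ strands r (n + 1), f (x * kap q μ (r n)) ∈ S)
    (hw : ∀ j l, j + l = n → ∀ x ∈ strands r (j + 1), f (x * word r (j + 1) l) ∈ S)
    (h0 : f (word r 0 (n + 1)) ∈ S) : ∀ X ∈ strands r (n + 2), f X ∈ S := by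
  have hc : ∀ i j, i + 2 ≤ j → Commute (r i) (r j) := fun i j hij =>
    (hr (j + 1)).comm i j hij (by omega)
  -- An operator `x` on the first `j + 1` strands is shortened step by step: either the generator `r_j`
  -- in `x` is absorbed into the word, or the product splits, or a contraction appears.
  have claim : ∀ j l, j + l = n → ∀ x ∈ strands r (j + 1), f (x * word r j (l + 1)) ∈ S := by
    intro j
    induction j with
    | zero =>
      intro l hl x hx
      obtain rfl : l = n := by omega
      rw [strands_eq_bot (by omega)] at hx
      obtain ⟨c, rfl⟩ := Algebra.mem_bot.1 hx
      rw [← Algebra.smul_def, map_smul]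
      exact S.smul_mem _ h0
    | succ j ih =>
      intro l hl x hx
      replace hx := mem_dspan_of_mem hP hr j x hx
      induction hx using Submodule.span_induction with
      | zero => simp
      | add u v _ _ hu hv => rw [add_mul, map_add]; exact add_mem hu hv
      | smul c u _ hu => rw [smul_mul_assoc, map_smul]; exact Submodule.smul_mem _ _ hu
      | mem w hw' =>
        obtain ⟨x, hx, y, hy, z, hz, rfl⟩ := hw'
        have hle : strands r (j + 1) ≤ strands r (n + 2) := strands_mono (by omega)
        have hle' : strands r (j + 1) ≤ strands r (n + 1) := strands_mono (by omega)
        have hzm : z ∈ strands r (n + 2) := by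
          rcases hz with rfl | rfl | rfl
          · exact one_mem _
          · exact gen_mem (by omega)
          · exact kap_mem_of (gen_mem (by omega))
        have hwm : word r (j + 1) (l + 1) ∈ strands r (n + 2) := word_mem (by omega)
        have e : f (x * z * y * word r (j + 1) (l + 1)) = f (y * x * (z * word r (j + 1) (l + 1))) := by
          rw [mul_assoc, (word_comm hc le_rfl hy _).eq, ← mul_assoc,
            hf _ (mul_mem (mul_mem (hle hx) hzm) hwm) _ (hle hy)]
          simp only [mul_assoc]
        rw [e]
        rcases hz with rfl | rfl | rfl
        · rw [one_mul]
          exact hw j (l + 1) (by omega) _ (mul_mem hy hx)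
        · exact ih (l + 1) (by omega) _ (mul_mem hy hx)
        · obtain ⟨u, hu, v, hv, e⟩ := kap_mul_word hP hr j (l + 1)
          obtain rfl : n = j + (l + 1) := by omega
          have hle2 : strands r (j + (l + 1) + 1) ≤ strands r (j + (l + 1) + 2) :=
            strands_mono (by omega)
          rw [e, ← mul_assoc, hf _ (mul_mem (mul_mem (hle hy) (hle hx))
            (mul_mem (hle2 hu) (kap_mem_of (gen_mem (by omega))))) _ (hle2 hv)]
          have := hk (v * (y * x * u)) (mul_mem hv (mul_mem (mul_mem (hle' hy) (hle' hx)) hu))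
          simpa only [mul_assoc] using this
  intro X hX
  replace hX := mem_dspan_of_mem hP hr n X hX
  induction hX using Submodule.span_induction with
  | zero => simp
  | add u v _ _ hu hv => rw [map_add]; exact add_mem hu hv
  | smul c u _ hu => rw [map_smul]; exact Submodule.smul_mem _ _ hu
  | mem w hw' =>
    obtain ⟨x, hx, y, hy, z, hz, rfl⟩ := hw'
    have hle : strands r (n + 1) ≤ strands r (n + 2) := strands_mono (by omega)
    have hzm : z ∈ strands r (n + 2) := by
      rcases hz with rfl | rfl | rfl
      · exact one_mem _
      · exact gen_mem (by omega)
      · exact kap_mem_of (gen_mem (by omega))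
    rw [hf _ (mul_mem (hle hx) hzm) _ (hle hy), ← mul_assoc]
    rcases hz with rfl | rfl | rfl
    · simpa [word] using hw n 0 rfl _ (mul_mem hy hx)
    · simpa [word] using claim n 0 rfl _ (mul_mem hy hx)
    · exact hk _ (mul_mem hy hx)

end Strands

/-! ### The matrices `C_R`, `D_R` and the rank of `κ` -/

section Legs

variable {N : ℕ} {A : Type} [Ring A] [Algebra ℂ A] {i j k : ℕ}

lemma vec3_injective (hij : i ≠ j) (hik : i ≠ k) (hjk : j ≠ k) :
    Function.Injective ![i, j, k] := by
  intro a b h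
  fin_cases a <;> fin_cases b <;> simp_all [eq_comm]

lemma num_opAt {n : ℕ} {φ : Fin n → ℕ} (hφ : Function.Injective φ) (X : Op2 N) {m : ℕ}
    (h : m + 1 < n) {l l' : ℕ} (hl : φ ⟨m, by omega⟩ = l) (hl' : φ ⟨m + 1, h⟩ = l') :
    num hφ A (opAt n X m) = opR A X l l' := by
  subst hl hl'
  rw [num_apply, emb_scal_opAt hφ X h]

/-- A relation in `V ⊗ V ⊗ V` holds in any three different legs. -/
lemma opR_rel₁ (hij : i ≠ j) (hik : i ≠ k) (hjk : j ≠ k) {X Y Z X' Y' Z' : Op2 N}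
    (h : opAt 3 X 0 * opAt 3 Y 1 * opAt 3 Z 0 = opAt 3 X' 1 * opAt 3 Y' 0 * opAt 3 Z' 1) :
    opR A X i j * opR A Y j k * opR A Z i j = opR A X' j k * opR A Y' i j * opR A Z' j k := by
  have hv := vec3_injective hij hik hjk
  have h0 : ∀ X : Op2 N, num hv A (opAt 3 X 0) = opR A X i j := fun X =>
    num_opAt hv X (by omega) rfl rfl
  have h1 : ∀ X : Op2 N, num hv A (opAt 3 X 1) = opR A X j k := fun X =>
    num_opAt hv X (by omega) rfl rfl
  have := congrArg (num hv A) h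
  simpa only [map_mul, h0, h1] using this

end Legs

section Basic

variable {N : ℕ} {A : Type} [Ring A] [Algebra ℂ A]

lemma opAt_inv [NeZero N] {X : Op2 N} (hX : IsUnit X) {n m : ℕ} (h : m + 1 < n) :
    (opAt n X m)⁻¹ = opAt n X⁻¹ m := by
  have hd := (Matrix.isUnit_iff_isUnit_det X).1 hX
  refine Matrix.inv_eq_right_inv ?_
  have hi := emb_injective (A := ℂ) (N := N) (ofs_injective 0 n)
  have hs : Function.Injective (scal ℂ : OpN N n → _) := by
    intro X Y h
    ext a b
    simpa [scal] using congrFun (congrFun h a) b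
  apply hs
  apply hi
  change num (ofs_injective 0 n) ℂ _ = num (ofs_injective 0 n) ℂ _
  rw [map_mul, map_one, num_apply, num_apply, emb_scal_opAt (ofs_injective 0 n) _ h,
    emb_scal_opAt (ofs_injective 0 n) _ h, opR_mul (by simp [ofs]), Matrix.mul_nonsing_inv _ hd,
    opR_one]

lemma opR_mul_inv {X : Op2 N} (hX : IsUnit X) {l m : ℕ} (h : l ≠ m) :
    opR A X l m * opR A X⁻¹ l m = 1 := by
  rw [opR_mul h, Matrix.mul_nonsing_inv _ ((Matrix.isUnit_iff_isUnit_det X).1 hX), opR_one]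

lemma opR_inv_mul {X : Op2 N} (hX : IsUnit X) {l m : ℕ} (h : l ≠ m) :
    opR A X⁻¹ l m * opR A X l m = 1 := by
  rw [opR_mul h, Matrix.nonsing_inv_mul _ ((Matrix.isUnit_iff_isUnit_det X).1 hX), opR_one]

lemma opR_kap (q μ : ℂ) (X : Op2 N) {l m : ℕ} (h : l ≠ m) :
    opR A (kap q μ X) l m = kap q μ (opR A X l m) := map_kap (opRHom A h) X

lemma antisym_eq (R : Op2 N) (q μ : ℂ) (n s i : ℕ) :
    antisym R q μ n s i = asym q μ (fun j => opAt n R (s + j)) i := by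
  induction i using asym.induct with
  | case1 => rfl
  | case2 => rfl
  | case3 i ih => rw [antisym, asym, ih]; rfl

/-- Under the R-trace over the leg `m'`, conjugation by `F` moves an operator from the leg `m` to the leg
`m'`. The argument rests on the skew invertibility of `R`. -/
lemma E_conj {R F : Op2 N} (hS : SkewInvertible R) (hF : IsUnit F)
    (ht : opAt 3 R 1 * opAt 3 F 0 * opAt 3 F 1 = opAt 3 F 0 * opAt 3 F 1 * opAt 3 R 0)
    {m m' : ℕ} (h : m ≠ m') {Y : Chain N A} (hY : Off m' Y) :
    E (matD R) m' (opR A F m m' * Y * opR A F⁻¹ m m') = E (matD R) m Y := by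
  have h1 : m + m' + 1 ≠ m := by omega
  have h2 : m + m' + 1 ≠ m' := by omega
  refine E_conj_of hS (l := m + m' + 1) (U := opR A F⁻¹ (m + m' + 1) m)
    (U' := opR A F (m + m' + 1) m) h1 h2 h (opR_off h2 h _) (opR_off h2 h _) (opR_inv_mul hF h1) ?_ hY
  -- The auxiliary leg `m + m' + 1` carries the third factor of the twist relation.
  have := opR_rel₁ (A := A) h1 h2 h ht.symm
  calc _ = opR A F⁻¹ (m + m' + 1) m * (opR A F (m + m' + 1) m * opR A F m m' *
        opR A R (m + m' + 1) m) * opR A F⁻¹ m m' := by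
        simp only [← mul_assoc]; rw [opR_inv_mul hF h1, one_mul]
    _ = _ := by
        rw [this]
        simp only [mul_assoc]; rw [opR_mul_inv hF h, mul_one]

lemma E_conj' {R F : Op2 N} (hS : SkewInvertible R) (hF : IsUnit F)
    (ht : opAt 3 R 0 * opAt 3 F 1 * opAt 3 F 0 = opAt 3 F 1 * opAt 3 F 0 * opAt 3 R 1)
    {m m' : ℕ} (h : m ≠ m') {Y : Chain N A} (hY : Off m' Y) :
    E (matD R) m' (opR A F⁻¹ m m' * Y * opR A F m m') = E (matD R) m Y := by
  have h1 : m + m' + 1 ≠ m := by omega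
  have h2 : m + m' + 1 ≠ m' := by omega
  refine E_conj_of hS (l := m + m' + 1) (U := opR A F (m + m' + 1) m)
    (U' := opR A F⁻¹ (m + m' + 1) m) h1 h2 h (opR_off h2 h _) (opR_off h2 h _) (opR_mul_inv hF h1) ?_ hY
  have := opR_rel₁ (A := A) h1 h2 h ht
  calc _ = opR A F⁻¹ m m' * (opR A R (m + m' + 1) m * opR A F m m' * opR A F (m + m' + 1) m) *
        opR A F⁻¹ (m + m' + 1) m := by
        simp only [mul_assoc]; rw [opR_mul_inv hF h1, mul_one]
    _ = _ := by
        rw [this]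
        simp only [← mul_assoc]; rw [opR_inv_mul hF h, one_mul]

end Basic

section Numeric

variable {N : ℕ} {R F : Op2 N} {q μ : ℂ}

variable (R F q μ) in
/-- The standing assumptions: a compatible pair whose first member is a skew invertible R-matrix of
BMW type. -/
structure Setup : Prop where
  params : Params q μ
  bmw : IsBMWType R q μ
  skew : SkewInvertible R
  compat : IsCompatiblePair R F

lemma IsBMWType.params (h : IsBMWType R q μ) : Params q μ := by
  refine ⟨h.q_ne.1, ?_, h.mu_ne.1, h.mu_ne.2.1, h.mu_ne.2.2⟩
  intro e
  have h0 := h.q_ne.1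
  have : (q - 1) * (q + 1) = 0 := by
    field_simp at e
    linear_combination e
  rcases mul_eq_zero.1 this with h1 | h1
  · exact h.q_ne.2.1 (sub_eq_zero.1 h1)
  · exact h.q_ne.2.2 (eq_neg_of_add_eq_zero_left h1)

lemma IsBMWType.cubic (h : IsBMWType R q μ) : Cubic q μ R := by
  have := minpoly.aeval ℂ R
  rw [h.minimal] at this
  simpa [Cubic, Algebra.algebraMap_eq_smul_one] using this

lemma IsBMWType.kap_ne (h : IsBMWType R q μ) : kap q μ R ≠ 0 := by
  intro e
  have hP := h.params
  have h2 : (R - q • (1 : Op2 N)) * (R + q⁻¹ • (1 : Op2 N)) = 0 := by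
    have : kap q μ R = (-(μ * (q - q⁻¹))⁻¹) • ((R - q • (1 : Op2 N)) * (R + q⁻¹ • (1 : Op2 N))) := by
      rw [kap, neg_smul, ← smul_neg, ← neg_mul, neg_sub, add_comm R]
    rw [this] at e
    exact (smul_eq_zero.1 e).resolve_left
      (neg_ne_zero.2 (inv_ne_zero (mul_ne_zero hP.mu_ne hP.lam_ne)))
  have hd := minpoly.dvd ℂ R (p := (Polynomial.X - Polynomial.C q) * (Polynomial.X + Polynomial.C q⁻¹))
    (by simpa [Algebra.algebraMap_eq_smul_one] using h2)
  rw [h.minimal] at hd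
  have hm : ((Polynomial.X - Polynomial.C q) * (Polynomial.X + Polynomial.C q⁻¹) :
      Polynomial ℂ).Monic := (Polynomial.monic_X_sub_C _).mul (Polynomial.monic_X_add_C _)
  have := Polynomial.natDegree_le_of_dvd hd hm.ne_zero
  rw [hm.natDegree_mul (Polynomial.monic_X_sub_C _), Polynomial.natDegree_X_sub_C] at this
  omega

namespace Setup

variable {A : Type} [Ring A] [Algebra ℂ A] (h : Setup R F q μ)
include h

omit [Ring A] [Algebra ℂ A] in
lemma isUnit_left : IsUnit R := h.compat.left.isUnit

omit [Ring A] [Algebra ℂ A] in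
lemma isUnit_right : IsUnit F := h.compat.right.isUnit

omit [Ring A] [Algebra ℂ A] in
/-- An R-matrix is compatible with itself. -/
lemma self : Setup R R q μ :=
  ⟨h.params, h.bmw, h.skew, h.compat.left, h.compat.left, h.compat.left.yangBaxter,
    h.compat.left.yangBaxter.symm⟩

omit [Ring A] [Algebra ℂ A] in
lemma inv_eq : R⁻¹ = inv' q μ R :=
  Matrix.inv_eq_right_inv (mul_inv' h.params h.bmw.cubic)

lemma cubic {l m : ℕ} (hlm : l ≠ m) : Cubic q μ (opR A R l m) := by
  have := congrArg (opRHom A hlm) h.bmw.cubic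
  simp only [map_mul, map_sub, map_add, map_smul, map_one, map_zero] at this
  exact this

lemma opR_inv {l m : ℕ} (hlm : l ≠ m) : opR A R⁻¹ l m = inv' q μ (opR A R l m) := by
  rw [h.inv_eq]; exact map_inv' (opRHom A hlm) R

lemma pair {i j k : ℕ} (hij : i ≠ j) (hik : i ≠ k) (hjk : j ≠ k) :
    BMWPair q μ (opR A R i j) (opR A R j k) := by
  have hv := vec3_injective hij hik hjk
  have h0 : num hv A (opAt 3 R 0) = opR A R i j :=
    num_opAt hv R (by omega) rfl rfl
  have h1 : num hv A (opAt 3 R 1) = opR A R j k :=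
    num_opAt hv R (by omega) rfl rfl
  have k0 : num hv A (opK R q μ 3 0) = kap q μ (opR A R i j) := by
    rw [← h0]; exact map_kap _ _
  have k1 : num hv A (opK R q μ 3 1) = kap q μ (opR A R j k) := by
    rw [← h1]; exact map_kap _ _
  refine BMWPair.of_rel h.params (h.cubic hij) (h.cubic hjk)
    (opR_rel₁ hij hik hjk h.compat.left.yangBaxter) ?_ ?_
  · simpa only [map_mul, h0, h1, k0, k1] using congrArg (num hv A) h.bmw.rel_pos
  · simpa only [map_mul, h0, h1, k0, k1] using congrArg (num hv A) h.bmw.rel_K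

end Setup

end Numeric

section Weight

variable {N : ℕ} {R F : Op2 N} {q μ : ℂ} (h : Setup R F q μ)
include h

lemma Setup.E_conj_left {A : Type} [Ring A] [Algebra ℂ A] {m m' : ℕ} (hm : m ≠ m') {Y : Chain N A}
    (hY : Off m' Y) : E (matD R) m' (opR A F m m' * Y * opR A F⁻¹ m m') = E (matD R) m Y :=
  E_conj h.skew h.isUnit_right h.compat.twist₂ hm hY

lemma Setup.E_conj_right {A : Type} [Ring A] [Algebra ℂ A] {m m' : ℕ} (hm : m ≠ m') {Y : Chain N A}
    (hY : Off m' Y) : E (matD R) m' (opR A F⁻¹ m m' * Y * opR A F m m') = E (matD R) m Y :=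
  E_conj' h.skew h.isUnit_right h.compat.twist₁ hm hY

end Weight

section WeightMatrix

variable {N : ℕ} {R F : Op2 N} {q μ : ℂ}

lemma opR_injective [NeZero N] {l m : ℕ} (hlm : l ≠ m) :
    Function.Injective fun X : Op2 N => opR ℂ X l m := by
  intro X Y h
  have hv : Function.Injective ![l, m] := by
    intro a b h
    fin_cases a <;> fin_cases b <;> simp_all [eq_comm]
  have e : ∀ X : Op2 N, num hv ℂ (opAt 2 X 0) = opR ℂ X l m := fun X =>
    num_opAt hv X (by omega) rfl rfl
  have h1 : opAt 2 X 0 = opAt 2 Y 0 := by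
    have := emb_injective hv (A := ℂ) (((e X).trans h).trans (e Y).symm)
    ext a b
    simpa [scal] using congrFun (congrFun this a) b
  ext ⟨a, b⟩ ⟨c, d⟩
  have := congrFun (congrFun h1 ![a, b]) ![c, d]
  have hl : ∀ l : Fin 2, (l : ℕ) ≠ 0 → (l : ℕ) ≠ 1 → (![a, b] : Fin 2 → Fin N) l = ![c, d] l := by
    intro l h0 h1
    fin_cases l <;> simp_all
  simpa [opAt, hl] using this

/-- An operator whose partial trace is scalar, in matrix entries. -/
lemma sum_of_E_eq [NeZero N] {D : Matrix (Fin N) (Fin N) ℂ} {W : Op2 N} {c : ℂ}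
    (h : E D 1 (opR ℂ W 0 1) = c • 1) (i k : Fin N) :
    ∑ j, ∑ n, W (i, j) (k, n) * D n j = if i = k then c else 0 := by
  rw [E_opR D W (by omega), ← sum_eU (A := ℂ) (N := N) 0] at h
  have h2 : ∑ i, ∑ k, cst N ℂ (∑ j, ∑ n, W (i, j) (k, n) * D n j) * eU ℂ 0 i k
      = ∑ i, ∑ k, cst N ℂ (if i = k then c else 0) * eU ℂ 0 i k := by
    have hc : ∀ z : ℂ, cst N ℂ z = z • 1 := fun z => by
      rw [← Algebra.algebraMap_eq_smul_one]; exact (cst N ℂ).commutes z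
    simpa only [hc, smul_mul_assoc, one_mul, ite_smul, zero_smul, ite_mul, zero_mul,
      Finset.sum_ite_eq, Finset.mem_univ, if_true, Finset.smul_sum] using h
  exact cst_injective (slices_unique (fun _ _ => Off.of_cst _) (fun _ _ => Off.of_cst _) h2 i k)

/-- The matrix unit of the first leg, as an operator on `V ⊗ V`. -/
def unitLeft (j l : Fin N) : Op2 N := Matrix.of fun p r =>
  if p.1 = j then if r.1 = l then if p.2 = r.2 then 1 else 0 else 0 else 0

lemma opR_unitLeft {A : Type} [Ring A] [Algebra ℂ A] {m m' : ℕ} (j l : Fin N) :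
    opR A (unitLeft j l) m m' = eU A m j l := by
  have : ∀ p : Fin N × Fin N, ∑ r, unitLeft j l p r • eU2 A m m' p r
      = if p.1 = j then eU A m j l * eU A m' p.2 p.2 else 0 := by
    intro p
    rw [Fintype.sum_prod_type, Finset.sum_eq_single l]
    · rw [Finset.sum_eq_single p.2]
      · by_cases h : p.1 = j <;> simp [unitLeft, h, eU2]
      · intro b _ hb
        simp [unitLeft, hb.symm]
      · simp
    · intro b _ hb
      simp [unitLeft, hb]
    · simp
  rw [opR]
  simp only [this, Fintype.sum_prod_type]
  rw [Finset.sum_eq_single j]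
  · simp [← Finset.mul_sum, sum_eU]
  · intro b _ hb; simp [hb]
  · simp

lemma mul_unitLeft_mul (X Y : Op2 N) (j l i t k s : Fin N) :
    (X * unitLeft j l * Y) (i, t) (k, s) = ∑ a, X (i, t) (j, a) * Y (l, a) (k, s) := by
  have h1 : ∀ r : Fin N × Fin N, (X * unitLeft j l) (i, t) r
      = if r.1 = l then X (i, t) (j, r.2) else 0 := by
    intro r
    rw [Matrix.mul_apply, Fintype.sum_prod_type, Finset.sum_eq_single j]
    · by_cases h : r.1 = l <;> simp [unitLeft, h]
    · intro b _ hb; simp [unitLeft, hb]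
    · simp
  rw [Matrix.mul_apply, Fintype.sum_prod_type, Finset.sum_eq_single l]
  · simp [h1]
  · intro b _ hb; simp [h1, hb]
  · simp

/-- The partial transpose of an operator on `V ⊗ V`. It is invertible if the operator is skew
invertible, with the inverse `twistedInv`. -/
def twisted (R : Op2 N) : Op2 N := Matrix.of fun p r => R (p.2, r.2) (p.1, r.1)

/-- The partial transpose of the skew inverse. -/
def twistedInv (R : Op2 N) : Op2 N := Matrix.of fun p r => skewInv R (p.1, r.1) (p.2, r.2)

lemma twistedInv_mul (h : SkewInvertible R) : twistedInv R * twisted R = 1 := by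
  ext ⟨c, d⟩ ⟨a, t⟩
  have := (skewInv_spec h).2 c d t a
  rw [Matrix.mul_apply, Fintype.sum_prod_type]
  simp only [twistedInv, twisted, Matrix.of_apply, Matrix.one_apply, Prod.mk.injEq]
  rw [this]
  simp only [eq_comm]

lemma twistedInv_mulVec (h : SkewInvertible R) {G H : Fin N × Fin N → ℂ}
    (hG : ∀ p, ∑ r, twisted R p r * G r = H p) (p : Fin N × Fin N) :
    G p = ∑ r, twistedInv R p r * H r := by
  have e : (twisted R).mulVec G = H := funext hG
  have : (twistedInv R).mulVec ((twisted R).mulVec G) = G := by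
    rw [Matrix.mulVec_mulVec, twistedInv_mul h, Matrix.one_mulVec]
  rw [e] at this
  exact (congrFun this p).symm

namespace Setup

variable (h : Setup R F q μ)
include h

/-- `R⁻¹ D₂` is expressed through the skew inverse: the equation `Tr₍₂₎ D₂ R X₁ R⁻¹ = Tr(D X) I` for the
matrix units `X` is solved for `R⁻¹ D₂`. -/
lemma inv_mul_weight [NeZero N] (l c k d : Fin N) :
    ∑ s, R⁻¹ (l, c) (k, s) * matD R s d = ∑ j, matD R l j * skewInv R (c, j) (d, k) := by
  have key : ∀ i j, ∑ t, ∑ s, (∑ a, R (i, t) (j, a) * R⁻¹ (l, a) (k, s)) * matD R s t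
      = if i = k then matD R l j else 0 := by
    intro i j
    have := h.self.E_conj_left (A := ℂ) (m := 0) (m' := 1) (by omega)
      (Off.of_eU zero_ne_one j l)
    rw [E_eU, ← opR_unitLeft (m' := 1), opR_mul (by omega), opR_mul (by omega)] at this
    simpa only [mul_unitLeft_mul] using sum_of_E_eq this i k
  have := twistedInv_mulVec h.skew
    (G := fun r => ∑ s, R⁻¹ (l, r.1) (k, s) * matD R s r.2)
    (H := fun r => if r.2 = k then matD R l r.1 else 0) (fun p => by
      rw [← key p.2 p.1, Fintype.sum_prod_type, Finset.sum_comm]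
      refine Finset.sum_congr rfl fun t _ => ?_
      simp only [Finset.mul_sum, Finset.sum_mul, twisted, Matrix.of_apply]
      rw [Finset.sum_comm]
      simp only [mul_assoc]) (c, d)
  rw [this, Fintype.sum_prod_type]
  refine Finset.sum_congr rfl fun j _ => ?_
  simp [twistedInv, mul_comm]

/-- The mirror image of `inv_mul_weight`. -/
lemma weight_mul_inv [NeZero N] (i j c d : Fin N) :
    ∑ t, matD R c t * R⁻¹ (i, t) (j, d) = ∑ l, skewInv R (c, i) (d, l) * matD R l j := by
  have key : ∀ l k, ∑ t, ∑ s, (∑ a, R⁻¹ (i, t) (j, a) * R (l, a) (k, s)) * matD R s t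
      = if i = k then matD R l j else 0 := by
    intro l k
    have := h.self.E_conj_right (A := ℂ) (m := 0) (m' := 1) (by omega)
      (Off.of_eU zero_ne_one j l)
    rw [E_eU, ← opR_unitLeft (m' := 1), opR_mul (by omega), opR_mul (by omega)] at this
    simpa only [mul_unitLeft_mul] using sum_of_E_eq this i k
  have := twistedInv_mulVec h.skew
    (G := fun r => ∑ t, matD R r.1 t * R⁻¹ (i, t) (j, r.2))
    (H := fun r => if i = r.1 then matD R r.2 j else 0) (fun p => by
      rw [← key p.2 p.1, Fintype.sum_prod_type]
      simp only [Finset.mul_sum, Finset.sum_mul, twisted, Matrix.of_apply]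
      conv_rhs => rw [sum_comm_one_two]
      refine Finset.sum_congr rfl fun t _ => Finset.sum_congr rfl fun _ _ =>
        Finset.sum_congr rfl fun _ _ => ?_
      ring) (c, d)
  rw [this, Fintype.sum_prod_type, Finset.sum_comm]
  refine Finset.sum_congr rfl fun l _ => ?_
  simp [twistedInv]

/-- `C_R D_R` is the partial trace of `R⁻¹`. -/
lemma matC_mul_matD [NeZero N] (i j : Fin N) :
    (matC R * matD R) i j = ∑ a, ∑ b, R⁻¹ (i, a) (j, b) * matD R b a := by
  rw [Finset.sum_comm]
  have := fun c => h.weight_mul_inv i j c c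
  simp only [mul_comm (R⁻¹ _ _), this]
  rw [Finset.sum_comm, Matrix.mul_apply]
  simp only [matC, Matrix.of_apply, Finset.sum_mul]

/-- The operator `D ⊗ D` commutes with the R-matrix. -/
lemma weight_comm {A : Type} [Ring A] [Algebra ℂ A] [NeZero N] {l m : ℕ} (hlm : l ≠ m) :
    Commute (legOp A (matD R) l * legOp A (matD R) m) (opR A R l m) := by
  set W : Op2 N := Matrix.of fun p r => matD R p.1 r.1 * matD R p.2 r.2 with hW
  have hD : legOp A (matD R) l * legOp A (matD R) m = opR A W l m := by
    simp only [legOp, opR, Fintype.sum_prod_type, Finset.sum_mul_sum, eU2, hW, Matrix.of_apply,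
      smul_mul_smul_comm]
  -- Both sides are computed in terms of the skew inverse.
  have hc : W * R⁻¹ = R⁻¹ * W := by
    ext ⟨l, c⟩ ⟨k, d⟩
    rw [Matrix.mul_apply, Matrix.mul_apply, Fintype.sum_prod_type, Fintype.sum_prod_type]
    simp only [hW, Matrix.of_apply, mul_assoc, ← Finset.mul_sum, h.weight_mul_inv]
    have e : ∀ x, ∑ y, R⁻¹ (l, c) (x, y) * (matD R x k * matD R y d)
        = (∑ j, matD R l j * skewInv R (c, j) (d, x)) * matD R x k := by
      intro x
      rw [← h.inv_mul_weight, Finset.sum_mul]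
      exact Finset.sum_congr rfl fun _ _ => by ring
    simp only [e, Finset.mul_sum, Finset.sum_mul]
    rw [Finset.sum_comm]
    simp only [mul_assoc]
  have hd := (Matrix.isUnit_iff_isUnit_det R).1 h.isUnit_left
  have hc' : W * R = R * W := by
    calc W * R = R * (R⁻¹ * W) * R := by rw [← mul_assoc, Matrix.mul_nonsing_inv _ hd, one_mul]
      _ = _ := by rw [← hc, mul_assoc, mul_assoc, Matrix.nonsing_inv_mul _ hd, mul_one]
  rw [hD, commute_iff_eq, opR_mul hlm, opR_mul hlm, hc']

section

variable {A : Type} [Ring A] [Algebra ℂ A]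

/-- The sandwich of a matrix unit. It follows from `κ_m r_{m-1} κ_m = μ⁻¹ κ_m` by comparison of the
coefficients in the auxiliary leg. -/
lemma kap_sandwich_eU {m m' : ℕ} (hm : m ≠ m') (j i : Fin N) :
    kap q μ (opR A R m m') * eU A m j i * kap q μ (opR A R m m')
      = matD R i j • μ⁻¹ • kap q μ (opR A R m m') := by
  have h1 : m + m' + 1 ≠ m := by omega
  have h2 : m + m' + 1 ≠ m' := by omega
  have hp := (h.pair (A := A) h1 h2 hm).symm.kap_mul_mul_kap h.params
  have hk : Off (m + m' + 1) (kap q μ (opR A R m m')) := by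
    rw [← opR_kap _ _ _ hm]; exact opR_off h1.symm h2.symm _
  refine matD_smul_of_slices (φ := fun j i => kap q μ (opR A R m m') * eU A m j i *
    kap q μ (opR A R m m')) h.skew (fun i k => ?_) i j
  refine slices_eq_of_sum (l := m + m' + 1) (fun j n => (hk.mul (Off.of_eU h1.symm _ _)).mul hk)
    (hk.smul _) ?_ i k
  rw [← hp, opR_eq_slices R h1]
  simp only [Finset.mul_sum, Finset.sum_mul, mul_smul_comm, smul_mul_assoc]
  refine Finset.sum_congr rfl fun a _ => Finset.sum_congr rfl fun b _ =>
    Finset.sum_congr rfl fun c _ => Finset.sum_congr rfl fun d _ => ?_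
  have e : eU A (m + m' + 1) a b * kap q μ (opR A R m m')
      = kap q μ (opR A R m m') * eU A (m + m' + 1) a b := (hk a b).eq.symm
  simp only [mul_assoc]
  rw [e]

/-- The sandwich of an operator between two copies of `κ` is its partial trace. -/
lemma kap_sandwich {m m' : ℕ} (hm : m ≠ m') {Y : Chain N A} (hY : Off m' Y) :
    kap q μ (opR A R m m') * Y * kap q μ (opR A R m m')
      = μ⁻¹ • (E (matD R) m Y * kap q μ (opR A R m m')) := by
  have hs : ∀ a b, Commute (∑ c, eU A m c a * Y * eU A m b c) (kap q μ (opR A R m m')) := by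
    intro a b
    rw [← opR_kap _ _ _ hm]
    exact off_opR_comm (Off.slice m Y a b) (Off.sum fun c _ =>
      ((Off.of_eU hm _ _).mul hY).mul (Off.of_eU hm _ _)) _
  rw [E_eq_sum_slices]
  conv_lhs => rw [← sum_slices m Y]
  rw [Finset.mul_sum, Finset.sum_mul, Finset.sum_mul, Finset.smul_sum]
  refine Finset.sum_congr rfl fun a _ => ?_
  rw [Finset.mul_sum, Finset.sum_mul, Finset.sum_mul, Finset.smul_sum]
  refine Finset.sum_congr rfl fun b _ => ?_
  rw [← mul_assoc, ← (hs a b).eq, mul_assoc, mul_assoc, ← mul_assoc (kap q μ _),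
    h.kap_sandwich_eU hm, smul_mul_assoc, mul_smul_comm, mul_smul_comm]
  rw [smul_comm]

omit [Ring A] [Algebra ℂ A] in
lemma kap_ne_zero [NeZero N] {l m : ℕ} (hlm : l ≠ m) : kap q μ (opR ℂ R l m) ≠ 0 := by
  rw [← opR_kap _ _ _ hlm]
  intro e
  refine h.bmw.kap_ne (opR_injective hlm ?_)
  simpa [opR] using e

omit [Ring A] [Algebra ℂ A] in
/-- `Tr D_R = μ η`, from `κ² = η κ`. -/
lemma trace_weight [NeZero N] : (matD R).trace = μ * eta q μ := by
  have h1 := h.kap_sandwich (A := ℂ) (m := 0) (m' := 1) (by omega) Off.one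
  rw [mul_one, kap_mul_kap h.params (h.cubic (by omega)), E_one, smul_mul_assoc, one_mul,
    smul_smul] at h1
  have := smul_left_injective ℂ (h.kap_ne_zero zero_ne_one) h1
  rw [this, ← mul_assoc, mul_inv_cancel₀ h.params.mu_ne, one_mul]

/-- The partial R-trace of `κ` is scalar, from `κ₂ κ₁ κ₂ = κ₂`. -/
lemma E_kap [NeZero N] {l m : ℕ} (hlm : l ≠ m) :
    E (matD R) m (kap q μ (opR A R l m)) = μ • 1 := by
  have hs := h.kap_sandwich (A := ℂ) (m := 1) (m' := 2) (by omega)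
    (Y := kap q μ (opR ℂ R 0 1))
    (by rw [← opR_kap _ _ _ (by omega)]; exact opR_off (by omega) (by omega) _)
  rw [(h.pair (A := ℂ) (i := 0) (j := 1) (k := 2) (by omega) (by omega) (by omega)).kkk₂,
    ← opR_kap _ _ R zero_ne_one, E_opR _ _ zero_ne_one] at hs
  have hk : ∀ c : ℂ, Off 0 (c • kap q μ (opR ℂ R 1 2)) := fun c => by
    rw [← opR_kap _ _ _ (by omega)]; exact (opR_off (by omega) (by omega) _).smul _
  have hc : ∀ i k, (∑ j, ∑ n, kap q μ R (i, j) (k, n) * matD R n j) = if i = k then μ else 0 := by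
    intro i k
    have e : ∑ i, ∑ k, ((∑ j, ∑ n, kap q μ R (i, j) (k, n) * matD R n j) •
          kap q μ (opR ℂ R 1 2)) * eU ℂ 0 i k
        = ∑ i, ∑ k, ((if i = k then μ else 0) • kap q μ (opR ℂ R 1 2)) * eU ℂ 0 i k := by
      have h1 : ∑ i, ∑ k, ((if i = k then μ else 0) • kap q μ (opR ℂ R 1 2)) * eU ℂ 0 i k
          = μ • kap q μ (opR ℂ R 1 2) := by
        simp only [ite_smul, zero_smul, ite_mul, zero_mul, Finset.sum_ite_eq, Finset.mem_univ,
          if_true, ← Finset.mul_sum, sum_eU, mul_one]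
      have h2 := congrArg (μ • ·) hs
      simp only [smul_smul, mul_inv_cancel₀ h.params.mu_ne, one_smul] at h2
      rw [h1, h2, Finset.sum_mul]
      refine Finset.sum_congr rfl fun i _ => ?_
      rw [Finset.sum_mul]
      refine Finset.sum_congr rfl fun k _ => ?_
      have := (hk 1 i k).eq
      rw [one_smul] at this
      rw [smul_mul_assoc, smul_mul_assoc, this]
    have := slices_unique (fun _ _ => hk _) (fun _ _ => hk _) e i k
    exact smul_left_injective ℂ (h.kap_ne_zero (by omega)) this
  rw [← opR_kap _ _ R hlm, E_opR _ _ hlm]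
  simp only [hc, ite_smul, zero_smul, Finset.sum_ite_eq, Finset.mem_univ, if_true,
    ← Finset.smul_sum, sum_eU]

omit [Ring A] [Algebra ℂ A] in
/-- The trace of `R⁻¹ = R - (q - q⁻¹)(1 - κ)` shows that `C_R` and `D_R` are inverse to each other up to a
factor. In particular `D_R` is invertible. -/
lemma matC_mul_matD_eq [NeZero N] : matC R * matD R = μ ^ 2 • (1 : Matrix (Fin N) (Fin N) ℂ) := by
  have hE : E (matD R) 1 (opR ℂ R⁻¹ 0 1) = μ ^ 2 • 1 := by
    rw [h.opR_inv (by omega), inv', map_add, map_sub, map_smul, map_smul, h.E_kap (by omega), E_one,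
      E_opR_self h.skew (by omega), h.trace_weight]
    have h2 := h.params.lam_ne
    have h3 := h.params.mu_ne
    have h4 : (q - q⁻¹) * (μ * eta q μ) = (q - μ) * (q⁻¹ + μ) := by
      rw [eta, mul_div_assoc', mul_div_assoc', div_eq_iff (mul_ne_zero h3 h2)]; ring
    have h5 := mul_inv_cancel₀ h.params.q_ne
    match_scalars
    linear_combination -h4 - h5
  ext i j
  rw [h.matC_mul_matD, sum_of_E_eq hE, Matrix.smul_apply, Matrix.one_apply]
  split_ifs <;> simp

omit [Ring A] [Algebra ℂ A] in
/-- The operator `κ` has rank one. -/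
lemma exists_kap_eq [NeZero N] : ∃ u v : Fin N × Fin N → ℂ, ∀ r c, kap q μ R r c = u r * v c := by
  set K := kap q μ R with hK
  have hs : ∀ i j (r c : Fin N × Fin N), ∑ a, K r (j, a) * K (i, a) c = matD R i j * (μ⁻¹ * K r c) := by
    intro i j r c
    have := h.kap_sandwich_eU (A := ℂ) (m := 0) (m' := 1) (by omega) j i
    rw [← opR_kap _ _ _ (by omega), ← opR_unitLeft (m' := 1), opR_mul (by omega),
      opR_mul (by omega), ← opR_smul, ← opR_smul] at this
    have := congrFun (congrFun (opR_injective (by omega) this) r) c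
    rw [← mul_unitLeft_mul K K j i r.1 r.2 c.1 c.2]
    simpa using this
  -- The sandwich formula with a fixed nonzero entry `K r₀ c₀` makes the matrix `U` invertible; the same
  -- formula with any row `r` then expresses this row through the single entry `K r c₀`.
  obtain ⟨r₀, c₀, h0⟩ : ∃ r₀ c₀, K r₀ c₀ ≠ 0 := by
    by_contra! hc
    exact h.bmw.kap_ne (by ext r c; exact hc r c)
  have hmu := h.params.mu_ne
  have hCD := h.matC_mul_matD_eq
  set U : Matrix (Fin N) (Fin N) ℂ := Matrix.of fun a i => K (i, a) c₀ with hU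
  have hs' : ∀ r, (Matrix.of fun j a => K r (j, a)) * U = (μ⁻¹ * K r c₀) • (matD R).transpose := by
    intro r
    ext j i
    simp only [Matrix.mul_apply, hU, Matrix.of_apply, Matrix.smul_apply, Matrix.transpose_apply]
    rw [hs]; simp [mul_comm]
  have hD : matD R * (μ⁻¹ ^ 2 • matC R) = 1 := by
    rw [mul_eq_one_comm, smul_mul_assoc, hCD, smul_smul, ← mul_pow, inv_mul_cancel₀ hmu,
      one_pow, one_smul]
  have hDt : (matD R).transpose * (μ⁻¹ ^ 2 • matC R).transpose = 1 := by
    rw [← Matrix.transpose_mul, mul_eq_one_comm.1 hD, Matrix.transpose_one]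
  obtain ⟨W, hW⟩ : ∃ W, U * W = 1 := by
    refine ⟨((μ * (K r₀ c₀)⁻¹) • (μ⁻¹ ^ 2 • matC R).transpose) * Matrix.of fun j a => K r₀ (j, a), ?_⟩
    rw [mul_eq_one_comm, mul_assoc, hs', smul_mul_smul_comm, mul_eq_one_comm.1 hDt]
    have : μ * (K r₀ c₀)⁻¹ * (μ⁻¹ * K r₀ c₀) = 1 := by field_simp
    rw [this, one_smul]
  refine ⟨fun r => K r c₀, fun c => μ⁻¹ * ((matD R).transpose * W) c.1 c.2, fun r c => ?_⟩
  have : (Matrix.of fun j a => K r (j, a)) = (μ⁻¹ * K r c₀) • ((matD R).transpose * W) := by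
    rw [← smul_mul_assoc, ← hs', mul_assoc, hW, mul_one]
  have := congrFun (congrFun this c.1) c.2
  simp only [Matrix.of_apply, Matrix.smul_apply, smul_eq_mul] at this
  rw [this]; ring

end

end Setup

/-- The R-trace over two legs is cyclic with respect to numerical operators that commute with
`D ⊗ D`. -/
lemma ptr_opR_comm {A : Type} [Ring A] [Algebra ℂ A] {l m : ℕ} (hlm : l ≠ m) (X : Op2 N)
    (Y : Chain N A) : ptr l (ptr m (opR A X l m * Y)) = ptr l (ptr m (Y * opR A X l m)) := by
  simp only [opR, Finset.sum_mul, Finset.mul_sum, map_sum, smul_mul_assoc, mul_smul_comm, map_smul,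
    eU2]
  refine Finset.sum_congr rfl fun p _ => Finset.sum_congr rfl fun r _ => ?_
  congr 1
  rw [mul_assoc, ptr_mul_left (Off.of_eU hlm _ _), ptr_eU_comm l, ptr_eU_comm m,
    ← ptr_mul_right (Off.of_eU hlm _ _), mul_assoc, (eU_comm hlm p.1 r.1 p.2 r.2).eq]

/-- The R-trace over two legs is cyclic with respect to `R`, because `D ⊗ D` commutes with `R`. -/
lemma Setup.E_cyclic {A : Type} [Ring A] [Algebra ℂ A] [NeZero N] (h : Setup R F q μ) {l m : ℕ}
    (hlm : l ≠ m) (Y : Chain N A) : E (matD R) l (E (matD R) m (opR A R l m * Y))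
      = E (matD R) l (E (matD R) m (Y * opR A R l m)) := by
  have e : ∀ Z : Chain N A, E (matD R) l (E (matD R) m Z)
      = ptr l (ptr m (Z * (legOp A (matD R) l * legOp A (matD R) m))) := by
    intro Z
    rw [E_apply, E_apply, ← ptr_mul_right (legOp_off _ hlm), mul_assoc,
      (off_legOp_comm (matD R) (legOp_off (matD R) hlm)).eq]
  rw [e, e, mul_assoc, ptr_opR_comm hlm, mul_assoc, (h.weight_comm hlm).eq, mul_assoc]

end WeightMatrix

/-! ### Copies of the matrix `M` -/

section Words

variable {B : Type*} [Ring B]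

lemma word_add (f : ℕ → B) (j l k : ℕ) : word f j (l + k) = word f j l * word f (j + l) k := by
  induction l generalizing j with
  | zero => simp [word]
  | succ l ih =>
    rw [show l + 1 + k = (l + k) + 1 by omega, word, word, ih, mul_assoc,
      show j + 1 + l = j + (l + 1) by omega]

/-- The word `f_{j+l-1} ⋯ f_{j+1} f_j`. -/
def wordD (f : ℕ → B) (j : ℕ) : ℕ → B
  | 0 => 1
  | l + 1 => wordD f (j + 1) l * f j

lemma wordD_succ (f : ℕ → B) (j l : ℕ) : wordD f j (l + 1) = f (j + l) * wordD f j l := by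
  induction l generalizing j with
  | zero => simp [wordD]
  | succ l ih =>
    rw [wordD, ih, mul_assoc, show j + 1 + l = j + (l + 1) by omega]
    rfl

lemma word_mul_wordD {f g : ℕ → B} (h : ∀ i, f i * g i = 1) (j l : ℕ) :
    word f j l * wordD g j l = 1 := by
  induction l with
  | zero => simp [word, wordD]
  | succ l ih =>
    rw [word_succ, wordD_succ, mul_assoc, ← mul_assoc (f _), h, one_mul, ih]

lemma wordD_mul_word {f g : ℕ → B} (h : ∀ i, f i * g i = 1) (j l : ℕ) :
    wordD f j l * word g j l = 1 := by
  induction l generalizing j with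
  | zero => simp [word, wordD]
  | succ l ih =>
    rw [word, wordD, mul_assoc, ← mul_assoc (f _), h, one_mul, ih]

lemma commute_word {f : ℕ → B} {z : B} {j l : ℕ} (h : ∀ i, j ≤ i → i < j + l → Commute z (f i)) :
    Commute z (word f j l) := by
  induction l generalizing j with
  | zero => exact Commute.one_right _
  | succ l ih =>
    exact (h j le_rfl (by omega)).mul_right (ih fun i h1 h2 => h i (by omega) (by omega))

lemma commute_wordD {f : ℕ → B} {z : B} {j l : ℕ} (h : ∀ i, j ≤ i → i < j + l → Commute z (f i)) :
    Commute z (wordD f j l) := by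
  induction l generalizing j with
  | zero => exact Commute.one_right _
  | succ l ih =>
    exact (ih fun i h1 h2 => h i (by omega) (by omega)).mul_right (h j le_rfl (by omega))

lemma word_intertwine₁ {f : ℕ → B} {z z' : B} {j l i : ℕ} (h1 : j ≤ i) (h2 : i < j + l)
    (h : f i * z = z' * f i) (hz : ∀ k, i < k → Commute z (f k)) (hz' : ∀ k, k < i → Commute z' (f k)) :
    word f j l * z = z' * word f j l := by
  obtain ⟨a, rfl⟩ := Nat.exists_eq_add_of_le h1
  obtain ⟨b, rfl⟩ : ∃ b, l = a + (1 + b) := ⟨l - a - 1, by omega⟩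
  have e1 : Commute z (word f (j + a + 1) b) := commute_word fun i h _ => hz i (by omega)
  have e2 : Commute z' (word f j a) := commute_word fun i _ h => hz' i (by omega)
  rw [word_add, word_add, show word f (j + a) 1 = f (j + a) by simp [word], mul_assoc, mul_assoc,
    ← e1.eq, ← mul_assoc (f _), h, mul_assoc z', ← mul_assoc _ z', ← e2.eq, mul_assoc]

lemma word_intertwine₂ {f : ℕ → B} {z z' : B} {j l i : ℕ} (h1 : j ≤ i) (h2 : i + 1 < j + l)
    (h : f i * f (i + 1) * z = z' * (f i * f (i + 1))) (hz : ∀ k, i + 1 < k → Commute z (f k))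
    (hz' : ∀ k, k < i → Commute z' (f k)) : word f j l * z = z' * word f j l := by
  obtain ⟨a, rfl⟩ := Nat.exists_eq_add_of_le h1
  obtain ⟨b, rfl⟩ : ∃ b, l = a + (2 + b) := ⟨l - a - 2, by omega⟩
  have e1 : Commute z (word f (j + a + 2) b) := commute_word fun i h _ => hz i (by omega)
  have e2 : Commute z' (word f j a) := commute_word fun i _ h => hz' i (by omega)
  rw [word_add, word_add, show word f (j + a) 2 = f (j + a) * f (j + a + 1) by simp [word],
    mul_assoc, mul_assoc, ← e1.eq, ← mul_assoc (f _ * f _), h, mul_assoc z', ← mul_assoc _ z',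
    ← e2.eq, mul_assoc]

end Words

section Families

variable {N : ℕ} {A : Type} [Ring A] [Algebra ℂ A]

/-- Families of operators, indexed by a shift of the legs: the member of index `s` of the family that
stands for a braid `α` is the image of `α^{↑s}`. -/
abbrev Fam (N : ℕ) (A : Type) [Ring A] [Algebra ℂ A] : Type := ℕ → Chain N A

/-- The operator `X` acting in the legs `i`, `i + 1`. -/
abbrev opN (A : Type) [Ring A] [Algebra ℂ A] (X : Op2 N) (i : ℕ) : Chain N A := opR A X i (i + 1)

/-- The family of the operators `R_i` and of their shifts. -/
def gen (A : Type) [Ring A] [Algebra ℂ A] (R : Op2 N) (i : ℕ) : Fam N A := fun s => opN A R (s + i)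

lemma opN_off {X : Op2 N} {i j : ℕ} (h : j < i ∨ i + 1 < j) : Off j (opN A X i) :=
  opR_off (by omega) (by omega) _

lemma opN_comm (X Y : Op2 N) {i j : ℕ} (h : i + 2 ≤ j ∨ j + 2 ≤ i) :
    Commute (opN A X i) (opN A Y j) :=
  off_opR_comm (opN_off (by omega)) (opN_off (by omega)) _

variable {R F : Op2 N} {q μ : ℂ}

lemma Setup.bmwSeq (h : Setup R F q μ) (n : ℕ) : BMWSeq q μ (gen A R) n := by
  have hc : ∀ i, Cubic q μ (gen A R i) := fun i => funext fun s => h.cubic (by omega)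
  refine ⟨fun i _ => hc i, fun i _ => ?_, fun i j hij _ => funext fun s =>
    (opN_comm R R (Or.inl (by omega))).eq⟩
  have hp : ∀ s, BMWPair q μ (opN A R (s + i)) (opN A R (s + (i + 1))) := fun s =>
    h.pair (by omega) (by omega) (by omega)
  exact ⟨hc i, hc (i + 1), funext fun s => (hp s).braid, funext fun s => (hp s).kk₁,
    funext fun s => (hp s).kk₂, funext fun s => (hp s).kk₃, funext fun s => (hp s).kk₄,
    funext fun s => (hp s).kkk₁, funext fun s => (hp s).kkk₂⟩

/-- The shift of a family. -/
def shf (m : ℕ) : Fam N A →ₐ[ℂ] Fam N A where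
  toFun X s := X (s + m)
  map_one' := rfl
  map_mul' _ _ := rfl
  map_zero' := rfl
  map_add' _ _ := rfl
  commutes' _ := rfl

@[simp] lemma shf_apply (m : ℕ) (X : Fam N A) (s : ℕ) : shf m X s = X (s + m) := rfl

lemma shf_gen (m i : ℕ) : shf m (gen A R i) = gen A R (i + m) := by
  funext s
  simp only [shf_apply, gen]
  rw [show s + m + i = s + (i + m) by omega]

lemma shf_shf (m n : ℕ) (X : Fam N A) : shf m (shf n X) = shf (m + n) X := by
  funext s
  simp [add_assoc]

lemma shf_mem {n : ℕ} (m : ℕ) {X : Fam N A} (hX : X ∈ strands (gen A R) n) :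
    shf m X ∈ strands (gen A R) (n + m) := by
  induction hX using Algebra.adjoin_induction with
  | mem x hx => obtain ⟨i, hi, rfl⟩ := hx; rw [shf_gen]; exact gen_mem (by omega)
  | algebraMap c => rw [AlgHom.commutes]; exact Subalgebra.algebraMap_mem _ _
  | add x y _ _ hx hy => rw [map_add]; exact add_mem hx hy
  | mul x y _ _ hx hy => rw [map_mul]; exact mul_mem hx hy

/-- An operator commuting with the generators commutes with all operators on the strands. -/
lemma commute_fam {n s : ℕ} {Z : Chain N A} (h : ∀ i, i + 1 < n → Commute Z (opN A R (s + i)))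
    {X : Fam N A} (hX : X ∈ strands (gen A R) n) : Commute Z (X s) := by
  induction hX using Algebra.adjoin_induction with
  | mem x hx => obtain ⟨i, hi, rfl⟩ := hx; exact h i hi
  | algebraMap c => exact (Algebra.commutes c Z).symm
  | add x y _ _ hx hy => exact hx.add_right hy
  | mul x y _ _ hx hy => exact hx.mul_right hy

lemma fam_off {n s j : ℕ} (h : j < s ∨ s + n ≤ j) {X : Fam N A} (hX : X ∈ strands (gen A R) n) :
    Off j (X s) := fun a b =>
  (commute_fam (Z := eU A j a b) (fun _ _ => (opN_off (by omega) a b).symm) hX).symm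

/-- Operators on disjoint sets of strands commute. -/
lemma shf_comm {n m : ℕ} {X Y : Fam N A} (hX : X ∈ strands (gen A R) n)
    (hY : Y ∈ strands (gen A R) m) : Commute X (shf n Y) := by
  funext s
  exact (commute_fam (fun i _ => (commute_fam (fun j _ => opN_comm R R (by omega)) hX).symm) hY).eq

variable (h : Setup R F q μ)
include h

lemma Setup.R_mul_inv (i : ℕ) : opN A R i * opN A R⁻¹ i = 1 := opR_mul_inv h.isUnit_left (by omega)
lemma Setup.R_inv_mul (i : ℕ) : opN A R⁻¹ i * opN A R i = 1 := opR_inv_mul h.isUnit_left (by omega)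
lemma Setup.F_mul_inv (i : ℕ) : opN A F i * opN A F⁻¹ i = 1 := opR_mul_inv h.isUnit_right (by omega)
lemma Setup.F_inv_mul (i : ℕ) : opN A F⁻¹ i * opN A F i = 1 := opR_inv_mul h.isUnit_right (by omega)

lemma Setup.twist_up (i : ℕ) :
    opN A F i * opN A F (i + 1) * opN A R i = opN A R (i + 1) * (opN A F i * opN A F (i + 1)) := by
  have := opR_rel₁ (A := A) (i := i) (j := i + 1) (k := i + 2) (by omega) (by omega) (by omega)
    h.compat.twist₂.symm
  rw [← mul_assoc]; exact this

lemma Setup.twist_down (i : ℕ) :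
    opN A R i * (opN A F (i + 1) * opN A F i) = opN A F (i + 1) * opN A F i * opN A R (i + 1) := by
  have := opR_rel₁ (A := A) (i := i) (j := i + 1) (k := i + 2) (by omega) (by omega) (by omega)
    h.compat.twist₁
  rw [← mul_assoc]; exact this

lemma Setup.braid_F (i : ℕ) : opN A F i * opN A F (i + 1) * opN A F i
    = opN A F (i + 1) * opN A F i * opN A F (i + 1) :=
  opR_rel₁ (i := i) (j := i + 1) (k := i + 2) (by omega) (by omega) (by omega)
    h.compat.right.yangBaxter

end Families

section Copies

variable {N : ℕ} {A : Type} [Ring A] [Algebra ℂ A] {R F : Op2 N} {q μ : ℂ}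

/-- The transport of an operator from the leg `0` to the leg `a` by conjugation with
`F_{a-1} ⋯ F_1 F_0`. -/
def cj (F : Op2 N) (a : ℕ) : Chain N A →ₗ[ℂ] Chain N A :=
  LinearMap.mulLeft ℂ (wordD (opN A F) 0 a) ∘ₗ LinearMap.mulRight ℂ (word (opN A F⁻¹) 0 a)

lemma cj_apply (F : Op2 N) (a : ℕ) (X : Chain N A) :
    cj F a X = wordD (opN A F) 0 a * X * word (opN A F⁻¹) 0 a := by
  simp [cj, mul_assoc]

@[simp] lemma cj_zero (F : Op2 N) (X : Chain N A) : cj F 0 X = X := by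
  simp [cj_apply, wordD, word]

lemma cj_succ (F : Op2 N) (a : ℕ) (X : Chain N A) :
    cj F (a + 1) X = opN A F a * cj F a X * opN A F⁻¹ a := by
  simp [cj_apply, wordD_succ, word_succ, mul_assoc]

lemma cj_off {a j : ℕ} (hj : a < j) {X : Chain N A} (hX : Off j X) : Off j (cj F a X) := by
  induction a with
  | zero => simpa
  | succ a ih =>
    rw [cj_succ]
    exact ((opN_off (by omega)).mul (ih (by omega))).mul (opN_off (by omega))

lemma num_cst_comm (X : Op2 N) (l m : ℕ) (c : A) : Commute (cst N A c) (opR A X l m) :=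
  off_opR_comm (Off.of_cst c) (Off.of_cst c) X

lemma cj_mul_cst (a : ℕ) (X : Chain N A) (c : A) : cj F a (X * cst N A c) = cj F a X * cst N A c := by
  have : Commute (cst N A c) (word (opN A F⁻¹) 0 a) := commute_word fun _ _ _ => num_cst_comm _ _ _ _
  rw [cj_apply, cj_apply, ← mul_assoc, mul_assoc _ (cst N A c), this.eq, ← mul_assoc]

/-- The copies of the matrix `M`. -/
def Mc (F : Op2 N) (M : Matrix (Fin N) (Fin N) A) (a : ℕ) : Chain N A := cj F a (leg M)

/-- The product of `n` consecutive copies, starting with the copy of index `a`. -/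
def Tp (F : Op2 N) (M : Matrix (Fin N) (Fin N) A) (a : ℕ) : ℕ → Chain N A
  | 0 => 1
  | n + 1 => Tp F M a n * Mc F M (a + n)

variable {M : Matrix (Fin N) (Fin N) A}

lemma Tp_add (a n k : ℕ) : Tp F M a (n + k) = Tp F M a n * Tp F M (a + n) k := by
  induction k with
  | zero => simp [Tp]
  | succ k ih => rw [← add_assoc, Tp, ih, Tp, mul_assoc, add_assoc]

lemma leg_off {j : ℕ} (hj : 0 < j) (X : Matrix (Fin N) (Fin N) A) : Off j (leg X) :=
  Off.sum fun _ _ => Off.sum fun _ _ => (Off.of_cst _).mul (Off.of_eU (by omega) _ _)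

lemma Mc_zero : Mc F M 0 = leg M := cj_zero _ _

lemma Mc_succ (a : ℕ) : Mc F M (a + 1) = opN A F a * Mc F M a * opN A F⁻¹ a := cj_succ _ _ _

lemma Mc_off {a j : ℕ} (hj : a < j) : Off j (Mc F M a) := cj_off hj (leg_off (by omega) M)

lemma Mc_comm {a i : ℕ} (h : a < i) (X : Op2 N) : Commute (Mc F M a) (opN A X i) :=
  off_opR_comm (Mc_off h) (Mc_off (by omega)) X

lemma Tp_off {a n j : ℕ} (hj : a + n ≤ j) : Off j (Tp F M a n) := by
  induction n with
  | zero => exact Off.one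
  | succ n ih => exact (ih (by omega)).mul (Mc_off (by omega))

variable (h : Setup R F q μ)
include h

lemma Setup.Mc_comm_F {a i : ℕ} (hi : i + 2 ≤ a) : Commute (Mc F M a) (opN A F i) := by
  induction a with
  | zero => omega
  | succ a ih =>
    rcases Nat.lt_or_ge a (i + 2) with h1 | h1
    · obtain rfl : a = i + 1 := by omega
      have e : opN A F i * (opN A F (i + 1) * opN A F i) = opN A F (i + 1) * opN A F i * opN A F (i + 1) := by
        rw [← mul_assoc]; exact h.braid_F i
      have e' : opN A F (i + 1) * (opN A F⁻¹ i * opN A F⁻¹ (i + 1))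
          = opN A F⁻¹ i * opN A F⁻¹ (i + 1) * opN A F i := by
        calc _ = (opN A F⁻¹ i * opN A F⁻¹ (i + 1) * opN A F (i + 1) * opN A F i) *
              opN A F (i + 1) * (opN A F⁻¹ i * opN A F⁻¹ (i + 1)) := by
              rw [mul_assoc (opN A F⁻¹ i), h.F_inv_mul, mul_one, h.F_inv_mul, one_mul]
          _ = opN A F⁻¹ i * opN A F⁻¹ (i + 1) * (opN A F i * (opN A F (i + 1) * opN A F i)) *
              (opN A F⁻¹ i * opN A F⁻¹ (i + 1)) := by rw [e]; simp only [mul_assoc]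
          _ = _ := by
              simp only [mul_assoc]
              rw [← mul_assoc (opN A F i) (opN A F⁻¹ i), h.F_mul_inv, one_mul, h.F_mul_inv, mul_one]
      rw [Mc_succ, Mc_succ, commute_iff_eq]
      have c : Commute (Mc F M i) (opN A F (i + 1)) := Mc_comm (by omega) _
      calc _ = opN A F (i + 1) * opN A F i * Mc F M i *
            (opN A F⁻¹ i * opN A F⁻¹ (i + 1) * opN A F i) := by simp only [mul_assoc]
        _ = opN A F (i + 1) * opN A F i * (Mc F M i * opN A F (i + 1)) *
            (opN A F⁻¹ i * opN A F⁻¹ (i + 1)) := by rw [← e']; simp only [mul_assoc]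
        _ = (opN A F (i + 1) * opN A F i * opN A F (i + 1)) * Mc F M i *
            (opN A F⁻¹ i * opN A F⁻¹ (i + 1)) := by rw [c.eq]; simp only [mul_assoc]
        _ = _ := by rw [← e]; simp only [mul_assoc]
    · rw [Mc_succ]
      exact ((opN_comm F F (by omega)).mul_left (ih h1)).mul_left (opN_comm _ F (by omega))

lemma Setup.Mc_comm_R {a i : ℕ} (hi : i + 2 ≤ a) : Commute (Mc F M a) (opN A R i) := by
  induction a with
  | zero => omega
  | succ a ih =>
    rcases Nat.lt_or_ge a (i + 2) with h1 | h1
    · obtain rfl : a = i + 1 := by omega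
      have e := h.twist_down (A := A) i
      have e' : opN A R (i + 1) * (opN A F⁻¹ i * opN A F⁻¹ (i + 1))
          = opN A F⁻¹ i * opN A F⁻¹ (i + 1) * opN A R i := by
        calc _ = opN A F⁻¹ i * opN A F⁻¹ (i + 1) * (opN A F (i + 1) * opN A F i * opN A R (i + 1)) *
              (opN A F⁻¹ i * opN A F⁻¹ (i + 1)) := by
              simp only [← mul_assoc]
              rw [mul_assoc (opN A F⁻¹ i), h.F_inv_mul, mul_one, h.F_inv_mul, one_mul]
          _ = _ := by
              rw [← e]
              simp only [mul_assoc]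
              rw [← mul_assoc (opN A F i) (opN A F⁻¹ i), h.F_mul_inv, one_mul, h.F_mul_inv, mul_one]
      rw [Mc_succ, Mc_succ, commute_iff_eq]
      have c : Commute (Mc F M i) (opN A R (i + 1)) := Mc_comm (by omega) _
      calc _ = opN A F (i + 1) * opN A F i * Mc F M i *
            (opN A F⁻¹ i * opN A F⁻¹ (i + 1) * opN A R i) := by simp only [mul_assoc]
        _ = opN A F (i + 1) * opN A F i * (Mc F M i * opN A R (i + 1)) *
            (opN A F⁻¹ i * opN A F⁻¹ (i + 1)) := by rw [← e']; simp only [mul_assoc]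
        _ = (opN A F (i + 1) * opN A F i * opN A R (i + 1)) * Mc F M i *
            (opN A F⁻¹ i * opN A F⁻¹ (i + 1)) := by rw [c.eq]; simp only [mul_assoc]
        _ = _ := by rw [← e]; simp only [mul_assoc]
    · rw [Mc_succ]
      exact ((opN_comm F R (by omega)).mul_left (ih h1)).mul_left (opN_comm _ R (by omega))

/-- Conjugation with `F_a F_{a+1} ⋯` shifts the copies of `M`. -/
lemma Setup.word_mul_Mc {a l i : ℕ} (h1 : a ≤ i) (h2 : i < a + l) :
    word (opN A F) a l * Mc F M i = Mc F M (i + 1) * word (opN A F) a l := by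
  refine word_intertwine₁ h1 h2 ?_ (fun k hk => Mc_comm hk _) (fun k hk => h.Mc_comm_F (by omega))
  rw [Mc_succ, mul_assoc, h.F_inv_mul, mul_one]

lemma Setup.word_mul_R {a l i : ℕ} (h1 : a ≤ i) (h2 : i + 1 < a + l) :
    word (opN A F) a l * opN A R i = opN A R (i + 1) * word (opN A F) a l :=
  word_intertwine₂ h1 h2 (h.twist_up i) (fun k hk => opN_comm _ _ (by omega))
    (fun k hk => opN_comm _ _ (by omega))

lemma Setup.word_mul_fam {a n : ℕ} {X : Fam N A} (hX : X ∈ strands (gen A R) n) :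
    word (opN A F) a n * X a = X (a + 1) * word (opN A F) a n := by
  induction hX using Algebra.adjoin_induction with
  | mem x hx =>
    obtain ⟨i, hi, rfl⟩ := hx
    have := h.word_mul_R (A := A) (a := a) (l := n) (i := a + i) (by omega) (by omega)
    simp only [gen]
    rwa [show a + 1 + i = a + i + 1 by omega]
  | algebraMap c => exact (Algebra.commutes c _).symm
  | add x y _ _ hx hy => simp only [Pi.add_apply, mul_add, add_mul, hx, hy]
  | mul x y _ _ hx hy => rw [Pi.mul_apply, Pi.mul_apply, ← mul_assoc, hx, mul_assoc, hy, mul_assoc]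

lemma Setup.word_mul_Tp {a n l : ℕ} (hn : n ≤ l) :
    word (opN A F) a l * Tp F M a n = Tp F M (a + 1) n * word (opN A F) a l := by
  induction n with
  | zero => simp [Tp]
  | succ n ih =>
    rw [Tp, Tp, ← mul_assoc, ih (by omega), mul_assoc, h.word_mul_Mc (by omega) (by omega),
      mul_assoc, show a + 1 + n = a + n + 1 by omega]

/-- The conjugation with `F_a F_{a+1} ⋯` under the partial traces. -/
lemma Setup.trs_conj (a n : ℕ) {Y : Chain N A} (hY : Off (a + n + 1) Y) :
    trs (matD R) (a + 1) n (word (opN A F) a (n + 1) * Y * wordD (opN A F⁻¹) a (n + 1))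
      = opN A F a * trs (matD R) a n Y * opN A F⁻¹ a := by
  induction n generalizing Y with
  | zero => simp [word, wordD]
  | succ n ih =>
    rw [trs_succ, trs_succ, word_succ, wordD_succ]
    have e : word (opN A F) a (n + 1) * opN A F (a + (n + 1)) * Y *
        (opN A F⁻¹ (a + (n + 1)) * wordD (opN A F⁻¹) a (n + 1))
        = word (opN A F) a (n + 1) * (opN A F (a + (n + 1)) * Y * opN A F⁻¹ (a + (n + 1))) *
          wordD (opN A F⁻¹) a (n + 1) := by simp only [mul_assoc]
    have o1 : ∀ X : Op2 N, Off (a + 1 + n + 1) (word (opN A X) a (n + 1)) := fun X b c =>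
      (commute_word fun i h1 h2 => (opN_off (by omega) b c).symm).symm
    have o2 : ∀ X : Op2 N, Off (a + 1 + n + 1) (wordD (opN A X) a (n + 1)) := fun X b c =>
      (commute_wordD fun i h1 h2 => (opN_off (by omega) b c).symm).symm
    have hE : E (matD R) (a + 1 + n + 1) (opN A F (a + (n + 1)) * Y * opN A F⁻¹ (a + (n + 1)))
        = E (matD R) (a + n + 1) Y := by
      rw [show a + 1 + n + 1 = a + (n + 1) + 1 by omega]
      exact h.E_conj_left (by omega) hY
    rw [e, E_mul_right _ (o2 _), E_mul_left _ (o1 _), hE]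
    exact ih (E_off _ _ _)

/-- The partial trace over a block of copies is a copy of the partial trace. -/
lemma Setup.trs_shift (a n : ℕ) {X : Fam N A} (hX : X ∈ strands (gen A R) (n + 1)) :
    trs (matD R) a n (Tp F M a (n + 1) * X a)
      = cj F a (trs (matD R) 0 n (Tp F M 0 (n + 1) * X 0)) := by
  induction a with
  | zero => simp
  | succ a ih =>
    rw [cj_succ, ← ih, ← h.trs_conj a n ((Tp_off (by omega)).mul (fam_off (by omega) hX))]
    congr 1
    rw [← mul_assoc, h.word_mul_Tp le_rfl, mul_assoc (Tp F M (a + 1) (n + 1)), h.word_mul_fam hX,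
      mul_assoc, mul_assoc, word_mul_wordD h.F_mul_inv, mul_one]

omit h in
lemma trs_add (D : Matrix (Fin N) (Fin N) ℂ) (s m k : ℕ) (Y : Chain N A) :
    trs D s (m + k) Y = trs D s m (trs D (s + m) k Y) := by
  induction k generalizing Y with
  | zero => rfl
  | succ k ih => rw [← add_assoc, trs_succ, ih, trs_succ, add_assoc s m k]

lemma Setup.E_cj (a : ℕ) {X : Chain N A} (hX : ∀ j, 0 < j → Off j X) :
    E (matD R) a (cj F a X) = E (matD R) 0 X := by
  induction a with
  | zero => simp
  | succ a ih =>
    rw [cj_succ, ← ih]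
    exact h.E_conj_left (by omega) (cj_off (by omega) (hX _ (by omega)))

end Copies

/-! ### The matrices `M^α` and the elements `ch(α)` -/

section Traces

variable {N : ℕ} {A : Type} [Ring A] [Algebra ℂ A] (D : Matrix (Fin N) (Fin N) ℂ)

lemma trs_off_of {s n j : ℕ} {Y : Chain N A} (h : Off j Y) : Off j (trs D s n Y) := by
  induction n generalizing Y with
  | zero => exact h
  | succ n ih => exact ih (E_off_of D h)

lemma trs_off {s n j : ℕ} (h1 : s < j) (h2 : j ≤ s + n) (Y : Chain N A) : Off j (trs D s n Y) := by
  induction n generalizing Y with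
  | zero => omega
  | succ n ih =>
    rw [trs_succ]
    rcases Nat.lt_or_ge j (s + n + 1) with h | h
    · exact ih (by omega) _
    · obtain rfl : j = s + n + 1 := by omega
      exact trs_off_of D (E_off _ _ _)

lemma trs_mul_left {s n : ℕ} {X : Chain N A} (h : ∀ j, s < j → j ≤ s + n → Off j X)
    (Y : Chain N A) : trs D s n (X * Y) = X * trs D s n Y := by
  induction n generalizing Y with
  | zero => rfl
  | succ n ih =>
    rw [trs_succ, trs_succ, E_mul_left D (h _ (by omega) (by omega)),
      ih fun j h1 h2 => h j h1 (by omega)]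

lemma trs_mul_right {s n : ℕ} {X : Chain N A} (h : ∀ j, s < j → j ≤ s + n → Off j X)
    (Y : Chain N A) : trs D s n (Y * X) = trs D s n Y * X := by
  induction n generalizing Y with
  | zero => rfl
  | succ n ih =>
    rw [trs_succ, trs_succ, E_mul_right D (h _ (by omega) (by omega)),
      ih fun j h1 h2 => h j h1 (by omega)]

variable {R F : Op2 N} {q μ : ℂ} [NeZero N] (h : Setup R F q μ)
include h

lemma Setup.trs_cyclic_gen {s n j : ℕ} (h1 : s < j) (h2 : j + 1 ≤ s + n) (Y : Chain N A) :
    trs (matD R) s n (opN A R j * Y) = trs (matD R) s n (Y * opN A R j) := by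
  obtain ⟨a, rfl⟩ : ∃ a, j = s + a + 1 := ⟨j - s - 1, by omega⟩
  obtain ⟨b, rfl⟩ : ∃ b, n = a + 2 + b := ⟨n - a - 2, by omega⟩
  have ho : ∀ j, s + (a + 2) < j → j ≤ s + (a + 2) + b → Off j (opN A R (s + a + 1)) :=
    fun j h1 h2 => opN_off (by omega)
  rw [trs_add _ _ _ b, trs_add _ _ _ b, trs_mul_left _ ho, trs_mul_right _ ho, trs_succ, trs_succ,
    trs_succ, trs_succ]
  congr 1
  exact h.E_cyclic (by omega) _

/-- The partial R-trace over all legs but the first is cyclic for operators acting in these legs. -/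
lemma Setup.trs_cyclic {s n : ℕ} {X : Fam N A} (hX : X ∈ strands (gen A R) n) (Y : Chain N A) :
    trs (matD R) s n (X (s + 1) * Y) = trs (matD R) s n (Y * X (s + 1)) := by
  induction hX using Algebra.adjoin_induction generalizing Y with
  | mem x hx =>
    obtain ⟨i, hi, rfl⟩ := hx
    exact h.trs_cyclic_gen (by omega) (by omega) Y
  | algebraMap c => exact congrArg _ (Algebra.commutes c Y)
  | add x y _ _ hx hy => rw [Pi.add_apply, add_mul, mul_add, map_add, map_add, hx, hy]
  | mul x y _ _ hx hy => rw [Pi.mul_apply, mul_assoc, hx, mul_assoc, hy, mul_assoc]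

/-- Cyclicity of the full R-trace. -/
lemma Setup.E_trs_cyclic {n : ℕ} {X : Fam N A} (hX : X ∈ strands (gen A R) (n + 1)) (Y : Chain N A) :
    E (matD R) 0 (trs (matD R) 0 n (X 0 * Y)) = E (matD R) 0 (trs (matD R) 0 n (Y * X 0)) := by
  induction hX using Algebra.adjoin_induction generalizing Y with
  | mem x hx =>
    obtain ⟨i, hi, rfl⟩ := hx
    simp only [gen, zero_add]
    rcases Nat.eq_zero_or_pos i with rfl | h0
    · obtain ⟨b, rfl⟩ : ∃ b, n = 1 + b := ⟨n - 1, by omega⟩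
      have ho : ∀ j, 0 + 1 < j → j ≤ 0 + 1 + b → Off j (opN A R 0) :=
        fun j h1 h2 => opN_off (by omega)
      rw [trs_add _ _ _ b, trs_add _ _ _ b, trs_mul_left _ ho, trs_mul_right _ ho, trs_succ, trs_succ, trs_zero,
        trs_zero]
      exact h.E_cyclic (by omega) _
    · rw [h.trs_cyclic_gen (by omega) (by omega)]
  | algebraMap c => exact congrArg (fun Z => E (matD R) 0 (trs (matD R) 0 n Z)) (Algebra.commutes c Y)
  | add x y _ _ hx hy =>
    rw [Pi.add_apply, add_mul, mul_add, map_add, map_add, map_add, map_add, hx, hy]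
  | mul x y _ _ hx hy => rw [Pi.mul_apply, mul_assoc, hx, mul_assoc, hy, mul_assoc]

end Traces

section Powers

variable {N : ℕ} {A : Type} [Ring A] [Algebra ℂ A] {R F : Op2 N} {q μ : ℂ}
  {M : Matrix (Fin N) (Fin N) A}

section Relation

variable (h : Setup R F q μ) (hM : Commute (opN A R 0) (Mc F M 0 * Mc F M 1))
include h

lemma Setup.cancel_word {a n : ℕ} {X Y : Chain N A}
    (e : X * word (opN A F) a n = Y * word (opN A F) a n) : X = Y := by
  have := congrArg (· * wordD (opN A F⁻¹) a n) e
  have e := word_mul_wordD (h.F_mul_inv (A := A)) a n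
  simpa only [mul_assoc, e, mul_one] using this

include hM

/-- The defining relation of the quantum matrix algebra, transported to the copies `i`, `i + 1`. -/
lemma Setup.R_comm_MM (i : ℕ) : Commute (opN A R i) (Mc F M i * Mc F M (i + 1)) := by
  induction i with
  | zero => exact hM
  | succ i ih =>
    have h1 := h.word_mul_R (A := A) (a := i) (l := 2) (i := i) le_rfl (by omega)
    have h2 := h.word_mul_Mc (M := M) (a := i) (l := 2) (i := i) le_rfl (by omega)
    have h3 := h.word_mul_Mc (M := M) (a := i) (l := 2) (i := i + 1) (by omega) (by omega)
    have h4 : word (opN A F) i 2 * (Mc F M i * Mc F M (i + 1))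
        = Mc F M (i + 1) * Mc F M (i + 1 + 1) * word (opN A F) i 2 := by
      rw [← mul_assoc, h2, mul_assoc, h3, mul_assoc]
    apply h.cancel_word (a := i) (n := 2)
    rw [mul_assoc, ← h4, ← mul_assoc, ← h1, mul_assoc, ih.eq, ← mul_assoc, h4, mul_assoc, h1,
      ← mul_assoc]

lemma Setup.Tp_comm_R {a n i : ℕ} (h1 : a ≤ i) (h2 : i + 1 < a + n) :
    Commute (Tp F M a n) (opN A R i) := by
  obtain ⟨k, rfl⟩ := Nat.exists_eq_add_of_le h1
  obtain ⟨l, rfl⟩ : ∃ l, n = k + (2 + l) := ⟨n - k - 2, by omega⟩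
  have e1 : Commute (Tp F M a k) (opN A R (a + k)) :=
    off_opR_comm (Tp_off (by omega)) (Tp_off (by omega)) R
  have e2 : Commute (Tp F M (a + k) 2) (opN A R (a + k)) := by
    simpa [Tp] using (h.R_comm_MM hM (a + k)).symm
  have e3 : ∀ l, Commute (Tp F M (a + k + 2) l) (opN A R (a + k)) := by
    intro l
    induction l with
    | zero => exact Commute.one_left _
    | succ l ih => exact ih.mul_left (h.Mc_comm_R (by omega))
  rw [Tp_add, Tp_add]
  exact e1.mul_left (e2.mul_left (e3 l))

lemma Setup.Tp_comm_fam {a n : ℕ} {X : Fam N A} (hX : X ∈ strands (gen A R) n) :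
    Commute (Tp F M a n) (X a) :=
  commute_fam (fun i hi => h.Tp_comm_R hM (by omega) (by omega)) hX

omit hM in
lemma Setup.Tp_comm_before {a n : ℕ} {X : Fam N A} (hX : X ∈ strands (gen A R) a) :
    Commute (Tp F M a n) (X 0) := by
  refine commute_fam (fun i hi => ?_) hX
  induction n with
  | zero => exact Commute.one_left _
  | succ n ih => exact ih.mul_left (h.Mc_comm_R (by omega))

end Relation

variable (R F M) in
/-- The operator in the leg `0` that stands for the matrix `M^α`, for `α` on `n + 1` strands. -/
def mp (n : ℕ) : Fam N A →ₗ[ℂ] Chain N A :=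
  trs (matD R) 0 n ∘ₗ LinearMap.mulLeft ℂ (Tp F M 0 (n + 1)) ∘ₗ LinearMap.proj 0

lemma mp_apply (n : ℕ) (X : Fam N A) :
    mp R F M n X = trs (matD R) 0 n (Tp F M 0 (n + 1) * X 0) := rfl

lemma mp_off {n j : ℕ} (hj : 0 < j) {X : Fam N A} (hX : X ∈ strands (gen A R) (n + 1)) :
    Off j (mp R F M n X) := by
  rcases Nat.lt_or_ge n j with h1 | h1
  · exact trs_off_of _ ((Tp_off (by omega)).mul (fam_off (by omega) hX))
  · exact trs_off _ hj (by omega) _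

variable (R F M) in
/-- The scalar operator `ch(α)`, for `α` on `n + 1` strands. -/
def chf (n : ℕ) : Fam N A →ₗ[ℂ] Chain N A := E (matD R) 0 ∘ₗ mp R F M n

lemma chf_apply (n : ℕ) (X : Fam N A) : chf R F M n X = E (matD R) 0 (mp R F M n X) := rfl

lemma chf_off {n : ℕ} (j : ℕ) {X : Fam N A} (hX : X ∈ strands (gen A R) (n + 1)) :
    Off j (chf R F M n X) := by
  rcases Nat.eq_zero_or_pos j with rfl | hj
  · exact E_off _ _ _
  · exact E_off_of _ (mp_off hj hX)

variable (h : Setup R F q μ)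
include h

/-- The factorization of the product of copies for juxtaposed braids. -/
lemma Setup.Tp_mul_juxt {n m : ℕ} {X : Fam N A} (hX : X ∈ strands (gen A R) (n + 1)) (Y : Fam N A) :
    Tp F M 0 (n + 1 + m + 1) * (X * shf (n + 1) Y) 0
      = Tp F M 0 (n + 1) * X 0 * (Tp F M (n + 1) (m + 1) * Y (n + 1)) := by
  rw [show n + 1 + m + 1 = (n + 1) + (m + 1) by omega, Tp_add, Pi.mul_apply, shf_apply, zero_add]
  have := (h.Tp_comm_before (M := M) (n := m + 1) hX).eq
  rw [mul_assoc, ← mul_assoc _ (X 0), this]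
  simp only [mul_assoc]

/-- The matrix `M^{α β^{↑} γ}` depends on `β` only through `M^β`, if `γ` acts in the strands of `α` and
in the first strand of `β`. -/
lemma Setup.mp_right {n m : ℕ} {X Y Z : Fam N A} (hX : X ∈ strands (gen A R) (n + 1))
    (hY : Y ∈ strands (gen A R) (m + 1)) (hZ : Z ∈ strands (gen A R) (n + 2)) :
    mp R F M (n + 1 + m) (X * shf (n + 1) Y * Z)
      = trs (matD R) 0 (n + 1) (Tp F M 0 (n + 1) * X 0 * cj F (n + 1) (mp R F M m Y) * Z 0) := by
  rw [mp_apply, Pi.mul_apply, ← mul_assoc, h.Tp_mul_juxt hX, trs_add, zero_add,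
    trs_mul_right _ fun j h1 h2 => fam_off (by omega) hZ,
    trs_mul_left _ fun j h1 h2 => (Tp_off (by omega)).mul (fam_off (by omega) hX),
    h.trs_shift _ _ hY, mp_apply]

/-- The mirror image of `mp_right`. -/
lemma Setup.mp_left (hM : Commute (opN A R 0) (Mc F M 0 * Mc F M 1)) {n m : ℕ} {X Y Z : Fam N A}
    (hX : X ∈ strands (gen A R) (n + 1))
    (hY : Y ∈ strands (gen A R) (m + 1)) (hZ : Z ∈ strands (gen A R) (n + 2)) :
    mp R F M (n + 1 + m) (Z * (X * shf (n + 1) Y))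
      = trs (matD R) 0 (n + 1)
          (Z 0 * (Tp F M 0 (n + 1) * X 0 * cj F (n + 1) (mp R F M m Y))) := by
  have hZ' : Z ∈ strands (gen A R) (n + 1 + m + 1) := strands_mono (by omega) hZ
  rw [mp_apply, Pi.mul_apply, ← mul_assoc, (h.Tp_comm_fam hM hZ').eq, mul_assoc, h.Tp_mul_juxt hX,
    trs_add, zero_add, trs_mul_left _ fun j h1 h2 => fam_off (by omega) hZ,
    trs_mul_left _ fun j h1 h2 => (Tp_off (by omega)).mul (fam_off (by omega) hX),
    h.trs_shift _ _ hY, mp_apply]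

/-- `M^{α β^{↑}} = M^α ch(β)`. -/
lemma Setup.mp_juxt {n m : ℕ} {X Y : Fam N A} (hX : X ∈ strands (gen A R) (n + 1))
    (hY : Y ∈ strands (gen A R) (m + 1)) :
    mp R F M (n + 1 + m) (X * shf (n + 1) Y) = mp R F M n X * chf R F M m Y := by
  have := h.mp_right (M := M) hX hY (one_mem _)
  rw [mul_one, Pi.one_apply, mul_one] at this
  rw [this, trs_succ, zero_add,
    E_mul_left _ ((Tp_off (by omega)).mul (fam_off (by omega) hX)),
    h.E_cj _ fun j hj => mp_off hj hY, ← chf_apply, trs_mul_right _ fun j _ _ => chf_off j hY]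
  rfl

/-- `ch(α β^{↑}) = ch(α) ch(β)`; thus the span of the characteristic elements is a subalgebra. -/
lemma Setup.chf_juxt {n m : ℕ} {X Y : Fam N A} (hX : X ∈ strands (gen A R) (n + 1))
    (hY : Y ∈ strands (gen A R) (m + 1)) :
    chf R F M (n + 1 + m) (X * shf (n + 1) Y) = chf R F M n X * chf R F M m Y := by
  rw [chf_apply, h.mp_juxt hX hY, E_mul_right _ (chf_off 0 hY)]
  rfl

variable [NeZero N] (hM : Commute (opN A R 0) (Mc F M 0 * Mc F M 1))
include hM

/-- `M^{xα} = M^{αx}` if `x` does not involve the first strand. -/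
lemma Setup.mp_cyclic {n : ℕ} {X : Fam N A} (hX : X ∈ strands (gen A R) n) (Y : Fam N A) :
    mp R F M n (shf 1 X * Y) = mp R F M n (Y * shf 1 X) := by
  have hX' : shf 1 X ∈ strands (gen A R) (n + 1) := shf_mem 1 hX
  rw [mp_apply, mp_apply, Pi.mul_apply, ← mul_assoc, (h.Tp_comm_fam hM hX').eq, mul_assoc,
    Pi.mul_apply, ← mul_assoc (Tp F M 0 (n + 1))]
  exact h.trs_cyclic hX _

lemma Setup.chf_cyclic {n : ℕ} {X : Fam N A} (hX : X ∈ strands (gen A R) (n + 1)) (Y : Fam N A) :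
    chf R F M n (X * Y) = chf R F M n (Y * X) := by
  rw [chf_apply, chf_apply, mp_apply, mp_apply, Pi.mul_apply, ← mul_assoc, (h.Tp_comm_fam hM hX).eq,
    mul_assoc, Pi.mul_apply, ← mul_assoc (Tp F M 0 (n + 1))]
  exact h.E_trs_cyclic hX _

end Powers

/-! ### From braids on finitely many strands to the chain, and the contraction `g` -/

section Link

variable {N : ℕ} {A : Type} [Ring A] [Algebra ℂ A] {R F : Op2 N} {q μ : ℂ}
  {M : Matrix (Fin N) (Fin N) A}

/-- The family of the shifts of an operator on `V^{⊗(n+1)}`. -/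
def famHom (A : Type) [Ring A] [Algebra ℂ A] (n : ℕ) : OpN N (n + 1) →ₐ[ℂ] Fam N A :=
  AlgHom.pi fun s => num (ofs_injective s (n + 1)) A

lemma famHom_apply (n : ℕ) (X : OpN N (n + 1)) (s : ℕ) :
    famHom A n X s = num (ofs_injective s (n + 1)) A X := rfl

lemma famHom_zero (n : ℕ) (X : OpN N (n + 1)) :
    famHom A n X 0 = emb (ofs 0 (n + 1)) (scal A X) := rfl

lemma famHom_opAt (X : Op2 N) {n i : ℕ} (hi : i < n) :
    famHom A n (opAt (n + 1) X i) = gen A X i := by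
  funext s
  exact num_opAt (ofs_injective s (n + 1)) X (by omega) rfl rfl

lemma emb_mul_const {n : ℕ} (φ : Fin n → ℕ) (X : Matrix (Fin n → Fin N) (Fin n → Fin N) A) (c : A) :
    emb φ (X.map fun x => x * c) = emb φ X * cst N A c := by
  ext f x
  simp [emb_apply, mul_assoc]

variable [NeZero N]

lemma emb_copy (hF : IsUnit F) {n i : ℕ} (hi : i ≤ n) :
    emb (ofs 0 (n + 1)) (copy F M n i) = Mc F M i := by
  induction i with
  | zero => rw [emb_copy_zero, Mc_zero]
  | succ i ih =>
    have h0 : ∀ X : Op2 N, emb (ofs 0 (n + 1)) (scal A (opAt (n + 1) X i)) = opN A X i := by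
      intro X
      have := congrFun (famHom_opAt (A := A) X (show i < n by omega)) 0
      rw [famHom_zero] at this
      rw [this, gen, zero_add]
    rw [copy, opAt_inv hF (by omega), emb_mul (ofs_injective _ _), emb_mul (ofs_injective _ _),
      ih (by omega), h0, h0, Mc_succ]

lemma emb_copyProd (hF : IsUnit F) (n : ℕ) :
    emb (ofs 0 (n + 1)) (copyProd F M n) = Tp F M 0 (n + 1) := by
  let φ : Matrix (Fin (n + 1) → Fin N) (Fin (n + 1) → Fin N) A →* Chain N A :=
    { toFun := emb (ofs 0 (n + 1))
      map_one' := emb_one (ofs_injective _ _)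
      map_mul' := emb_mul (ofs_injective _ _) }
  have h1 : emb (ofs 0 (n + 1)) (copyProd F M n)
      = (List.ofFn fun i : Fin (n + 1) => Mc F M i).prod := by
    change φ _ = _
    rw [copyProd, map_list_prod, List.map_ofFn]
    congr 2
    funext i
    exact emb_copy hF (by omega)
  have h2 : ∀ k, (List.ofFn fun i : Fin k => Mc F M i).prod = Tp F M 0 k := by
    intro k
    induction k with
    | zero => simp [Tp]
    | succ k ih =>
      rw [List.ofFn_succ', List.concat_eq_append, List.prod_append, Tp, zero_add, ← ih]
      simp
  rw [h1, h2]

lemma leg_tail (hF : IsUnit F) (n : ℕ) (α : OpN N (n + 1)) :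
    leg (traceTail (matD R) (copyProd F M n * scal A α)) = mp R F M n (famHom A n α) := by
  rw [leg_traceTail, emb_mul (ofs_injective _ _), emb_copyProd hF, mp_apply, famHom_zero]

lemma cst_all (hF : IsUnit F) (n : ℕ) (α : OpN N (n + 1)) :
    cst N A (traceAll (matD R) (copyProd F M n * scal A α)) = chf R F M n (famHom A n α) := by
  rw [cst_traceAll, emb_mul (ofs_injective _ _), emb_copyProd hF, chf_apply, mp_apply, famHom_zero]

variable (h : Setup R F q μ)
include h

omit [NeZero N] in
lemma Setup.gen_inv (i : ℕ) : gen A R⁻¹ i = inv' q μ (gen A R i) :=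
  funext fun s => h.opR_inv (by omega)

lemma Setup.famHom_mem {n : ℕ} {α : OpN N (n + 1)} (hα : α ∈ braidImage R n) :
    famHom A n α ∈ strands (gen A R) (n + 1) := by
  induction hα using Algebra.adjoin_induction with
  | mem x hx =>
    obtain ⟨i, hi, rfl | rfl⟩ := hx
    · rw [famHom_opAt R hi]; exact gen_mem (by omega)
    · rw [opAt_inv h.isUnit_left (by omega), famHom_opAt _ hi, h.gen_inv]
      exact inv'_mem_of (gen_mem (by omega))
  | algebraMap c => rw [AlgHom.commutes]; exact Subalgebra.algebraMap_mem _ _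
  | add x y _ _ hx hy => rw [map_add]; exact add_mem hx hy
  | mul x y _ _ hx hy => rw [map_mul]; exact mul_mem hx hy

omit h [NeZero N] in
lemma exists_famHom {n : ℕ} {X : Fam N A} (hX : X ∈ strands (gen A R) (n + 1)) :
    ∃ α ∈ braidImage R n, famHom A n α = X := by
  induction hX using Algebra.adjoin_induction with
  | mem x hx =>
    obtain ⟨i, hi, rfl⟩ := hx
    exact ⟨_, opAt_mem R (by omega), famHom_opAt R (by omega)⟩
  | algebraMap c => exact ⟨_, Subalgebra.algebraMap_mem _ c, AlgHom.commutes _ c⟩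
  | add x y _ _ hx hy =>
    obtain ⟨a, ha, rfl⟩ := hx
    obtain ⟨b, hb, rfl⟩ := hy
    exact ⟨a + b, add_mem ha hb, map_add _ _ _⟩
  | mul x y _ _ hx hy =>
    obtain ⟨a, ha, rfl⟩ := hx
    obtain ⟨b, hb, rfl⟩ := hy
    exact ⟨a * b, mul_mem ha hb, map_mul _ _ _⟩

end Link

section Contraction

variable {N : ℕ} {A : Type} [Ring A] [Algebra ℂ A] {R F : Op2 N} {q μ : ℂ}
  {M : Matrix (Fin N) (Fin N) A} [NeZero N]

omit [NeZero N] in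
/-- The sandwich of an operator with entries in `A` between two copies of an operator of rank one. -/
lemma rank_one_sandwich {K : Op2 N} {u v : Fin N × Fin N → ℂ} (hK : ∀ r c, K r c = u r * v c)
    (Y : Matrix (Fin 2 → Fin N) (Fin 2 → Fin N) A) :
    ∃ c : A, opN A K 0 * emb (ofs 0 2) Y * opN A K 0 = opN A K 0 * cst N A c := by
  have e : opN A K 0 = emb (ofs 0 2) (scal A (opAt 2 K 0)) := by
    rw [emb_scal_opAt (ofs_injective 0 2) K (by omega)]
    rfl
  have hent : ∀ x y : Fin 2 → Fin N, opAt 2 K 0 x y = u (x 0, x 1) * v (y 0, y 1) := by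
    intro x y
    have hl : ∀ l : Fin 2, (l : ℕ) ≠ 0 → (l : ℕ) ≠ 0 + 1 → x l = y l := by
      intro l h0 h1; omega
    simp only [opAt, Matrix.of_apply]
    rw [dif_pos (by omega), if_pos hl, hK]
    rfl
  refine ⟨∑ p, ∑ r, (v (p 0, p 1) * u (r 0, r 1)) • Y p r, ?_⟩
  rw [e, ← emb_mul (ofs_injective _ _), ← emb_mul (ofs_injective _ _), ← emb_mul_const]
  congr 1
  ext x y
  simp only [Matrix.mul_apply, scal, Matrix.map_apply, hent, Finset.sum_mul, Finset.mul_sum]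
  rw [Finset.sum_comm]
  refine Finset.sum_congr rfl fun p _ => Finset.sum_congr rfl fun r _ => ?_
  simp only [Algebra.algebraMap_eq_smul_one, smul_mul_assoc, one_mul, mul_smul_comm, mul_one,
    smul_smul]
  congr 1
  ring

variable (h : Setup R F q μ) (hM : Commute (opN A R 0) (Mc F M 0 * Mc F M 1))
include h hM

/-- `M_{\bar i} M_{\overline{i+1}} κ_i` is a scalar multiple of `κ_i`: `κ` commutes with the product of the
two copies, and the rank-one sandwich of this product is scalar. -/
lemma Setup.exists_contr : ∃ c : A, ∀ i, Mc F M i * Mc F M (i + 1) * kap q μ (opN A R i)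
    = kap q μ (opN A R i) * cst N A c := by
  obtain ⟨u, v, hK⟩ := h.exists_kap_eq
  obtain ⟨c, hc⟩ := rank_one_sandwich (A := A) hK (copyProd F M 1)
  rw [emb_copyProd h.isUnit_right, opN, opR_kap _ _ _ (by omega)] at hc
  have h0 : Tp F M 0 (1 + 1) = Mc F M 0 * Mc F M 1 := by simp [Tp]
  rw [h0] at hc
  refine ⟨(eta q μ)⁻¹ • c, fun i => ?_⟩
  induction i with
  | zero =>
    have hk : Commute (kap q μ (opN A R 0)) (Mc F M 0 * Mc F M 1) := kap_comm hM
    rw [hk.eq, mul_assoc, kap_mul_kap h.params (h.cubic (by omega)), mul_smul_comm] at hc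
    rw [map_smul, mul_smul_comm, ← hc, smul_smul, inv_mul_cancel₀ (eta_ne h.params), one_smul]
  | succ i ih =>
    -- The relation for the legs `i`, `i + 1` is shifted to the next legs by conjugation with `F_i F_{i+1}`.
    have h1 : word (opN A F) i 2 * kap q μ (opN A R i) = kap q μ (opN A R (i + 1)) * word (opN A F) i 2 :=
      kap_intertwine (h.word_mul_R (A := A) (a := i) (l := 2) (i := i) le_rfl (by omega))
    have h2 := h.word_mul_Mc (M := M) (a := i) (l := 2) (i := i) le_rfl (by omega)
    have h3 := h.word_mul_Mc (M := M) (a := i) (l := 2) (i := i + 1) (by omega) (by omega)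
    have hc : Commute (cst N A ((eta q μ)⁻¹ • c)) (word (opN A F) i 2) :=
      commute_word fun _ _ _ => num_cst_comm _ _ _ _
    apply h.cancel_word (a := i) (n := 2)
    calc _ = Mc F M (i + 1) * Mc F M (i + 1 + 1) * (word (opN A F) i 2 * kap q μ (opN A R i)) := by
          rw [h1]; simp only [mul_assoc]
      _ = word (opN A F) i 2 * (Mc F M i * Mc F M (i + 1) * kap q μ (opN A R i)) := by
          simp only [mul_assoc]
          rw [← mul_assoc (Mc F M (i + 1 + 1)), ← h3, ← mul_assoc (word _ _ _), h2]
          simp only [mul_assoc]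
      _ = _ := by
          rw [ih, ← mul_assoc, h1, mul_assoc, mul_assoc, hc.eq]

variable (R F M q μ) in
omit [NeZero N] h hM in
/-- The scalar operator of the contraction `g`. -/
def Gc : Chain N A := (eta q μ)⁻¹ • chf R F M 1 (kap q μ (gen A R 0))

/-- The scalar of `exists_contr` is `μ⁻² g`, and `M^{κ₁} = μ⁻¹ g I`. -/
lemma Setup.mp_kap_aux : ∃ c : A, Gc R F q μ M = cst N A c ∧
    (∀ i, Mc F M i * Mc F M (i + 1) * kap q μ (opN A R i) = (μ⁻¹ ^ 2) • (kap q μ (opN A R i) * cst N A c))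
    ∧ mp R F M 1 (kap q μ (gen A R 0)) = μ⁻¹ • cst N A c := by
  obtain ⟨c, hc⟩ := h.exists_contr hM
  have hmu := h.params.mu_ne
  have e1 : mp R F M 1 (kap q μ (gen A R 0)) = μ • cst N A c := by
    have e : kap q μ (gen A R 0) 0 = kap q μ (opN A R 0) := rfl
    rw [mp_apply, trs_succ, trs_zero, e]
    have : Tp F M 0 (1 + 1) = Mc F M 0 * Mc F M (0 + 1) := by simp [Tp]
    rw [this, hc, E_mul_right _ (Off.of_cst c), zero_add, zero_add, h.E_kap (by omega),
      smul_mul_assoc, one_mul]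
  have e2 : Gc R F q μ M = cst N A (μ ^ 2 • c) := by
    rw [Gc, chf_apply, e1, map_smul, ← one_mul (cst N A c), E_mul_right _ (Off.of_cst c), E_one,
      h.trace_weight, smul_mul_assoc, one_mul, smul_smul, smul_smul, ← map_smul]
    congr 2
    have := eta_ne h.params
    field_simp
  refine ⟨μ ^ 2 • c, e2, fun i => ?_, ?_⟩
  · rw [hc, map_smul, mul_smul_comm, smul_smul, ← mul_pow, inv_mul_cancel₀ hmu, one_pow, one_smul]
  · rw [e1, map_smul, smul_smul]
    congr 1
    field_simp

lemma Setup.mp_kap : mp R F M 1 (kap q μ (gen A R 0)) = μ⁻¹ • Gc R F q μ M := by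
  obtain ⟨c, h1, -, h2⟩ := h.mp_kap_aux hM
  rw [h1, h2]

end Contraction

section Generators

variable {N : ℕ} {R F : Op2 N} {q μ : ℂ}

lemma copy_map {A B : Type} [Ring A] [Algebra ℂ A] [Ring B] [Algebra ℂ B] (f : A →ₐ[ℂ] B)
    (F : Op2 N) (M : Matrix (Fin N) (Fin N) A) (n i : ℕ) :
    (copy F M n i).map f = copy F (M.map f) n i := by
  induction i with
  | zero =>
    ext x y
    simp only [copy, Matrix.map_apply, Matrix.of_apply]
    split_ifs <;> simp
  | succ i ih =>
    have hs : ∀ X : OpN N (n + 1), (scal A X).map f = scal B X := by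
      intro X; ext x y; simp [scal]
    rw [copy, copy, ← ih, ← hs, ← hs, ← Matrix.map_mul, ← Matrix.map_mul]

lemma Setup.gen_rel [NeZero N] (h : Setup R F q μ) : Commute (opN (QMA R F) R 0)
    (Mc F (genMat R F) 0 * Mc F (genMat R F) 1) := by
  have hs : ∀ X : OpN N 2, (scal (FreeAlgebra ℂ (Fin N × Fin N)) X).map (QMA.mk R F)
      = scal (QMA R F) X := by
    intro X; ext x y; simp [scal]
  have h1 : scal (QMA R F) (opAt 2 R 0) * (copy F (genMat R F) 1 0 * copy F (genMat R F) 1 1)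
      = copy F (genMat R F) 1 0 * copy F (genMat R F) 1 1 * scal (QMA R F) (opAt 2 R 0) := by
    rw [genMat, ← copy_map, ← copy_map, ← hs, ← Matrix.map_mul, ← Matrix.map_mul, ← Matrix.map_mul]
    ext x y
    exact RingQuot.mkAlgHom_rel ℂ (QMRel.entry x y)
  have h2 := congrArg (emb (ofs 0 2)) h1
  have e := congrFun (famHom_opAt (A := QMA R F) R (show 0 < 1 by omega)) 0
  rw [famHom_zero] at e
  simp only [emb_mul (ofs_injective 0 2), emb_copy h.isUnit_right (show 0 ≤ 1 by omega),
    emb_copy h.isUnit_right (show 1 ≤ 1 by omega)] at h2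
  exact (congrArg (· * _) e).symm.trans (h2.trans (congrArg (_ * ·) e))

end Generators

/-! ### Braids that exchange blocks of strands -/

section Braids

variable {B : Type*} [Ring B]

/-- A sequence of invertible elements satisfying the braid relations; `r'` is the sequence of their
inverses. -/
structure BraidSeq (r r' : ℕ → B) : Prop where
  mul_inv : ∀ i, r i * r' i = 1
  inv_mul : ∀ i, r' i * r i = 1
  braid : ∀ i, r i * r (i + 1) * r i = r (i + 1) * r i * r (i + 1)
  comm : ∀ i j, i + 2 ≤ j → Commute (r i) (r j)

variable {r r' : ℕ → B}

lemma commute_inv {x y z : B} (hyz : y * z = 1) (hzy : z * y = 1) (h : Commute x y) : Commute x z := by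
  calc x * z = z * y * x * z := by rw [hzy, one_mul]
    _ = z * (x * y) * z := by rw [h.eq]; simp only [mul_assoc]
    _ = z * x := by rw [mul_assoc, mul_assoc, hyz, mul_one]

lemma BraidSeq.comm' (hb : BraidSeq r r') {i j : ℕ} (h : i + 2 ≤ j ∨ j + 2 ≤ i) :
    Commute (r i) (r j) := by
  rcases h with h | h
  · exact hb.comm i j h
  · exact (hb.comm j i h).symm

lemma BraidSeq.comm_inv (hb : BraidSeq r r') {i j : ℕ} (h : i + 2 ≤ j ∨ j + 2 ≤ i) :
    Commute (r i) (r' j) := commute_inv (hb.mul_inv j) (hb.inv_mul j) (hb.comm' h)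

lemma wordD_add (f : ℕ → B) (j l k : ℕ) :
    wordD f j (l + k) = wordD f (j + l) k * wordD f j l := by
  induction l generalizing j with
  | zero => simp [wordD]
  | succ l ih =>
    rw [show l + 1 + k = (l + k) + 1 by omega, wordD, wordD, ih, mul_assoc,
      show j + 1 + l = j + (l + 1) by omega]

lemma wordD_intertwine {f : ℕ → B} {z z' : B} {j l i : ℕ} (h1 : j ≤ i) (h2 : i + 1 < j + l)
    (h : f (i + 1) * f i * z = z' * (f (i + 1) * f i)) (hz : ∀ k, k < i → Commute z (f k))
    (hz' : ∀ k, i + 1 < k → Commute z' (f k)) : wordD f j l * z = z' * wordD f j l := by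
  obtain ⟨a, rfl⟩ := Nat.exists_eq_add_of_le h1
  obtain ⟨b, rfl⟩ : ∃ b, l = a + (2 + b) := ⟨l - a - 2, by omega⟩
  have e1 : Commute z (wordD f j a) := commute_wordD fun i _ h => hz i (by omega)
  have e2 : Commute z' (wordD f (j + a + 2) b) := commute_wordD fun i h _ => hz' i (by omega)
  have e3 : wordD f (j + a) 2 = f (j + a + 1) * f (j + a) := by simp [wordD]
  rw [wordD_add, wordD_add, e3, mul_assoc, ← e1.eq]
  calc _ = wordD f (j + a + 2) b * (f (j + a + 1) * f (j + a) * z) * wordD f j a := by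
        simp only [mul_assoc]
    _ = _ := by
        rw [h, ← mul_assoc, ← e2.eq]; simp only [mul_assoc]

/-- The positive braid in which `m` strands pass `n` strands; the numbering of the generators starts
with `o`. -/
def grid (r : ℕ → B) (o n : ℕ) : ℕ → B
  | 0 => 1
  | m + 1 => grid r o n m * wordD r (o + m) n

lemma grid_succ_left (o n m : ℕ) : grid r o n (m + 1) = wordD r o n * grid r (o + 1) n m := by
  induction m with
  | zero => simp [grid]
  | succ m ih => rw [grid, ih, grid, mul_assoc, show o + 1 + m = o + (m + 1) by omega]

variable (hb : BraidSeq r r')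
include hb

lemma BraidSeq.grid_succ (o n m : ℕ) :
    grid r o (n + 1) m = grid r (o + 1) n m * word r o m := by
  induction m with
  | zero => simp [grid, word]
  | succ m ih =>
    have hc : Commute (word r o m) (wordD r (o + m + 1) n) :=
      commute_wordD fun i h1 h2 => (commute_word fun k h3 h4 => hb.comm' (by omega)).symm
    rw [grid, ih, wordD, word_succ, grid, mul_assoc, ← mul_assoc (word r o m), hc.eq,
      show o + 1 + m = o + m + 1 by omega]
    simp only [mul_assoc]

lemma BraidSeq.wordD_mul_gen {j n i : ℕ} (h1 : j ≤ i) (h2 : i + 1 < j + n) :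
    wordD r j n * r (i + 1) = r i * wordD r j n :=
  wordD_intertwine h1 h2 (by rw [← hb.braid]; simp only [mul_assoc]) (fun k hk => hb.comm' (by omega))
    (fun k hk => hb.comm' (by omega))

lemma BraidSeq.grid_mul_gen {n m i : ℕ} (hi : i + 1 < n) :
    grid r 0 n m * r (i + m) = r i * grid r 0 n m := by
  induction m with
  | zero => simp [grid]
  | succ m ih =>
    rw [grid, mul_assoc, ← add_assoc, hb.wordD_mul_gen (by omega) (by omega), ← mul_assoc, ih,
      mul_assoc]

lemma BraidSeq.wordD_mul_wordD_gen (i n : ℕ) :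
    wordD r i n * wordD r (i + 1) n * r i = r (n + i) * (wordD r i n * wordD r (i + 1) n) := by
  induction n with
  | zero => simp [wordD]
  | succ n ih =>
    have hc : Commute (wordD r i n) (r (i + 1 + n)) :=
      (commute_wordD fun k h1 h2 => hb.comm' (by omega)).symm
    have e : r (i + n) * r (i + 1 + n) * r (n + i) = r (n + 1 + i) * r (i + n) * r (i + 1 + n) := by
      have := hb.braid (i + n)
      rwa [show n + i = i + n by omega, show i + 1 + n = i + n + 1 by omega,
        show n + 1 + i = i + n + 1 by omega]
    rw [wordD_succ, wordD_succ]
    calc _ = r (i + n) * (wordD r i n * r (i + 1 + n)) * wordD r (i + 1) n * r i := by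
          simp only [mul_assoc]
      _ = r (i + n) * r (i + 1 + n) * (wordD r i n * wordD r (i + 1) n * r i) := by
          rw [hc.eq]; simp only [mul_assoc]
      _ = r (n + 1 + i) * r (i + n) * (r (i + 1 + n) * wordD r i n) * wordD r (i + 1) n := by
          rw [ih, ← mul_assoc, e]; simp only [mul_assoc]
      _ = _ := by rw [← hc.eq]; simp only [mul_assoc]

lemma BraidSeq.grid_mul_gen' {n m i : ℕ} (hi : i + 1 < m) :
    grid r 0 n m * r i = r (n + i) * grid r 0 n m := by
  obtain ⟨k, rfl⟩ : ∃ k, m = i + 2 + k := ⟨m - i - 2, by omega⟩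
  clear hi
  induction k with
  | zero =>
    have hc : Commute (grid r 0 n i) (r (n + i)) := by
      have : ∀ j, j ≤ i → Commute (grid r 0 n j) (r (n + i)) := by
        intro j
        induction j with
        | zero => exact fun _ => Commute.one_left _
        | succ j ih =>
          exact fun hj => (ih (by omega)).mul_left
            (commute_wordD fun k h1 h2 => hb.comm' (by omega)).symm
      exact this i le_rfl
    have e := hb.wordD_mul_wordD_gen i n
    rw [add_zero, grid, grid, zero_add, zero_add]
    calc _ = grid r 0 n i * (wordD r i n * wordD r (i + 1) n * r i) := by simp only [mul_assoc]
      _ = _ := by rw [e, ← mul_assoc, hc.eq]; simp only [mul_assoc]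
  | succ k ih =>
    have hc : Commute (r i) (wordD r (0 + (i + 2 + k)) n) :=
      commute_wordD fun k h1 h2 => hb.comm' (by omega)
    rw [← add_assoc, grid, mul_assoc, ← hc.eq, ← mul_assoc, ih, mul_assoc]

omit hb in
variable (r r') in
/-- The pure braid `r_n ⋯ r_1 r_0 r_1⁻¹ ⋯ r_n⁻¹`. -/
def pureR (n : ℕ) : B := wordD r 0 (n + 1) * word r' 1 n

omit hb in
variable (r r') in
/-- The pure braid `r_n⁻¹ ⋯ r_1⁻¹ r_0 r_1 ⋯ r_n`. -/
def pureL (n : ℕ) : B := wordD r' 1 n * r 0 * word r 1 n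

omit hb in
lemma pureR_zero : pureR r r' 0 = r 0 := by simp [pureR, wordD, word]

omit hb in
lemma pureL_zero : pureL r r' 0 = r 0 := by simp [pureL, wordD, word]

omit hb in
lemma pureR_succ (n : ℕ) : pureR r r' (n + 1) = r (n + 1) * pureR r r' n * r' (n + 1) := by
  rw [pureR, wordD_succ, word_succ, pureR, add_comm 1 n, zero_add]
  simp only [mul_assoc]

omit hb in
lemma pureL_succ (n : ℕ) : pureL r r' (n + 1) = r' (n + 1) * pureL r r' n * r (n + 1) := by
  rw [pureL, wordD_succ, word_succ, pureL, add_comm 1 n]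
  simp only [mul_assoc]

/-- The braid `w = grid r 1 n (m + 1) · word r 1 m` satisfies `pureR · w = grid = w · pureL`, so that it
conjugates the two pure braids into each other. -/
lemma BraidSeq.pureR_mul (n m : ℕ) :
    pureR r r' n * (grid r 1 n (m + 1) * word r 1 m) = grid r 0 (n + 1) (m + 1) := by
  rw [grid_succ_left, grid_succ_left, hb.grid_succ, pureR]
  have : word r' 1 n * wordD r 1 n = 1 := word_mul_wordD hb.inv_mul 1 n
  calc _ = wordD r 0 (n + 1) * (word r' 1 n * wordD r 1 n) * (grid r (1 + 1) n m * word r 1 m) := by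
        simp only [mul_assoc]
    _ = _ := by rw [this, mul_one]

lemma BraidSeq.mul_pureL (n m : ℕ) :
    grid r 1 n (m + 1) * word r 1 m * pureL r r' m = grid r 0 (n + 1) (m + 1) := by
  rw [hb.grid_succ, pureL]
  have : word r 1 m * wordD r' 1 m = 1 := word_mul_wordD hb.mul_inv 1 m
  calc _ = grid r 1 n (m + 1) * (word r 1 m * wordD r' 1 m) * (r 0 * word r 1 m) := by
        simp only [mul_assoc]
    _ = _ := by rw [this, mul_one]; rfl

lemma BraidSeq.pureR_comm {n j : ℕ} (hj : n + 2 ≤ j) : Commute (pureR r r' n) (r j) :=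
  ((commute_wordD fun i h1 h2 => hb.comm' (by omega)).symm).mul_left
    ((commute_word fun i h1 h2 => hb.comm_inv (by omega)).symm)

/-- The pure braids satisfy a braid relation with the next generator. -/
lemma BraidSeq.pureR_braid (n : ℕ) :
    pureR r r' n * r (n + 1) * pureR r r' n = r (n + 1) * pureR r r' n * r (n + 1) := by
  induction n with
  | zero => rw [pureR_zero]; exact hb.braid 0
  | succ n ih =>
    set a := pureR r r' n with ha
    have hac : Commute a (r (n + 1 + 1)) := hb.pureR_comm (by omega)
    have hbc := hb.braid (n + 1)
    set b := r (n + 1)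
    set c := r (n + 1 + 1)
    set b' := r' (n + 1)
    have h1 : b * b' = 1 := hb.mul_inv _
    have h2 : b' * b = 1 := hb.inv_mul _
    rw [pureR_succ]
    change b * a * b' * c * (b * a * b') = c * (b * a * b') * c
    -- both sides are multiplied by `a` from the left and by `b` from the right
    obtain ⟨a', ha1, ha2⟩ : ∃ a', a * a' = 1 ∧ a' * a = 1 := by
      refine ⟨wordD r 1 n * word r' 0 (n + 1), ?_, ?_⟩
      · rw [ha, pureR]
        calc _ = wordD r 0 (n + 1) * (word r' 1 n * wordD r 1 n) * word r' 0 (n + 1) := by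
              simp only [mul_assoc]
          _ = 1 := by
              rw [word_mul_wordD hb.inv_mul, mul_one, wordD_mul_word hb.mul_inv]
      · rw [ha, pureR]
        calc _ = wordD r 1 n * (word r' 0 (n + 1) * wordD r 0 (n + 1)) * word r' 1 n := by
              simp only [mul_assoc]
          _ = 1 := by
              rw [word_mul_wordD hb.inv_mul, mul_one, wordD_mul_word hb.mul_inv]
    have e : b * a * b' = a' * b * a := by
      calc b * a * b' = a' * (a * b * a) * b' := by
            simp only [← mul_assoc]; rw [ha2, one_mul]
        _ = a' * b * a * (b * b') := by rw [ih]; simp only [mul_assoc]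
        _ = _ := by rw [h1, mul_one]
    have hac' : Commute a' c := (commute_inv ha1 ha2 hac.symm).symm
    calc b * a * b' * c * (b * a * b') = a' * b * (a * c) * (a' * b * a) := by
          rw [e]; simp only [mul_assoc]
      _ = a' * (b * c * b) * a := by
          rw [hac.eq, mul_assoc, mul_assoc, mul_assoc c, ← mul_assoc a, ← mul_assoc a, ha1, one_mul]
          simp only [mul_assoc]
      _ = (a' * c) * b * (c * a) := by rw [hbc]; simp only [mul_assoc]
      _ = _ := by rw [hac'.eq, ← hac.eq, e]; simp only [mul_assoc]

/-- The relation between the pure braids that underlies the associativity of the `⋆`-product. -/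
lemma BraidSeq.pureR_mul_pureR (n m : ℕ) :
    pureR r r' n * pureR r r' (n + m + 1)
      = pureR (fun i => r (n + 1 + i)) (fun i => r' (n + 1 + i)) m * pureR r r' n := by
  have key : ∀ m, pureR r r' (n + m + 1) = wordD r (n + 2) m * (r (n + 1) * pureR r r' n * r' (n + 1)) *
      word r' (n + 2) m := by
    intro m
    induction m with
    | zero => simp [wordD, word, pureR_succ]
    | succ m ih =>
      rw [← add_assoc, pureR_succ, ih, wordD_succ, word_succ, show n + 2 + m = n + m + 1 + 1 by omega]
      simp only [mul_assoc]
  have key2 : pureR (fun i => r (n + 1 + i)) (fun i => r' (n + 1 + i)) m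
      = wordD r (n + 2) m * r (n + 1) * word r' (n + 2) m := by
    induction m with
    | zero => simp [pureR_zero, wordD, word]
    | succ m ih =>
      rw [pureR_succ, ih, wordD_succ, word_succ, show n + 1 + (m + 1) = n + 2 + m by omega]
      simp only [mul_assoc]
  have c1 : Commute (pureR r r' n) (wordD r (n + 2) m) :=
    commute_wordD fun i h1 h2 => hb.pureR_comm (by omega)
  have c2 : Commute (pureR r r' n) (word r' (n + 2) m) :=
    commute_word fun i h1 h2 => commute_inv (hb.mul_inv i) (hb.inv_mul i) (hb.pureR_comm (by omega))
  rw [key, key2]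
  calc _ = wordD r (n + 2) m * (pureR r r' n * r (n + 1) * pureR r r' n) * r' (n + 1) *
        word r' (n + 2) m := by
        simp only [← mul_assoc]; rw [c1.eq]
    _ = wordD r (n + 2) m * r (n + 1) * pureR r r' n * (r (n + 1) * r' (n + 1)) *
        word r' (n + 2) m := by
        rw [hb.pureR_braid]; simp only [mul_assoc]
    _ = _ := by
        rw [hb.mul_inv, mul_one, mul_assoc _ _ (word r' _ _), c2.eq]; simp only [mul_assoc]

end Braids

section StarPower

variable {N : ℕ} {A : Type} [Ring A] [Algebra ℂ A] {R F : Op2 N} {q μ : ℂ}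
  {M : Matrix (Fin N) (Fin N) A}

variable (h : Setup R F q μ)

lemma Setup.braidSeq (h : Setup R F q μ) : BraidSeq (gen A R) (gen A R⁻¹) :=
  ⟨fun _ => funext fun _ => h.R_mul_inv _, fun _ => funext fun _ => h.R_inv_mul _,
    fun i => ((h.bmwSeq (i + 2)).pair i (by omega)).braid,
    fun i j hij => (h.bmwSeq (j + 1)).comm i j hij (by omega)⟩

include h

lemma Setup.gen_inv_mem {n i : ℕ} (hi : i + 1 < n) : gen A R⁻¹ i ∈ strands (gen A R) n := by
  rw [h.gen_inv]; exact inv'_mem_of (gen_mem hi)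

omit h in
lemma word_mem_of {S : Subalgebra ℂ (Fam N A)} {f : ℕ → Fam N A} {j l : ℕ}
    (hf : ∀ i, j ≤ i → i < j + l → f i ∈ S) : word f j l ∈ S := by
  induction l generalizing j with
  | zero => exact one_mem _
  | succ l ih => exact mul_mem (hf j le_rfl (by omega)) (ih fun i _ _ => hf i (by omega) (by omega))

omit h in
lemma wordD_mem_of {S : Subalgebra ℂ (Fam N A)} {f : ℕ → Fam N A} {j l : ℕ}
    (hf : ∀ i, j ≤ i → i < j + l → f i ∈ S) : wordD f j l ∈ S := by
  induction l generalizing j with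
  | zero => exact one_mem _
  | succ l ih => exact mul_mem (ih fun i _ _ => hf i (by omega) (by omega)) (hf j le_rfl (by omega))

variable (A R) in
omit h in
/-- The pure braid `σ_n ⋯ σ_2 σ_1 σ_2⁻¹ ⋯ σ_n⁻¹` of the `⋆`-product. -/
abbrev sW (n : ℕ) : Fam N A := pureR (gen A R) (gen A R⁻¹) n

variable (A R) in
omit h in
/-- The mirror image `σ_n⁻¹ ⋯ σ_2⁻¹ σ_1 σ_2 ⋯ σ_n` of the pure braid of the `⋆`-product. -/
abbrev tW (n : ℕ) : Fam N A := pureL (gen A R) (gen A R⁻¹) n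

lemma Setup.sW_mem (n : ℕ) : sW A R n ∈ strands (gen A R) (n + 2) :=
  mul_mem (wordD_mem_of fun i _ _ => gen_mem (by omega))
    (word_mem_of fun i _ _ => h.gen_inv_mem (by omega))

lemma Setup.tW_mem (n : ℕ) : tW A R n ∈ strands (gen A R) (n + 2) :=
  mul_mem (mul_mem (wordD_mem_of fun i _ _ => h.gen_inv_mem (by omega)) (gen_mem (by omega)))
    (word_mem_of fun i _ _ => gen_mem (by omega))

lemma Setup.E_sW (n : ℕ) : E (matD R) (n + 1) (sW A R n 0) = 1 := by
  induction n with
  | zero => rw [sW, pureR_zero]; exact E_opR_self h.skew (by omega)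
  | succ n ih =>
    rw [← ih, sW, pureR_succ]
    have := h.self.E_conj_left (A := A) (m := n + 1) (m' := n + 1 + 1) (by omega)
      (fam_off (s := 0) (j := n + 1 + 1) (Or.inr (by omega)) (h.sW_mem n))
    simpa [gen] using this

lemma Setup.E_tW (n : ℕ) : E (matD R) (n + 1) (tW A R n 0) = 1 := by
  induction n with
  | zero => rw [tW, pureL_zero]; exact E_opR_self h.skew (by omega)
  | succ n ih =>
    rw [← ih, tW, pureL_succ]
    have := h.self.E_conj_right (A := A) (m := n + 1) (m' := n + 1 + 1) (by omega)
      (fam_off (s := 0) (j := n + 1 + 1) (Or.inr (by omega)) (h.tW_mem n))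
    simpa [gen] using this

lemma Setup.grid_mul_shf {n m : ℕ} {X : Fam N A} (hX : X ∈ strands (gen A R) n) :
    grid (gen A R) 0 n m * shf m X = X * grid (gen A R) 0 n m := by
  induction hX using Algebra.adjoin_induction with
  | mem x hx => obtain ⟨i, hi, rfl⟩ := hx; rw [shf_gen]; exact h.braidSeq.grid_mul_gen hi
  | algebraMap c => rw [AlgHom.commutes]; exact (Algebra.commutes c _).symm
  | add x y _ _ hx hy => rw [map_add, mul_add, hx, hy, add_mul]
  | mul x y _ _ hx hy => rw [map_mul, ← mul_assoc, hx, mul_assoc, hy, mul_assoc]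

lemma Setup.grid_mul {n m : ℕ} {X : Fam N A} (hX : X ∈ strands (gen A R) m) :
    grid (gen A R) 0 n m * X = shf n X * grid (gen A R) 0 n m := by
  induction hX using Algebra.adjoin_induction with
  | mem x hx =>
    obtain ⟨i, hi, rfl⟩ := hx
    rw [shf_gen, add_comm i n]; exact h.braidSeq.grid_mul_gen' hi
  | algebraMap c => rw [AlgHom.commutes]; exact (Algebra.commutes c _).symm
  | add x y _ _ hx hy => rw [map_add, mul_add, hx, hy, add_mul]
  | mul x y _ _ hx hy => rw [map_mul, ← mul_assoc, hx, mul_assoc, hy, mul_assoc]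

lemma Setup.grid_mul_juxt {n m : ℕ} {X Y : Fam N A} (hX : X ∈ strands (gen A R) n)
    (hY : Y ∈ strands (gen A R) m) :
    grid (gen A R) 0 n m * (Y * shf m X) = X * shf n Y * grid (gen A R) 0 n m := by
  rw [← mul_assoc, h.grid_mul hY, mul_assoc, h.grid_mul_shf hX, ← mul_assoc, (shf_comm hX hY).eq]

omit h in
/-- The elements of a subalgebra that are invertible in it. -/
def InvIn (S : Subalgebra ℂ (Fam N A)) (x : Fam N A) : Prop :=
  x ∈ S ∧ ∃ y ∈ S, x * y = 1 ∧ y * x = 1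

omit h in
lemma InvIn.one {S : Subalgebra ℂ (Fam N A)} : InvIn S 1 :=
  ⟨one_mem _, 1, one_mem _, one_mul _, one_mul _⟩

omit h in
lemma InvIn.mul {S : Subalgebra ℂ (Fam N A)} {x y : Fam N A} (hx : InvIn S x) (hy : InvIn S y) :
    InvIn S (x * y) := by
  obtain ⟨h1, x', h2, h3, h4⟩ := hx
  obtain ⟨k1, y', k2, k3, k4⟩ := hy
  refine ⟨mul_mem h1 k1, y' * x', mul_mem k2 h2, ?_, ?_⟩
  · rw [mul_assoc, ← mul_assoc y, k3, one_mul, h3]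
  · rw [mul_assoc, ← mul_assoc x', h4, one_mul, k4]

lemma Setup.invIn_gen {n i : ℕ} (hi : i + 1 < n) : InvIn (strands (gen A R) n) (gen A R i) :=
  ⟨gen_mem hi, _, h.gen_inv_mem hi, h.braidSeq.mul_inv i, h.braidSeq.inv_mul i⟩

lemma Setup.invIn_word {n j l : ℕ} (hl : j + l < n) :
    InvIn (strands (gen A R) n) (word (gen A R) j l) := by
  induction l generalizing j with
  | zero => exact InvIn.one
  | succ l ih => exact (h.invIn_gen (by omega)).mul (ih (by omega))

lemma Setup.invIn_wordD {n j l : ℕ} (hl : j + l < n) :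
    InvIn (strands (gen A R) n) (wordD (gen A R) j l) := by
  induction l generalizing j with
  | zero => exact InvIn.one
  | succ l ih => exact (ih (by omega)).mul (h.invIn_gen (by omega))

lemma Setup.invIn_grid {n l m k : ℕ} (hl : l + m ≤ n) (hk : k ≤ m) :
    InvIn (strands (gen A R) n) (grid (gen A R) 0 l k) := by
  induction k with
  | zero => exact InvIn.one
  | succ k ih => exact (ih (by omega)).mul (h.invIn_wordD (by omega))

omit h in
lemma shf_word (k j l : ℕ) : shf k (word (gen A R) j l) = word (gen A R) (j + k) l := by
  induction l generalizing j with
  | zero => exact map_one _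
  | succ l ih => rw [word, word, map_mul, ih, shf_gen, show j + 1 + k = j + k + 1 by omega]

omit h in
lemma shf_wordD (k j l : ℕ) : shf k (wordD (gen A R) j l) = wordD (gen A R) (j + k) l := by
  induction l generalizing j with
  | zero => exact map_one _
  | succ l ih => rw [wordD, wordD, map_mul, ih, shf_gen, show j + 1 + k = j + k + 1 by omega]

omit h in
lemma shf_grid (k o l m : ℕ) : shf k (grid (gen A R) o l m) = grid (gen A R) (o + k) l m := by
  induction m with
  | zero => exact map_one _
  | succ m ih => rw [grid, grid, map_mul, ih, shf_wordD, show o + m + k = o + k + m by omega]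

omit h in
lemma shf_pureR (k n : ℕ) : shf k (sW A R n)
    = pureR (fun i => gen A R (k + i)) (fun i => gen A R⁻¹ (k + i)) n := by
  induction n with
  | zero => rw [sW, pureR_zero, pureR_zero, shf_gen, add_comm]
  | succ n ih => rw [sW, pureR_succ, pureR_succ, map_mul, map_mul, ih, shf_gen, shf_gen, add_comm k]

variable [NeZero N] (hM : Commute (opN A R 0) (Mc F M 0 * Mc F M 1))
include hM

/-- The two expressions for the exponent of a `⋆`-product differ by a conjugation that does not involve
the first strand. -/
lemma Setup.mp_star {n m : ℕ} {X Y : Fam N A} (hX : X ∈ strands (gen A R) (n + 1))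
    (hY : Y ∈ strands (gen A R) (m + 1)) :
    mp R F M (n + 1 + m) (X * shf (n + 1) Y * sW A R n)
      = mp R F M (m + 1 + n) (tW A R m * (Y * shf (m + 1) X)) := by
  have hw : InvIn (strands (gen A R) (n + 1 + m))
      (grid (gen A R) 0 n (m + 1) * word (gen A R) 0 m) :=
    (h.invIn_grid (m := m + 1) (by omega) le_rfl).mul (h.invIn_word (by omega))
  obtain ⟨h1, w', h2, h3, h4⟩ := hw
  set w := grid (gen A R) 0 n (m + 1) * word (gen A R) 0 m with hwdef
  have hs : shf 1 w = grid (gen A R) 1 n (m + 1) * word (gen A R) 1 m := by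
    rw [hwdef, map_mul, shf_grid, shf_word]
  have e1 : sW A R n * shf 1 w = grid (gen A R) 0 (n + 1) (m + 1) := by
    rw [hs]; exact h.braidSeq.pureR_mul n m
  have e2 : shf 1 w * tW A R m = grid (gen A R) 0 (n + 1) (m + 1) := by
    rw [hs]; exact h.braidSeq.mul_pureL n m
  have h3' : shf 1 w * shf 1 w' = 1 := by rw [← map_mul, h3, map_one]
  have h4' : shf 1 w' * shf 1 w = 1 := by rw [← map_mul, h4, map_one]
  rw [show m + 1 + n = n + 1 + m by omega]
  -- `w` is shifted by one strand, so that the factor `shf 1 w` can be moved around cyclically.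
  have key : X * shf (n + 1) Y * sW A R n * shf 1 w = shf 1 w * (tW A R m * (Y * shf (m + 1) X)) := by
    rw [mul_assoc, e1, ← h.grid_mul_juxt hX hY, ← e2, mul_assoc]
  calc _ = mp R F M (n + 1 + m) (X * shf (n + 1) Y * sW A R n * shf 1 w * shf 1 w') := by
        rw [mul_assoc _ (shf 1 w), h3', mul_one]
    _ = _ := by
        rw [key, mul_assoc, h.mp_cyclic hM h1, mul_assoc, h4', mul_one]

/-- The characteristic elements commute. -/
lemma Setup.chf_comm {n m : ℕ} {X Y : Fam N A} (hX : X ∈ strands (gen A R) (n + 1))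
    (hY : Y ∈ strands (gen A R) (m + 1)) :
    chf R F M n X * chf R F M m Y = chf R F M m Y * chf R F M n X := by
  rw [← h.chf_juxt hX hY, ← h.chf_juxt hY hX, show m + 1 + n = n + 1 + m by omega]
  obtain ⟨h1, w', h2, h3, h4⟩ : InvIn (strands (gen A R) (n + 1 + m + 1))
    (grid (gen A R) 0 (n + 1) (m + 1)) := h.invIn_grid (m := m + 1) (by omega) le_rfl
  have e := h.grid_mul_juxt hX hY
  calc _ = chf R F M (n + 1 + m) (X * shf (n + 1) Y * grid (gen A R) 0 (n + 1) (m + 1) * w') := by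
        rw [mul_assoc _ _ w', h3, mul_one]
    _ = _ := by
        rw [← e, mul_assoc, h.chf_cyclic hM h1, mul_assoc, h4, mul_one]

end StarPower

/-! ### The characteristic subalgebra and the space `P(R, F)` -/

section Juxt

variable {N : ℕ} {A : Type} [Ring A] [Algebra ℂ A] {R F : Op2 N} {q μ : ℂ}

lemma famHom_juxt {n m : ℕ} (α : OpN N (n + 1)) (β : OpN N (m + 1)) :
    famHom A (n + 1 + m) (juxt α β) = famHom A n α * shf (n + 1) (famHom A m β) := by
  funext s
  ext f x
  rw [Pi.mul_apply, shf_apply, famHom_apply, famHom_apply, famHom_apply, num_apply, num_apply,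
    num_apply, Module.End.mul_apply, emb_apply, emb_apply]
  have hi := ofs_injective s (n + 1 + m + 1)
  have hi1 := ofs_injective s (n + 1)
  have hi2 := ofs_injective (s + (n + 1)) (m + 1)
  have off1 : ∀ j : Fin (m + 1), ¬ ∃ i, ofs s (n + 1) i = ofs (s + (n + 1)) (m + 1) j := by
    rintro j ⟨i, hi⟩
    have := i.2
    simp only [ofs] at hi
    omega
  have off2 : ∀ j : Fin (n + 1), ¬ ∃ i, ofs (s + (n + 1)) (m + 1) i = ofs s (n + 1) j := by
    rintro j ⟨i, hi⟩
    have := j.2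
    simp only [ofs] at hi
    omega
  refine ((Fin.appendEquiv (α := Fin N) (n + 1) (m + 1)).sum_comp
    (fun y : Fin (n + 1 + m + 1) → Fin N => scal A (juxt α β) (x ∘ ofs s (n + 1 + m + 1)) y *
      f (Function.extend (ofs s (n + 1 + m + 1)) y x))).symm.trans ?_
  refine (Fintype.sum_prod_type _).trans (Finset.sum_congr rfl fun y _ => ?_)
  rw [emb_apply, Finset.mul_sum]
  refine Finset.sum_congr rfl fun z _ => ?_
  have e1 : Function.extend (ofs s (n + 1 + m + 1)) (Fin.append (m := n + 1) (n := m + 1) y z) x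
      = Function.extend (ofs (s + (n + 1)) (m + 1)) z (Function.extend (ofs s (n + 1)) y x) := by
    rw [extend_eq_iff hi]
    refine ⟨funext fun i => ?_, fun l hl => ?_⟩
    · refine Fin.addCases (m := n + 1) (n := m + 1) (fun i => ?_) (fun i => ?_) i
      · rw [Fin.append_left]
        have := (Function.extend_apply' z (Function.extend (ofs s (n + 1)) y x) _ (off2 i))
        exact this.trans (hi1.extend_apply _ _ _)
      · rw [Fin.append_right]
        have := hi2.extend_apply z (Function.extend (ofs s (n + 1)) y x) i
        rw [← this, Function.comp_apply]
        congr 1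
        simp only [ofs, Fin.val_natAdd]
        omega
    · rw [Function.extend_apply', Function.extend_apply']
      · rintro ⟨i, rfl⟩
        exact hl ⟨⟨i, by omega⟩, rfl⟩
      · rintro ⟨i, rfl⟩
        refine hl ⟨⟨n + 1 + i, by omega⟩, ?_⟩
        simp only [ofs]
        omega
  have e2 : (Function.extend (ofs s (n + 1)) y x) ∘ ofs (s + (n + 1)) (m + 1)
      = x ∘ ofs (s + (n + 1)) (m + 1) := by
    funext j
    exact Function.extend_apply' _ _ _ (off1 j)
  have e3 : juxt α β (x ∘ ofs s (n + 1 + m + 1)) (Fin.append (m := n + 1) (n := m + 1) y z)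
      = α (x ∘ ofs s (n + 1)) y * β (x ∘ ofs (s + (n + 1)) (m + 1)) z := by
    simp only [juxt, Matrix.of_apply]
    congr 2
    · funext i
      exact Fin.append_left y z i
    · funext j
      simp only [Function.comp_apply, ofs]
      congr 1
      omega
    · funext j
      exact Fin.append_right y z j
  rw [e2, ← mul_assoc, ← e1]
  congr 1
  simp only [scal, Matrix.map_apply, ← map_mul]
  exact congrArg _ e3

lemma prod_reverse_range {B : Type*} [Ring B] (f : ℕ → B) (n : ℕ) :
    ((List.range n).reverse.map f).prod = wordD f 0 n := by
  induction n with
  | zero => simp [wordD]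
  | succ n ih => rw [List.range_succ, List.reverse_append, wordD_succ, ← ih, zero_add]; simp

lemma prod_range_succ' {B : Type*} [Ring B] (f : ℕ → B) (n : ℕ) :
    ((List.range n).map fun j => f (j + 1)).prod = word f 1 n := by
  induction n with
  | zero => simp [word]
  | succ n ih => rw [List.range_succ, List.map_append, List.prod_append, ih, word_succ, add_comm 1 n]; simp

lemma famHom_starExp [NeZero N] (h : Setup R F q μ) {n m : ℕ} (α : OpN N (n + 1))
    (β : OpN N (m + 1)) : famHom A (n + 1 + m) (starExp R α β)
      = famHom A n α * shf (n + 1) (famHom A m β) * sW A R n := by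
  have e1 : famHom A (n + 1 + m)
      ((List.range (n + 1)).reverse.map fun j => opAt (n + 1 + m + 1) R j).prod
      = wordD (gen A R) 0 (n + 1) := by
    rw [map_list_prod, ← prod_reverse_range, List.map_map]
    congr 1
    refine List.map_congr_left fun j hj => famHom_opAt R ?_
    simp at hj; omega
  have e2 : famHom A (n + 1 + m)
      ((List.range n).map fun j => (opAt (n + 1 + m + 1) R (j + 1))⁻¹).prod
      = word (gen A R⁻¹) 1 n := by
    rw [map_list_prod, ← prod_range_succ', List.map_map]
    congr 1
    refine List.map_congr_left fun j hj => ?_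
    simp only [List.mem_range] at hj
    rw [Function.comp_apply, opAt_inv h.isUnit_left (by omega), famHom_opAt _ (by omega)]
  rw [starExp, map_mul, map_mul, famHom_juxt, e1, e2, mul_assoc]
  rfl

end Juxt

section CharAlg

variable {N : ℕ} {R F : Op2 N} {q μ : ℂ} [NeZero N] (h : Setup R F q μ)
include h

lemma Setup.cst_ch (n : ℕ) (α : OpN N (n + 1)) : cst N (QMA R F) (ch R F n α)
    = chf R F (genMat R F) n (famHom _ n α) := cst_all h.isUnit_right n α

lemma Setup.leg_matPow (n : ℕ) (α : OpN N (n + 1)) : leg (matPow R F n α)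
    = mp R F (genMat R F) n (famHom _ n α) := leg_tail h.isUnit_right n α

omit [NeZero N] h in
lemma ch_mem_charSpace {n : ℕ} {α : OpN N (n + 1)} (hα : α ∈ braidImage R n) :
    ch R F n α ∈ charSpace R F := Submodule.subset_span (Or.inr ⟨n, α, hα, rfl⟩)

lemma Setup.exists_ch {n : ℕ} {X : Fam N (QMA R F)} (hX : X ∈ strands (gen _ R) (n + 1)) :
    ∃ c ∈ charSpace R F, cst N _ c = chf R F (genMat R F) n X := by
  obtain ⟨α, hα, rfl⟩ := exists_famHom hX
  exact ⟨_, ch_mem_charSpace hα, h.cst_ch n α⟩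

lemma Setup.charSpace_mul {x y : QMA R F} (hx : x ∈ charSpace R F) (hy : y ∈ charSpace R F) :
    x * y ∈ charSpace R F := by
  induction hx using Submodule.span_induction with
  | zero => rw [zero_mul]; exact zero_mem _
  | add u v _ _ hu hv => rw [add_mul]; exact add_mem hu hv
  | smul c u _ hu => rw [smul_mul_assoc]; exact Submodule.smul_mem _ _ hu
  | mem u hu =>
    rcases hu with rfl | ⟨n, α, hα, rfl⟩
    · rwa [one_mul]
    induction hy using Submodule.span_induction with
    | zero => rw [mul_zero]; exact zero_mem _
    | add u v _ _ hu hv => rw [mul_add]; exact add_mem hu hv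
    | smul c u _ hu => rw [mul_smul_comm]; exact Submodule.smul_mem _ _ hu
    | mem u hu =>
      rcases hu with rfl | ⟨m, β, hβ, rfl⟩
      · rw [mul_one]; exact ch_mem_charSpace hα
      have hX := h.famHom_mem (A := QMA R F) hα
      have hY := h.famHom_mem (A := QMA R F) hβ
      obtain ⟨c, hc, e⟩ := h.exists_ch (n := n + 1 + m)
        (mul_mem (strands_mono (by omega) hX)
          (strands_mono (by omega) (shf_mem (n + 1) hY)) :
          _ * shf (n + 1) _ ∈ strands (gen (QMA R F) R) (n + 1 + m + 1))
      have : ch R F n α * ch R F m β = c := by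
        apply cst_injective (N := N)
        rw [map_mul, h.cst_ch, h.cst_ch, e, h.chf_juxt hX hY]
      rwa [this]

lemma Setup.charAlg_eq : (charAlg R F).toSubmodule = charSpace R F := by
  apply le_antisymm
  · let S : Subalgebra ℂ (QMA R F) := (charSpace R F).toSubalgebra
      (Submodule.subset_span (Or.inl rfl)) fun x y hx hy => h.charSpace_mul hx hy
    have : charAlg R F ≤ S := Algebra.adjoin_le fun x hx => hx
    exact this
  · exact fun x hx => Algebra.subset_adjoin hx

lemma Setup.charAlg_induction {p : QMA R F → Prop} (one : p 1)
    (mem : ∀ n, ∀ X ∈ strands (gen (QMA R F) R) (n + 1), ∀ c,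
      cst N _ c = chf R F (genMat R F) n X → p c)
    (add : ∀ x y, p x → p y → p (x + y)) (smul : ∀ (c : ℂ) x, p x → p (c • x))
    {x : QMA R F} (hx : x ∈ charAlg R F) : p x := by
  replace hx : x ∈ charSpace R F := by rw [← h.charAlg_eq]; exact hx
  induction hx using Submodule.span_induction with
  | zero => simpa using smul 0 1 one
  | add u v _ _ hu hv => exact add _ _ hu hv
  | smul c u _ hu => exact smul _ _ hu
  | mem u hu =>
    rcases hu with rfl | ⟨n, α, hα, rfl⟩
    · exact one
    · exact mem n _ (h.famHom_mem hα) _ (h.cst_ch n α)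

lemma Setup.charAlg_comm {x y : QMA R F} (hx : x ∈ charAlg R F) (hy : y ∈ charAlg R F) :
    x * y = y * x := by
  refine h.charAlg_induction (p := fun x => x * y = y * x) ?_ ?_ ?_ ?_ hx
  · rw [one_mul, mul_one]
  · intro n X hX c hc
    refine h.charAlg_induction (p := fun y => c * y = y * c) ?_ ?_ ?_ ?_ hy
    · rw [one_mul, mul_one]
    · intro m Y hY d hd
      apply cst_injective (N := N)
      rw [map_mul, map_mul, hc, hd, h.chf_comm h.gen_rel hX hY]
    · intro u v hu hv; rw [mul_add, add_mul, hu, hv]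
    · intro c u hu; rw [mul_smul_comm, smul_mul_assoc, hu]
  · intro u v hu hv; rw [mul_add, add_mul, hu, hv]
  · intro c u hu; rw [mul_smul_comm, smul_mul_assoc, hu]

end CharAlg

section PAlgebra

variable {N : ℕ} {R F : Op2 N} {q μ : ℂ}

lemma leg_add {A : Type} [Ring A] [Algebra ℂ A] (X Y : Matrix (Fin N) (Fin N) A) :
    leg (X + Y) = leg X + leg Y := by
  simp [leg, add_mul, Finset.sum_add_distrib]

lemma leg_smul {A : Type} [Ring A] [Algebra ℂ A] (c : ℂ) (X : Matrix (Fin N) (Fin N) A) :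
    leg (c • X) = c • leg X := by
  simp [leg, Finset.smul_sum]

lemma leg_idMul {A : Type} [Ring A] [Algebra ℂ A] (c : A) : leg (idMul c : Matrix (Fin N) (Fin N) A)
    = cst N A c := by
  have : ∀ a, ∑ b, cst N A ((idMul c : Matrix (Fin N) (Fin N) A) a b) * eU A 0 a b
      = cst N A c * eU A 0 a a := by
    intro a
    rw [Finset.sum_eq_single a]
    · simp [idMul]
    · intro b _ hb; simp [idMul, Matrix.diagonal_apply_ne _ hb.symm]
    · simp
  rw [leg]
  simp only [this, ← Finset.mul_sum, sum_eU, mul_one]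

lemma leg_rightMul {A : Type} [Ring A] [Algebra ℂ A] (X : Matrix (Fin N) (Fin N) A) (c : A) :
    leg (rightMul X c) = leg X * cst N A c := by
  simp only [leg, rightMul, Matrix.map_apply, map_mul, Finset.sum_mul]
  refine Finset.sum_congr rfl fun a _ => Finset.sum_congr rfl fun b _ => ?_
  rw [mul_assoc, (cst_comm c 0 a b).eq, mul_assoc]

/-- The elements of `P(R, F)` as operators in the leg `0`. -/
def legP : PAlg R F →ₗ[ℂ] Chain N (QMA R F) where
  toFun X := leg X.toMat
  map_add' X Y := by rw [map_add, leg_add]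
  map_smul' c X := by rw [map_smul, leg_smul]; rfl

lemma legP_apply (X : PAlg R F) : legP X = leg X.toMat := rfl

lemma legP_injective [NeZero N] : Function.Injective (legP : PAlg R F → Chain N (QMA R F)) :=
  fun _ _ h => Subtype.ext (leg_injective h)

lemma exists_legP_cst {c : QMA R F} (hc : c ∈ charAlg R F) : ∃ X : PAlg R F, legP X = cst N _ c :=
  ⟨⟨idMul c, Submodule.subset_span (Or.inl ⟨c, hc, rfl⟩)⟩, leg_idMul c⟩

lemma Setup.exists_legP_mp [NeZero N] (h : Setup R F q μ) {n : ℕ} {X : Fam N (QMA R F)}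
    (hX : X ∈ strands (gen _ R) (n + 1)) :
    ∃ Y : PAlg R F, legP Y = mp R F (genMat R F) n X := by
  obtain ⟨α, hα, rfl⟩ := exists_famHom hX
  exact ⟨⟨matPow R F n α, Submodule.subset_span (Or.inr ⟨n, α, hα, rfl⟩)⟩, h.leg_matPow n α⟩

lemma Setup.PAlg_induction [NeZero N] (h : Setup R F q μ) {p : PAlg R F → Prop}
    (id : ∀ c ∈ charAlg R F, ∀ X : PAlg R F, legP X = cst N _ c → p X)
    (pow : ∀ n, ∀ Y ∈ strands (gen (QMA R F) R) (n + 1), ∀ X : PAlg R F,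
      legP X = mp R F (genMat R F) n Y → p X)
    (add : ∀ X Y, p X → p Y → p (X + Y)) (smul : ∀ (c : ℂ) X, p X → p (c • X)) (X : PAlg R F) :
    p X := by
  have : ∀ (Z) (hZ : Z ∈ PSpace R F), p (⟨Z, hZ⟩ : PSpace R F) := by
    intro Z hZ
    induction hZ using Submodule.span_induction with
    | zero => exact id 0 (zero_mem _) _ (by rw [map_zero]; exact map_zero legP)
    | add u v _ _ hu hv => exact add _ _ hu hv
    | smul c u _ hu => exact smul _ _ hu
    | mem u hu =>
      rcases hu with ⟨c, hc, rfl⟩ | ⟨n, α, hα, rfl⟩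
      · exact id c hc _ (leg_idMul c)
      · exact pow n _ (h.famHom_mem hα) _ (h.leg_matPow n α)
  exact this X.1 X.2

/-- The restriction to `P(R, F)` of a linear map on operators that preserves it. -/
def liftP [NeZero N] (f : Chain N (QMA R F) →ₗ[ℂ] Chain N (QMA R F))
    (hf : ∀ X : PAlg R F, ∃ Y : PAlg R F, legP Y = f (legP X)) : PAlg R F →ₗ[ℂ] PAlg R F where
  toFun X := (hf X).choose
  map_add' X Y := legP_injective (by
    rw [(hf _).choose_spec, map_add, map_add, map_add, (hf _).choose_spec, (hf _).choose_spec])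
  map_smul' c X := legP_injective (by
    rw [(hf _).choose_spec, map_smul, map_smul, map_smul, (hf _).choose_spec]; rfl)

lemma legP_liftP [NeZero N] (f : Chain N (QMA R F) →ₗ[ℂ] Chain N (QMA R F))
    (hf : ∀ X : PAlg R F, ∃ Y : PAlg R F, legP Y = f (legP X)) (X : PAlg R F) :
    legP (liftP f hf X) = f (legP X) := (hf X).choose_spec

/-- A bilinear product is determined by compatible left and right multiplications by the elements of a
spanning family. -/
lemma exists_bilin {P ι : Type*} [AddCommGroup P] [Module ℂ P] (p : ι → P)
    (hp : Submodule.span ℂ (Set.range p) = ⊤) (S S' : ι → P →ₗ[ℂ] P)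
    (hS : ∀ i j, S i (p j) = S' j (p i)) :
    ∃ star : P →ₗ[ℂ] P →ₗ[ℂ] P, (∀ i Y, star (p i) Y = S i Y) ∧ ∀ j X, star X (p j) = S' j X := by
  set π : (ι →₀ ℂ) →ₗ[ℂ] P := Finsupp.linearCombination ℂ p with hπ
  have hsurj : LinearMap.range π = ⊤ := by rw [hπ, Finsupp.range_linearCombination, hp]
  -- The product is defined on coordinates with respect to the family; it does not depend on the choice
  -- of the coordinates of the left factor because it coincides with `S'` on the family.
  obtain ⟨σ, hσ⟩ := π.exists_rightInverse_of_surjective hsurj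
  have h2 : ∀ j X, Finsupp.linearCombination ℂ S (σ X) (p j) = S' j X := by
    intro j X
    have : ∀ f : ι →₀ ℂ, Finsupp.linearCombination ℂ S f (p j) = S' j (π f) := by
      intro f
      induction f using Finsupp.induction_linear with
      | zero => simp
      | add f g hf hg => rw [map_add, LinearMap.add_apply, hf, hg, map_add, map_add]
      | single i c => simp [hπ, hS]
    rw [this]
    congr 1
    exact LinearMap.congr_fun hσ X
  refine ⟨Finsupp.linearCombination ℂ S ∘ₗ σ, fun i Y => ?_, h2⟩
  have : ∀ Y ∈ Submodule.span ℂ (Set.range p),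
      (Finsupp.linearCombination ℂ S ∘ₗ σ) (p i) Y = S i Y := by
    intro Y hY
    induction hY using Submodule.span_induction with
    | mem Y hY => obtain ⟨j, rfl⟩ := hY; rw [hS]; exact h2 j _
    | zero => simp
    | add u v _ _ hu hv => rw [map_add, map_add, hu, hv]
    | smul c u _ hu => rw [map_smul, map_smul, hu]
  exact this Y (by rw [hp]; trivial)

end PAlgebra

/-! ### The `⋆`-product -/

section Maps

variable {N : ℕ} {A : Type} [Ring A] [Algebra ℂ A] {R F : Op2 N} {q μ : ℂ}
  {M : Matrix (Fin N) (Fin N) A}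

variable (R F M) in
/-- The operation `M^α ⋆ -` on operators in the leg `0`. -/
def mulPowL (n : ℕ) (X : Fam N A) : Chain N A →ₗ[ℂ] Chain N A :=
  trs (matD R) 0 (n + 1) ∘ₗ LinearMap.mulRight ℂ (sW A R n 0) ∘ₗ
    LinearMap.mulLeft ℂ (Tp F M 0 (n + 1) * X 0) ∘ₗ cj F (n + 1)

variable (R F M) in
/-- The operation `- ⋆ M^α` on operators in the leg `0`. -/
def mulPowR (n : ℕ) (X : Fam N A) : Chain N A →ₗ[ℂ] Chain N A :=
  trs (matD R) 0 (n + 1) ∘ₗ LinearMap.mulLeft ℂ (tW A R n 0) ∘ₗ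
    LinearMap.mulLeft ℂ (Tp F M 0 (n + 1) * X 0) ∘ₗ cj F (n + 1)

lemma mulPowL_apply (n : ℕ) (X : Fam N A) (Z : Chain N A) : mulPowL R F M n X Z
    = trs (matD R) 0 (n + 1) (Tp F M 0 (n + 1) * X 0 * cj F (n + 1) Z * sW A R n 0) := rfl

lemma mulPowR_apply (n : ℕ) (X : Fam N A) (Z : Chain N A) : mulPowR R F M n X Z
    = trs (matD R) 0 (n + 1) (tW A R n 0 * (Tp F M 0 (n + 1) * X 0 * cj F (n + 1) Z)) := rfl

variable (h : Setup R F q μ)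
include h

lemma Setup.mulPowL_cst_mul (n : ℕ) (X : Fam N A) (Z : Chain N A) (c : A) :
    mulPowL R F M n X (Z * cst N A c) = mulPowL R F M n X Z * cst N A c := by
  have hc : Commute (cst N A c) (sW A R n 0) :=
    commute_fam (fun _ _ => num_cst_comm _ _ _ _) (h.sW_mem n)
  rw [mulPowL_apply, mulPowL_apply, cj_mul_cst, ← mul_assoc, mul_assoc _ (cst N A c), hc.eq,
    ← mul_assoc, trs_mul_right _ fun _ _ _ => Off.of_cst c]

omit h in
lemma mulPowR_cst_mul (n : ℕ) (X : Fam N A) (Z : Chain N A) (c : A) :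
    mulPowR R F M n X (Z * cst N A c) = mulPowR R F M n X Z * cst N A c := by
  rw [mulPowR_apply, mulPowR_apply, cj_mul_cst, ← trs_mul_right _ fun _ _ _ => Off.of_cst c]
  simp only [mul_assoc]

lemma Setup.cj_one (a : ℕ) : cj F a (1 : Chain N A) = 1 := by
  rw [cj_apply, mul_one, wordD_mul_word h.F_mul_inv]

lemma Setup.mulPowL_cst {n : ℕ} {X : Fam N A} (hX : X ∈ strands (gen A R) (n + 1)) (c : A) :
    mulPowL R F M n X (cst N A c) = mp R F M n X * cst N A c := by
  rw [← one_mul (cst N A c), h.mulPowL_cst_mul, mulPowL_apply, h.cj_one, mul_one, trs_succ, zero_add,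
    E_mul_left _ ((Tp_off (by omega)).mul (fam_off (by omega) hX)), h.E_sW, mul_one, one_mul]
  rfl

lemma Setup.mulPowR_cst {n : ℕ} {X : Fam N A} (hX : X ∈ strands (gen A R) (n + 1)) (c : A) :
    mulPowR R F M n X (cst N A c) = mp R F M n X * cst N A c := by
  rw [← one_mul (cst N A c), mulPowR_cst_mul, mulPowR_apply, h.cj_one, mul_one, trs_succ, zero_add,
    E_mul_right _ ((Tp_off (by omega)).mul (fam_off (by omega) hX)), h.E_tW, one_mul, one_mul]
  rfl

/-- `M^α ⋆ M^β`, computed by the multiplication operator of the left factor. -/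
lemma Setup.mulPowL_mp {n m : ℕ} {X Y : Fam N A} (hX : X ∈ strands (gen A R) (n + 1))
    (hY : Y ∈ strands (gen A R) (m + 1)) : mulPowL R F M n X (mp R F M m Y)
      = mp R F M (n + 1 + m) (X * shf (n + 1) Y * sW A R n) :=
  (h.mp_right hX hY (h.sW_mem n)).symm

/-- The multiplication operator of the right factor gives the same product, by `mp_star`. -/
lemma Setup.mulPowR_mp [NeZero N] (hM : Commute (opN A R 0) (Mc F M 0 * Mc F M 1)) {n m : ℕ}
    {X Y : Fam N A} (hX : X ∈ strands (gen A R) (n + 1)) (hY : Y ∈ strands (gen A R) (m + 1)) :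
    mulPowR R F M m Y (mp R F M n X) = mulPowL R F M n X (mp R F M m Y) := by
  rw [h.mulPowL_mp hX hY, h.mp_star hM hX hY]
  exact (h.mp_left hM hY hX (h.tW_mem m)).symm

end Maps

section Star

variable {N : ℕ} {R F : Op2 N} {q μ : ℂ} [NeZero N] (h : Setup R F q μ)
include h

omit [NeZero N] in
lemma Setup.star_mem {n m : ℕ} {X Y : Fam N (QMA R F)} (hX : X ∈ strands (gen _ R) (n + 1))
    (hY : Y ∈ strands (gen _ R) (m + 1)) :
    X * shf (n + 1) Y * sW _ R n ∈ strands (gen _ R) (n + 1 + m + 1) :=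
  mul_mem (mul_mem (strands_mono (by omega) hX) (strands_mono (by omega) (shf_mem (n + 1) hY)))
    (strands_mono (by omega) (h.sW_mem n))

/-- `P(R, F)` is stable under right multiplication by the characteristic subalgebra. -/
lemma Setup.exists_rmul {c : QMA R F} (hc : c ∈ charAlg R F) (X : PAlg R F) :
    ∃ Y : PAlg R F, legP Y = legP X * cst N _ c := by
  induction X using h.PAlg_induction with
  | id d hd X hX =>
    obtain ⟨Y, hY⟩ := exists_legP_cst (mul_mem hd hc)
    exact ⟨Y, by rw [hY, hX, map_mul]⟩
  | pow n Y hY X hX =>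
    refine h.charAlg_induction (p := fun c => ∃ Y : PAlg R F, legP Y = legP X * cst N _ c)
      ⟨X, by rw [map_one, mul_one]⟩ (fun m Z hZ c hc => ?_) (fun x y hx hy => ?_)
      (fun c x hx => ?_) hc
    · obtain ⟨W, hW⟩ := h.exists_legP_mp (n := n + 1 + m) (X := Y * shf (n + 1) Z)
        (mul_mem (strands_mono (by omega) hY) (strands_mono (by omega) (shf_mem (n + 1) hZ)))
      exact ⟨W, by rw [hW, hX, hc, h.mp_juxt hY hZ]⟩
    · obtain ⟨U, hU⟩ := hx
      obtain ⟨V, hV⟩ := hy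
      exact ⟨U + V, by rw [map_add, map_add, hU, hV, mul_add]⟩
    · obtain ⟨U, hU⟩ := hx
      exact ⟨c • U, by rw [map_smul, map_smul, hU, mul_smul_comm]⟩
  | add X Y hX hY =>
    obtain ⟨U, hU⟩ := hX
    obtain ⟨V, hV⟩ := hY
    exact ⟨U + V, by rw [map_add, map_add, hU, hV, add_mul]⟩
  | smul c X hX =>
    obtain ⟨U, hU⟩ := hX
    exact ⟨c • U, by rw [map_smul, map_smul, hU, smul_mul_assoc]⟩

lemma Setup.exists_mulPowL {n : ℕ} {X : Fam N (QMA R F)} (hX : X ∈ strands (gen _ R) (n + 1))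
    (Z : PAlg R F) : ∃ Y : PAlg R F, legP Y = mulPowL R F (genMat R F) n X (legP Z) := by
  induction Z using h.PAlg_induction with
  | id c hc Z hZ =>
    obtain ⟨W, hW⟩ := h.exists_legP_mp hX
    obtain ⟨Y, hY⟩ := h.exists_rmul hc W
    exact ⟨Y, by rw [hY, hW, hZ, h.mulPowL_cst hX]⟩
  | pow m Y hY Z hZ =>
    obtain ⟨W, hW⟩ := h.exists_legP_mp (h.star_mem hX hY)
    exact ⟨W, by rw [hW, hZ, h.mulPowL_mp hX hY]⟩
  | add X Y hX hY =>
    obtain ⟨U, hU⟩ := hX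
    obtain ⟨V, hV⟩ := hY
    exact ⟨U + V, by rw [map_add, map_add, map_add, hU, hV]⟩
  | smul c X hX =>
    obtain ⟨U, hU⟩ := hX
    exact ⟨c • U, by rw [map_smul, map_smul, map_smul, hU]⟩

lemma Setup.exists_mulPowR {n : ℕ} {X : Fam N (QMA R F)} (hX : X ∈ strands (gen _ R) (n + 1))
    (Z : PAlg R F) : ∃ Y : PAlg R F, legP Y = mulPowR R F (genMat R F) n X (legP Z) := by
  induction Z using h.PAlg_induction with
  | id c hc Z hZ =>
    obtain ⟨W, hW⟩ := h.exists_legP_mp hX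
    obtain ⟨Y, hY⟩ := h.exists_rmul hc W
    exact ⟨Y, by rw [hY, hW, hZ, h.mulPowR_cst hX]⟩
  | pow m Y hY Z hZ =>
    obtain ⟨W, hW⟩ := h.exists_legP_mp (h.star_mem hY hX)
    exact ⟨W, by rw [hW, hZ, h.mulPowR_mp h.gen_rel hY hX, h.mulPowL_mp hY hX]⟩
  | add X Y hX hY =>
    obtain ⟨U, hU⟩ := hX
    obtain ⟨V, hV⟩ := hY
    exact ⟨U + V, by rw [map_add, map_add, map_add, hU, hV]⟩
  | smul c X hX =>
    obtain ⟨U, hU⟩ := hX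
    exact ⟨c • U, by rw [map_smul, map_smul, map_smul, hU]⟩

/-- The characterization of the `⋆`-product in terms of operators. -/
structure StarSpec (star : PAlg R F →ₗ[ℂ] PAlg R F →ₗ[ℂ] PAlg R F) : Prop where
  pow_left : ∀ n, ∀ Y ∈ strands (gen (QMA R F) R) (n + 1), ∀ X Z : PAlg R F,
    legP X = mp R F (genMat R F) n Y →
      legP (star X Z) = mulPowL R F (genMat R F) n Y (legP Z)
  pow_right : ∀ n, ∀ Y ∈ strands (gen (QMA R F) R) (n + 1), ∀ X Z : PAlg R F,
    legP X = mp R F (genMat R F) n Y →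
      legP (star Z X) = mulPowR R F (genMat R F) n Y (legP Z)
  id_left : ∀ c ∈ charAlg R F, ∀ X Z : PAlg R F, legP X = cst N _ c →
    legP (star X Z) = legP Z * cst N _ c
  id_right : ∀ c ∈ charAlg R F, ∀ X Z : PAlg R F, legP X = cst N _ c →
    legP (star Z X) = legP Z * cst N _ c

/-- The `⋆`-product is well defined: multiplication by a spanning element from the left depends linearly
on the operator of the right factor and vice versa. -/
lemma Setup.exists_star : ∃ star : PAlg R F →ₗ[ℂ] PAlg R F →ₗ[ℂ] PAlg R F, StarSpec star := by
  let ι := charAlg R F ⊕ (Σ n : ℕ, strands (gen (QMA R F) R) (n + 1))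
  let p : ι → PAlg R F := Sum.elim (fun c => (exists_legP_cst c.2).choose)
    fun y => (h.exists_legP_mp y.2.2).choose
  have p1 : ∀ c, legP (p (Sum.inl c)) = cst N _ (c : QMA R F) := fun c =>
    (exists_legP_cst c.2).choose_spec
  have p2 : ∀ y, legP (p (Sum.inr y)) = mp R F (genMat R F) y.1 y.2 := fun y =>
    (h.exists_legP_mp y.2.2).choose_spec
  let T : charAlg R F → PAlg R F →ₗ[ℂ] PAlg R F := fun c =>
    liftP (LinearMap.mulRight ℂ (cst N _ (c : QMA R F))) (h.exists_rmul c.2)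
  let S : ι → PAlg R F →ₗ[ℂ] PAlg R F := Sum.elim T
    fun y => liftP (mulPowL R F (genMat R F) y.1 y.2) (h.exists_mulPowL y.2.2)
  let S' : ι → PAlg R F →ₗ[ℂ] PAlg R F := Sum.elim T
    fun y => liftP (mulPowR R F (genMat R F) y.1 y.2) (h.exists_mulPowR y.2.2)
  have hT : ∀ c X, legP (T c X) = legP X * cst N _ (c : QMA R F) := fun c X => legP_liftP _ _ _
  have hS : ∀ y X, legP (S (Sum.inr y) X) = mulPowL R F (genMat R F) y.1 y.2 (legP X) :=
    fun y X => legP_liftP _ _ _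
  have hS' : ∀ y X, legP (S' (Sum.inr y) X) = mulPowR R F (genMat R F) y.1 y.2 (legP X) :=
    fun y X => legP_liftP _ _ _
  have hspan : Submodule.span ℂ (Set.range p) = ⊤ := by
    rw [eq_top_iff]
    intro X _
    induction X using h.PAlg_induction with
    | id c hc X hX =>
      have : X = p (Sum.inl ⟨c, hc⟩) := legP_injective (by rw [hX, p1])
      rw [this]; exact Submodule.subset_span ⟨_, rfl⟩
    | pow n Y hY X hX =>
      have : X = p (Sum.inr ⟨n, Y, hY⟩) := legP_injective (by rw [hX, p2])
      rw [this]; exact Submodule.subset_span ⟨_, rfl⟩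
    | add X Y hX hY => exact add_mem (hX trivial) (hY trivial)
    | smul c X hX => exact Submodule.smul_mem _ _ (hX trivial)
  obtain ⟨star, s1, s2⟩ := exists_bilin p hspan S S' (by
    rintro (c | y) (d | z) <;> apply legP_injective
    · change legP (T c _) = legP (T d _)
      rw [hT, hT, p1, p1, ← map_mul, ← map_mul, h.charAlg_comm c.2 d.2]
    · change legP (T c _) = legP (S' _ _)
      rw [hT, hS', p1, p2, h.mulPowR_cst z.2.2]
    · change legP (S _ _) = legP (T d _)
      rw [hT, hS, p1, p2, h.mulPowL_cst y.2.2]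
    · rw [hS, hS', p2, p2, h.mulPowR_mp h.gen_rel y.2.2 z.2.2])
  refine ⟨star, fun n Y hY X Z hX => ?_, fun n Y hY X Z hX => ?_, fun c hc X Z hX => ?_,
    fun c hc X Z hX => ?_⟩
  · have : X = p (Sum.inr ⟨n, Y, hY⟩) := legP_injective (by rw [hX, p2])
    rw [this, s1, hS]
  · have : X = p (Sum.inr ⟨n, Y, hY⟩) := legP_injective (by rw [hX, p2])
    rw [this, s2, hS']
  · have : X = p (Sum.inl ⟨c, hc⟩) := legP_injective (by rw [hX, p1])
    rw [this, s1]; exact hT _ _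
  · have : X = p (Sum.inl ⟨c, hc⟩) := legP_injective (by rw [hX, p1])
    rw [this, s2]; exact hT _ _

variable {star : PAlg R F →ₗ[ℂ] PAlg R F →ₗ[ℂ] PAlg R F} (hs : StarSpec star)
include hs

lemma StarSpec.isStarProduct : IsStarProduct R F star := by
  have hm : ∀ c d : QMA R F, c ∈ charAlg R F → d ∈ charAlg R F → c * d = d * c :=
    fun c d hc hd => h.charAlg_comm hc hd
  refine ⟨fun n m α hα β hβ X Y hX hY => ?_, fun n α hα c hc X Y hX hY => ?_,
    fun c hc d hd X Y hX hY => ?_⟩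
  · apply leg_injective
    have e := hs.pow_left n _ (h.famHom_mem hα) X Y (by rw [legP_apply, hX, h.leg_matPow])
    rw [← legP_apply, e, legP_apply, hY, h.leg_matPow, h.leg_matPow, famHom_starExp h,
      h.mulPowL_mp (h.famHom_mem hα) (h.famHom_mem hβ)]
  · have e : legP X = cst N _ c := by rw [legP_apply, hX, leg_idMul]
    constructor <;> apply leg_injective
    · rw [← legP_apply, hs.id_left c hc X Y e, legP_apply, hY, leg_rightMul]
    · rw [← legP_apply, hs.id_right c hc X Y e, legP_apply, hY, leg_rightMul]
  · have e : legP X = cst N _ c := by rw [legP_apply, hX, leg_idMul]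
    apply leg_injective
    rw [← legP_apply, hs.id_left c hc X Y e, legP_apply, hY, leg_idMul, leg_idMul, ← map_mul,
      hm c d hc hd]

/-- The `⋆`-product is linear over the characteristic subalgebra. -/
lemma StarSpec.cst_mul {c : QMA R F} (hc : c ∈ charAlg R F) {X X' : PAlg R F}
    (hX : legP X' = legP X * cst N _ c) (Z : PAlg R F) :
    legP (star X' Z) = legP (star X Z) * cst N _ c := by
  induction Z using h.PAlg_induction with
  | id d hd Z hZ =>
    rw [hs.id_right d hd Z _ hZ, hs.id_right d hd Z _ hZ, hX, mul_assoc, mul_assoc, ← map_mul,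
      ← map_mul, h.charAlg_comm hc hd]
  | pow n Y hY Z hZ =>
    rw [hs.pow_right n Y hY Z _ hZ, hs.pow_right n Y hY Z _ hZ, hX, mulPowR_cst_mul]
  | add Y Z hY hZ => rw [map_add, map_add, map_add, map_add, hY, hZ, add_mul]
  | smul c Y hY => rw [map_smul, map_smul, map_smul, map_smul, hY, smul_mul_assoc]

lemma StarSpec.mul_cst {c : QMA R F} (hc : c ∈ charAlg R F) {X X' : PAlg R F}
    (hX : legP X' = legP X * cst N _ c) (Z : PAlg R F) :
    legP (star Z X') = legP (star Z X) * cst N _ c := by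
  induction Z using h.PAlg_induction with
  | id d hd Z hZ =>
    rw [hs.id_left d hd Z _ hZ, hs.id_left d hd Z _ hZ, hX, mul_assoc, mul_assoc, ← map_mul,
      ← map_mul, h.charAlg_comm hc hd]
  | pow n Y hY Z hZ =>
    rw [hs.pow_left n Y hY Z _ hZ, hs.pow_left n Y hY Z _ hZ, hX, h.mulPowL_cst_mul]
  | add Y Z hY hZ =>
    simp only [map_add, LinearMap.add_apply, hY, hZ, add_mul]
  | smul c Y hY =>
    simp only [map_smul, LinearMap.smul_apply, hY, smul_mul_assoc]

lemma StarSpec.assoc (X Y Z : PAlg R F) : star (star X Y) Z = star X (star Y Z) := by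
  apply legP_injective
  induction X using h.PAlg_induction with
  | id c hc X hX =>
    rw [hs.id_left c hc X _ hX]
    exact hs.cst_mul h hc (hs.id_left c hc X Y hX) Z
  | add X X' hX hX' => simp only [map_add, LinearMap.add_apply, hX, hX']
  | smul c X hX => simp only [map_smul, LinearMap.smul_apply, hX]
  | pow n U hU X hX =>
    induction Y using h.PAlg_induction with
    | id c hc Y hY =>
      rw [hs.cst_mul h hc (hs.id_right c hc Y X hY) Z]
      exact (hs.mul_cst h hc (hs.id_left c hc Y Z hY) X).symm
    | add X X' hX hX' => simp only [map_add, LinearMap.add_apply, hX, hX']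
    | smul c X hX => simp only [map_smul, LinearMap.smul_apply, hX]
    | pow m V hV Y hY =>
      induction Z using h.PAlg_induction with
      | id c hc Z hZ =>
        rw [hs.id_right c hc Z _ hZ]
        exact (hs.mul_cst h hc (hs.id_right c hc Z Y hZ) X).symm
      | add X X' hX hX' => simp only [map_add, hX, hX']
      | smul c X hX => simp only [map_smul, hX]
      | pow l W hW Z hZ =>
        have hUV := h.star_mem hU hV
        have hVW := h.star_mem hV hW
        have e1 : legP (star X Y) = mp R F (genMat R F) (n + 1 + m) (U * shf (n + 1) V * sW _ R n) := by
          rw [hs.pow_left n U hU X Y hX, hY, h.mulPowL_mp hU hV]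
        have e2 : legP (star Y Z) = mp R F (genMat R F) (m + 1 + l) (V * shf (m + 1) W * sW _ R m) := by
          rw [hs.pow_left m V hV Y Z hY, hZ, h.mulPowL_mp hV hW]
        rw [hs.pow_left _ _ hUV _ Z e1, hZ, h.mulPowL_mp hUV hW, hs.pow_left n U hU X _ hX, e2,
          h.mulPowL_mp hU hVW, show n + 1 + (m + 1 + l) = n + 1 + m + 1 + l by omega]
        congr 1
        have c1 : Commute (sW (QMA R F) R n) (shf (n + 1 + m + 1) W) := by
          rw [show n + 1 + m + 1 = (n + 2) + m by omega, ← shf_shf]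
          exact shf_comm (h.sW_mem n) (shf_mem m hW)
        -- Both sides are `M^{α β^{↑} γ^{↑↑} s}` with a product `s` of two pure braids in either order.
        have c2 := h.braidSeq (A := QMA R F) |>.pureR_mul_pureR n m
        rw [← shf_pureR] at c2
        rw [show n + 1 + m = n + m + 1 by omega] at c1 ⊢
        calc _ = U * shf (n + 1) V * (sW _ R n * shf (n + m + 1 + 1) W) * sW _ R (n + m + 1) := by
              simp only [mul_assoc]
          _ = U * shf (n + 1) V * shf (n + m + 1 + 1) W * (sW _ R n * sW _ R (n + m + 1)) := by
              rw [c1.eq]; simp only [mul_assoc]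
          _ = _ := by
              rw [c2, map_mul, map_mul, shf_shf, show n + 1 + (m + 1) = n + m + 1 + 1 by omega]
              simp only [mul_assoc]

end Star

/-! ### Recursions for the matrices of the antisymmetrizers -/

section Recursions

variable {N : ℕ} {A : Type} [Ring A] [Algebra ℂ A] {R F : Op2 N} {q μ : ℂ}
  {M : Matrix (Fin N) (Fin N) A}

/-- The term linear in `t` of the expansion of `κ_s σ⁻_t(x) s⁻¹`. -/
lemma BMWPair.kap_mul_mul_inv' {B : Type*} [Ring B] [Algebra ℂ B] (hP : Params q μ) {s t : B}
    (h : BMWPair q μ s t) : kap q μ s * t * inv' q μ s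
      = kap q μ s * kap q μ t + ((q - q⁻¹) * μ⁻¹) • kap q μ s - (q - q⁻¹) • (kap q μ s * t) := by
  rw [inv', mul_add, mul_sub, mul_smul_comm, mul_smul_comm, mul_one, h.kap_mul_mul_kap hP, ← h.kk₄]
  module

lemma den_eq (hP : Params q μ) (i : ℕ) :
    q * μ⁻¹ * q⁻¹ ^ (2 * (i + 1)) + 1 = (μ * q ^ (2 * i + 1))⁻¹ * (1 + μ * q ^ (2 * i + 1)) := by
  have h1 := hP.q_ne
  have h3 := hP.mu_ne
  rw [inv_pow]
  field_simp
  ring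

/-- The coefficient of the generator in `q^i σ⁻(q^{-2i})`. -/
lemma bax_coeff_left (hP : Params q μ) (i : ℕ) :
    q ^ i * ((q⁻¹ ^ (2 * i) - 1) / (q - q⁻¹)) = - qNum q i := by
  have h1 := hP.q_ne
  rw [qNum, ← mul_div_assoc, ← neg_div, inv_pow, inv_pow]
  congr 1
  field_simp
  ring

/-- The coefficient of `κ` in `q^{i+1} σ⁻(q^{-2(i+1)})`. -/
lemma bax_coeff_right (hP : Params q μ) (i : ℕ) :
    q ^ (i + 1) * ((q⁻¹ ^ (2 * (i + 1)) - 1) / (q * μ⁻¹ * q⁻¹ ^ (2 * (i + 1)) + 1))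
      = - ((q - q⁻¹) * (μ * q ^ (2 * i + 1)) / (1 + μ * q ^ (2 * i + 1)) * qNum q (i + 1)) := by
  have h1 := hP.q_ne
  have h2 := hP.lam_ne
  have e3 : (q - q⁻¹) * (μ * q ^ (2 * i + 1)) / (1 + μ * q ^ (2 * i + 1)) * qNum q (i + 1)
      = - (q ^ (i + 1) * (q⁻¹ ^ (2 * (i + 1)) - 1)) * (μ * q ^ (2 * i + 1))
        / (1 + μ * q ^ (2 * i + 1)) := by
    have := bax_coeff_left hP (i + 1)
    rw [← mul_div_assoc, div_eq_iff h2] at this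
    rw [this]
    ring
  rw [e3, den_eq hP, ← mul_div_assoc, neg_mul, neg_div, neg_neg, ← div_div, div_inv_eq_mul]

variable (q μ) in
/-- The antisymmetrizer on the strands `0, …, i - 1`. -/
def asymF (A : Type) [Ring A] [Algebra ℂ A] (R : Op2 N) (i : ℕ) : Fam N A := asym q μ (gen A R) i

lemma asymF_mem (i : ℕ) : asymF q μ A R i ∈ strands (gen A R) i :=
  asym_mem_of fun _ hj => gen_mem hj

lemma shf_asymF (m i : ℕ) : shf m (asymF q μ A R i) = asym q μ (fun j => gen A R (j + m)) i := by
  rw [asymF, map_asym]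
  simp only [shf_gen]

lemma shf_kap (m i : ℕ) : shf m (kap q μ (gen A R i)) = kap q μ (gen A R (i + m)) := by
  rw [map_kap, shf_gen]

variable (R F q μ M) in
/-- The matrix `(i+1)_q M^{a^{(i+1)}}`. -/
def vecA (i : ℕ) : Chain N A := qNum q (i + 1) • mp R F M i (asymF q μ A R (i + 1))

variable (R F q μ M) in
/-- The matrix `(i+1)_q M^{a^{(i+1)↑1} κ₁}`. -/
def vecB (i : ℕ) : Chain N A :=
  qNum q (i + 1) • mp R F M (i + 1) (shf 1 (asymF q μ A R (i + 1)) * kap q μ (gen A R 0))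

variable (h : Setup R F q μ)
include h

/-- `M ⋆ M^α = M^{α^{↑1} σ₁}`. -/
lemma Setup.mulPowL_one_mp {n : ℕ} {X : Fam N A} (hX : X ∈ strands (gen A R) (n + 1)) :
    mulPowL R F M 0 1 (mp R F M n X) = mp R F M (n + 1) (shf 1 X * gen A R 0) := by
  rw [h.mulPowL_mp (one_mem _) hX, one_mul, sW, pureR_zero, zero_add, add_comm 1 n]

/-- `M^{α^{↑1}} = M ch(α)`. -/
lemma Setup.mp_shf_one {n : ℕ} {X : Fam N A} (hX : X ∈ strands (gen A R) (n + 1)) :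
    mp R F M (n + 1) (shf 1 X) = mp R F M 0 1 * chf R F M n X := by
  rw [← h.mp_juxt (one_mem _) hX, one_mul, zero_add, add_comm 1 n]

variable [NeZero N] (hM : Commute (opN A R 0) (Mc F M 0 * Mc F M 1))
include hM

/-- `M^{α^{↑2} κ₁ κ₂} = M^α g`. -/
lemma Setup.mp_kap_kap {n : ℕ} {X : Fam N A} (hX : X ∈ strands (gen A R) (n + 1)) :
    mp R F M (n + 2) (shf 2 X * kap q μ (gen A R 0) * kap q μ (gen A R 1))
      = mp R F M n X * Gc R F q μ M := by
  have hP := h.params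
  obtain ⟨c, hc, -, -⟩ := h.mp_kap_aux hM
  have hk : kap q μ (gen A R 0) ∈ strands (gen A R) (1 + 1) := kap_mem_of (gen_mem (by omega))
  have p : BMWPair q μ (gen A R 0) (gen A R 1) := (h.bmwSeq (A := A) 2).pair 0 (by omega)
  -- `M^{κ₁} ⋆ M^α` is computed twice: through `M^{κ₁} = μ⁻¹ g I` and through the exponent of the product.
  have e := h.mulPowR_mp hM hk hX
  rw [h.mp_kap hM, hc, ← map_smul, h.mulPowR_cst hX, h.mulPowL_mp hk hX] at e
  have c1 : Commute (kap q μ (gen A R 0)) (shf 2 X) := shf_comm hk hX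
  have e2 : kap q μ (gen A R 0) * shf (1 + 1) X * sW A R 1
      = μ⁻¹ • (shf 2 X * kap q μ (gen A R 0) * kap q μ (gen A R 1)) := by
    rw [sW, pureR_succ, pureR_zero, h.gen_inv, c1.eq, zero_add, mul_assoc (shf 2 X),
      ← mul_assoc (kap q μ (gen A R 0)), ← mul_assoc (kap q μ (gen A R 0)), ← p.kk₄,
      mul_assoc (kap q μ (gen A R 0)), kap_mul_inv' hP p.cubic_right, mul_smul_comm, mul_smul_comm,
      mul_assoc]
  rw [e2, map_smul, map_smul, mul_smul_comm, show 1 + 1 + n = n + 2 by omega] at e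
  rw [hc]
  exact (smul_right_injective _ (inv_ne_zero hP.mu_ne) e).symm

/-- The relation `σ₁ κ₂ = σ₂⁻¹ κ₁ κ₂` under the partial trace; operators that do not involve the first strand
are moved by cyclicity. -/
lemma Setup.mp_mul_kap_gen {n : ℕ} {W : Fam N A} (hW : W ∈ strands (gen A R) (n + 1)) :
    mp R F M (n + 2) (shf 2 W * kap q μ (gen A R 1) * gen A R 0)
      = mp R F M (n + 2) (kap q μ (gen A R 0) * kap q μ (gen A R 1) * shf 2 W
        * inv' q μ (gen A R 1)) := by
  have hP := h.params
  have p : BMWPair q μ (gen A R 0) (gen A R 1) := (h.bmwSeq (A := A) 2).pair 0 (by omega)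
  have c1 : Commute (gen A R 0) (shf 2 W) := shf_comm (gen_mem (n := 2) (by omega)) hW
  have hg : gen A R 0 ∈ strands (gen A R) (n + 2) := gen_mem (by omega)
  have hW1 : shf 1 W ∈ strands (gen A R) (n + 2) := shf_mem 1 hW
  have i1 : shf 2 W * kap q μ (gen A R 1) = shf 1 (shf 1 W * kap q μ (gen A R 0)) := by
    rw [map_mul, shf_shf, shf_kap]
  have i2 : shf 2 W * inv' q μ (gen A R 1) = shf 1 (shf 1 W * inv' q μ (gen A R 0)) := by
    rw [map_mul, shf_shf, map_inv', shf_gen]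
  rw [i1, h.mp_cyclic hM (mul_mem hW1 (kap_mem_of hg)), ← i1, ← mul_assoc, c1.eq, mul_assoc,
    p.symm.mul_kap_eq hP, ← mul_assoc, i2, h.mp_cyclic hM (mul_mem hW1 (inv'_mem_of hg)), ← i2,
    ← mul_assoc]

variable {k : ℕ} (hk : ParamsUpTo q μ k)
include hk

omit [NeZero N] hM in
lemma Setup.asymF_idem {i : ℕ} (hi : i ≤ k) :
    asymF q μ A R i * asymF q μ A R i = asymF q μ A R i :=
  (asym_absorb h.params hk (h.bmwSeq i) hi (by omega)).1

/-- The relation between consecutive antisymmetrizers; for `i + 1 = k` the left hand side vanishes for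
an R-matrix of type `Sp(2k)`. -/
lemma Setup.mp_asymF_bax {i : ℕ} (hi : i + 1 ≤ k) :
    q ^ (i + 1) • mp R F M (i + 1) (shf 1 (asymF q μ A R (i + 1))
        * bax q μ (gen A R 0) (q⁻¹ ^ (2 * (i + 1))) * shf 1 (asymF q μ A R (i + 1)))
      = q ^ (i + 1) • (mp R F M 0 1 * chf R F M i (asymF q μ A R (i + 1)))
        - mulPowL R F M 0 1 (vecA R F q μ M i)
        - ((q - q⁻¹) * (μ * q ^ (2 * i + 1)) / (1 + μ * q ^ (2 * i + 1))) • vecB R F q μ M i := by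
  have hP := h.params
  have ha : asymF q μ A R (i + 1) ∈ strands (gen A R) (i + 1) := asymF_mem _
  rw [mul_assoc, h.mp_cyclic hM ha, mul_assoc, ← map_mul, h.asymF_idem hk hi,
    ← h.mp_cyclic hM ha, bax, mul_add, mul_add, mul_one, mul_smul_comm, mul_smul_comm, map_add,
    map_add, map_smul, map_smul, h.mp_shf_one ha, vecA, map_smul, h.mulPowL_one_mp ha, vecB]
  have e1 := bax_coeff_left hP (i + 1)
  have e2 := bax_coeff_right hP i
  rw [smul_add, smul_add, smul_smul, smul_smul, e1, e2]
  module

/-- The recursion for the matrices `i_q M^{a^{(i)}}`; it comes from the recursion for the antisymmetrizers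
that adds a strand on the left. -/
lemma Setup.vecA_succ {i : ℕ} (hi : i + 2 ≤ k) :
    vecA R F q μ M (i + 1)
      = q ^ (i + 1) • (mp R F M 0 1 * chf R F M i (asymF q μ A R (i + 1)))
        - mulPowL R F M 0 1 (vecA R F q μ M i)
        - ((q - q⁻¹) * (μ * q ^ (2 * i + 1)) / (1 + μ * q ^ (2 * i + 1))) • vecB R F q μ M i := by
  have hq := hk.qNum_ne (i + 2) (by omega) hi
  rw [← h.mp_asymF_bax hM hk (by omega), vecA, asymF, asym_succ_left h.params hk (h.bmwSeq _) hi,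
    map_smul, smul_smul, mul_div_cancel₀ _ hq, shf_asymF]

/-- The recursion for the matrices `i_q M^{a^{(i)↑1} κ₁}`. -/
lemma Setup.mulPowL_vecB_succ {i : ℕ} (hi : i + 2 ≤ k) :
    mulPowL R F M 0 1 (vecB R F q μ M (i + 1))
      = (μ⁻¹ * q⁻¹ ^ (i + 1)) • (mp R F M 0 1 * chf R F M i (asymF q μ A R (i + 1)) * Gc R F q μ M)
        - vecB R F q μ M i * Gc R F q μ M
        + ((q - q⁻¹) / (1 + μ * q ^ (2 * i + 1))) •
          (mulPowL R F M 0 1 (vecA R F q μ M i) * Gc R F q μ M) := by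
  have hP := h.params
  have hq := hk.qNum_ne (i + 2) (by omega) hi
  have ha : asymF q μ A R (i + 1) ∈ strands (gen A R) (i + 1) := asymF_mem _
  have ha1 : shf 1 (asymF q μ A R (i + 1)) ∈ strands (gen A R) (i + 2) := shf_mem 1 ha
  have ha2 : asymF q μ A R (i + 2) ∈ strands (gen A R) (i + 2) := asymF_mem _
  have hseq := h.bmwSeq (A := A) 4
  have p : BMWPair q μ (gen A R 1) (gen A R 2) := hseq.pair 1 (by omega)
  have hg : ∀ {j n}, j + 1 < n → gen A R j ∈ strands (gen A R) n := fun hj => gen_mem hj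
  set b := shf 3 (asymF q μ A R (i + 1)) with hb
  have hb1 : b = shf 1 (shf 2 (asymF q μ A R (i + 1))) := by rw [hb, shf_shf]
  have hb2 : b = shf 2 (shf 1 (asymF q μ A R (i + 1))) := by rw [hb, shf_shf]
  have hbb : b * b = b := by rw [hb, ← map_mul, h.asymF_idem hk (by omega)]
  have hbc : ∀ {Z : Fam N A}, Z ∈ strands (gen A R) 3 → Commute Z b := fun hZ => shf_comm hZ ha
  have c0 := hbc (kap_mem_of (q := q) (μ := μ) (hg (j := 0) (by omega)))
  have c1 := hbc (kap_mem_of (q := q) (μ := μ) (hg (j := 1) (by omega)))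
  have c2 := hbc (hg (j := 0) (by omega))
  -- By cyclicity the factor `b` on the right is moved to the left and absorbed there.
  have e1 : shf 2 (asymF q μ A R (i + 2)) = (q ^ (i + 1) / qNum q (i + 2)) •
      (b * bax q μ (gen A R 2) (q⁻¹ ^ (2 * (i + 1))) * b) := by
    rw [asymF, asym_succ_left hP hk (h.bmwSeq _) hi, ← shf_asymF, map_smul, map_mul, map_mul,
      map_bax, shf_shf, shf_gen]
  have e2 : mulPowL R F M 0 1 (vecB R F q μ M (i + 1)) = q ^ (i + 1) • mp R F M (i + 1 + 2)
      (b * bax q μ (gen A R 2) (q⁻¹ ^ (2 * (i + 1))) * kap q μ (gen A R 1) * gen A R 0) := by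
    rw [vecB, map_smul, h.mulPowL_one_mp (mul_mem (shf_mem 1 ha2) (kap_mem_of (hg (by omega)))),
      map_mul (shf 1), shf_shf, shf_kap, e1, smul_mul_assoc, smul_mul_assoc, map_smul, smul_smul,
      mul_div_cancel₀ _ hq, mul_assoc, mul_assoc, mul_assoc b]
    congr 1
    rw [← mul_assoc b (kap q μ _), ← c1.eq, mul_assoc _ b, ← c2.eq]
    simp only [← mul_assoc]
    nth_rw 2 [hb1]
    rw [← h.mp_cyclic hM (shf_mem 2 ha), ← hb1]
    simp only [← mul_assoc, hbb]
  have r2 : gen A R 2 = shf 2 (gen A R 0) := by rw [shf_gen]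
  -- The three contractions to which the expansion of `kb` reduces the left hand side.
  have t0 : mp R F M (i + 1 + 2) (b * kap q μ (gen A R 0) * kap q μ (gen A R 1))
      = mp R F M 0 1 * chf R F M i (asymF q μ A R (i + 1)) * Gc R F q μ M := by
    rw [hb2, h.mp_kap_kap hM ha1, h.mp_shf_one ha]
  have tt : ∀ z, z ∈ strands (gen A R) (i + 1 + 1) → mp R F M (i + 1 + 2)
      (b * kap q μ (gen A R 0) * kap q μ (gen A R 1) * shf 2 z)
      = mp R F M (i + 1) (shf 1 (asymF q μ A R (i + 1)) * z) * Gc R F q μ M := by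
    intro z hz
    have cz : Commute (kap q μ (gen A R 0)) (shf 2 z) :=
      shf_comm (kap_mem_of (hg (n := 2) (by omega))) hz
    rw [show shf 2 z = shf 1 (shf 1 z) by rw [shf_shf], ← h.mp_cyclic hM (shf_mem 1 hz), shf_shf]
    have e : shf 2 z * (b * kap q μ (gen A R 0) * kap q μ (gen A R 1))
        = shf 2 (z * shf 1 (asymF q μ A R (i + 1))) * kap q μ (gen A R 0) * kap q μ (gen A R 1) := by
      rw [map_mul, ← hb2]; simp only [mul_assoc]
    rw [e, h.mp_kap_kap hM (mul_mem hz ha1), ← h.mp_cyclic hM ha]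
  have w : ∀ z, z ∈ strands (gen A R) (i + 1 + 1) → mp R F M (i + 1 + 2)
      (b * shf 2 z * kap q μ (gen A R 1) * gen A R 0) = mp R F M (i + 1 + 2)
      (b * kap q μ (gen A R 0) * (kap q μ (gen A R 1) * shf 2 z * inv' q μ (gen A R 1))) := by
    intro z hz
    rw [hb2, ← map_mul (shf 2), h.mp_mul_kap_gen hM (mul_mem ha1 hz), map_mul (shf 2), ← hb2]
    congr 1
    rw [← mul_assoc _ b, mul_assoc _ _ b, c1.eq, ← mul_assoc _ b, c0.eq]
    simp only [mul_assoc]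
  have hg0 : gen A R 0 ∈ strands (gen A R) (i + 1 + 1) := hg (by omega)
  have k2 : kap q μ (gen A R 2) = shf 2 (kap q μ (gen A R 0)) := by rw [shf_kap]
  have kb : kap q μ (gen A R 1) * bax q μ (gen A R 2) (q⁻¹ ^ (2 * (i + 1))) * inv' q μ (gen A R 1)
      = μ⁻¹ • kap q μ (gen A R 1)
        + ((q⁻¹ ^ (2 * (i + 1)) - 1) / (q - q⁻¹)) • (kap q μ (gen A R 1) * kap q μ (gen A R 2)
          + ((q - q⁻¹) * μ⁻¹) • kap q μ (gen A R 1) - (q - q⁻¹) • (kap q μ (gen A R 1) * gen A R 2))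
        + ((q⁻¹ ^ (2 * (i + 1)) - 1) / (q * μ⁻¹ * q⁻¹ ^ (2 * (i + 1)) + 1)) •
          (kap q μ (gen A R 1) * gen A R 2) := by
    rw [bax, mul_add, mul_add, add_mul, add_mul, mul_one, mul_smul_comm, mul_smul_comm,
      smul_mul_assoc, smul_mul_assoc, p.kap_mul_mul_inv' hP, ← p.kap_mul_eq hP,
      kap_mul_inv' hP p.cubic_left]
  have e1 := bax_coeff_left hP (i + 1)
  have e3 := bax_coeff_right hP i
  have e4 : (μ⁻¹ * q⁻¹ ^ (i + 1)) = μ⁻¹ * (q ^ (i + 1) - (q - q⁻¹) * qNum q (i + 1)) := by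
    rw [qNum, mul_div_cancel₀ _ hP.lam_ne]; ring
  have e5 : ((q - q⁻¹) / (1 + μ * q ^ (2 * i + 1))) = (q - q⁻¹)
      - (q - q⁻¹) * (μ * q ^ (2 * i + 1)) / (1 + μ * q ^ (2 * i + 1)) := by
    have h5 : 1 + μ * q ^ (2 * i + 1) ≠ 0 := by
      intro h0
      exact hk.den_ne (i + 1) (by omega) (by omega) (by rw [den_eq hP, h0, mul_zero])
    field_simp
    ring
  have t1 := tt _ hg0
  have t2 := tt _ (kap_mem_of (q := q) (μ := μ) hg0)
  rw [← h.mulPowL_one_mp ha, ← r2] at t1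
  rw [← k2] at t2
  have w' := w _ (bax_mem_of (q := q) (μ := μ) hg0 (q⁻¹ ^ (2 * (i + 1))))
  rw [map_bax, ← r2, kb] at w'
  generalize q⁻¹ ^ (2 * (i + 1)) = x at e1 e2 e3 w'
  simp only [mul_add, mul_sub, mul_smul_comm, ← mul_assoc, map_add, map_sub, map_smul] at w'
  rw [t0, t1, t2] at w'
  rw [e2, vecA, vecB, map_smul, e4, e5, smul_mul_assoc, smul_mul_assoc]
  generalize mulPowL R F M 0 1 (mp R F M i (asymF q μ A R (i + 1))) * Gc R F q μ M = v2 at *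
  generalize mp R F M 0 1 * chf R F M i (asymF q μ A R (i + 1)) * Gc R F q μ M = v0 at *
  generalize mp R F M (i + 1) (shf 1 (asymF q μ A R (i + 1)) * kap q μ (gen A R 0)) * Gc R F q μ M
    = v1 at *
  linear_combination (norm := module) q ^ (i + 1) • w' + e1 • (v1 + ((q - q⁻¹) * μ⁻¹) • v0 - (q - q⁻¹) • v2)
    + e3 • v2

end Recursions

/-! ### The Cayley-Hamilton identity -/

section Telescope

variable {V : Type*} [AddCommGroup V] [Module ℂ V] (q : ℂ) (Y G : Module.End ℂ V) (w : ℕ → V)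

/-- The partial sums `∑_{j ≤ i} (-q)^j Y^{i-j} w_j`. -/
def partP : ℕ → V
  | 0 => w 0
  | i + 1 => Y (partP i) + (-q) ^ (i + 1) • w (i + 1)

/-- The sums `∑_{m < i} (q² G)^{i-1-m} P_m`. -/
def partE : ℕ → V
  | 0 => 0
  | i + 1 => partP q Y w i + q ^ 2 • G (partE i)

lemma partP_eq (i : ℕ) :
    partP q Y w i = ∑ j ∈ Finset.range (i + 1), (-q) ^ j • (Y ^ (i - j)) (w j) := by
  induction i with
  | zero => simp [partP]
  | succ i ih =>
    rw [partP, ih, Finset.sum_range_succ _ (i + 1), map_sum]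
    congr 1
    · refine Finset.sum_congr rfl fun j hj => ?_
      have : j ≤ i := by simpa [Nat.lt_succ_iff] using hj
      rw [map_smul, Nat.succ_sub this, pow_succ', Module.End.mul_apply]
    · simp

lemma partE_eq (i : ℕ) :
    partE q Y G w i = ∑ m ∈ Finset.range i, (q ^ 2) ^ (i - 1 - m) • (G ^ (i - 1 - m)) (partP q Y w m) := by
  induction i with
  | zero => simp [partE]
  | succ i ih =>
    rw [partE, ih, Finset.sum_range_succ, map_sum, Finset.smul_sum, add_comm]
    congr 1
    · refine Finset.sum_congr rfl fun m hm => ?_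
      have : m < i := by simpa using hm
      rw [show i + 1 - 1 - m = i - 1 - m + 1 by omega, map_smul, smul_smul, pow_succ' (q ^ 2),
        pow_succ' G, Module.End.mul_apply]
    · simp

/-- The solution of the recursions for `M^{a^{(i)}}` and `M^{a^{(i)↑1} κ₁}`. Here `Y` stands for
`(M ⋆ -)²`, `G` for the multiplication by `g`, and `w i` for `M^{\bar i} a_i`. -/
lemma telescope {q} {μ : ℂ} (hP : Params q μ) {k : ℕ} {α β : ℕ → V}
    (hd : ∀ n, n + 1 ≤ k → 1 + μ * q ^ (2 * n + 1) ≠ 0) (hYG : ∀ v, Y (G v) = G (Y v))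
    (hα₀ : 1 ≤ k → α 0 = q • w 1 - Y (w 0)
      - ((q - q⁻¹) * (μ * q) / (1 + μ * q) * μ⁻¹) • G (w 0))
    (hβ₀ : 2 ≤ k → β 0 = (μ⁻¹ * q⁻¹) • G (w 1) - μ⁻¹ • G (G (w 0))
      + ((q - q⁻¹) / (1 + μ * q)) • G (Y (w 0)))
    (hα : ∀ n, n + 2 ≤ k → α (n + 1) = q ^ (n + 2) • w (n + 2) - Y (α n)
      - ((q - q⁻¹) * (μ * q ^ (2 * n + 3)) / (1 + μ * q ^ (2 * n + 3))) • β n)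
    (hβ : ∀ n, n + 3 ≤ k → β (n + 1) = (μ⁻¹ * q⁻¹ ^ (n + 2)) • G (w (n + 2)) - G (β n)
      + ((q - q⁻¹) / (1 + μ * q ^ (2 * n + 3))) • G (Y (α n))) (n : ℕ) :
    (n + 1 ≤ k → α n = (-1 : ℂ) ^ (n + 1) • (partP q Y w (n + 1)
      + ((q - q⁻¹) * q / (1 + μ * q ^ (2 * n + 1))) • G (partE q Y G w (n + 1)))) ∧
    (n + 2 ≤ k → β n = ((-1) ^ n * μ⁻¹ * q⁻¹ ^ (2 * n + 2)) • (- G (partE q Y G w (n + 2))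
      + ((1 + μ * q ^ (2 * n + 3)) / (1 + μ * q ^ (2 * n + 1))) • G (Y (partE q Y G w (n + 1))))) := by
  have h1 := hP.q_ne
  have h3 := hP.mu_ne
  have hs : ∀ n : ℕ, (-q) ^ n = (-1) ^ n * q ^ n := fun n => by rw [← mul_pow, neg_one_mul]
  induction n with
  | zero =>
    refine ⟨fun hk => ?_, fun hk => ?_⟩
    · have hd0 := hd 0 hk
      rw [hα₀ hk]
      simp only [partP, partE, map_zero, map_add, map_smul]
      simp only [mul_zero, zero_add, pow_one] at hd0 ⊢
      generalize e0 : 1 + μ * q = d0 at *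
      match_scalars <;> field_simp
    · have hd0 := hd 0 (by omega)
      rw [hβ₀ hk]
      simp only [partP, partE, map_zero, map_add, map_smul]
      simp only [mul_zero, zero_add, pow_one] at hd0 ⊢
      generalize e0 : 1 + μ * q = d0 at *
      match_scalars <;> field_simp
      simp only [← e0]
      ring
  | succ n ih =>
    refine ⟨fun hk => ?_, fun hk => ?_⟩
    · have hd0 := hd n (by omega)
      have hd1 := hd (n + 1) hk
      rw [show 2 * (n + 1) + 1 = 2 * n + 3 by ring] at hd1
      rw [hα n hk, ih.1 (by omega), ih.2 (by omega), show 2 * (n + 1) + 1 = 2 * n + 3 by ring]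
      simp only [partP, partE, map_add, map_smul, hYG, hs, inv_pow, pow_succ (-1 : ℂ)]
      generalize e0 : 1 + μ * q ^ (2 * n + 1) = d0 at *
      generalize e1 : 1 + μ * q ^ (2 * n + 3) = d1 at *
      rcases neg_one_pow_eq_or ℂ n with h0 | h0 <;> rw [h0] <;> match_scalars <;> field_simp <;>
        (try simp only [← e0, ← e1]) <;> ring
    · have hd0 := hd n (by omega)
      have hd1 := hd (n + 1) (by omega)
      rw [show 2 * (n + 1) + 1 = 2 * n + 3 by ring] at hd1
      rw [hβ n hk, ih.1 (by omega), ih.2 (by omega), show 2 * (n + 1) + 1 = 2 * n + 3 by ring]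
      simp only [partP, partE, map_add, map_smul, map_neg, hYG, hs, inv_pow, pow_succ (-1 : ℂ)]
      generalize e0 : 1 + μ * q ^ (2 * n + 1) = d0 at *
      generalize e1 : 1 + μ * q ^ (2 * n + 3) = d1 at *
      rcases neg_one_pow_eq_or ℂ n with h0 | h0 <;> rw [h0] <;> match_scalars <;> field_simp <;>
        (try simp only [← e0, ← e1]) <;> ring

/-- The telescoped recursion written out as the left hand side of the Cayley-Hamilton identity. -/
lemma partE_expand {X : Module.End ℂ V} (hXG : Commute X G) (a : ℕ → V) (k : ℕ) :
    partE q (X ^ 2) G (fun i => (X ^ i) (a i)) (k + 1)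
      = ∑ i ∈ Finset.range (2 * k + 1), (-q) ^ i • (X ^ (2 * k - i))
        (∑ j ∈ Finset.range (min i (2 * k - i) / 2 + 1),
          (G ^ (j + (i - k))) (a (i - 2 * (j + (i - k))))) := by
  have e : ∀ m, m ≤ k → ∀ j, j ≤ m → (q ^ 2) ^ (k - m) • (G ^ (k - m))
      ((-q) ^ j • ((X ^ 2) ^ (m - j)) ((X ^ j) (a j)))
      = (-q) ^ (2 * (k - m) + j) • (X ^ (2 * m - j)) ((G ^ (k - m)) (a j)) := by
    intro m hm j hj
    rw [map_smul, smul_smul, ← Module.End.mul_apply, ← Module.End.mul_apply, ← pow_mul, ← pow_mul,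
      mul_assoc, ← pow_add, show 2 * (m - j) + j = 2 * m - j by omega, ← Module.End.mul_apply,
      (hXG.pow_pow _ _).eq, pow_add (-q), pow_mul (-q), neg_sq, pow_mul q 2]
  simp only [partE_eq, partP_eq, map_sum, Finset.smul_sum, Nat.add_sub_cancel]
  rw [Finset.sum_sigma', Finset.sum_sigma']
  -- The term of `P_m` with the index `j` belongs to `ε_i` with `i = 2(k - m) + j`.
  refine Finset.sum_bij' (fun p _ => ⟨2 * (k - p.1) + p.2, if 2 * (k - p.1) + p.2 ≤ k then k - p.1
      else p.1 - p.2⟩) (fun p _ => ⟨k - (p.2 + (p.1 - k)), p.1 - 2 * (p.2 + (p.1 - k))⟩) ?_ ?_ ?_ ?_ ?_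
  · rintro ⟨m, j⟩ hp
    simp only [Finset.mem_sigma, Finset.mem_range] at hp ⊢
    split_ifs <;> omega
  · rintro ⟨m, j⟩ hp
    simp only [Finset.mem_sigma, Finset.mem_range] at hp ⊢
    omega
  · rintro ⟨m, j⟩ hp
    simp only [Finset.mem_sigma, Finset.mem_range] at hp
    simp only [Sigma.mk.injEq, heq_eq_eq]
    split_ifs <;> omega
  · rintro ⟨m, j⟩ hp
    simp only [Finset.mem_sigma, Finset.mem_range] at hp
    simp only [Sigma.mk.injEq, heq_eq_eq]
    split_ifs <;> omega
  · rintro ⟨m, j⟩ hp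
    simp only [Finset.mem_sigma, Finset.mem_range] at hp
    simp only
    rw [e m (by omega) j (by omega)]
    have e1 : (if 2 * (k - m) + j ≤ k then k - m else m - j) + (2 * (k - m) + j - k) = k - m := by
      split_ifs <;> omega
    rw [e1, show 2 * (k - m) + j - 2 * (k - m) = j by omega,
      show 2 * k - (2 * (k - m) + j) = 2 * m - j by omega]

end Telescope

section CayleyHamilton

variable {N : ℕ} {R F : Op2 N} {q μ : ℂ} [NeZero N] (h : Setup R F q μ)
include h

lemma Setup.cst_elemA_succ (i : ℕ) : cst N (QMA R F) (elemA R F q μ (i + 1) : QMA R F)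
    = chf R F (genMat R F) i (asymF q μ (QMA R F) R (i + 1)) := by
  rw [elemA, h.cst_ch, antisym_eq, map_asym, asymF]
  congr 1
  exact asym_congr fun j hj => by rw [zero_add, famHom_opAt _ (by omega)]

lemma Setup.cst_contr : cst N (QMA R F) (contr R F q μ : QMA R F) = Gc R F q μ (genMat R F) := by
  have : (contr R F q μ : QMA R F) = (eta q μ)⁻¹ • ch R F 1 (opK R q μ 2 0) := rfl
  rw [this, map_smul, h.cst_ch, Gc, show opK R q μ 2 0 = kap q μ (opAt 2 R 0) from rfl, map_kap,
    famHom_opAt _ (by omega)]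

omit [NeZero N] h in
/-- A formula for `ε_i` that is uniform in `i ≤ 2k`. -/
lemma eps_eq {k i : ℕ} (hi : i ≤ 2 * k) : eps R F q μ k i
    = ∑ j ∈ Finset.range (min i (2 * k - i) / 2 + 1),
      elemA R F q μ (i - 2 * (j + (i - k))) * contr R F q μ ^ (j + (i - k)) := by
  rw [eps]
  split_ifs with hk
  · rw [min_eq_left (by omega), Nat.sub_eq_zero_of_le hk]
    rfl
  · rw [min_eq_right (by omega), Finset.sum_mul]
    refine Finset.sum_congr rfl fun j hj => ?_
    rw [Finset.mem_range] at hj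
    rw [mul_assoc, ← pow_add, show 2 * k - i - 2 * j = i - 2 * (j + (i - k)) by omega]

omit [NeZero N] in
lemma Setup.mulPowL_pow_cst (n : ℕ) (c : QMA R F) :
    (mulPowL R F (genMat R F) 0 1 ^ n) (cst N _ c)
      = (mulPowL R F (genMat R F) 0 1 ^ n) 1 * cst N _ c := by
  induction n with
  | zero => simp
  | succ n ih =>
    rw [pow_succ', Module.End.mul_apply, ih, h.mulPowL_cst_mul, Module.End.mul_apply]

/-- The Cayley-Hamilton identity. -/
theorem Setup.cayley_hamilton {k : ℕ} (hk : ParamsUpTo q μ k) (hk2 : 2 ≤ k)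
    (hμ : μ = -q⁻¹ ^ (2 * k + 1))
    (hv : shf 1 (asymF q μ (QMA R F) R k) * bax q μ (gen _ R 0) (q⁻¹ ^ (2 * k))
      * shf 1 (asymF q μ (QMA R F) R k) = 0) :
    ∑ i ∈ Finset.range (2 * k + 1), (-q) ^ i •
      ((mulPowL R F (genMat R F) 0 1 ^ (2 * k - i)) 1 * cst N _ (eps R F q μ k i : QMA R F)) = 0 := by
  have hP := h.params
  have h1 := hP.q_ne
  have hM := h.gen_rel
  set X := mulPowL R F (genMat R F) 0 1 with hX
  set G : Module.End ℂ (Chain N (QMA R F)) := LinearMap.mulRight ℂ (Gc R F q μ (genMat R F)) with hG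
  set a : ℕ → Chain N (QMA R F) := fun i => cst N _ (elemA R F q μ i : QMA R F) with ha
  have hGc := h.cst_contr
  have hXG' : ∀ v, X (G v) = G (X v) := fun v => by
    change X (v * _) = X v * _
    rw [← hGc, h.mulPowL_cst_mul]
  have hXG : Commute X G := LinearMap.ext hXG'
  have hd : ∀ n, n + 1 ≤ k → 1 + μ * q ^ (2 * n + 1) ≠ 0 := fun n hn h0 =>
    hk.den_ne (n + 1) (by omega) hn (by rw [den_eq hP, h0, mul_zero])
  have hXa : ∀ i, mp R F (genMat R F) 0 1 * chf R F (genMat R F) i (asymF q μ (QMA R F) R (i + 1))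
      = X (a (i + 1)) := fun i => by
    rw [← h.cst_elemA_succ, hX, h.mulPowL_cst (one_mem _)]
  have hXn : ∀ n v, (X ^ (n + 1)) v = (X ^ n) (X v) := fun n v => by
    rw [pow_succ, Module.End.mul_apply]
  have hX2 : ∀ n v, (X ^ n) (X (X v)) = (X ^ 2) ((X ^ n) v) := fun n v => by
    rw [← hXn, ← hXn, ← Module.End.mul_apply, ← pow_add, add_comm 2]
  have hX2' : ∀ n v, (X ^ (n + 1)) (X v) = (X ^ 2) ((X ^ n) v) := fun n v => by rw [hXn, hX2]
  have hXnG : ∀ n v, (X ^ n) (G v) = G ((X ^ n) v) := fun n v =>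
    LinearMap.congr_fun (hXG.pow_left n).eq v
  have a0 : a 0 = 1 := by rw [ha]; simp [elemA]
  set w : ℕ → Chain N (QMA R F) := fun i => (X ^ i) (a i) with hw
  -- The antisymmetrizer of order `k + 1` need not exist, since `(k + 1)_q` may vanish. By `hv` the
  -- recursion remains valid if zero is put in its place.
  set A' : ℕ → Chain N (QMA R F) := fun i => if i < k then vecA R F q μ (genMat R F) i else 0 with hA'
  have hrec : ∀ i, i + 1 ≤ k → A' (i + 1) = q ^ (i + 1) • X (a (i + 1)) - X (A' i)
      - ((q - q⁻¹) * (μ * q ^ (2 * i + 1)) / (1 + μ * q ^ (2 * i + 1))) •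
        vecB R F q μ (genMat R F) i := by
    intro i hi
    rw [hA']
    simp only
    rw [if_pos (show i < k by omega)]
    split_ifs with h2
    · rw [h.vecA_succ hM hk (by omega), hXa]
    · obtain rfl : i + 1 = k := by omega
      have := h.mp_asymF_bax hM hk hi
      rwa [hv, map_zero, smul_zero, hXa] at this
  have hA0 : A' 0 = X 1 := by
    rw [hA']
    simp only
    rw [if_pos (by omega), vecA, hX, show qNum q (0 + 1) = 1 by simp [qNum, hP.lam_ne], one_smul,
      show (1 : Chain N (QMA R F)) = cst N _ 1 by rw [map_one], h.mulPowL_cst (one_mem _), map_one (cst N _),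
      mul_one]
    rfl
  have hB0 : vecB R F q μ (genMat R F) 0 = μ⁻¹ • G 1 := by
    have e : shf 1 (asymF q μ (QMA R F) R (0 + 1)) = 1 := map_one _
    rw [vecB, e, one_mul, h.mp_kap hM, show qNum q (0 + 1) = 1 by simp [qNum, hP.lam_ne], one_smul,
      hG, LinearMap.mulRight_apply, one_mul]
  have hBrec : ∀ i, i + 2 ≤ k → X (vecB R F q μ (genMat R F) (i + 1))
      = (μ⁻¹ * q⁻¹ ^ (i + 1)) • G (X (a (i + 1))) - G (vecB R F q μ (genMat R F) i)
        + ((q - q⁻¹) / (1 + μ * q ^ (2 * i + 1))) • G (X (A' i)) := by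
    intro i hi
    rw [hX, h.mulPowL_vecB_succ hM hk hi, hXa, hA']
    simp only
    rw [if_pos (show i < k by omega)]
    rfl
  obtain ⟨n, rfl⟩ : ∃ n, k = n + 1 := ⟨k - 1, by omega⟩
  have key := (telescope (X ^ 2) G w hP (k := n + 1) (α := fun n => (X ^ n) (A' (n + 1)))
    (β := fun n => (X ^ (n + 1)) (vecB R F q μ (genMat R F) (n + 1))) hd
    (fun v => hXnG 2 v) ?_ ?_ ?_ ?_ n).1 le_rfl
  · have hz : A' (n + 1) = 0 := by rw [hA']; simp
    rw [hz, map_zero] at key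
    -- For `μ = -q^{-1-2k}` the coefficient of the last step is the one in the recursion for `partE`.
    have e2 : (q - q⁻¹) * q / (1 + μ * q ^ (2 * n + 1)) = q ^ 2 := by
      have h0 := hd n le_rfl
      have : μ * q ^ (2 * n + 1) = - q⁻¹ ^ 2 := by
        rw [hμ, inv_pow, inv_pow]; field_simp; ring
      rw [this] at h0 ⊢
      rw [div_eq_iff h0]
      field_simp
      ring
    rw [e2] at key
    have key2 : partE q (X ^ 2) G w (n + 1 + 1) = 0 := by
      rw [partE]
      rcases smul_eq_zero.1 key.symm with h0 | h0
      · exact absurd h0 (pow_ne_zero _ (by norm_num))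
      · exact h0
    rw [hw, partE_expand q G hXG] at key2
    rw [← key2]
    refine Finset.sum_congr rfl fun i hi => ?_
    rw [Finset.mem_range] at hi
    rw [← h.mulPowL_pow_cst, eps_eq (by omega)]
    congr 2
    push_cast
    rw [map_sum]
    refine Finset.sum_congr rfl fun j _ => ?_
    rw [map_mul, map_pow, hGc, hG, LinearMap.pow_mulRight]
    rfl
  · intro _
    simp only [hw, pow_zero, pow_one, Module.End.one_apply, a0]
    rw [hrec 0 (by omega), hA0, hB0, sq, Module.End.mul_apply, smul_smul]
    simp only [mul_zero, zero_add, pow_one]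
  · intro _
    simp only [hw, pow_zero, zero_add, pow_one, Module.End.one_apply, a0]
    rw [hBrec 0 (by omega), hA0, hB0, map_smul, sq, Module.End.mul_apply]
    simp only [mul_zero, zero_add, pow_one]
  · intro i hi
    rw [hrec (i + 1) (by omega), map_sub, map_sub, map_smul, map_smul, hX2' i (A' _), ← hXn]
    rfl
  · intro i hi
    rw [hXn, hBrec (i + 1) (by omega), map_add, map_sub, map_smul, map_smul, hXnG, hXnG, hXnG,
      hX2' i (A' _), ← hXn]
    rfl

end CayleyHamilton

/-! ### Generators of the characteristic subalgebra -/

section Generation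

variable {N : ℕ} {R F : Op2 N} {q μ : ℂ}

variable (R F q μ) in
/-- The subalgebra generated by the 2-contraction `g` and by `a_1, …, a_k`. -/
def genAlg (k : ℕ) : Subalgebra ℂ (QMA R F) :=
  Algebra.adjoin ℂ ({(contr R F q μ : QMA R F)} ∪ {x | ∃ i < k, x = elemA R F q μ (i + 1)})

variable (R F q μ) in
/-- The subalgebra `genAlg` regarded as a space of constant operators. -/
def genOp (k : ℕ) : Submodule ℂ (Chain N (QMA R F)) :=
  (genAlg R F q μ k).toSubmodule.map (cst N (QMA R F)).toLinearMap

lemma contr_mem_genAlg (k : ℕ) : (contr R F q μ : QMA R F) ∈ genAlg R F q μ k :=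
  Algebra.subset_adjoin (Or.inl rfl)

lemma elemA_mem_genAlg {k i : ℕ} (hi : i < k) : (elemA R F q μ (i + 1) : QMA R F) ∈ genAlg R F q μ k :=
  Algebra.subset_adjoin (Or.inr ⟨i, hi, rfl⟩)

lemma cst_mem_genOp {k : ℕ} {c : QMA R F} (hc : c ∈ genAlg R F q μ k) : cst N _ c ∈ genOp R F q μ k :=
  ⟨c, hc, rfl⟩

lemma mul_mem_genOp {k : ℕ} {x y : Chain N (QMA R F)} (hx : x ∈ genOp R F q μ k)
    (hy : y ∈ genOp R F q μ k) : x * y ∈ genOp R F q μ k := by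
  obtain ⟨c, hc, rfl⟩ := hx
  obtain ⟨d, hd, rfl⟩ := hy
  exact ⟨c * d, (genAlg R F q μ k).mul_mem hc hd, map_mul (cst N (QMA R F)) c d⟩

variable (R F q μ) in
/-- The span over `genAlg` of `I` and of the matrices `M^{a^{(i)}}`, `M^{a^{(i)↑1} κ₁}`, `i ≤ k`. -/
def vecSpan (k : ℕ) : Submodule ℂ (Chain N (QMA R F)) :=
  Submodule.span ℂ {x | ∃ c ∈ genAlg R F q μ k, ∃ v, (v = 1 ∨ (∃ i < k, v = vecA R F q μ (genMat R F) i)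
    ∨ ∃ i < k, v = vecB R F q μ (genMat R F) i) ∧ x = v * cst N _ c}

lemma vecSpan_mul {k : ℕ} {x : Chain N (QMA R F)} (hx : x ∈ vecSpan R F q μ k) {c : QMA R F}
    (hc : c ∈ genAlg R F q μ k) : x * cst N _ c ∈ vecSpan R F q μ k := by
  induction hx using Submodule.span_induction with
  | zero => rw [zero_mul]; exact zero_mem _
  | add u v _ _ hu hv => rw [add_mul]; exact add_mem hu hv
  | smul a u _ hu => rw [smul_mul_assoc]; exact Submodule.smul_mem _ _ hu
  | mem x hx =>
    obtain ⟨d, hd, v, hv, rfl⟩ := hx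
    exact Submodule.subset_span ⟨d * c, mul_mem hd hc, v, hv, by rw [map_mul, mul_assoc]⟩

lemma vecA_mem_vecSpan {k i : ℕ} (hi : i < k) :
    vecA R F q μ (genMat R F) i ∈ vecSpan R F q μ k :=
  Submodule.subset_span ⟨1, one_mem _, _, Or.inr (Or.inl ⟨i, hi, rfl⟩), by rw [map_one, mul_one]⟩

lemma vecB_mem_vecSpan {k i : ℕ} (hi : i < k) :
    vecB R F q μ (genMat R F) i ∈ vecSpan R F q μ k :=
  Submodule.subset_span ⟨1, one_mem _, _, Or.inr (Or.inr ⟨i, hi, rfl⟩), by rw [map_one, mul_one]⟩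

lemma vecA_zero {A : Type} [Ring A] [Algebra ℂ A] {M : Matrix (Fin N) (Fin N) A} (hP : Params q μ) :
    vecA R F q μ M 0 = mp R F M 0 1 := by
  rw [vecA, show qNum q (0 + 1) = 1 by simp [qNum, hP.lam_ne], one_smul]
  rfl

variable [NeZero N] (h : Setup R F q μ)
include h

lemma Setup.vecB_zero : vecB R F q μ (genMat R F) 0 = μ⁻¹ • cst N _ (contr R F q μ : QMA R F) := by
  have e : shf 1 (asymF q μ (QMA R F) R (0 + 1)) = 1 := map_one _
  rw [vecB, e, one_mul, h.mp_kap h.gen_rel, show qNum q (0 + 1) = 1 by simp [qNum, h.params.lam_ne],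
    one_smul, h.cst_contr]

variable {k : ℕ} (hk : ParamsUpTo q μ k)
  (hv : shf 1 (asymF q μ (QMA R F) R k) * bax q μ (gen _ R 0) (q⁻¹ ^ (2 * k))
      * shf 1 (asymF q μ (QMA R F) R k) = 0)
include hk hv

/-- The span of the matrices `M^{a^{(i)}}`, `M^{a^{(i)↑1} κ₁}` is stable under `M ⋆ -`. -/
lemma Setup.mulPowL_mem_vecSpan {x : Chain N (QMA R F)} (hx : x ∈ vecSpan R F q μ k) (hk1 : 1 ≤ k) :
    mulPowL R F (genMat R F) 0 1 x ∈ vecSpan R F q μ k := by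
  have hM := h.gen_rel
  have h1 : mp R F (genMat R F) 0 1 ∈ vecSpan R F q μ k := by
    rw [← vecA_zero h.params]; exact vecA_mem_vecSpan hk1
  have hA : ∀ i < k, mulPowL R F (genMat R F) 0 1 (vecA R F q μ (genMat R F) i) ∈ vecSpan R F q μ k := by
    intro i hi
    have e := h.mp_asymF_bax hM hk (i := i) hi
    have e2 : q ^ (i + 1) • mp R F (genMat R F) (i + 1) (shf 1 (asymF q μ (QMA R F) R (i + 1))
        * bax q μ (gen (QMA R F) R 0) (q⁻¹ ^ (2 * (i + 1))) * shf 1 (asymF q μ (QMA R F) R (i + 1)))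
        ∈ vecSpan R F q μ k := by
      rcases Nat.lt_or_ge (i + 1) k with h2 | h2
      · rw [e, ← h.vecA_succ hM hk (by omega)]
        exact vecA_mem_vecSpan h2
      · obtain rfl : k = i + 1 := by omega
        rw [hv, map_zero, smul_zero]
        exact zero_mem _
    have e3 : mulPowL R F (genMat R F) 0 1 (vecA R F q μ (genMat R F) i)
        = q ^ (i + 1) • (mp R F (genMat R F) 0 1 *
            chf R F (genMat R F) i (asymF q μ (QMA R F) R (i + 1)))
          - ((q - q⁻¹) * (μ * q ^ (2 * i + 1)) / (1 + μ * q ^ (2 * i + 1))) •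
            vecB R F q μ (genMat R F) i
          - q ^ (i + 1) • mp R F (genMat R F) (i + 1) (shf 1 (asymF q μ (QMA R F) R (i + 1))
            * bax q μ (gen (QMA R F) R 0) (q⁻¹ ^ (2 * (i + 1)))
            * shf 1 (asymF q μ (QMA R F) R (i + 1))) := by
      rw [e]; abel
    rw [e3, ← h.cst_elemA_succ]
    exact sub_mem (sub_mem (Submodule.smul_mem _ _ (vecSpan_mul h1 (elemA_mem_genAlg hi)))
      (Submodule.smul_mem _ _ (vecB_mem_vecSpan hi))) e2
  induction hx using Submodule.span_induction with
  | zero => rw [map_zero]; exact zero_mem _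
  | add u v _ _ hu hv => rw [map_add]; exact add_mem hu hv
  | smul a u _ hu => rw [map_smul]; exact Submodule.smul_mem _ _ hu
  | mem x hx =>
    obtain ⟨d, hd, v, hv, rfl⟩ := hx
    rw [h.mulPowL_cst_mul]
    refine vecSpan_mul ?_ hd
    rcases hv with rfl | ⟨i, hi, rfl⟩ | ⟨i, hi, rfl⟩
    · rw [← map_one (cst N (QMA R F)), h.mulPowL_cst (one_mem _), map_one (cst N _), mul_one]
      exact h1
    · exact hA i hi
    · cases i with
      | zero =>
        rw [h.vecB_zero, map_smul, h.mulPowL_cst (one_mem _)]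
        exact Submodule.smul_mem _ _ (vecSpan_mul h1 (contr_mem_genAlg k))
      | succ i =>
        rw [h.mulPowL_vecB_succ hM hk (by omega), ← h.cst_contr, ← h.cst_elemA_succ]
        have c := contr_mem_genAlg (R := R) (F := F) (q := q) (μ := μ) k
        exact add_mem (sub_mem (Submodule.smul_mem _ _ (vecSpan_mul (vecSpan_mul h1
          (elemA_mem_genAlg (by omega))) c)) (vecSpan_mul (vecB_mem_vecSpan (by omega)) c))
          (Submodule.smul_mem _ _ (vecSpan_mul (hA i (by omega)) c))

omit hv in
/-- `ch(a^{(i)↑1} κ₁)` is a multiple of `a_{i-1} g`. -/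
lemma Setup.E_vecB_mem {i : ℕ} (hi : i < k) :
    E (matD R) 0 (vecB R F q μ (genMat R F) i) ∈ genOp R F q μ k := by
  have hP := h.params
  have hM := h.gen_rel
  have he := eta_ne hP
  have hg : ∀ {j n}, j + 1 < n → gen (QMA R F) R j ∈ strands (gen _ R) n := fun hj => gen_mem hj
  cases i with
  | zero =>
    rw [h.vecB_zero, map_smul, ← one_mul (cst N _ _), E_mul_right _ (Off.of_cst _), E_one,
      smul_mul_assoc, one_mul]
    exact Submodule.smul_mem _ _ (Submodule.smul_mem _ _ (cst_mem_genOp (contr_mem_genAlg k)))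
  | succ i =>
    have p : BMWPair q μ (gen (QMA R F) R 0) (gen (QMA R F) R 1) :=
      (h.bmwSeq (A := QMA R F) 2).pair 0 (by omega)
    have ha : asymF q μ (QMA R F) R (i + 1) ∈ strands (gen _ R) (i + 1) := asymF_mem _
    set b := shf 2 (asymF q μ (QMA R F) R (i + 1)) with hb
    have hbm : b ∈ strands (gen _ R) (i + 2 + 1) := shf_mem 2 ha
    have hkm : kap q μ (gen (QMA R F) R 0) ∈ strands (gen _ R) (i + 2 + 1) :=
      kap_mem_of (hg (by omega))
    have hbb : b * b = b := by rw [hb, ← map_mul, h.asymF_idem hk (by omega)]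
    have c0 : Commute (kap q μ (gen (QMA R F) R 0)) b := shf_comm (kap_mem_of (hg (n := 2) (by omega))) ha
    have e1 : shf 1 (asymF q μ (QMA R F) R (i + 2)) = (q ^ (i + 1) / qNum q (i + 2)) •
        (b * bax q μ (gen (QMA R F) R 1) (q⁻¹ ^ (2 * (i + 1))) * b) := by
      rw [asymF, asym_succ_left hP hk (h.bmwSeq _) (by omega), ← shf_asymF, map_smul, map_mul, map_mul,
        map_bax, shf_shf, shf_gen]
    generalize q⁻¹ ^ (2 * (i + 1)) = x at e1
    -- `κ₁ σ₂⁻(x) κ₁` is a multiple of `κ₁`, and `κ₁` is `η⁻¹ κ₁²`.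
    obtain ⟨c, hc⟩ : ∃ c : ℂ, kap q μ (gen (QMA R F) R 0) * bax q μ (gen (QMA R F) R 1) x
        * kap q μ (gen (QMA R F) R 0) = c • kap q μ (gen (QMA R F) R 0) := by
      refine ⟨eta q μ + (x - 1) / (q - q⁻¹) * μ⁻¹ + (x - 1) / (q * μ⁻¹ * x + 1), ?_⟩
      rw [bax, mul_add, mul_add, add_mul, add_mul, mul_one, mul_smul_comm, mul_smul_comm,
        smul_mul_assoc, smul_mul_assoc, p.kap_mul_mul_kap hP, p.kkk₁, kap_mul_kap hP p.cubic_left,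
        smul_smul, ← add_smul, ← add_smul]
    have e2 : chf R F (genMat R F) (i + 2) (shf 1 (asymF q μ (QMA R F) R (i + 2))
        * kap q μ (gen (QMA R F) R 0)) = ((q ^ (i + 1) / qNum q (i + 2)) * (eta q μ)⁻¹ * c) •
          chf R F (genMat R F) (1 + 1 + i) (kap q μ (gen (QMA R F) R 0) * b) := by
      set κ := kap q μ (gen (QMA R F) R 0) with hκ
      set z := bax q μ (gen (QMA R F) R 1) x with hz
      have s1 : chf R F (genMat R F) (i + 2) (b * z * b * κ) = chf R F (genMat R F) (i + 2) (b * z * κ) := by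
        rw [mul_assoc, ← c0.eq, ← mul_assoc, ← h.chf_cyclic hM hbm, ← mul_assoc, ← mul_assoc, hbb]
      have s2 : κ = (eta q μ)⁻¹ • (κ * κ) := by
        rw [kap_mul_kap hP p.cubic_left, smul_smul, inv_mul_cancel₀ he, one_smul]
      have s3 : chf R F (genMat R F) (i + 2) (b * z * (κ * κ))
          = c • chf R F (genMat R F) (i + 2) (κ * b) := by
        rw [← mul_assoc, ← h.chf_cyclic hM hkm, ← mul_assoc, ← mul_assoc, c0.eq, mul_assoc, mul_assoc,
          ← mul_assoc κ, hc, mul_smul_comm, map_smul]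
      rw [e1, smul_mul_assoc, map_smul, s1, show 1 + 1 + i = i + 2 by omega]
      nth_rw 1 [s2]
      rw [mul_smul_comm, map_smul, s3, smul_smul, smul_smul]
    rw [vecB, map_smul]
    refine Submodule.smul_mem _ _ ?_
    change chf R F (genMat R F) (i + 2) _ ∈ _
    rw [e2, h.chf_juxt (kap_mem_of (hg (by omega))) ha]
    have e3 : chf R F (genMat R F) 1 (kap q μ (gen (QMA R F) R 0))
        = eta q μ • cst N _ (contr R F q μ : QMA R F) := by
      rw [h.cst_contr, Gc, smul_smul, mul_inv_cancel₀ he, one_smul]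
    rw [e3, ← h.cst_elemA_succ]
    exact Submodule.smul_mem _ _ (mul_mem_genOp (Submodule.smul_mem _ _ (cst_mem_genOp
      (contr_mem_genAlg k))) (cst_mem_genOp (elemA_mem_genAlg (by omega))))

omit hv in
lemma Setup.E_vecSpan_mem {x : Chain N (QMA R F)} (hx : x ∈ vecSpan R F q μ k) :
    E (matD R) 0 x ∈ genOp R F q μ k := by
  induction hx using Submodule.span_induction with
  | zero => rw [map_zero]; exact zero_mem _
  | add u v _ _ hu hv => rw [map_add]; exact add_mem hu hv
  | smul a u _ hu => rw [map_smul]; exact Submodule.smul_mem _ _ hu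
  | mem x hx =>
    obtain ⟨d, hd, v, hv, rfl⟩ := hx
    rw [E_mul_right _ (Off.of_cst _)]
    refine mul_mem_genOp ?_ (cst_mem_genOp hd)
    rcases hv with rfl | ⟨i, hi, rfl⟩ | ⟨i, hi, rfl⟩
    · rw [E_one, ← map_one (cst N (QMA R F))]
      exact Submodule.smul_mem _ _ (cst_mem_genOp (one_mem _))
    · rw [vecA, map_smul]
      change _ • chf R F (genMat R F) i _ ∈ _
      rw [← h.cst_elemA_succ]
      exact Submodule.smul_mem _ _ (cst_mem_genOp (elemA_mem_genAlg hi))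
    · exact h.E_vecB_mem hk hi

/-- The characteristic elements of the Coxeter words, the power sums, are generated by `g` and
`a_1, …, a_k`. -/
lemma Setup.chf_wordD_mem (hk1 : 1 ≤ k) (n : ℕ) :
    chf R F (genMat R F) n (wordD (gen _ R) 0 n) ∈ genOp R F q μ k := by
  have : mp R F (genMat R F) n (wordD (gen _ R) 0 n) ∈ vecSpan R F q μ k := by
    induction n with
    | zero =>
      rw [wordD, ← vecA_zero h.params]
      exact vecA_mem_vecSpan hk1
    | succ n ih =>
      have e := h.mulPowL_one_mp (M := genMat R F) (n := n) (X := wordD (gen _ R) 0 n)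
        (wordD_mem_of fun i _ hi => gen_mem (by omega))
      rw [shf_wordD] at e
      rw [wordD, ← e]
      exact h.mulPowL_mem_vecSpan hk hv ih hk1
  exact h.E_vecSpan_mem hk this

omit hk hv in
/-- The ascending and the descending Coxeter words have the same characteristic element. -/
lemma Setup.chf_word_eq (n : ℕ) : chf R F (genMat R F) n (word (gen _ R) 0 n)
    = chf R F (genMat R F) n (wordD (gen _ R) 0 n) := by
  have key : ∀ j l, j + l = n → chf R F (genMat R F) n (word (gen _ R) 0 j * wordD (gen _ R) j l)
      = chf R F (genMat R F) n (wordD (gen _ R) 0 n) := by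
    intro j
    induction j with
    | zero =>
      intro l hl
      rw [word, one_mul, ← hl, zero_add]
    | succ j ih =>
      intro l hl
      have hD : wordD (gen (QMA R F) R) (j + 1) l ∈ strands (gen _ R) (n + 1) :=
        wordD_mem_of fun i _ hi => gen_mem (by omega)
      have hc : Commute (word (gen (QMA R F) R) 0 j) (wordD (gen _ R) (j + 1) l) :=
        commute_wordD fun i h1 _ => (commute_word fun i' _ h2 => (h.bmwSeq (i + 1)).comm i' i (by omega) (by omega) |>.symm).symm
      rw [← h.chf_cyclic h.gen_rel hD, word_succ, ← mul_assoc, ← hc.eq, zero_add, mul_assoc]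
      exact ih (l + 1) (by omega)
  have := key n 0 rfl
  rwa [wordD, mul_one] at this

/-- All characteristic elements are generated by `g` and `a_1, …, a_k`, by induction on the number of
strands. -/
lemma Setup.chf_mem_genOp (hk1 : 1 ≤ k) (n : ℕ) : ∀ X ∈ strands (gen (QMA R F) R) (n + 1),
    chf R F (genMat R F) n X ∈ genOp R F q μ k := by
  have hP := h.params
  have hM := h.gen_rel
  have he := eta_ne hP
  have e0 : ∀ X ∈ strands (gen (QMA R F) R) 1, chf R F (genMat R F) 0 X ∈ genOp R F q μ k := by
    intro X hX
    rw [strands_eq_bot le_rfl] at hX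
    obtain ⟨c, rfl⟩ := Algebra.mem_bot.1 hX
    rw [Algebra.algebraMap_eq_smul_one, map_smul]
    exact Submodule.smul_mem _ _ (h.chf_wordD_mem hk hv hk1 0)
  have eκ : chf R F (genMat R F) 1 (kap q μ (gen (QMA R F) R 0)) ∈ genOp R F q μ k := by
    have : chf R F (genMat R F) 1 (kap q μ (gen (QMA R F) R 0))
        = eta q μ • cst N _ (contr R F q μ : QMA R F) := by
      rw [h.cst_contr, Gc, smul_smul, mul_inv_cancel₀ he, one_smul]
    rw [this]
    exact Submodule.smul_mem _ _ (cst_mem_genOp (contr_mem_genAlg k))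
  induction n using Nat.strong_induction_on with
  | _ n ih =>
  cases n with
  | zero => exact e0
  | succ n =>
    refine reduction hP h.bmwSeq (chf R F (genMat R F) (n + 1)) (genOp R F q μ k) n
      (fun x hx y _ => h.chf_cyclic hM hx y) (fun x hx => ?_) (fun j l hjl x hx => ?_) ?_
    -- `ch(x κ_n) = η⁻¹ ch(κ_n x κ_n)`, where `κ_n x κ_n = w κ_n` with `w` on fewer strands.
    · obtain ⟨w, hw, e⟩ := kap_mul_mul_kap_mem hP h.bmwSeq n hx
      have hkm : kap q μ (gen (QMA R F) R n) ∈ strands (gen _ R) (n + 1 + 1) :=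
        kap_mem_of (gen_mem (by omega))
      have s1 : chf R F (genMat R F) (n + 1) (x * kap q μ (gen (QMA R F) R n))
          = (eta q μ)⁻¹ • chf R F (genMat R F) (n + 1) (w * kap q μ (gen (QMA R F) R n)) := by
        rw [← e, mul_assoc, h.chf_cyclic hM hkm, mul_assoc, kap_mul_kap hP ((h.bmwSeq (n + 1)).cubic n
          (by omega)), mul_smul_comm, map_smul, smul_smul, inv_mul_cancel₀ he, one_smul]
      rw [s1]
      refine Submodule.smul_mem _ _ ?_
      cases n with
      | zero =>
        rw [strands_eq_bot (by omega)] at hw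
        obtain ⟨c, rfl⟩ := Algebra.mem_bot.1 hw
        rw [← Algebra.smul_def, map_smul]
        exact Submodule.smul_mem _ _ eκ
      | succ n =>
        have := h.chf_juxt (M := genMat R F) (m := 1) hw (kap_mem_of (q := q) (μ := μ)
          (gen_mem (by omega) : gen (QMA R F) R 0 ∈ strands (gen _ R) 2))
        rw [shf_kap, zero_add] at this
        rw [this]
        exact mul_mem_genOp (ih n (by omega) w hw) eκ
    · subst hjl
      have hwm : word (gen (QMA R F) R) 0 l ∈ strands (gen _ R) (l + 1) := word_mem (by omega)
      have := h.chf_juxt (M := genMat R F) hx hwm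
      rw [shf_word, zero_add, show j + 1 + l = j + l + 1 by omega] at this
      rw [this]
      exact mul_mem_genOp (ih j (by omega) x hx) (ih l (by omega) _ hwm)
    · rw [h.chf_word_eq]
      exact h.chf_wordD_mem hk hv hk1 (n + 1)

/-- The characteristic subalgebra is generated by `g` and `a_1, …, a_k`. -/
lemma Setup.charAlg_eq_genAlg (hk1 : 1 ≤ k) : charAlg R F = genAlg R F q μ k := by
  refine le_antisymm (fun x hx => ?_) (Algebra.adjoin_le ?_)
  · refine h.charAlg_induction (p := fun x => x ∈ genAlg R F q μ k) (one_mem _) ?_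
      (fun _ _ => add_mem) (fun c _ hx => (genAlg R F q μ k).smul_mem hx c) hx
    intro n X hX c hc
    obtain ⟨d, hd, e⟩ := h.chf_mem_genOp hk hv hk1 n X hX
    rw [← hc] at e
    rwa [← cst_injective e]
  · rintro x (rfl | ⟨i, -, rfl⟩)
    · exact (contr R F q μ).2
    · exact (elemA R F q μ (i + 1)).2

end Generation

/-! ### Spectral variables -/

section FreeCommutative

/-- A commutative algebra generated by algebraically independent elements is free on them. -/
lemma existsUnique_algHom {B C : Type} [CommRing B] [Algebra ℂ B] [CommRing C] [Algebra ℂ C] {m : ℕ}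
    (x : Fin m → B) (hx : MonomialsIndependent x) (hgen : Algebra.adjoin ℂ (Set.range x) = ⊤)
    (y : Fin m → C) : ∃! π : B →ₐ[ℂ] C, ∀ i, π (x i) = y i := by
  have hbas : ∀ d : Fin m →₀ ℕ, MvPolynomial.aeval x (MvPolynomial.basisMonomials (Fin m) ℂ d)
      = (List.ofFn fun i => x i ^ d i).prod := fun d => by
    rw [MvPolynomial.coe_basisMonomials, MvPolynomial.aeval_monomial, map_one, one_mul, List.prod_ofFn,
      Finsupp.prod_fintype _ _ (fun i => pow_zero _)]
  have hinj : Function.Injective (MvPolynomial.aeval x : MvPolynomial (Fin m) ℂ →ₐ[ℂ] B) := by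
    have hli : LinearIndependent ℂ ((MvPolynomial.aeval x).toLinearMap ∘
        (MvPolynomial.basisMonomials (Fin m) ℂ)) := by
      have := hx.comp (fun d : Fin m →₀ ℕ => (d : Fin m → ℕ)) DFunLike.coe_injective
      convert this using 1
      funext d
      exact hbas d
    refine (injective_iff_map_eq_zero _).2 fun p hp => ?_
    have h0 := linearIndependent_iff.1 hli ((MvPolynomial.basisMonomials (Fin m) ℂ).repr p) (by
      rw [← Finsupp.apply_linearCombination, Module.Basis.linearCombination_repr]
      exact hp)
    exact (LinearEquiv.map_eq_zero_iff _).1 h0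
  have hsurj : Function.Surjective (MvPolynomial.aeval x : MvPolynomial (Fin m) ℂ →ₐ[ℂ] B) := by
    rw [← AlgHom.range_eq_top, ← hgen, Algebra.adjoin_range_eq_range_aeval]
  let e := AlgEquiv.ofBijective _ ⟨hinj, hsurj⟩
  have he : ∀ i, e.symm (x i) = MvPolynomial.X i := fun i => by
    rw [AlgEquiv.symm_apply_eq]
    exact (MvPolynomial.aeval_X x i).symm
  refine ⟨(MvPolynomial.aeval y).comp e.symm.toAlgHom, fun i => ?_, fun π hπ => ?_⟩
  · change MvPolynomial.aeval y (e.symm (x i)) = y i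
    rw [he, MvPolynomial.aeval_X]
  · refine AlgHom.ext_of_adjoin_eq_top hgen ?_
    rintro _ ⟨i, rfl⟩
    rw [hπ]
    change _ = MvPolynomial.aeval y (e.symm (x i))
    rw [he, MvPolynomial.aeval_X]

end FreeCommutative

section Spectral

variable {N : ℕ} {R F : Op2 N} {q μ : ℂ} [NeZero N] (h : Setup R F q μ)
include h

/-- The characteristic subalgebra is a polynomial algebra if its generators are independent. -/
lemma Setup.existsUnique_spectralHom {k : ℕ} (hg : charAlg R F = genAlg R F q μ k)
    (hi : MonomialsIndependent (Fin.cons (contr R F q μ : QMA R F)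
        (fun i : Fin k => (elemA R F q μ (i + 1) : QMA R F)) : Fin (k + 1) → QMA R F)) :
    ∃! π : charAlg R F →ₐ[ℂ] SpecAlg k, IsSpectralHom R F q μ k π := by
  let _ : CommRing (charAlg R F) :=
    { (inferInstance : Ring (charAlg R F)) with
      mul_comm := fun x y => Subtype.ext (h.charAlg_comm x.2 y.2) }
  let x : Fin (k + 1) → charAlg R F := Fin.cons (contr R F q μ) fun i : Fin k => elemA R F q μ (i + 1)
  have hx : ∀ i, (x i : QMA R F) = (Fin.cons (contr R F q μ : QMA R F)
      (fun i : Fin k => (elemA R F q μ (i + 1) : QMA R F)) : Fin (k + 1) → QMA R F) i := by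
    intro i
    refine Fin.cases ?_ (fun i => ?_) i <;> rfl
  have hxi : MonomialsIndependent x := by
    refine LinearIndependent.of_comp (charAlg R F).val.toLinearMap ?_
    have e : (⇑(charAlg R F).val.toLinearMap ∘ fun d : Fin (k + 1) → ℕ =>
        (List.ofFn fun i => x i ^ d i).prod)
        = fun d => (List.ofFn fun i => (x i : QMA R F) ^ d i).prod := by
      funext d
      change (charAlg R F).val (List.prod _) = _
      rw [map_list_prod, List.map_ofFn]
      rfl
    rw [e]
    simp only [hx]
    exact hi
  have hgen : Algebra.adjoin ℂ (Set.range x) = ⊤ := by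
    rw [eq_top_iff]
    rintro z -
    have hz : (z : QMA R F) ∈ genAlg R F q μ k := by rw [← hg]; exact z.2
    have : genAlg R F q μ k ≤ (Algebra.adjoin ℂ (Set.range x)).map (charAlg R F).val := by
      refine Algebra.adjoin_le ?_
      rintro _ (rfl | ⟨i, hi, rfl⟩)
      · exact ⟨x 0, Algebra.subset_adjoin ⟨0, rfl⟩, rfl⟩
      · exact ⟨x (Fin.succ ⟨i, hi⟩), Algebra.subset_adjoin ⟨_, rfl⟩, rfl⟩
    obtain ⟨w, hw, e⟩ := this hz
    have : w = z := Subtype.ext e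
    rwa [← this]
  have hiff : ∀ π : charAlg R F →ₐ[ℂ] SpecAlg k, IsSpectralHom R F q μ k π ↔ ∀ i, π (x i)
      = (Fin.cons (nu k 0 ^ 2) (fun i : Fin k => (spectrumSp k).esymm (i + 1)) : Fin (k + 1) → _) i := by
    intro π
    constructor
    · intro hπ i
      refine Fin.cases hπ.map_contr (fun i => hπ.map_elemA (i + 1) (by omega) (by omega)) i
    · intro hπ
      refine ⟨hπ 0, fun i h1 h2 => ?_⟩
      have := hπ (Fin.succ ⟨i - 1, by omega⟩)
      simp only [x, Fin.cons_succ, Nat.sub_add_cancel h1] at this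
      exact this
  obtain ⟨π, h1, h2⟩ := existsUnique_algHom x hxi hgen
    (Fin.cons (nu k 0 ^ 2) (fun i : Fin k => (spectrumSp k).esymm (i + 1)) : Fin (k + 1) → SpecAlg k)
  exact ⟨π, (hiff π).2 h1, fun π' h' => h2 π' ((hiff π').1 h')⟩

end Spectral

section Palindromic

variable {E : Type*} [CommRing E]

open Polynomial

/-- The coefficients of a polynomial, extended by zero to negative indices. -/
def coeffZ (p : E[X]) : ℤ → E
  | Int.ofNat n => p.coeff n
  | Int.negSucc _ => 0

lemma coeffZ_natCast (p : E[X]) (n : ℕ) : coeffZ p (n : ℤ) = p.coeff n := rfl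

lemma coeffZ_neg (p : E[X]) {m : ℤ} (h : m < 0) : coeffZ p m = 0 := by
  cases m with
  | ofNat n => simp at h; omega
  | negSucc n => rfl

lemma coeffZ_mul_X (p : E[X]) (m : ℤ) : coeffZ (p * X) m = coeffZ p (m - 1) := by
  cases m with
  | ofNat n =>
    cases n with
    | zero => rw [coeffZ_neg p (by simp)]; exact mul_coeff_zero p X |>.trans (by simp)
    | succ n =>
      rw [show (Int.ofNat (n + 1)) - 1 = (n : ℤ) by simp, coeffZ_natCast]
      exact coeff_mul_X p n
  | negSucc n => rw [coeffZ_neg p (by omega)]; rfl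

lemma coeffZ_quadratic (p : E[X]) (s t : E) (m : ℤ) : coeffZ (p * (X ^ 2 + C s * X + C t)) m
    = coeffZ p (m - 2) + s * coeffZ p (m - 1) + t * coeffZ p m := by
  have e : p * (X ^ 2 + C s * X + C t) = p * X * X + C s * (p * X) + C t * p := by ring
  have hadd : ∀ a b : E[X], coeffZ (a + b) m = coeffZ a m + coeffZ b m := by
    intro a b
    cases m with
    | ofNat n => exact coeff_add _ _ _
    | negSucc n => exact (add_zero 0).symm
  have hmul : ∀ (a : E) (b : E[X]), coeffZ (C a * b) m = a * coeffZ b m := by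
    intro a b
    cases m with
    | ofNat n => exact coeff_C_mul _
    | negSucc n => exact (mul_zero _).symm
  rw [e, hadd, hadd, hmul, hmul, coeffZ_mul_X, coeffZ_mul_X, coeffZ_mul_X, sub_sub]
  rfl

/-- A product of quadratic polynomials with the same constant term is palindromic up to powers of it. -/
lemma coeffZ_prod_quadratic (t : E) (s : ℕ → E) (k : ℕ) : ∀ i : ℕ,
    coeffZ (∏ j ∈ Finset.range k, (X ^ 2 + C (s j) * X + C t)) ((k : ℤ) - i)
      = t ^ i * coeffZ (∏ j ∈ Finset.range k, (X ^ 2 + C (s j) * X + C t)) ((k : ℤ) + i) := by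
  induction k with
  | zero =>
    intro i
    cases i with
    | zero => simp
    | succ i =>
      rw [coeffZ_neg _ (by push_cast; omega), Finset.prod_range_zero,
        show ((0 : ℕ) : ℤ) + ((i + 1 : ℕ) : ℤ) = ((i + 1 : ℕ) : ℤ) by simp, coeffZ_natCast,
        coeff_one]
      simp
  | succ k ih =>
    intro i
    rw [Finset.prod_range_succ, coeffZ_quadratic, coeffZ_quadratic]
    cases i with
    | zero => simp
    | succ i =>
      have h0 := ih i
      have h1 := ih (i + 1)
      have h2 := ih (i + 2)
      generalize coeffZ (∏ j ∈ Finset.range k, (X ^ 2 + C (s j) * X + C t)) = f at *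
      push_cast at *
      rw [show (k : ℤ) + 1 - (i + 1) - 2 = k - (i + 2) by ring,
        show (k : ℤ) + 1 - (i + 1) - 1 = k - (i + 1) by ring,
        show (k : ℤ) + 1 - (i + 1) = k - i by ring, h0, h1, h2,
        show (k : ℤ) + 1 + (i + 1) - 2 = k + i by ring,
        show (k : ℤ) + 1 + (i + 1) - 1 = k + (i + 1) by ring,
        show (k : ℤ) + 1 + (i + 1) = k + (i + 2) by ring]
      ring

end Palindromic

section Vieta

open Polynomial

/-- The spectral variables `ν_1, …, ν_{2k}`. -/
def spec (k : ℕ) : Multiset (SpecAlg k) := Finset.univ.val.map fun i : Fin (2 * k) => nu k i.succ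

lemma card_spec (k : ℕ) : Multiset.card (spec k) = 2 * k := by simp [spec]

lemma nu_mul_nu {k j : ℕ} (hj : j < k) :
    nu k ⟨k + j + 1, by omega⟩ * nu k ⟨k - j, by omega⟩ = nu k 0 ^ 2 := by
  rw [nu, nu, nu, ← map_mul, ← map_pow, Ideal.Quotient.mk_eq_mk_iff_sub_mem]
  refine Ideal.subset_span ⟨⟨j, hj⟩, ?_⟩
  have e : k + 1 - (j + 1) = k - j := by omega
  simp only [e, add_assoc]

/-- The polynomial with the roots `-ν_i` is a product of quadratic polynomials with constant term
`ν_0²`. -/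
lemma prod_spec (k : ℕ) : ∃ s : ℕ → SpecAlg k, ((spec k).map fun r => X + C r).prod
    = ∏ j ∈ Finset.range k, (X ^ 2 + C (s j) * X + C (nu k 0 ^ 2)) := by
  let v : ℕ → SpecAlg k := fun i => if h : i < 2 * k then nu k ⟨i + 1, by omega⟩ else 0
  refine ⟨fun j => v (k + j) + v (k - 1 - j), ?_⟩
  have e : ((spec k).map fun r => X + C r).prod = ∏ i ∈ Finset.range (2 * k), (X + C (v i)) := by
    rw [spec, Multiset.map_map, ← Fin.prod_univ_eq_prod_range (fun i => X + C (v i))]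
    refine Finset.prod_congr rfl fun i _ => ?_
    simp only [Function.comp, v, i.2, dif_pos]
    rfl
  rw [e, show Finset.range (2 * k) = Finset.range (k + k) by rw [two_mul], Finset.prod_range_add,
    ← Finset.prod_range_reflect, ← Finset.prod_mul_distrib]
  refine Finset.prod_congr rfl fun j hj => ?_
  rw [Finset.mem_range] at hj
  have : v (k + j) * v (k - 1 - j) = nu k 0 ^ 2 := by
    rw [← nu_mul_nu hj]
    simp only [v]
    rw [dif_pos (by omega), dif_pos (by omega)]
    congr 2
    exact Fin.ext (by simp; omega)
  rw [← this, C_add, C_mul]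
  ring

lemma esymm_spec {k i : ℕ} (hi : i ≤ 2 * k) :
    (spec k).esymm i = (((spec k).map fun r => X + C r).prod).coeff (2 * k - i) := by
  rw [Multiset.prod_X_add_C_coeff _ (by rw [card_spec]; omega), card_spec]
  congr 1
  omega

/-- The symmetry of the elementary symmetric functions under the pairing `ν_{k+j} ν_{k+1-j} = ν_0²`. -/
lemma esymm_spec_add {k i : ℕ} (hi : i ≤ k) :
    (spec k).esymm (k + i) = (spec k).esymm (k - i) * (nu k 0 ^ 2) ^ i := by
  obtain ⟨s, hs⟩ := prod_spec k
  have := coeffZ_prod_quadratic (nu k 0 ^ 2) s k i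
  rw [← hs, show (k : ℤ) - i = ((2 * k - (k + i) : ℕ) : ℤ) by omega,
    show (k : ℤ) + i = ((2 * k - (k - i) : ℕ) : ℤ) by omega, coeffZ_natCast, coeffZ_natCast,
    ← esymm_spec (by omega), ← esymm_spec (by omega)] at this
  rw [this, mul_comm]

/-- The two additional variables `ν_0`, `-ν_0` multiply the generating polynomial by `X² - ν_0²`. -/
lemma esymm_spectrumSp {k i : ℕ} (hi : i + 2 ≤ 2 * k) : (spectrumSp k).esymm (i + 2)
    = (spec k).esymm (i + 2) - nu k 0 ^ 2 * (spec k).esymm i := by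
  have hc : Multiset.card (spectrumSp k) = 2 * k + 2 := by
    have := card_spec k
    rw [spec] at this
    rw [spectrumSp, Multiset.card_cons, Multiset.card_cons, this]
  have e : ((spectrumSp k).map fun r => X + C r).prod
      = ((spec k).map fun r => X + C r).prod * X ^ 2
        - C (nu k 0 ^ 2) * ((spec k).map fun r => X + C r).prod := by
    rw [spectrumSp, Multiset.map_cons, Multiset.map_cons, Multiset.prod_cons, Multiset.prod_cons,
      C_neg, C_pow, ← spec]
    ring
  have h1 := Multiset.prod_X_add_C_coeff (spectrumSp k) (k := 2 * k - i) (by rw [hc]; omega)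
  rw [hc, show 2 * k + 2 - (2 * k - i) = i + 2 by omega] at h1
  rw [← h1, e, coeff_sub, coeff_C_mul, show 2 * k - i = 2 * k - (i + 2) + 2 by omega,
    coeff_mul_X_pow, esymm_spec hi, esymm_spec (by omega : i ≤ 2 * k),
    show 2 * k - i = 2 * k - (i + 2) + 2 by omega]

lemma esymm_spectrumSp_one (k : ℕ) : (spectrumSp k).esymm 1 = (spec k).esymm 1 := by
  have h1 : ∀ s : Multiset (SpecAlg k), s.esymm 1 = s.sum := fun s => by
    rw [Multiset.esymm, Multiset.powersetCard_one, Multiset.map_map]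
    simp
  rw [h1, h1, spectrumSp, ← spec, Multiset.sum_cons, Multiset.sum_cons, add_neg_cancel_left]

variable {N : ℕ} {R F : Op2 N} {q μ : ℂ} {k : ℕ} {π : charAlg R F →ₐ[ℂ] SpecAlg k}

/-- The sum `ε_i = ∑ a_{i-2j} g^j` undoes the multiplication by `X² - ν_0²`. -/
lemma IsSpectralHom.map_sum (hπ : IsSpectralHom R F q μ k π) {i : ℕ} (hi : i ≤ k) :
    π (∑ j ∈ Finset.range (i / 2 + 1), elemA R F q μ (i - 2 * j) * contr R F q μ ^ j)
      = (spec k).esymm i := by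
  induction i using Nat.strong_induction_on with
  | _ i ih =>
  match i, hi with
  | 0, _ =>
    have h0 : (spec k).esymm 0 = 1 := by
      rw [Multiset.esymm, Multiset.powersetCard_zero_left]
      simp
    simp [elemA, h0]
  | 1, h1 => simp [hπ.map_elemA 1 le_rfl h1, esymm_spectrumSp_one]
  | i + 2, h2 =>
    have h0 := ih i (by omega) (by omega)
    rw [show (i + 2) / 2 + 1 = i / 2 + 1 + 1 by omega, Finset.sum_range_succ', pow_zero, mul_one,
      mul_zero, Nat.sub_zero, map_add, hπ.map_elemA _ (by omega) h2, esymm_spectrumSp (by omega), ← h0]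
    have : ∑ j ∈ Finset.range (i / 2 + 1), elemA R F q μ (i + 2 - 2 * (j + 1)) * contr R F q μ ^ (j + 1)
        = (∑ j ∈ Finset.range (i / 2 + 1), elemA R F q μ (i - 2 * j) * contr R F q μ ^ j)
          * contr R F q μ := by
      rw [Finset.sum_mul]
      refine Finset.sum_congr rfl fun j _ => ?_
      rw [pow_succ, mul_assoc, show i + 2 - 2 * (j + 1) = i - 2 * j by omega]
    rw [this, map_mul, hπ.map_contr]
    ring

/-- The coefficients of the Cayley-Hamilton identity are the elementary symmetric functions of the
spectral variables. -/
lemma IsSpectralHom.map_eps (hπ : IsSpectralHom R F q μ k π) {i : ℕ} (hi : i ≤ 2 * k) :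
    π (eps R F q μ k i) = (spec k).esymm i := by
  rw [eps]
  split_ifs with h
  · exact hπ.map_sum h
  · rw [map_mul, hπ.map_sum (by omega), map_pow, hπ.map_contr]
    have := esymm_spec_add (k := k) (i := i - k) (by omega)
    rw [show k + (i - k) = i by omega, show k - (i - k) = 2 * k - i by omega] at this
    exact this.symm

end Vieta

/-! ### The completed algebra -/

section Vieta

open Polynomial

lemma prod_X_sub_C_smul {E : Type*} [CommRing E] [Algebra ℂ E] (q : ℂ) (s : Multiset E) :
    ((s.map (q • ·)).map fun t => X - C t).prod
      = ∑ i ∈ Finset.range (Multiset.card s + 1),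
        monomial (Multiset.card s - i) ((-q) ^ i • s.esymm i) := by
  rw [Multiset.prod_X_sub_X_eq_sum_esymm, Multiset.card_map]
  refine Finset.sum_congr rfl fun i _ => ?_
  rw [← Multiset.pow_smul_esymm, C_mul_X_pow_eq_monomial, neg_pow q, mul_smul]
  rcases Nat.even_or_odd i with e | e <;> simp [e.neg_one_pow]

end Vieta

section Completion

open Polynomial

variable {N : ℕ} {R F : Op2 N} {k : ℕ} {π : charAlg R F →ₐ[ℂ] SpecAlg k}

lemma tens_eq_mkQ (X : PAlg R F) (ν : SpecAlg k) :
    tens R F π X ν = (balanced R F π).mkQ (TensorProduct.mk ℂ _ _ X ν) := rfl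

lemma tens_smul (c : ℂ) (X : PAlg R F) (ν : SpecAlg k) :
    tens R F π X (c • ν) = c • tens R F π X ν := by
  rw [tens_eq_mkQ, map_smul, map_smul, tens_eq_mkQ]

lemma smul_tens (c : ℂ) (X : PAlg R F) (ν : SpecAlg k) :
    tens R F π (c • X) ν = c • tens R F π X ν := by
  rw [tens_eq_mkQ, map_smul, LinearMap.smul_apply, map_smul, tens_eq_mkQ]

/-- A factor from the characteristic subalgebra passes through the tensor sign. -/
lemma tens_eq_of_legP [NeZero N] {X Y : PAlg R F} {c : charAlg R F}
    (hY : legP Y = legP X * cst N _ (c : QMA R F)) (ν : SpecAlg k) :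
    tens R F π Y ν = tens R F π X (π c * ν) := by
  refine (Submodule.Quotient.eq _).2 (Submodule.subset_span ⟨X, Y, c, ν, ?_, rfl⟩)
  exact leg_injective (by rw [leg_rightMul]; exact hY)

lemma completion_induction {p : Completion R F π → Prop} (z : Completion R F π)
    (tens : ∀ X ν, p (tens R F π X ν)) (add : ∀ x y, p x → p y → p (x + y)) : p z := by
  obtain ⟨z, rfl⟩ := Submodule.Quotient.mk_surjective _ z
  induction z with
  | zero =>
    have := tens 0 0
    rwa [tens_eq_mkQ, map_zero] at this
  | tmul X ν => exact tens X ν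
  | add x y hx hy => exact add _ _ hx hy

/-- Bilinear products on the factors descend to the completed space as soon as they are compatible with
the tensor relations. -/
lemma exists_completion_mul (star : PAlg R F →ₗ[ℂ] PAlg R F →ₗ[ℂ] PAlg R F)
    (h₁ : ∀ (X Y Z : PAlg R F) (c : charAlg R F) (ν : SpecAlg k),
      Y.toMat = rightMul X.toMat (c : QMA R F) →
        tens R F π (star Y Z) ν = tens R F π (star X Z) (π c * ν))
    (h₂ : ∀ (X Y Z : PAlg R F) (c : charAlg R F) (ν : SpecAlg k),
      Y.toMat = rightMul X.toMat (c : QMA R F) →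
        tens R F π (star Z Y) ν = tens R F π (star Z X) (π c * ν)) :
    ∃ mul : Completion R F π →ₗ[ℂ] Completion R F π →ₗ[ℂ] Completion R F π,
      ∀ (X Y : PAlg R F) (ν ν' : SpecAlg k),
        mul (tens R F π X ν) (tens R F π Y ν') = tens R F π (star X Y) (ν * ν') := by
  let B : (PAlg R F ⊗[ℂ] SpecAlg k) →ₗ[ℂ] (PAlg R F ⊗[ℂ] SpecAlg k) →ₗ[ℂ] Completion R F π :=
    (TensorProduct.map₂ star (LinearMap.mul ℂ (SpecAlg k))).compr₂ (balanced R F π).mkQ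
  have hB : ∀ X ν Y ν', B (X ⊗ₜ ν) (Y ⊗ₜ ν') = tens R F π (star X Y) (ν * ν') := fun _ _ _ _ => rfl
  have hB1 : balanced R F π ≤ LinearMap.ker B := by
    refine Submodule.span_le.2 ?_
    rintro _ ⟨X, Y, c, ν, hY, rfl⟩
    refine LinearMap.mem_ker.2 (TensorProduct.ext' fun Z ν' => ?_)
    rw [map_sub, LinearMap.sub_apply, hB, hB, h₁ X Y Z c _ hY, mul_assoc, sub_self]
    rfl
  let B' : (PAlg R F ⊗[ℂ] SpecAlg k) →ₗ[ℂ] Completion R F π →ₗ[ℂ] Completion R F π :=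
    ((balanced R F π).liftQ B hB1).flip
  have hB' : ∀ X ν Y ν', B' (Y ⊗ₜ ν') (tens R F π X ν) = tens R F π (star X Y) (ν * ν') :=
    fun _ _ _ _ => rfl
  have hB2 : balanced R F π ≤ LinearMap.ker B' := by
    refine Submodule.span_le.2 ?_
    rintro _ ⟨X, Y, c, ν, hY, rfl⟩
    refine LinearMap.mem_ker.2 (LinearMap.ext fun z => ?_)
    induction z using completion_induction with
    | tens Z ν' =>
      rw [map_sub, LinearMap.sub_apply, hB', hB', h₂ X Y Z c _ hY, mul_left_comm, sub_self]
      rfl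
    | add x y hx hy => rw [map_add, hx, hy, map_add]
  exact ⟨((balanced R F π).liftQ B' hB2).flip, fun _ _ _ _ => rfl⟩

variable (π) in
/-- The value of a polynomial with coefficients in `E_{2k}` on a sequence `w` of elements of `P(R, F)`
that plays the role of the powers of the unknown. -/
def polyVal (w : ℕ → PAlg R F) : (SpecAlg k)[X] →ₗ[ℂ] Completion R F π :=
  Polynomial.lsum fun n => (balanced R F π).mkQ ∘ₗ TensorProduct.mk ℂ _ _ (w n)

lemma polyVal_monomial (w : ℕ → PAlg R F) (n : ℕ) (ν : SpecAlg k) :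
    polyVal π w (monomial n ν) = tens R F π (w n) ν := by
  rw [polyVal, Polynomial.lsum_apply, Polynomial.sum_monomial_index]
  · rfl
  · exact map_zero _

variable {star : PAlg R F →ₗ[ℂ] PAlg R F →ₗ[ℂ] PAlg R F}
  {mul : Completion R F π →ₗ[ℂ] Completion R F π →ₗ[ℂ] Completion R F π}

/-- The `⋆`-powers of `M`. -/
def starPow (star : PAlg R F →ₗ[ℂ] PAlg R F →ₗ[ℂ] PAlg R F) (n : ℕ) : PAlg R F :=
  prodWith star (idP R F) fun _ : Fin n => genP R F

lemma starPow_succ (n : ℕ) : starPow star (n + 1) = star (genP R F) (starPow star n) := by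
  rw [starPow, prodWith, List.ofFn_succ]
  rfl

/-- Multiplication by `M - q ν I` corresponds to the multiplication of polynomials by `X - q ν`. -/
lemma mul_polyVal (hid : ∀ Y, star (idP R F) Y = Y)
    (hmul : ∀ (X Y : PAlg R F) (ν ν' : SpecAlg k),
      mul (tens R F π X ν) (tens R F π Y ν') = tens R F π (star X Y) (ν * ν'))
    (q : ℂ) (ν : SpecAlg k) (p : (SpecAlg k)[X]) :
    mul (tens R F π (genP R F) 1 - q • tens R F π (idP R F) ν) (polyVal π (starPow star) p)
      = polyVal π (starPow star) ((X - C (q • ν)) * p) := by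
  induction p using Polynomial.induction_on' with
  | add p r hp hr => rw [map_add, map_add, hp, hr, mul_add, map_add]
  | monomial n a =>
    rw [polyVal_monomial, map_sub, map_smul, LinearMap.sub_apply, LinearMap.smul_apply, hmul, hmul,
      hid, ← starPow_succ, sub_mul, map_sub, X_mul_monomial, C_mul_monomial, polyVal_monomial,
      polyVal_monomial, one_mul, smul_mul_assoc, tens_smul]

/-- The `⋆`-product of the factors `M - q ν_i I` is the value of `∏ (X - q ν_i)`. -/
lemma prodWith_eq_polyVal (hid : ∀ Y, star (idP R F) Y = Y)
    (hmul : ∀ (X Y : PAlg R F) (ν ν' : SpecAlg k),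
      mul (tens R F π X ν) (tens R F π Y ν') = tens R F π (star X Y) (ν * ν'))
    (q : ℂ) {r : ℕ} (v : Fin r → SpecAlg k) :
    prodWith mul (tens R F π (idP R F) 1)
        (fun i => tens R F π (genP R F) 1 - q • tens R F π (idP R F) (v i))
      = polyVal π (starPow star) (∏ i, (X - C (q • v i))) := by
  induction r with
  | zero =>
    rw [Fin.prod_univ_zero, ← monomial_zero_one, polyVal_monomial]
    rfl
  | succ r ih =>
    rw [Fin.prod_univ_succ, ← mul_polyVal hid hmul, ← ih, prodWith, List.ofFn_succ]
    rfl

/-- The factorization of the polynomial with the coefficients `(-q)^i e_i(ν_1, …, ν_{2k})`, evaluated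
at the `⋆`-powers of `M`. -/
lemma sum_eq_prodWith (hid : ∀ Y, star (idP R F) Y = Y)
    (hmul : ∀ (X Y : PAlg R F) (ν ν' : SpecAlg k),
      mul (tens R F π X ν) (tens R F π Y ν') = tens R F π (star X Y) (ν * ν')) (q : ℂ) :
    ∑ i ∈ Finset.range (2 * k + 1), tens R F π (starPow star (2 * k - i)) ((-q) ^ i • (spec k).esymm i)
      = prodWith mul (tens R F π (idP R F) 1) (fun i : Fin (2 * k) =>
          tens R F π (genP R F) 1 - q • tens R F π (idP R F) (nu k i.succ)) := by
  have e : ∏ i : Fin (2 * k), (X - C (q • nu k i.succ))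
      = (((spec k).map (q • ·)).map fun t => X - C t).prod := by
    rw [spec, Multiset.map_map, Multiset.map_map]
    rfl
  rw [prodWith_eq_polyVal hid hmul, e, prod_X_sub_C_smul, card_spec, map_sum]
  exact Finset.sum_congr rfl fun i _ => (polyVal_monomial _ _ _).symm

variable {q μ : ℂ} [NeZero N] (h : Setup R F q μ) (hs : StarSpec star)

omit [NeZero N] in
lemma legP_idP : legP (idP R F) = 1 := by
  have := leg_idMul (N := N) (1 : QMA R F)
  rw [map_one] at this
  rw [legP_apply, ← this]
  congr 1

include hs

lemma StarSpec.idP_mul (Y : PAlg R F) : star (idP R F) Y = Y := by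
  apply legP_injective
  rw [hs.id_left 1 (one_mem _) _ Y (by rw [legP_idP, map_one]), map_one, mul_one]

include h

lemma StarSpec.legP_starPow (n : ℕ) :
    legP (starPow star n) = (mulPowL R F (genMat R F) 0 1 ^ n) 1 := by
  induction n with
  | zero => exact legP_idP
  | succ n ih =>
    have hg : legP (genP R F) = mp R F (genMat R F) 0 1 := by
      have := h.leg_matPow 0 1
      rw [matPow_one, map_one] at this
      exact this
    rw [starPow_succ, hs.pow_left 0 1 (one_mem _) _ _ hg, ih, pow_succ']
    rfl

lemma StarSpec.exists_completion_mul (π : charAlg R F →ₐ[ℂ] SpecAlg k) :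
    ∃ mul : Completion R F π →ₗ[ℂ] Completion R F π →ₗ[ℂ] Completion R F π,
      (∀ (X Y : PAlg R F) (ν ν' : SpecAlg k),
        mul (tens R F π X ν) (tens R F π Y ν') = tens R F π (star X Y) (ν * ν')) ∧
      ∀ x y z, mul (mul x y) z = mul x (mul y z) := by
  have hl : ∀ (X Y : PAlg R F) (c : charAlg R F), Y.toMat = rightMul X.toMat (c : QMA R F) →
      legP Y = legP X * cst N _ (c : QMA R F) := fun X Y c e => by
    rw [legP_apply, e, leg_rightMul, legP_apply]
  obtain ⟨mul, hm⟩ := OSpQM.exists_completion_mul (π := π) star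
    (fun X Y Z c ν e => tens_eq_of_legP (hs.cst_mul h c.2 (hl X Y c e) Z) ν)
    (fun X Y Z c ν e => tens_eq_of_legP (hs.mul_cst h c.2 (hl X Y c e) Z) ν)
  refine ⟨mul, hm, fun x y z => ?_⟩
  induction x using completion_induction with
  | add x x' hx hx' => simp only [map_add, LinearMap.add_apply, hx, hx']
  | tens X ν =>
    induction y using completion_induction with
    | add y y' hy hy' => simp only [map_add, LinearMap.add_apply, hy, hy']
    | tens Y ν' =>
      induction z using completion_induction with
      | add z z' hz hz' => simp only [map_add, hz, hz']
      | tens Z ν'' => rw [hm, hm, hm, hm, hs.assoc h, mul_assoc]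

/-- The Cayley-Hamilton identity survives the extension of scalars. -/
lemma StarSpec.sum_tens_eq_zero (π : charAlg R F →ₐ[ℂ] SpecAlg k)
    (hch : ∑ i ∈ Finset.range (2 * k + 1), (-q) ^ i •
      ((mulPowL R F (genMat R F) 0 1 ^ (2 * k - i)) 1 * cst N _ (eps R F q μ k i : QMA R F)) = 0) :
    ∑ i ∈ Finset.range (2 * k + 1), tens R F π (starPow star (2 * k - i))
      ((-q) ^ i • π (eps R F q μ k i)) = 0 := by
  choose Y hY using fun i : ℕ => h.exists_rmul (eps R F q μ k i).2 (starPow star (2 * k - i))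
  have e : ∀ i, tens R F π (starPow star (2 * k - i)) ((-q) ^ i • π (eps R F q μ k i))
      = tens R F π ((-q) ^ i • Y i) 1 := fun i => by
    rw [tens_smul, smul_tens, tens_eq_of_legP (hY i), mul_one]
  have h0 : ∑ i ∈ Finset.range (2 * k + 1), (-q) ^ i • Y i = 0 := by
    apply legP_injective
    rw [map_sum, map_zero, ← hch]
    refine Finset.sum_congr rfl fun i _ => ?_
    rw [map_smul, hY, hs.legP_starPow h]
  rw [Finset.sum_congr rfl fun i _ => e i]
  have := congrArg (fun X => (balanced R F π).mkQ (TensorProduct.mk ℂ _ _ X (1 : SpecAlg k))) h0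
  simp only [map_sum, LinearMap.sum_apply, map_zero, LinearMap.zero_apply] at this
  exact this

end Completion

/-! ### R-matrices of type `Sp(2k)` -/

section SpType

variable {N k : ℕ} {R F : Op2 N} {q μ : ℂ}

lemma qNum_one (h : Params q μ) : qNum q 1 = 1 := by
  rw [qNum, pow_one, pow_one, div_self h.lam_ne]

/-- The denominators of the baxterized generators of an `Sp(2k)`-type R-matrix are
`1 - q^{2(k+1-i)}`; they do not vanish because `(k+1-i)_q ≠ 0`. -/
lemma IsSpType.paramsUpTo (hR : IsSpType R q k) : ParamsUpTo q (-q⁻¹ ^ (2 * k + 1)) k := by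
  have hP := hR.bmw.params
  have h0 := hP.q_ne
  have hn : ∀ i, 1 ≤ i → i ≤ k → qNum q i ≠ 0 := fun i h1 h2 => by
    rcases h1.eq_or_lt with rfl | h1
    · rw [qNum_one hP]
      exact one_ne_zero
    · exact hR.qNum_ne i h1 h2
  refine ⟨hP, hn, fun i h1 h2 e => hn (k + 1 - i) (by omega) (by omega) ?_⟩
  obtain ⟨m, rfl⟩ : ∃ m, k = i + m := ⟨k - i, by omega⟩
  have e1 : (q ^ (m + 1)) ^ 2 = 1 := by
    have : q * (-q⁻¹ ^ (2 * (i + m) + 1))⁻¹ * q⁻¹ ^ (2 * i) = -(q ^ (m + 1)) ^ 2 := by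
      rw [inv_neg, inv_pow, inv_inv, show 2 * (i + m) + 1 = 2 * i + (2 * m + 1) by omega, pow_add,
        inv_pow]
      field_simp
      ring
    rw [this] at e
    linear_combination -e
  have e2 : q ^ (m + 1) - q⁻¹ ^ (m + 1) = 0 := by
    have h2 : q ^ (m + 1) ≠ 0 := pow_ne_zero _ h0
    rw [inv_pow]
    field_simp
    linear_combination e1
  rw [show i + m + 1 - i = m + 1 by omega, qNum, e2, zero_div]

/-- The space `V` is not zero, since otherwise the antisymmetrizers would vanish. -/
lemma IsSpType.neZero (hR : IsSpType R q k) : NeZero N := by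
  refine ⟨?_⟩
  rintro rfl
  refine hR.rank_ne 2 le_rfl hR.two_le ?_
  rw [show antisym R q (-q⁻¹ ^ (2 * k + 1)) 2 0 2 = 0 from
    Matrix.ext fun x _ => (x 0).elim0, Matrix.rank_zero]

lemma IsSpType.antisym_vanish (hR : IsSpType R q k) (A : Type) [Ring A] [Algebra ℂ A] :
    shf 1 (asymF q (-q⁻¹ ^ (2 * k + 1)) A R k) * bax q (-q⁻¹ ^ (2 * k + 1)) (gen A R 0) (q⁻¹ ^ (2 * k))
      * shf 1 (asymF q (-q⁻¹ ^ (2 * k + 1)) A R k) = 0 := by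
  have hv := congrArg (famHom A k) hR.vanish
  have hk := hR.two_le
  rw [map_zero, map_mul, map_mul, antisym_eq, map_asym] at hv
  have e1 : asym q (-q⁻¹ ^ (2 * k + 1)) (fun j => famHom A k (opAt (k + 1) R (1 + j))) k
      = shf 1 (asymF q (-q⁻¹ ^ (2 * k + 1)) A R k) := by
    rw [shf_asymF]
    refine asym_congr fun j hj => ?_
    rw [famHom_opAt R (by omega), add_comm]
  have e2 : famHom A k (baxt R q (-q⁻¹ ^ (2 * k + 1)) (k + 1) 0 (q⁻¹ ^ (2 * k)))
      = bax q (-q⁻¹ ^ (2 * k + 1)) (gen A R 0) (q⁻¹ ^ (2 * k)) := by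
    rw [← famHom_opAt R (by omega : 0 < k), ← map_bax]
    rfl
  rwa [e1, e2] at hv

end SpType

end

end OSpQM

open OSpQM in
theorem corollary5p5 {N k : ℕ} (R F : Op2 N) (q μ : ℂ)
    (hR : IsSpType R q k) (hμ : μ = -q⁻¹ ^ (2 * k + 1))
    (hRF : IsCompatiblePair R F) (hF : StrictSkewInvertible F) :
    -- `C(R, F)` is the span of the `ch(α)`, and it is commutative
    ((charAlg R F).toSubmodule = charSpace R F ∧ ∀ x y : charAlg R F, x * y = y * x) ∧
    -- the homomorphism exists, and it is determined by its values on the generators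
    (MonomialsIndependent (Fin.cons (contr R F q μ : QMA R F)
        (fun i : Fin k => (elemA R F q μ (i + 1) : QMA R F)) : Fin (k + 1) → QMA R F) →
      ∃! π : charAlg R F →ₐ[ℂ] SpecAlg k, IsSpectralHom R F q μ k π) ∧
    -- the `⋆`-product on `P(R, F)` and on its completion, and the factorization
    ∃ star : PAlg R F →ₗ[ℂ] PAlg R F →ₗ[ℂ] PAlg R F,
      IsStarProduct R F star ∧
      (∀ X Y Z, star (star X Y) Z = star X (star Y Z)) ∧
      ∀ π : charAlg R F →ₐ[ℂ] SpecAlg k, IsSpectralHom R F q μ k π →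
        ∃ mul : Completion R F π →ₗ[ℂ] Completion R F π →ₗ[ℂ] Completion R F π,
          (∀ (X Y : PAlg R F) (ν ν' : SpecAlg k),
            mul (tens R F π X ν) (tens R F π Y ν') = tens R F π (star X Y) (ν * ν')) ∧
          (∀ x y z, mul (mul x y) z = mul x (mul y z)) ∧
          ∑ i ∈ Finset.range (2 * k + 1),
              tens R F π (prodWith star (idP R F) fun _ : Fin (2 * k - i) => genP R F)
                ((-q) ^ i • π (eps R F q μ k i))
            = prodWith mul (tens R F π (idP R F) 1) (fun i : Fin (2 * k) =>
                tens R F π (genP R F) 1 - q • tens R F π (idP R F) (nu k i.succ)) ∧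
          prodWith mul (tens R F π (idP R F) 1) (fun i : Fin (2 * k) =>
                tens R F π (genP R F) 1 - q • tens R F π (idP R F) (nu k i.succ)) = 0 := by
  subst hμ
  have : NeZero N := hR.neZero
  have hk := hR.paramsUpTo
  have h : Setup R F q (-q⁻¹ ^ (2 * k + 1)) := ⟨hR.bmw.params, hR.bmw, hR.skew, hRF⟩
  have hv := hR.antisym_vanish (QMA R F)
  have hk2 := hR.two_le
  obtain ⟨star, hs⟩ := h.exists_star
  refine ⟨⟨h.charAlg_eq, fun x y => Subtype.ext (h.charAlg_comm x.2 y.2)⟩,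
    h.existsUnique_spectralHom (h.charAlg_eq_genAlg hk hv (by omega)), star, hs.isStarProduct h,
    hs.assoc h, fun π hπ => ?_⟩
  obtain ⟨mul, hm, ha⟩ := hs.exists_completion_mul h π
  have hz := hs.sum_tens_eq_zero h π (h.cayley_hamilton hk hk2 rfl hv)
  have hf := sum_eq_prodWith hs.idP_mul hm q
  rw [Finset.sum_congr rfl fun i hi => by
    rw [← hπ.map_eps (by rw [Finset.mem_range] at hi; omega)]] at hf
  exact ⟨mul, hm, ha, hf, hf ▸ hz⟩
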